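/- Let $k\ge 1$, $m\ge 0$, $n=m+k$, and let $\mathbb H^{n+1}=\{w=(x,y,z): x>0,\ y\in\mathbb R^{m},\ z\in\mathbb R^k\}$ carry the metric $x^{-2}(dx^2+|dy|^2+|dz|^2)$. Let $\Gamma_c$ be the group generated by $k$ isometries $\gamma_j(x,y,z)=(x,A_jy,z+v_j)$, where $v_1,\dots,v_k$ is a basis of $\mathbb R^k$ and $A_1,\dots,A_k\in O(m)$ commute. Put $X_c=\Gamma_c\backslash\mathbb H^{n+1}$ (a model cusp of rank $k$) and $\overline X_c=\Gamma_c\backslash\{x\ge 0\}$, and let $\mathcal F=\mathbb R^+\times\mathbb R^m\times\mathcal F_T$, where $\mathcal F_T$ is the Dirichlet domain centred at $0$ of the lattice spanned by the $v_j$; $L^2(X_c)$ is $L^2(\mathcal F)$ with hyperbolic volume. For $X=\mathbb H^{n+1}$ or $X=X_c$ and $\mathrm{Re}(s)>n/2$, let $R_X(s)=(\Delta_X-s(n-s))^{-1}$, where $\Delta_X\ge 0$ is the self-adjoint Laplacian on $L^2(X)$ (the closure of the Laplacian on $C_0^\infty(X)$), and let $R_X(s;w,w')$ be its integral kernel with respect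 to hyperbolic volume, regarded as a $\Gamma_c$-invariant function of $w$ and of $w'$ when $X=X_c$. Write $a=0$ if $X=\mathbb H^{n+1}$ and $a=k/2$ if $X=X_c$. **Continuation.** In both cases, for $\mathrm{Re}(s)>n/2$ (and $\mathrm{Re}(s)>a$), $R_X(s)$ exists as a bounded operator and is an integral operator. Its kernel is smooth off the diagonal and continues holomorphically in $s$ to $\mathrm{Re}(s)>a$ off the diagonal, remaining smooth there. This is the continuation of the resolvent in weighted spaces: with $\rho=x/(x+1)$, for all $N>0$ and $\chi\in C_0^\infty(\overline X)$ the operator $\chi R_X(s)\chi$ extends to a holomorphic family of bounded operators $\rho^NL^2(X)\to\rho^{-N}L^2(X)$ on $\{\mathrm{Re}(s)>a,\ \mathrm{Re}(s)>n/2-N\}$, with integral kernel $\chi(w)R_X(s;w,w')\chi(w')$. **Series.** For $\mathrm{Re}(s)>k/2$ and all $w,w'\in\mathbb H^{n+1}$ with $w\notin\Gamma_cw'$ (in particular for such $w,w'\in\mathcal F$), $$R_{X_c}(s;w,w')=\sum_{\gamma\in\Gamma_c}R_{\mathbb H^{n+1}}(s;w,\gamma w').$$ The series converges in $C^\infty$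 on compact sets apart from the diagonal singularity: if $K\subset\mathbb H^{n+1}\times\mathbb H^{n+1}$ is compact, then the set $S_K$ of all $\gamma\in\Gamma_c$ with $w=\gamma w'$ for some $(w,w')\in K$ is finite, the terms with $\gamma\notin S_K$ and their sum are smooth at every point of $K$, and the series over $\gamma\notin S_K$ converges to that sum uniformly on $K$ together with all derivatives in $(w,w')$. **Estimates.** Let $\chi\in C_0^\infty(\overline X_c)$ and $\psi\in C^\infty(\overline X_c)$ have disjoint supports in $\overline X_c$, let $\mathrm{Re}(s)>k/2$, and let $j\ge0$ and $\alpha\in\mathbb N_0^m$, $\beta\in\mathbb N_0^k$. All derivatives below are in $w$. (a) There is $C>0$ such that for all $w,w'\in\mathbb H^{n+1}$ with $w\in\operatorname{supp}\psi$, $$\big|\partial_x^j\partial_y^\alpha\partial_z^\beta\big[(xx')^{-s}R_{X_c}(s;w,w')\chi(w')\big]\big|\le C(1+x^2+|y|^2)^{(k-|\alpha|-|\beta|-j)/2-\mathrm{Re}(s)} .$$ (b) If in addition, for all $j'\le j$, $\alpha'\le\alpha$, $\beta'\le\beta$, the function $\partial_x^{j'}\partial_y^{\alpha'}\partial_z^{\beta'}\psi$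 is $O\big((1+x^2+|y|^2)^{-(j'+|\alpha'|+|\beta'|)/2}\big)$ on $\mathbb H^{n+1}$ (for example if $\psi$ is constant outside a compact subset of $\overline X_c$), then there is $C>0$ such that for all $w,w'\in\mathbb H^{n+1}$, $$\big|\partial_x^j\partial_y^\alpha\partial_z^\beta\big[(xx')^{-s}\psi(w)R_{X_c}(s;w,w')\chi(w')\big]\big|\le C(1+x^2+|y|^2)^{(k-|\alpha|-|\beta|-j)/2-\mathrm{Re}(s)} .$$ -/

import Mathlib

open scoped ContDiff

namespace ModelCusp

/-- Points `w = (x, y, z)` of `ℝ × ℝᵐ × ℝᵏ`.  With `n = m + k`, hyperbolic space `ℍⁿ⁺¹` is the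
part `x > 0`, with metric `x⁻² (dx² + |dy|² + |dz|²)`. -/
abbrev Pt (m k : ℕ) : Type :=
  ℝ × EuclideanSpace ℝ (Fin m) × EuclideanSpace ℝ (Fin k)

/-- The open upper half-space, i.e. hyperbolic space `ℍⁿ⁺¹`. -/
def halfSpace (m k : ℕ) : Set (Pt m k) := {w | 0 < w.1}

/-- The closed upper half-space `[0, ∞) × ℝᵐ × ℝᵏ`. -/
def closedHalfSpace (m k : ℕ) : Set (Pt m k) := {w | 0 ≤ w.1}

/-! ### Partial derivatives -/

/-- Coordinate vector in the `x` direction. -/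
def ex (m k : ℕ) : Pt m k := (1, 0, 0)

/-- Coordinate vectors in the `y` directions. -/
noncomputable def ey (m k : ℕ) (i : Fin m) : Pt m k := (0, EuclideanSpace.single i 1, 0)

/-- Coordinate vectors in the `z` directions. -/
noncomputable def ez (m k : ℕ) (i : Fin k) : Pt m k := (0, 0, EuclideanSpace.single i 1)

/-- The derivative of `f` in the constant direction `e`, as a function. -/
noncomputable def pd {m k : ℕ} (e : Pt m k) (f : Pt m k → ℂ) : Pt m k → ℂ :=
  fun w => lineDeriv ℝ f w e

/-- `∂_x^j ∂_y^α ∂_z^β f`, with multi-indices `α ∈ ℕᵐ`, `β ∈ ℕᵏ`. -/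
noncomputable def mixedDeriv {m k : ℕ} (j : ℕ) (α : Fin m → ℕ) (β : Fin k → ℕ)
    (f : Pt m k → ℂ) : Pt m k → ℂ :=
  (pd (ex m k))^[j]
    ((List.finRange m).foldr (fun i g => (pd (ey m k i))^[α i] g)
      ((List.finRange k).foldr (fun i g => (pd (ez m k i))^[β i] g) f))

/-- The (nonnegative) Laplacian of hyperbolic space, with `n = m + k`:
`Δ = -x² (∂_x² + ∑ ∂_{y_i}² + ∑ ∂_{z_i}²) + (n - 1) x ∂_x`. -/
noncomputable def hypLaplacian {m k : ℕ} (φ : Pt m k → ℂ) : Pt m k → ℂ := fun w =>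
  -((w.1 : ℂ) ^ 2) *
      (pd (ex m k) (pd (ex m k) φ) w + ∑ i, pd (ey m k i) (pd (ey m k i) φ) w
        + ∑ i, pd (ez m k i) (pd (ez m k i) φ) w)
    + (((m + k : ℕ) : ℂ) - 1) * (w.1 : ℂ) * pd (ex m k) φ w

/-- The Riemannian volume `x^{-(n+1)} dx dy dz` of hyperbolic space. -/
noncomputable def hypVolume (m k : ℕ) : MeasureTheory.Measure (Pt m k) :=
  (MeasureTheory.volume.restrict (halfSpace m k)).withDensity
    (fun w => ENNReal.ofReal ((w.1 ^ (m + k + 1))⁻¹))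

/-! ### Quotients `X = Γ \ ℍⁿ⁺¹`

`Γ` is a group of isometries, given as a group of bijections of `ℝ × ℝᵐ × ℝᵏ` that preserves
`{x > 0}` and `{x ≥ 0}`, and `F ⊆ ℍⁿ⁺¹` is a fundamental domain of `Γ`.  Functions on `X` are
`Γ`-invariant functions, and `L²(X) = L²(F)`. -/

/-- Hyperbolic volume on the fundamental domain `F`. -/
noncomputable def quotVolume {m k : ℕ} (F : Set (Pt m k)) : MeasureTheory.Measure (Pt m k) :=
  (hypVolume m k).restrict F

/-- `L²(X)`, realised on the fundamental domain. -/
abbrev L2 {m k : ℕ} (F : Set (Pt m k)) : Type :=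
  MeasureTheory.Lp ℂ 2 (quotVolume F)

/-- `φ ∈ C₀^∞(X)`: smooth, `Γ`-invariant, with support compact modulo `Γ`. -/
def IsTestFunction {m k : ℕ} (Γ : Subgroup (Equiv.Perm (Pt m k))) (φ : Pt m k → ℂ) : Prop :=
  ContDiffOn ℝ ∞ φ (halfSpace m k) ∧
  (∀ γ ∈ Γ, ∀ w ∈ halfSpace m k, φ (γ w) = φ w) ∧
  ∃ K ⊆ halfSpace m k, IsCompact K ∧ ∀ w ∈ halfSpace m k, φ w ≠ 0 → ∃ γ ∈ Γ, γ w ∈ K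

/-- `ψ ∈ C^∞(X̄)`, `X̄ = Γ \ {x ≥ 0}`: smooth up to `x = 0` and `Γ`-invariant. -/
def IsSmoothUpToBoundary {m k : ℕ} (Γ : Subgroup (Equiv.Perm (Pt m k)))
    (ψ : Pt m k → ℂ) : Prop :=
  ContDiffOn ℝ ∞ ψ (closedHalfSpace m k) ∧
  ∀ γ ∈ Γ, ∀ w ∈ closedHalfSpace m k, ψ (γ w) = ψ w

/-- `χ ∈ C₀^∞(X̄)`: moreover the support in `X̄` is compact (it may meet `x = 0`). -/
def IsCutoff {m k : ℕ} (Γ : Subgroup (Equiv.Perm (Pt m k))) (χ : Pt m k → ℂ) : Prop :=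
  IsSmoothUpToBoundary Γ χ ∧
  ∃ K ⊆ closedHalfSpace m k, IsCompact K ∧
    ∀ w ∈ closedHalfSpace m k, χ w ≠ 0 → ∃ γ ∈ Γ, γ w ∈ K

/-- The support, in the closed half-space, of a function on it. -/
def closedSupport {m k : ℕ} (ψ : Pt m k → ℂ) : Set (Pt m k) :=
  closure {w | w ∈ closedHalfSpace m k ∧ ψ w ≠ 0}

/-- The graph in `L²(X) × L²(X)` of the Laplacian `Δ_X`, i.e. of the closure of `Δ` on
`C₀^∞(X)`. -/
def laplacianGraph {m k : ℕ} (Γ : Subgroup (Equiv.Perm (Pt m k))) (F : Set (Pt m k)) :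
    Set (L2 F × L2 F) :=
  closure {p | ∃ φ : Pt m k → ℂ, IsTestFunction Γ φ ∧
    p.1 =ᵐ[quotVolume F] φ ∧ p.2 =ᵐ[quotVolume F] hypLaplacian φ}

/-- `R = (Δ_X - s (n - s))⁻¹` as a bounded operator on `L²(X)`: `R f = u` if and only if `u` lies
in the domain of `Δ_X` and `Δ_X u = f + s (n - s) u`. -/
def IsResolvent {m k : ℕ} (Γ : Subgroup (Equiv.Perm (Pt m k))) (F : Set (Pt m k)) (s : ℂ)
    (R : L2 F →L[ℂ] L2 F) : Prop :=
  ∀ f u : L2 F, R f = u ↔ (u, f + (s * (((m + k : ℕ) : ℂ) - s)) • u) ∈ laplacianGraph Γ F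

/-- `T` is the integral operator on `L²(X)` with kernel `K`, with respect to hyperbolic volume. -/
def HasIntegralKernel {m k : ℕ} (F : Set (Pt m k)) (T : L2 F →L[ℂ] L2 F)
    (K : Pt m k → Pt m k → ℂ) : Prop :=
  ∀ f : L2 F, ∀ᵐ w ∂(quotVolume F),
    MeasureTheory.Integrable (fun w' => K w w' * f w') (quotVolume F) ∧
    T f w = ∫ w', K w w' * f w' ∂(quotVolume F)

/-- Pairs of points of `ℍⁿ⁺¹` whose images in `X` are different. -/
def offDiagonal {m k : ℕ} (Γ : Subgroup (Equiv.Perm (Pt m k))) : Set (Pt m k × Pt m k) :=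
  {p | p.1 ∈ halfSpace m k ∧ p.2 ∈ halfSpace m k ∧ ∀ γ ∈ Γ, p.1 ≠ γ p.2}

/-- The weight `ρ^N χ` on the closed half-space, where `ρ = x / (x + 1)`. -/
noncomputable def weight {m k : ℕ} (N : ℝ) (χ : Pt m k → ℂ) : Pt m k → ℂ :=
  fun w => (((w.1 / (w.1 + 1)) ^ N : ℝ) : ℂ) * χ w

/-- `K(s; w, w')` is, for `Re s > a`, the kernel of the resolvent of `Δ_X` and of its
continuation from `Re s > n / 2`. -/
structure IsResolventKernel {m k : ℕ} (Γ : Subgroup (Equiv.Perm (Pt m k))) (F : Set (Pt m k))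
    (a : ℝ) (K : ℂ → Pt m k → Pt m k → ℂ) : Prop where
  /-- `K` is a function on `X × X`. -/
  invariant : ∀ s : ℂ, a < s.re → ∀ w ∈ halfSpace m k, ∀ w' ∈ halfSpace m k,
    ∀ γ ∈ Γ, K s (γ w) w' = K s w w' ∧ K s w (γ w') = K s w w'
  /-- `K` is smooth away from the diagonal. -/
  smooth : ∀ s : ℂ, a < s.re →
    ContDiffOn ℝ ∞ (fun p : Pt m k × Pt m k => K s p.1 p.2) (offDiagonal Γ)
  /-- `K` is holomorphic in `s` away from the diagonal. -/
  holomorphic : ∀ p ∈ offDiagonal Γ,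
    DifferentiableOn ℂ (fun s => K s p.1 p.2) {s | a < s.re}
  /-- For `Re s > n / 2` the resolvent `R(s)` exists and has kernel `K(s)`, and for `χ ∈ C₀^∞(X̄)`
  and `N > 0` the operator `χ R(s) χ` continues holomorphically to `Re s > n / 2 - N`, `Re s > a`,
  as a bounded operator `T(s)` from `ρ^N L²(X)` to `ρ^{-N} L²(X)`, with kernel `χ K(s) χ`.  A
  bounded operator from `ρ^N L²` to `ρ^{-N} L²` is written as the bounded operator `ρ^N T(s) ρ^N`
  on `L²`. -/
  resolvent : ∃ R : ℂ → (L2 F →L[ℂ] L2 F),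
    (∀ s : ℂ, a < s.re → ((m + k : ℕ) : ℝ) / 2 < s.re →
      IsResolvent Γ F s (R s) ∧ HasIntegralKernel F (R s) (K s)) ∧
    ∀ (N : ℝ) (χ : Pt m k → ℂ), 0 < N → IsCutoff Γ χ →
      ∃ T : ℂ → (L2 F →L[ℂ] L2 F),
        DifferentiableOn ℂ T {s | a < s.re ∧ ((m + k : ℕ) : ℝ) / 2 - N < s.re} ∧
        (∀ s : ℂ, a < s.re → ((m + k : ℕ) : ℝ) / 2 < s.re → ∀ f g : L2 F,
          g =ᵐ[quotVolume F] (fun w => weight N χ w * f w) →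
            T s f =ᵐ[quotVolume F] (fun w => weight N χ w * R s g w)) ∧
        (∀ s : ℂ, a < s.re → ((m + k : ℕ) : ℝ) / 2 - N < s.re →
          HasIntegralKernel F (T s) (fun w w' => weight N χ w * K s w w' * weight N χ w'))

/-- The kernel `R_X(s; w, w')` of the resolvent of `Δ_X`, continued to `Re s > a`.  Off the
diagonal it is determined by `IsResolventKernel`. -/
noncomputable def resolventKernel {m k : ℕ} (Γ : Subgroup (Equiv.Perm (Pt m k)))
    (F : Set (Pt m k)) (a : ℝ) : ℂ → Pt m k → Pt m k → ℂ :=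
  Classical.epsilon (fun K => IsResolventKernel Γ F a K)

/-- The resolvent kernel of `ℍⁿ⁺¹` itself, continued to `Re s > 0`. -/
noncomputable def freeKernel (m k : ℕ) : ℂ → Pt m k → Pt m k → ℂ :=
  resolventKernel ⊥ (halfSpace m k) 0

/-! ### Model cusps -/

/-- The isometry `(x, y, z) ↦ (x, A y, z + v)`. -/
noncomputable def cuspIsometry {m k : ℕ}
    (A : EuclideanSpace ℝ (Fin m) ≃ₗᵢ[ℝ] EuclideanSpace ℝ (Fin m))
    (v : EuclideanSpace ℝ (Fin k)) : Equiv.Perm (Pt m k) :=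
  (Equiv.refl ℝ).prodCongr (A.toEquiv.prodCongr (Equiv.addRight v))

/-- The group `Γ_c` generated by the isometries `(x, y, z) ↦ (x, A_j y, z + v_j)`. -/
noncomputable def cuspGroup {m k : ℕ}
    (A : Fin k → (EuclideanSpace ℝ (Fin m) ≃ₗᵢ[ℝ] EuclideanSpace ℝ (Fin m)))
    (v : Fin k → EuclideanSpace ℝ (Fin k)) : Subgroup (Equiv.Perm (Pt m k)) :=
  Subgroup.closure (Set.range fun j => cuspIsometry (A j) (v j))

/-- The fundamental domain `ℝ⁺ × ℝᵐ × 𝓕_T`, where `𝓕_T` is the Dirichlet domain, centred at `0`,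
of the lattice generated by the `v_j`. -/
def cuspDomain (m : ℕ) {k : ℕ} (v : Fin k → EuclideanSpace ℝ (Fin k)) : Set (Pt m k) :=
  {w | 0 < w.1 ∧ ∀ l ∈ AddSubgroup.closure (Set.range v), ‖w.2.2‖ ≤ ‖w.2.2 - l‖}

/-- The kernel `R_{X_c}(s; w, w')` of the resolvent of `X_c = Γ_c \ ℍⁿ⁺¹`, continued to
`Re s > k / 2`. -/
noncomputable def cuspKernel {m k : ℕ}
    (A : Fin k → (EuclideanSpace ℝ (Fin m) ≃ₗᵢ[ℝ] EuclideanSpace ℝ (Fin m)))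
    (v : Fin k → EuclideanSpace ℝ (Fin k)) : ℂ → Pt m k → Pt m k → ℂ :=
  resolventKernel (cuspGroup A v) (cuspDomain m v) ((k : ℝ) / 2)

/-- The series `∑ f i` of functions that are smooth at every point of `K` converges in `C^∞`
on `K`: it has a smooth sum there, and all derivatives of the series converge uniformly on `K`. -/
def ConvergesSmoothlyOn {ι E : Type*} [NormedAddCommGroup E] [NormedSpace ℝ E]
    (f : ι → E → ℂ) (K : Set E) : Prop :=
  (∀ i, ∀ p ∈ K, ContDiffAt ℝ ∞ (f i) p) ∧
  (∀ p ∈ K, ContDiffAt ℝ ∞ (fun q => ∑' i, f i q) p) ∧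
  ∀ r : ℕ, HasSumUniformlyOn (fun i => iteratedFDeriv ℝ r (f i))
    (iteratedFDeriv ℝ r (fun q => ∑' i, f i q)) K

/-- The elements of `Γ` for which `w = γ w'` for some `(w, w') ∈ K`. -/
def singularElements {m k : ℕ} (Γ : Subgroup (Equiv.Perm (Pt m k)))
    (K : Set (Pt m k × Pt m k)) : Set Γ :=
  {γ | ∃ p ∈ K, p.1 = (γ : Equiv.Perm (Pt m k)) p.2}

end ModelCusp

/-!
Write `T = 2 cosh d(w, w')` and `n = m + k`. The resolvent kernel of `ℍⁿ⁺¹` is the series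
`∑_j c_j(s) T^{-s-2j}`, which converges for `T > 2`. Since
`Δ T^{-p} = p (n - p) T^{-p} + 4 p (p + 1) T^{-p-2}`, the recurrence `coef_succ` for the `c_j` makes
`Δ - s (n - s)` telescope on the partial sums (`CuspLike.telescope`): what remains is a multiple of the
single power `T^{-s-2J-2}`. These powers form an approximate identity as `J → ∞`: by the explicit integral
`integral_twoCosh_cpow` of `T^{-p}` against the eigenfunction `x^{n/2}` their masses tend to `1`
(`tendsto_coef_mul_schurC`), and away from the diagonal they tend to `0`
(`CuspLike.tendsto_approx_identity`). So no singular Green formula is needed, only the symmetry of `Δ` for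
smooth kernels.

The same integral is a Schur test with weight `x^{n/2}`. It is inherited by kernels summed over `Γ`, since
`x` is invariant, and gives for `Re s > n / 2` a bounded operator on `L²(X)` with kernel
`∑_γ R(s; w, γ w')`. The telescoping identity, density of the test functions and closedness of the graph
show that it is the resolvent (`CuspLike.isResolvent_foldOp`). The structure `CuspLike` collects what is
used of `Γ`; it holds for the trivial group (`cuspLike_bot`) and for the cusp groups
(`cuspLike_cuspGroup`), so that both cases of the continuation are one theorem.

For `Re s > a` the sum over `Γ` still converges, and holomorphically in `s`. With weights `ρ^N χ` on both
sides each term is dominated, near the diagonal by a series of powers `T^{-p}` with `p > n / 2` and away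
from it by a product (`CuspLike.enorm_resFun_mul_le`); the sum then satisfies a Schur test locally uniformly
in `s` (`CuspLike.exists_weighted_majorant`), and such a family of operators is holomorphic
(`SchurBound.differentiableAt`). An integral operator determines its continuous invariant kernel off the
diagonal, and holomorphy determines the continuation of that kernel. Hence the resolvent kernel, which the
statement characterises by its properties, is the sum over `Γ` (`CuspLike.resolventKernel_eq`).

For the derivatives, `(x x')^{-s} R(s; w, w')` is a function `coneFun` of `(x', x, y - y', z - z')` that is
homogeneous of degree `-2 s` and smooth on the cone `Q > 2 |x x'|`, where
`Q = x² + x'² + |y - y'|² + |z - z'|²`. By homogeneity its derivatives of order `r` are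
`O(Q^{-Re s - r/2})` on closed subcones (`exists_coneFun_bound`). This gives the convergence of the series
in `C^∞` (`CuspLike.convergesSmoothlyOn`). Summed over the lattice of translations, whose sum is comparable
with an integral over `ℝᵏ` (`exists_lattice_sum_bound`), the bound loses the factor
`(1 + x² + |y|²)^{k/2}`, and this is the decay in the estimates (`exists_scaledKernel_bound`,
`exists_mixedDeriv_bound`, `exists_mixedDeriv_mul_bound`).
-/

namespace ModelCusp

section

open Filter Topology Complex

/-! ### The coefficients of the free resolvent -/

/-- The coefficient `c_j(s)` of `(2 cosh d)^{-s-2j}` in the resolvent kernel of `ℍⁿ⁺¹`. -/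
noncomputable def coef (n : ℕ) (s : ℂ) (j : ℕ) : ℂ :=
  Gamma (s + 2 * j) * (Gamma (s - n / 2 + 1 + j))⁻¹ /
    ((j.factorial : ℂ) * (2 * (Real.pi : ℂ) ^ ((n : ℂ) / 2)))

/-- The constant `I(p)` for which `∫ (2 cosh d(w, w'))^{-p} x'^{n/2} dvol(w') = I(p) x^{n/2}`. -/
noncomputable def schurC (n : ℕ) (p : ℂ) : ℂ :=
  (Real.pi : ℂ) ^ ((n : ℂ) / 2) / 2 * Gamma ((p - n / 2) / 2) ^ 2 / Gamma p

/-- The constant `schurC` at real exponents. -/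
noncomputable def schurR (n : ℕ) (p : ℝ) : ℝ :=
  Real.pi ^ ((n : ℝ) / 2) / 2 * Real.Gamma ((p - n / 2) / 2) ^ 2 / Real.Gamma p

lemma schurC_ofReal (n : ℕ) (p : ℝ) : schurC n (p : ℂ) = (schurR n p : ℂ) := by
  unfold schurC schurR
  push_cast
  rw [← Complex.Gamma_ofReal, ← Complex.Gamma_ofReal,
    Complex.ofReal_cpow Real.pi_pos.le]
  push_cast
  rfl

lemma schurR_pos {n : ℕ} {p : ℝ} (hp : (n : ℝ) / 2 < p) : 0 < schurR n p := by
  have h0 : (0 : ℝ) ≤ n / 2 := by positivity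
  have h1 := Real.Gamma_pos_of_pos (show 0 < (p - n / 2) / 2 by linarith)
  have h2 := Real.Gamma_pos_of_pos (show 0 < p by linarith)
  have h3 := Real.pi_pos
  unfold schurR
  positivity

lemma schurR_add_two {n : ℕ} {p : ℝ} (hp : (n : ℝ) / 2 < p) :
    4 * p * (p + 1) * schurR n (p + 2) = (p - n / 2) ^ 2 * schurR n p := by
  have h0 : (0 : ℝ) ≤ n / 2 := by positivity
  have hb : (p - n / 2) / 2 ≠ 0 := by
    have : 0 < (p - n / 2) / 2 := by linarith
    exact this.ne'
  have hp0 : p ≠ 0 := by linarith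
  have hp1 : p + 1 ≠ 0 := by linarith
  have h2 := (Real.Gamma_pos_of_pos (show 0 < p by linarith)).ne'
  unfold schurR
  rw [show (p + 2 - (n : ℝ) / 2) / 2 = (p - n / 2) / 2 + 1 by ring, Real.Gamma_add_one hb,
    show p + 2 = (p + 1) + 1 by ring, Real.Gamma_add_one hp1, Real.Gamma_add_one hp0]
  field_simp
  ring

/-- The recurrence that makes the defects of the partial sums telescope. -/
lemma coef_succ {n : ℕ} {s : ℂ} (hs : 0 < s.re) (j : ℕ) :
    ((s + 2 * (j + 1 : ℕ)) - s) * ((s + 2 * (j + 1 : ℕ)) + s - n) * coef n s (j + 1)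
      = 4 * (s + 2 * j) * (s + 2 * j + 1) * coef n s j := by
  have h0 : s + 2 * j ≠ 0 := by
    intro h; have := congrArg Complex.re h; simp at this
    have h3 : (0 : ℝ) ≤ j := by positivity
    linarith
  have h1 : s + 2 * j + 1 ≠ 0 := by
    intro h; have := congrArg Complex.re h; simp at this
    have h3 : (0 : ℝ) ≤ j := by positivity
    linarith
  have e1 := Complex.one_div_Gamma_eq_self_mul_one_div_Gamma_add_one (s - n / 2 + 1 + j)
  have hpi : (Real.pi : ℂ) ^ ((n : ℂ) / 2) ≠ 0 := by
    rw [Ne, Complex.cpow_eq_zero_iff]; simp [Real.pi_ne_zero]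
  have hf : (j.factorial : ℂ) ≠ 0 := by exact_mod_cast j.factorial_ne_zero
  have hj : ((j : ℂ) + 1) ≠ 0 := by exact_mod_cast j.succ_ne_zero
  unfold coef
  rw [e1]
  push_cast [Nat.factorial_succ]
  rw [show s + 2 * ((j : ℂ) + 1) = (s + 2 * j + 1) + 1 by ring, Complex.Gamma_add_one _ h1,
    Complex.Gamma_add_one _ h0, show s - n / 2 + 1 + ((j : ℂ) + 1) = s - n / 2 + 1 + j + 1 by ring]
  field_simp
  ring

lemma coef_differentiableAt {n : ℕ} {s : ℂ} (hs : 0 < s.re) (j : ℕ) :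
    DifferentiableAt ℂ (fun s => coef n s j) s := by
  unfold coef
  refine DifferentiableAt.div_const (DifferentiableAt.mul ?_ ?_) _
  · refine DifferentiableAt.comp s (Complex.differentiableAt_Gamma _ ?_) (by fun_prop)
    intro k h
    have := congrArg Complex.re h; simp at this
    have h3 : (0 : ℝ) ≤ j := by positivity
    have h4 : (0 : ℝ) ≤ k := by positivity
    linarith
  · exact (Complex.differentiable_one_div_Gamma _).comp s (by fun_prop)

/-- Replacing two linear factors by two others with the same sum costs a factor `1 + O(j⁻²)`. -/
lemma norm_factor_swap {M x : ℝ} {α₁ α₂ γ₁ γ₂ : ℂ} (h : α₁ + α₂ = γ₁ + γ₂) (h1 : ‖α₁‖ ≤ M)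
    (h2 : ‖α₂‖ ≤ M) (h3 : ‖γ₁‖ ≤ M) (h4 : ‖γ₂‖ ≤ M) (hx : 2 * M + 1 ≤ x) :
    ‖(x : ℂ) + α₁‖ * ‖(x : ℂ) + α₂‖
      ≤ Real.exp (8 * M ^ 2 / x ^ 2) * (‖(x : ℂ) + γ₁‖ * ‖(x : ℂ) + γ₂‖) := by
  have hM : 0 ≤ M := (norm_nonneg _).trans h1
  have hx0 : 0 < x := by linarith
  have low : ∀ γ : ℂ, ‖γ‖ ≤ M → x / 2 ≤ ‖(x : ℂ) + γ‖ := by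
    intro γ hγ
    have := norm_sub_norm_le (x : ℂ) (-γ)
    rw [sub_neg_eq_add, norm_neg, Complex.norm_real, Real.norm_of_nonneg hx0.le] at this
    linarith
  have e : ((x : ℂ) + α₁) * (x + α₂) = (x + γ₁) * (x + γ₂) + (α₁ * α₂ - γ₁ * γ₂) := by
    linear_combination (x : ℂ) * h
  rw [← norm_mul, ← norm_mul, e]
  have hd : ‖α₁ * α₂ - γ₁ * γ₂‖ ≤ 2 * M ^ 2 := by
    refine (norm_sub_le _ _).trans ?_
    rw [norm_mul, norm_mul]
    nlinarith [norm_nonneg α₁, norm_nonneg α₂, norm_nonneg γ₁, norm_nonneg γ₂,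
      mul_le_mul h1 h2 (norm_nonneg _) hM, mul_le_mul h3 h4 (norm_nonneg _) hM]
  have hl : x ^ 2 / 4 ≤ ‖((x : ℂ) + γ₁) * (x + γ₂)‖ := by
    rw [norm_mul]
    have := mul_le_mul (low γ₁ h3) (low γ₂ h4) (by positivity) (norm_nonneg _)
    linarith
  calc ‖((x : ℂ) + γ₁) * (x + γ₂) + (α₁ * α₂ - γ₁ * γ₂)‖
      ≤ ‖((x : ℂ) + γ₁) * (x + γ₂)‖ + 2 * M ^ 2 := (norm_add_le _ _).trans (by linarith)
    _ ≤ (8 * M ^ 2 / x ^ 2 + 1) * ‖((x : ℂ) + γ₁) * (x + γ₂)‖ := by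
        have : 8 * M ^ 2 / x ^ 2 * (x ^ 2 / 4) ≤
          8 * M ^ 2 / x ^ 2 * ‖((x : ℂ) + γ₁) * (x + γ₂)‖ := by gcongr
        have e2 : 8 * M ^ 2 / x ^ 2 * (x ^ 2 / 4) = 2 * M ^ 2 := by field_simp; ring
        linarith
    _ ≤ _ := by gcongr; exact Real.add_one_le_exp _

/-- A sequence whose successive quotients are `1 + O(j⁻²)` is bounded. -/
lemma le_of_ratio_le_exp {K : ℝ} (hK : 0 ≤ K) {J : ℕ} {x : ℕ → ℝ} (hx0 : 0 ≤ x J)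
    (hx : ∀ j ≥ J, x (j + 1) ≤ Real.exp (K / (j : ℝ) ^ 2) * x j) (j : ℕ) (hj : J ≤ j) :
    x j ≤ Real.exp (K * ∑' i : ℕ, 1 / (i : ℝ) ^ 2) * x J := by
  have hsum : Summable (fun i : ℕ => 1 / (i : ℝ) ^ 2) :=
    Real.summable_one_div_nat_pow.mpr (by norm_num)
  have key : ∀ j ≥ J, x j ≤ Real.exp (K * ∑ i ∈ Finset.Ico J j, 1 / (i : ℝ) ^ 2) * x J := by
    intro j hj
    induction j, hj using Nat.le_induction with
    | base => simp
    | succ j hj ih =>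
      rw [Finset.sum_Ico_succ_top hj, mul_add, Real.exp_add]
      refine (hx j hj).trans ?_
      calc _ ≤ Real.exp (K / (j : ℝ) ^ 2) *
            (Real.exp (K * ∑ i ∈ Finset.Ico J j, 1 / (i : ℝ) ^ 2) * x J) := by gcongr
        _ = _ := by rw [mul_one_div]; ring
  refine (key j hj).trans ?_
  gcongr
  exact hsum.sum_le_tsum _ (fun i _ => by positivity)

/-- Quotient bound for the coefficients, uniform in `s`. -/
lemma norm_coef_succ_le {n : ℕ} {M : ℝ} {s : ℂ} (hs : 0 < s.re) (hM : ‖s‖ + n + 1 ≤ M) {j : ℕ}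
    (hj : 2 * M + 1 ≤ j) :
    ((j : ℝ) + 1) * ‖coef n s (j + 1)‖ ≤
      4 * Real.exp (8 * M ^ 2 / (j : ℝ) ^ 2) * ‖(j : ℂ) + ((n : ℂ) - 1) / 2‖ * ‖coef n s j‖ := by
  have hn : (0 : ℝ) ≤ n := by positivity
  have hs0 := norm_nonneg s
  have e := coef_succ (n := n) hs j
  have e' : ((j : ℂ) + 1) * ((j : ℂ) + (1 + s - n / 2)) * coef n s (j + 1)
      = 4 * ((((j : ℝ) : ℂ) + s / 2) * (((j : ℝ) : ℂ) + (s + 1) / 2)) * coef n s j := by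
    push_cast at e ⊢
    linear_combination e / 4
  have n1 : ‖s / 2‖ ≤ M := by rw [norm_div]; norm_num; linarith
  have n2 : ‖(s + 1) / 2‖ ≤ M := by
    rw [norm_div]; norm_num
    have := norm_add_le s 1
    simp at this; linarith
  have n3 : ‖1 + s - (n : ℂ) / 2‖ ≤ M := by
    have h1 := norm_sub_le (1 + s) ((n : ℂ) / 2)
    have h2 := norm_add_le 1 s
    rw [norm_div] at h1
    simp at h1 h2; linarith
  have n4 : ‖((n : ℂ) - 1) / 2‖ ≤ M := by
    rw [norm_div]; norm_num
    have := norm_sub_le (n : ℂ) 1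
    simp at this; linarith
  have sw := norm_factor_swap (x := j) (show s / 2 + (s + 1) / 2 = (1 + s - (n : ℂ) / 2) +
    ((n : ℂ) - 1) / 2 by ring) n1 n2 n3 n4 hj
  have pos : 0 < ‖(j : ℂ) + (1 + s - n / 2)‖ := by
    have := norm_sub_norm_le (j : ℂ) (-(1 + s - n / 2))
    rw [sub_neg_eq_add, norm_neg] at this
    simp at this
    linarith
  have e2 := congrArg norm e'
  simp only [norm_mul] at e2
  have hj1 : ‖(j : ℂ) + 1‖ = (j : ℝ) + 1 := by
    rw [← Nat.cast_succ, Complex.norm_natCast]; push_cast; rfl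
  rw [hj1] at e2
  refine le_of_mul_le_mul_left ?_ pos
  calc _ = ‖(4 : ℂ)‖ * (‖((j : ℝ) : ℂ) + s / 2‖ * ‖((j : ℝ) : ℂ) + (s + 1) / 2‖) * ‖coef n s j‖ := by
        rw [← e2]; ring
    _ ≤ 4 * (Real.exp (8 * M ^ 2 / (j : ℝ) ^ 2) * (‖((j : ℝ) : ℂ) + (1 + s - n / 2)‖ *
          ‖((j : ℝ) : ℂ) + ((n : ℂ) - 1) / 2‖)) * ‖coef n s j‖ := by
        gcongr; norm_num
    _ = _ := by push_cast; ring

lemma exists_coef_bound_initial (n : ℕ) {S : Set ℂ} (hS : IsCompact S) (hS0 : ∀ s ∈ S, 0 < s.re)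
    (J : ℕ) : ∃ B > 0, ∀ s ∈ S, ∀ j ≤ J, ‖coef n s j‖ ≤ B := by
  have h : ∀ j : ℕ, ∃ B : ℝ, ∀ s ∈ S, ‖coef n s j‖ ≤ B := fun j =>
    hS.exists_bound_of_continuousOn
      (fun s hs => (coef_differentiableAt (hS0 s hs) j).continuousAt.continuousWithinAt)
  choose B hB using h
  refine ⟨∑ j ∈ Finset.range (J + 1), |B j| + 1, by positivity, fun s hs j hj => ?_⟩
  have h1 := Finset.single_le_sum (f := fun j => |B j|) (fun i _ => abs_nonneg _)
    (Finset.mem_range.mpr (Nat.lt_succ_of_le hj))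
  have := (hB j s hs).trans (le_abs_self _)
  linarith

lemma exists_norm_bound {S : Set ℂ} (hS : IsCompact S) (n : ℕ) (q : ℝ) :
    ∃ M : ℝ, q ≤ M ∧ 1 ≤ M ∧ ∀ s ∈ S, ‖s‖ + n + 1 ≤ M := by
  obtain ⟨B, hB⟩ := hS.exists_bound_of_continuousOn (f := fun s : ℂ => s) continuousOn_id
  refine ⟨|B| + n + 1 + |q|, ?_, ?_, fun s hs => ?_⟩
  · linarith [le_abs_self q, abs_nonneg B, (Nat.cast_nonneg n : (0 : ℝ) ≤ n)]
  · linarith [abs_nonneg q, abs_nonneg B, (Nat.cast_nonneg n : (0 : ℝ) ≤ n)]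
  · linarith [hB s hs, abs_nonneg q, le_abs_self B]

/-- The series of the resolvent kernel is a power series in `T⁻²` of radius `1 / 4`, so it converges for
`T > 2`. -/
lemma exists_coef_bound_geom (n : ℕ) (hn : 0 < n) {S : Set ℂ} (hS : IsCompact S)
    (hS0 : ∀ s ∈ S, 0 < s.re) :
    ∃ B > 0, ∀ s ∈ S, ∀ j, ‖coef n s j‖ ≤ B * (4 ^ j * ((j : ℝ) + 1) ^ n) := by
  obtain ⟨M, -, hM1, hM⟩ := exists_norm_bound hS n 0
  set J := ⌈2 * M + 1⌉₊ with hJ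
  obtain ⟨B, hB0, hB⟩ := exists_coef_bound_initial n hS hS0 J
  set E := Real.exp (8 * M ^ 2 * ∑' i : ℕ, 1 / (i : ℝ) ^ 2) with hE
  have hn1 : (1 : ℝ) ≤ n := by exact_mod_cast hn
  refine ⟨B * (E + 1), by positivity, fun s hs j => ?_⟩
  have big : ∀ j ≤ J, ‖coef n s j‖ / (4 ^ j * ((j : ℝ) + 1) ^ n) ≤ B := fun j hj =>
    (div_le_self (norm_nonneg _) (one_le_mul_of_one_le_of_one_le
      (one_le_pow₀ (by norm_num)) (one_le_pow₀ (by linarith [(Nat.cast_nonneg j : (0:ℝ) ≤ j)])))).trans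
      (hB s hs j hj)
  rw [← div_le_iff₀ (by positivity)]
  rcases le_total j J with h | h
  · refine (big j h).trans ?_
    have : 0 < E := Real.exp_pos _
    nlinarith
  · have := le_of_ratio_le_exp (K := 8 * M ^ 2) (by positivity) (J := J)
      (x := fun j => ‖coef n s j‖ / (4 ^ j * ((j : ℝ) + 1) ^ n)) (by positivity) ?_ j h
    · refine this.trans ?_
      have h2 := big J le_rfl
      have : 0 < E := Real.exp_pos _
      calc _ ≤ E * B := by gcongr
        _ ≤ _ := by nlinarith
    · intro j hj
      have hj' : 2 * M + 1 ≤ (j : ℝ) := (Nat.le_ceil _).trans (by exact_mod_cast hj)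
      have r := norm_coef_succ_le (hS0 s hs) (hM s hs) hj'
      have hd : ‖(j : ℂ) + ((n : ℂ) - 1) / 2‖ = (j : ℝ) + ((n : ℝ) - 1) / 2 := by
        rw [← Complex.norm_of_nonneg (show 0 ≤ (j : ℝ) + ((n : ℝ) - 1) / 2 by linarith)]
        push_cast; rfl
      rw [hd] at r
      have hp : ((j : ℝ) + ((n : ℝ) - 1) / 2) * ((j : ℝ) + 1) ^ n ≤ ((j : ℝ) + 1) * ((j : ℝ) + 2) ^ n := by
        have h1 := one_add_mul_le_pow (a := 1 / ((j : ℝ) + 1)) (by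
          have : 0 < 1 / ((j : ℝ) + 1) := by positivity
          linarith) n
        have h2 : ((j : ℝ) + 2) ^ n = ((j : ℝ) + 1) ^ n * (1 + 1 / ((j : ℝ) + 1)) ^ n := by
          rw [← mul_pow]; congr 1; field_simp; ring
        rw [h2]
        calc _ ≤ ((j : ℝ) + 1) * (((j : ℝ) + 1) ^ n * (1 + n * (1 / ((j : ℝ) + 1)))) := by
              have : ((j : ℝ) + 1) * (((j : ℝ) + 1) ^ n * (1 + n * (1 / ((j : ℝ) + 1)))) =
                ((j : ℝ) + 1 + n) * ((j : ℝ) + 1) ^ n := by field_simp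
              rw [this]
              exact mul_le_mul_of_nonneg_right (by linarith) (by positivity)
          _ ≤ _ := by gcongr
      rw [div_le_iff₀ (by positivity)]
      refine le_of_mul_le_mul_left (a := (j : ℝ) + 1) (r.trans ?_) (by positivity)
      push_cast
      have e : ((j : ℝ) + 1) * (Real.exp (8 * M ^ 2 / (j : ℝ) ^ 2) *
          (‖coef n s j‖ / (4 ^ j * ((j : ℝ) + 1) ^ n)) * (4 ^ (j + 1) * ((j : ℝ) + 1 + 1) ^ n)) =
          (4 * Real.exp (8 * M ^ 2 / (j : ℝ) ^ 2) * ‖coef n s j‖ / ((j : ℝ) + 1) ^ n) *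
            (((j : ℝ) + 1) * ((j : ℝ) + 2) ^ n) := by
        field_simp; ring
      rw [e]
      refine le_trans (le_of_eq ?_) (mul_le_mul_of_nonneg_left hp (by positivity))
      field_simp

/-- The Schur masses of the terms of the series are `O(j⁻²)`, hence summable: the growth of `c_j` is
beaten, but only just, by the decay of `I(p + 2j)`. -/
lemma exists_coef_bound_schur (n : ℕ) (hn : 0 < n) {S : Set ℂ} (hS : IsCompact S)
    (hS0 : ∀ s ∈ S, 0 < s.re) {p : ℝ} (hp : (n : ℝ) / 2 < p) :
    ∃ B > 0, ∀ s ∈ S, ∀ j : ℕ, ‖coef n s j‖ * schurR n (p + 2 * j) ≤ B / ((j : ℝ) + 1) ^ 2 := by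
  obtain ⟨M, hMp, hM1, hM⟩ := exists_norm_bound hS n (p + n + 1)
  set J := ⌈2 * M + 1⌉₊ with hJ
  obtain ⟨B₀, hB₀, hB₀'⟩ := exists_coef_bound_initial n hS hS0 J
  have hn1 : (1 : ℝ) ≤ n := by exact_mod_cast hn
  have hI : ∀ j : ℕ, 0 < schurR n (p + 2 * j) := fun j =>
    schurR_pos (by have : (0 : ℝ) ≤ j := by positivity
                   linarith)
  set D : ℝ := ∑ j ∈ Finset.range (J + 1), schurR n (p + 2 * j) * ((j : ℝ) + 1) ^ 2 with hD
  have hD0 : 0 < D := Finset.sum_pos (fun j _ => mul_pos (hI j) (by positivity)) (by simp)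
  set E := Real.exp (3 * (8 * M ^ 2) * ∑' i : ℕ, 1 / (i : ℝ) ^ 2) with hE
  have hE0 : 0 < E := Real.exp_pos _
  refine ⟨B₀ * D * (E + 1), by positivity, fun s hs j => ?_⟩
  rw [le_div_iff₀ (by positivity)]
  have big : ∀ j ≤ J, ‖coef n s j‖ * schurR n (p + 2 * j) * ((j : ℝ) + 1) ^ 2 ≤ B₀ * D := by
    intro j hj
    have h1 := Finset.single_le_sum (f := fun j : ℕ => schurR n (p + 2 * j) * ((j : ℝ) + 1) ^ 2)
      (fun i _ => (mul_pos (hI i) (by positivity)).le) (Finset.mem_range.mpr (Nat.lt_succ_of_le hj))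
    rw [mul_assoc]
    exact mul_le_mul (hB₀' s hs j hj) h1 (mul_pos (hI j) (by positivity)).le hB₀.le
  rcases le_total j J with h | h
  · refine (big j h).trans ?_
    have := mul_pos hB₀ hD0
    nlinarith
  · have := le_of_ratio_le_exp (K := 3 * (8 * M ^ 2)) (by positivity) (J := J)
      (x := fun j => ‖coef n s j‖ * schurR n (p + 2 * j) * ((j : ℝ) + 1) ^ 2)
      (mul_nonneg (mul_nonneg (norm_nonneg _) (hI J).le) (by positivity)) ?_ j h
    · refine this.trans ?_
      have h2 := big J le_rfl
      calc _ ≤ E * (B₀ * D) := by gcongr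
        _ ≤ _ := by nlinarith [mul_pos hB₀ hD0]
    · intro j hj
      have hj' : 2 * M + 1 ≤ (j : ℝ) := (Nat.le_ceil _).trans (by exact_mod_cast hj)
      have r := norm_coef_succ_le (hS0 s hs) (hM s hs) hj'
      have hd : ∀ a : ℝ, |a| ≤ M → ‖((j : ℝ) : ℂ) + (a : ℂ)‖ = (j : ℝ) + a := fun a ha => by
        rw [← Complex.ofReal_add, Complex.norm_of_nonneg]
        linarith [neg_abs_le a]
      have hna : ∀ a : ℝ, |a| ≤ M → ‖(a : ℂ)‖ ≤ M := fun a ha => by simpa using ha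
      have real_swap : ∀ a₁ a₂ g₁ g₂ : ℝ, a₁ + a₂ = g₁ + g₂ → |a₁| ≤ M → |a₂| ≤ M → |g₁| ≤ M →
          |g₂| ≤ M → ((j : ℝ) + a₁) * (j + a₂) ≤
            Real.exp (8 * M ^ 2 / (j : ℝ) ^ 2) * ((j + g₁) * (j + g₂)) := by
        intro a₁ a₂ g₁ g₂ e h1 h2 h3 h4
        have := norm_factor_swap (x := j) (α₁ := a₁) (α₂ := a₂) (γ₁ := g₁) (γ₂ := g₂)
          (by exact_mod_cast e) (hna _ h1) (hna _ h2) (hna _ h3) (hna _ h4) hj'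
        rwa [hd _ h1, hd _ h2, hd _ h3, hd _ h4] at this
      have hδ : ‖(j : ℂ) + ((n : ℂ) - 1) / 2‖ = (j : ℝ) + ((n : ℝ) - 1) / 2 := by
        rw [← hd (((n : ℝ) - 1) / 2) (by rw [abs_le]; constructor <;> linarith)]
        push_cast; rfl
      rw [hδ] at r
      set X := Real.exp (8 * M ^ 2 / (j : ℝ) ^ 2) with hX
      have hX0 : 0 < X := Real.exp_pos _
      -- factors with equal sums are exchanged until the quotient of successive terms is at most
      -- the exponential times `(j - 1) (j + 2)² / (j + 1)³ ≤ 1`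
      have s1 := real_swap (((n : ℝ) - 1) / 2) (p / 2 - n / 4) (p / 2) (n / 4 - 1 / 2) (by ring)
        (by rw [abs_le]; constructor <;> linarith) (by rw [abs_le]; constructor <;> linarith)
        (by rw [abs_le]; constructor <;> linarith) (by rw [abs_le]; constructor <;> linarith)
      have s2 := real_swap (n / 4 - 1 / 2) (p / 2 - n / 4) ((p + 1) / 2) (-1) (by ring)
        (by rw [abs_le]; constructor <;> linarith) (by rw [abs_le]; constructor <;> linarith)
        (by rw [abs_le]; constructor <;> linarith) (by rw [abs_le]; constructor <;> linarith)
      have hrec := schurR_add_two (n := n) (p := p + 2 * j)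
        (by have : (0 : ℝ) ≤ j := by positivity
            linarith)
      have hrec' : 4 * (((j : ℝ) + p / 2) * (j + (p + 1) / 2)) * schurR n (p + 2 * (j + 1 : ℕ)) =
          (j + (p / 2 - n / 4)) ^ 2 * schurR n (p + 2 * j) := by
        rw [show p + 2 * ((j + 1 : ℕ) : ℝ) = p + 2 * j + 2 by push_cast; ring]
        linear_combination hrec / 4
      set c0 := ‖coef n s j‖
      set c1 := ‖coef n s (j + 1)‖
      set I0 := schurR n (p + 2 * j) with hI0
      set I1 := schurR n (p + 2 * (j + 1 : ℕ)) with hI1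
      have pI0 : 0 < I0 := hI j
      have pI1 : 0 < I1 := hI (j + 1)
      have hc0 : 0 ≤ c0 := norm_nonneg _
      set A := ((j : ℝ) + p / 2) * (j + (p + 1) / 2) with hA
      have hjp : 0 < (j : ℝ) + p / 2 := by linarith
      have hjp1 : 0 < (j : ℝ) + (p + 1) / 2 := by linarith
      have hA0 : 0 < A := mul_pos hjp hjp1
      have hb0 : 0 ≤ (j : ℝ) + (p / 2 - n / 4) := by linarith
      have hE3 : Real.exp (3 * (8 * M ^ 2) / (j : ℝ) ^ 2) = X * X * X := by
        rw [hX, ← Real.exp_add, ← Real.exp_add]; congr 1; ring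
      simp only [hE3]
      push_cast
      rw [show (j : ℝ) + 1 + 1 = j + 2 by ring]
      have key : ((j : ℝ) + 1) * (4 * A) * (c1 * I1 * (j + 2) ^ 2) ≤
          ((j : ℝ) + 1) * (4 * A) * (X * X * X * (c0 * I0 * (j + 1) ^ 2)) := by
        calc ((j : ℝ) + 1) * (4 * A) * (c1 * I1 * (j + 2) ^ 2)
            = ((j + 1) * c1) * (4 * A * I1) * (j + 2) ^ 2 := by ring
          _ = ((j + 1) * c1) * ((j + (p / 2 - n / 4)) ^ 2 * I0) * (j + 2) ^ 2 := by rw [hrec']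
          _ ≤ (4 * X * (j + ((n : ℝ) - 1) / 2) * c0) * ((j + (p / 2 - n / 4)) ^ 2 * I0) *
              (j + 2) ^ 2 := by gcongr
          _ = 4 * X * c0 * I0 * (j + 2) ^ 2 * (j + (p / 2 - n / 4)) *
              ((j + ((n : ℝ) - 1) / 2) * (j + (p / 2 - n / 4))) := by ring
          _ ≤ 4 * X * c0 * I0 * (j + 2) ^ 2 * (j + (p / 2 - n / 4)) *
              (X * ((j + p / 2) * (j + (n / 4 - 1 / 2)))) := by gcongr
          _ = 4 * X * X * c0 * I0 * (j + 2) ^ 2 * (j + p / 2) *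
              ((j + (n / 4 - 1 / 2)) * (j + (p / 2 - n / 4))) := by ring
          _ ≤ 4 * X * X * c0 * I0 * (j + 2) ^ 2 * (j + p / 2) *
              (X * ((j + (p + 1) / 2) * (j + -1))) := by gcongr
          _ = 4 * X * X * X * c0 * I0 * A * ((j + -1) * (j + 2) ^ 2) := by rw [hA]; ring
          _ ≤ 4 * X * X * X * c0 * I0 * A * ((j + 1) ^ 3) := by
              gcongr; nlinarith
          _ = _ := by ring
      exact le_of_mul_le_mul_left key (by positivity)

/-- Euler's limit formula, rearranged to give the growth of the Gamma function. -/
lemma Gamma_add_nat_eq_GammaSeq {z : ℂ} (hz : 0 < z.re) {J : ℕ} (hJ : J ≠ 0) :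
    Gamma (z + J + 1) = Gamma z * ((J : ℂ) ^ z * J.factorial) * (GammaSeq z J)⁻¹ := by
  have hne : ∀ i : ℕ, z + i ≠ 0 := fun i h => by
    have := congrArg Complex.re h; simp at this
    have h3 : (0 : ℝ) ≤ i := by positivity
    linarith
  have h : ∀ i : ℕ, Gamma (z + i) = Gamma z * ∏ l ∈ Finset.range i, (z + l) := by
    intro i
    induction i with
    | zero => simp
    | succ i ih =>
      rw [Finset.prod_range_succ, Nat.cast_succ, ← add_assoc, Complex.Gamma_add_one _ (hne i), ih]
      ring
  have h1 := h (J + 1)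
  rw [Nat.cast_succ, ← add_assoc] at h1
  rw [h1, GammaSeq, inv_div, mul_assoc]
  congr 1
  have hJ' : (J : ℂ) ^ z ≠ 0 := by
    rw [Ne, Complex.cpow_eq_zero_iff]; push Not; intro h; exact absurd h (by exact_mod_cast hJ)
  have hf : (J.factorial : ℂ) ≠ 0 := by exact_mod_cast J.factorial_ne_zero
  field_simp

/-- The normalisation of the kernel: the defect of the truncated series has total mass
tending to `1`. -/
lemma tendsto_coef_mul_schurC {n : ℕ} {s : ℂ} (hs : (n : ℝ) / 2 < s.re) :
    Tendsto (fun J : ℕ => 4 * (s + 2 * J) * (s + 2 * J + 1) * coef n s J * schurC n (s + 2 * J + 2))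
      atTop (𝓝 1) := by
  set z : ℂ := s - n / 2 with hz
  have hz0 : 0 < z.re := by
    simp only [hz, Complex.sub_re]
    have : ((n : ℂ) / 2).re = (n : ℝ) / 2 := by simp
    rw [this]; linarith
  have hz2 : 0 < (z / 2).re := by simp; linarith
  have hs0 : 0 < s.re := lt_of_le_of_lt (by positivity) hs
  have g1 := Complex.Gamma_ne_zero_of_re_pos hz0
  have g2 := Complex.Gamma_ne_zero_of_re_pos hz2
  have lim : Tendsto (fun J : ℕ => (Gamma (z / 2) * (GammaSeq (z / 2) J)⁻¹) ^ 2 *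
      ((Gamma z)⁻¹ * GammaSeq z J)) atTop (𝓝 1) := by
    have h1 := ((GammaSeq_tendsto_Gamma (z / 2)).inv₀ g2).const_mul (Gamma (z / 2))
    have h2 := (GammaSeq_tendsto_Gamma z).const_mul (Gamma z)⁻¹
    have := (h1.pow 2).mul h2
    rwa [mul_inv_cancel₀ g2, inv_mul_cancel₀ g1, one_pow, one_mul] at this
  refine lim.congr' ?_
  filter_upwards [eventually_ne_atTop 0] with J hJ
  have hj0 : (0 : ℝ) ≤ J := by positivity
  have h0 : s + 2 * J ≠ 0 := by
    intro h; have := congrArg Complex.re h; simp at this; linarith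
  have h1 : s + 2 * J + 1 ≠ 0 := by
    intro h; have := congrArg Complex.re h; simp at this; linarith
  have hpi : (Real.pi : ℂ) ^ ((n : ℂ) / 2) ≠ 0 := by
    rw [Ne, Complex.cpow_eq_zero_iff]; simp [Real.pi_ne_zero]
  have hf : (J.factorial : ℂ) ≠ 0 := by exact_mod_cast J.factorial_ne_zero
  have hG : Gamma (s + 2 * J) ≠ 0 := Complex.Gamma_ne_zero_of_re_pos (by simp; linarith)
  have e1 := Gamma_add_nat_eq_GammaSeq hz2 hJ
  have e2 := Gamma_add_nat_eq_GammaSeq hz0 hJ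
  have hpw : (J : ℂ) ^ z = (J : ℂ) ^ (z / 2) * (J : ℂ) ^ (z / 2) := by
    rw [← Complex.cpow_add _ _ (by exact_mod_cast hJ)]; congr 1; ring
  have hJ' : (J : ℂ) ^ (z / 2) ≠ 0 := by
    rw [Ne, Complex.cpow_eq_zero_iff]; push Not; intro h; exact absurd h (by exact_mod_cast hJ)
  unfold coef schurC
  rw [show s - n / 2 + 1 + J = z + J + 1 by rw [hz]; ring,
    show (s + 2 * J + 2 - n / 2) / 2 = z / 2 + J + 1 by rw [hz]; ring,
    show s + 2 * (J : ℂ) + 2 = (s + 2 * J + 1) + 1 by ring, Complex.Gamma_add_one _ h1,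
    Complex.Gamma_add_one _ h0, e1, e2, hpw]
  simp only [mul_inv, inv_inv]
  field_simp
  ring

/-- The masses of the defects stay bounded in absolute value. -/
lemma exists_defect_bound {n : ℕ} (hn : 0 < n) {s : ℂ} (hs : (n : ℝ) / 2 < s.re) :
    ∃ B > 0, ∀ J : ℕ, ‖4 * (s + 2 * J) * (s + 2 * J + 1) * coef n s J‖ *
      schurR n (s.re + 2 * J + 2) ≤ B := by
  have hn0 : (0 : ℝ) ≤ (n : ℝ) / 2 := by positivity
  have hs0 : 0 < s.re := by linarith
  obtain ⟨B, hB0, hB⟩ := exists_coef_bound_schur n hn (S := {s}) isCompact_singleton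
    (by simpa using hs0) hs
  refine ⟨(‖s‖ + s.re + 3) ^ 2 / s.re ^ 2 * (s.re + 2) ^ 2 * B, by positivity, fun J => ?_⟩
  have hJ0 : (0 : ℝ) ≤ J := by positivity
  have hsn := norm_nonneg s
  have r := schurR_add_two (n := n) (p := s.re + 2 * J) (by linarith)
  have hI : 0 < schurR n (s.re + 2 * J) := schurR_pos (by linarith)
  have hI2 : 0 < schurR n (s.re + 2 * J + 2) := schurR_pos (by linarith)
  have b := hB s rfl J
  rw [le_div_iff₀ (by positivity)] at b
  have n2 : ‖s + 2 * J‖ ≤ (‖s‖ + s.re + 3) / s.re * (s.re + 2 * J) := by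
    have h := norm_add_le s (2 * (J : ℂ))
    simp at h
    rw [div_mul_eq_mul_div, le_div_iff₀ hs0]
    nlinarith [mul_nonneg hsn hJ0, mul_nonneg hs0.le hJ0]
  have n3 : ‖s + 2 * J + 1‖ ≤ (‖s‖ + s.re + 3) / s.re * (s.re + 2 * J + 1) := by
    have h := norm_add_le s (2 * (J : ℂ))
    have h2 := norm_add_le (s + 2 * (J : ℂ)) 1
    simp at h h2
    rw [div_mul_eq_mul_div, le_div_iff₀ hs0]
    nlinarith [mul_nonneg hsn hJ0, mul_nonneg hs0.le hJ0]
  set q := (‖s‖ + s.re + 3) / s.re with hq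
  have hq0 : 0 < q := by positivity
  rw [← div_pow, ← hq]
  simp only [norm_mul]
  have h4 : ‖(4 : ℂ)‖ = 4 := by norm_num
  rw [h4]
  calc 4 * ‖s + 2 * (J : ℂ)‖ * ‖s + 2 * (J : ℂ) + 1‖ * ‖coef n s J‖ * schurR n (s.re + 2 * J + 2)
      ≤ 4 * (q * (s.re + 2 * J)) * (q * (s.re + 2 * J + 1)) * ‖coef n s J‖ *
        schurR n (s.re + 2 * J + 2) := by gcongr
    _ = q ^ 2 * ‖coef n s J‖ * (4 * (s.re + 2 * J) * (s.re + 2 * J + 1) *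
        schurR n (s.re + 2 * J + 2)) := by ring
    _ = q ^ 2 * (s.re + 2 * J - n / 2) ^ 2 * (‖coef n s J‖ * schurR n (s.re + 2 * J)) := by
        rw [r]; ring
    _ ≤ q ^ 2 * ((s.re + 2) * (J + 1)) ^ 2 * (‖coef n s J‖ * schurR n (s.re + 2 * J)) := by
        gcongr
        · linarith
        · nlinarith [mul_nonneg hs0.le hJ0]
    _ = q ^ 2 * (s.re + 2) ^ 2 * (‖coef n s J‖ * schurR n (s.re + 2 * J) * (J + 1) ^ 2) := by ring
    _ ≤ _ := by gcongr

/-- Away from the diagonal the defects tend to `0`. -/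
lemma tendsto_defect_zero {n : ℕ} (hn : 0 < n) {s : ℂ} (hs : 0 < s.re) {r : ℝ} (hr : 2 < r) :
    Tendsto (fun J : ℕ => ‖4 * (s + 2 * J) * (s + 2 * J + 1) * coef n s J‖ * (r ^ (2 * J))⁻¹)
      atTop (𝓝 0) := by
  obtain ⟨B, hB0, hB⟩ := exists_coef_bound_geom n hn (S := {s}) isCompact_singleton
    (by simpa using hs)
  have hlim : Tendsto (fun J : ℕ => (4 * (‖s‖ + 3) ^ 2 * B * 2 ^ (n + 2)) *
      ((J : ℝ) ^ (n + 2) * ((2 / r) ^ 2) ^ J)) atTop (𝓝 0) := by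
    have h1 : 2 / r < 1 := by rw [div_lt_one (by linarith)]; exact hr
    have h2 : ‖(2 / r) ^ 2‖ < 1 := by
      rw [Real.norm_of_nonneg (by positivity)]
      exact pow_lt_one₀ (by positivity) h1 (by norm_num)
    generalize (2 / r) ^ 2 = q at h2
    have := (summable_pow_mul_geometric_of_norm_lt_one (n + 2) h2).tendsto_atTop_zero
    simpa using this.const_mul _
  refine squeeze_zero' (Eventually.of_forall fun J => by positivity) ?_ hlim
  filter_upwards [eventually_ge_atTop 1] with J hJ
  have hJ1 : (1 : ℝ) ≤ J := by exact_mod_cast hJ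
  have hsn := norm_nonneg s
  have n2 : ‖s + 2 * J‖ ≤ (‖s‖ + 3) * (J + 1) := by
    have h := norm_add_le s (2 * (J : ℂ))
    simp at h
    nlinarith
  have n3 : ‖s + 2 * J + 1‖ ≤ (‖s‖ + 3) * (J + 1) := by
    have h := norm_add_le s (2 * (J : ℂ))
    have h2 := norm_add_le (s + 2 * (J : ℂ)) 1
    simp at h h2
    nlinarith
  have b := hB s rfl J
  simp only [norm_mul]
  have h4 : ‖(4 : ℂ)‖ = 4 := by norm_num
  have hr0 : 0 < r := by linarith
  rw [h4]
  calc _ ≤ 4 * ((‖s‖ + 3) * (J + 1)) * ((‖s‖ + 3) * (J + 1)) * (B * (4 ^ J * ((J : ℝ) + 1) ^ n)) *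
        (r ^ (2 * J))⁻¹ := by gcongr
    _ = 4 * (‖s‖ + 3) ^ 2 * B * ((J : ℝ) + 1) ^ (n + 2) * (4 ^ J * (r ^ (2 * J))⁻¹) := by ring
    _ ≤ 4 * (‖s‖ + 3) ^ 2 * B * (2 * J) ^ (n + 2) * (4 ^ J * (r ^ (2 * J))⁻¹) := by
        gcongr; linarith
    _ = _ := by
        rw [mul_pow, ← pow_mul, div_pow, pow_mul 2 2 J]; norm_num; ring

end

end ModelCusp

namespace ModelCusp

section

open Filter Topology Complex MeasureTheory Set

variable {m k : ℕ}

/-! ### The distance function and the Schur integral -/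

/-- `x² + x'² + |y - y'|² + |z - z'|²`. -/
noncomputable def quad (w w' : Pt m k) : ℝ :=
  w.1 ^ 2 + w'.1 ^ 2 + ‖w.2.1 - w'.2.1‖ ^ 2 + ‖w.2.2 - w'.2.2‖ ^ 2

/-- `2 cosh d(w, w')`, where `d` is the hyperbolic distance. -/
noncomputable def twoCosh (w w' : Pt m k) : ℝ := quad w w' / (w.1 * w'.1)

lemma quad_comm (w w' : Pt m k) : quad w w' = quad w' w := by
  unfold quad; rw [norm_sub_rev w.2.1, norm_sub_rev w.2.2]; ring

lemma twoCosh_comm (w w' : Pt m k) : twoCosh w w' = twoCosh w' w := by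
  unfold twoCosh; rw [quad_comm, mul_comm]

lemma two_mul_le_quad (w w' : Pt m k) : 2 * (w.1 * w'.1) ≤ quad w w' := by
  unfold quad; nlinarith [sq_nonneg (w.1 - w'.1), sq_nonneg ‖w.2.1 - w'.2.1‖,
    sq_nonneg ‖w.2.2 - w'.2.2‖]

lemma quad_pos {w w' : Pt m k} (hw : w ∈ halfSpace m k) : 0 < quad w w' := by
  have : 0 < w.1 := hw
  unfold quad; positivity

lemma two_le_twoCosh {w w' : Pt m k} (hw : w ∈ halfSpace m k) (hw' : w' ∈ halfSpace m k) :
    2 ≤ twoCosh w w' := by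
  have h1 : 0 < w.1 := hw
  have h2 : 0 < w'.1 := hw'
  rw [twoCosh, le_div_iff₀ (by positivity)]
  exact two_mul_le_quad w w'

lemma quad_eq_two_mul_iff {w w' : Pt m k} : quad w w' = 2 * (w.1 * w'.1) ↔ w = w' := by
  constructor
  · intro h
    unfold quad at h
    have h1 := sq_nonneg (w.1 - w'.1)
    have h2 := sq_nonneg ‖w.2.1 - w'.2.1‖
    have h3 := sq_nonneg ‖w.2.2 - w'.2.2‖
    have e1 : (w.1 - w'.1) ^ 2 = 0 := by nlinarith
    have e2 : ‖w.2.1 - w'.2.1‖ ^ 2 = 0 := by nlinarith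
    have e3 : ‖w.2.2 - w'.2.2‖ ^ 2 = 0 := by nlinarith
    refine Prod.ext (sub_eq_zero.mp (pow_eq_zero_iff (by norm_num) |>.mp e1)) (Prod.ext ?_ ?_)
    · exact sub_eq_zero.mp (norm_eq_zero.mp (pow_eq_zero_iff (by norm_num) |>.mp e2))
    · exact sub_eq_zero.mp (norm_eq_zero.mp (pow_eq_zero_iff (by norm_num) |>.mp e3))
  · rintro rfl; simp [quad]; ring

lemma two_lt_twoCosh {w w' : Pt m k} (hw : w ∈ halfSpace m k) (hw' : w' ∈ halfSpace m k)
    (h : w ≠ w') : 2 < twoCosh w w' := by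
  have h1 : 0 < w.1 := hw
  have h2 : 0 < w'.1 := hw'
  refine lt_of_le_of_ne (two_le_twoCosh hw hw') fun e => h (quad_eq_two_mul_iff.mp ?_)
  rw [twoCosh, eq_div_iff (by positivity)] at e
  exact e.symm

lemma isOpen_halfSpace : IsOpen (halfSpace m k) := isOpen_lt continuous_const continuous_fst

lemma measurableSet_halfSpace : MeasurableSet (halfSpace m k) := isOpen_halfSpace.measurableSet

lemma continuous_quad : Continuous (fun p : Pt m k × Pt m k => quad p.1 p.2) := by
  unfold quad; fun_prop

lemma measurable_twoCosh : Measurable (fun p : Pt m k × Pt m k => twoCosh p.1 p.2) := by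
  unfold twoCosh
  exact continuous_quad.measurable.div (by fun_prop)

lemma volume_restrict_halfSpace :
    (volume : Measure (Pt m k)).restrict (halfSpace m k) =
      (volume.restrict (Ioi (0 : ℝ))).prod volume := by
  have : halfSpace m k = Ioi (0 : ℝ) ×ˢ univ := by ext w; simp [halfSpace]
  rw [this, Measure.volume_eq_prod, ← Measure.prod_restrict, Measure.restrict_univ]

lemma measurable_density :
    Measurable (fun w : Pt m k => ENNReal.ofReal ((w.1 ^ (m + k + 1))⁻¹)) := by fun_prop

lemma integrable_hypVolume_iff {f : Pt m k → ℂ} :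
    Integrable f (hypVolume m k) ↔
      Integrable (fun w => (((w.1 ^ (m + k + 1))⁻¹ : ℝ) : ℂ) * f w)
        (volume.restrict (halfSpace m k)) := by
  unfold hypVolume
  rw [integrable_withDensity_iff_integrable_smul' measurable_density (by simp)]
  refine integrable_congr ?_
  filter_upwards [ae_restrict_mem measurableSet_halfSpace] with w hw
  have : 0 < w.1 := hw
  rw [ENNReal.toReal_ofReal (by positivity), Complex.real_smul]

lemma integral_hypVolume (f : Pt m k → ℂ) :
    ∫ w, f w ∂(hypVolume m k) =
      ∫ w in halfSpace m k, (((w.1 ^ (m + k + 1))⁻¹ : ℝ) : ℂ) * f w := by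
  unfold hypVolume
  rw [integral_withDensity_eq_integral_toReal_smul measurable_density (by simp)]
  refine integral_congr_ae ?_
  filter_upwards [ae_restrict_mem measurableSet_halfSpace] with w hw
  have : 0 < w.1 := hw
  rw [ENNReal.toReal_ofReal (by positivity), Complex.real_smul]

lemma ae_hypVolume_mem : ∀ᵐ w ∂(hypVolume m k), w ∈ halfSpace m k :=
  (withDensity_absolutelyContinuous _ _).ae_le (ae_restrict_mem measurableSet_halfSpace)

lemma sq_cpow_of_pos {x : ℝ} (hx : 0 < x) (c : ℂ) : ((x : ℂ) ^ 2) ^ c = (x : ℂ) ^ (2 * c) := by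
  rw [pow_two, Complex.mul_cpow_ofReal_nonneg hx.le hx.le, two_mul,
    Complex.cpow_add _ _ (by exact_mod_cast hx.ne')]

lemma integrable_cpow_mul_exp_neg_sq {b : ℂ} (hb : 0 < b.re) {t : ℝ} (ht : 0 < t) :
    Integrable (fun x : ℝ => (x : ℂ) ^ (2 * b - 1) * cexp (-(t * (x : ℂ) ^ 2)))
      (volume.restrict (Ioi 0)) := by
  have h := integrableOn_rpow_mul_exp_neg_mul_sq ht (s := 2 * b.re - 1) (by linarith)
  refine Integrable.mono' h ?_ ?_
  · refine Measurable.aestronglyMeasurable ?_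
    fun_prop
  · filter_upwards [ae_restrict_mem measurableSet_Ioi] with x hx
    have hx : 0 < x := hx
    rw [norm_mul, Complex.norm_cpow_eq_rpow_re_of_pos hx, Complex.norm_exp]
    have : (-(t * (x : ℂ) ^ 2)).re = -t * x ^ 2 := by
      rw [← Complex.ofReal_pow, ← Complex.ofReal_mul, ← Complex.ofReal_neg, Complex.ofReal_re]; ring
    rw [this]; simp

lemma integral_cpow_mul_exp_neg_sq {b : ℂ} (hb : 0 < b.re) {t : ℝ} (ht : 0 < t) :
    ∫ x in Ioi (0 : ℝ), (x : ℂ) ^ (2 * b - 1) * cexp (-(t * (x : ℂ) ^ 2)) =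
      (1 / t) ^ b * Gamma b / 2 := by
  have h := integral_comp_rpow_Ioi_of_pos (g := fun u : ℝ => (u : ℂ) ^ (b - 1) * cexp (-(t * u)))
    (p := 2) (by norm_num)
  rw [Complex.integral_cpow_mul_exp_neg_mul_Ioi hb ht] at h
  rw [← h, eq_div_iff (by norm_num), ← integral_mul_const]
  refine setIntegral_congr_fun measurableSet_Ioi fun x hx => ?_
  have hx : 0 < x := hx
  have hx0 : (x : ℂ) ≠ 0 := by exact_mod_cast hx.ne'
  simp only [Complex.real_smul]
  rw [show ((x ^ (2 : ℝ) : ℝ) : ℂ) = (x : ℂ) ^ 2 by norm_cast,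
    sq_cpow_of_pos hx,
    show (2 * b - 1 : ℂ) = 1 + 2 * (b - 1) by ring, Complex.cpow_add _ _ hx0]
  norm_num
  ring

/-- The integrand which represents `T^{-p} x'^{n/2}` as a superposition of Gaussians. -/
noncomputable def gaussKer (p : ℂ) (w : Pt m k) (q : ℝ × Pt m k) : ℂ :=
  ((q.1 : ℂ) ^ (p - 1) * cexp (-(q.1 * (w.1 : ℂ) ^ 2))) *
    (((q.2.1 : ℂ) ^ (2 * ((p - (m + k : ℕ) / 2) / 2) - 1) * cexp (-(q.1 * (q.2.1 : ℂ) ^ 2))) *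
      (cexp (-(q.1 : ℂ) * ‖w.2.1 - q.2.2.1‖ ^ 2) * cexp (-(q.1 : ℂ) * ‖w.2.2 - q.2.2.2‖ ^ 2)))

lemma measurable_gaussKer (p : ℂ) (w : Pt m k) : Measurable (gaussKer p w) := by
  unfold gaussKer
  fun_prop

section
variable {p : ℂ} (hp : ((m + k : ℕ) : ℝ) / 2 < p.re) {w : Pt m k} (hw : w ∈ halfSpace m k)

include hp in
lemma half_re_pos : 0 < ((p - (m + k : ℕ) / 2) / 2).re := by
  have h : (((m + k : ℕ) : ℂ) / 2).re = ((m + k : ℕ) : ℝ) / 2 := by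
    rw [← Complex.ofReal_re (((m + k : ℕ) : ℝ) / 2)]; push_cast; rfl
  have h2 : ((p - (m + k : ℕ) / 2) / 2).re = (p.re - ((m + k : ℕ) : ℝ) / 2) / 2 := by
    rw [← h, ← Complex.sub_re]; simp
  rw [h2]; linarith
end

lemma integrable_gauss {E : Type*} [NormedAddCommGroup E] [InnerProductSpace ℝ E]
    [FiniteDimensional ℝ E] [MeasurableSpace E] [BorelSpace E] {t : ℝ} (ht : 0 < t) (v : E) :
    Integrable (fun u : E => cexp (-(t : ℂ) * ‖v - u‖ ^ 2)) := by
  have := GaussianFourier.integrable_cexp_neg_mul_sq_norm_add (b := (t : ℂ)) (V := E) (by simpa) 0 0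
  simp only [zero_mul, add_zero] at this
  exact this.comp_sub_left v

lemma integral_gauss {E : Type*} [NormedAddCommGroup E] [InnerProductSpace ℝ E]
    [FiniteDimensional ℝ E] [MeasurableSpace E] [BorelSpace E] {t : ℝ} (ht : 0 < t) (v : E) :
    ∫ u : E, cexp (-(t : ℂ) * ‖v - u‖ ^ 2) = (Real.pi / t) ^ (Module.finrank ℝ E / 2 : ℂ) := by
  rw [← GaussianFourier.integral_cexp_neg_mul_sq_norm (b := (t : ℂ)) (V := E) (by simpa)]
  exact integral_sub_left_eq_self (fun u : E => cexp (-(t : ℂ) * ‖u‖ ^ 2)) volume v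

lemma integrable_gaussKer_slice {p : ℂ} (hp : ((m + k : ℕ) : ℝ) / 2 < p.re) (w : Pt m k)
    {t : ℝ} (ht : 0 < t) :
    Integrable (fun w' => gaussKer p w (t, w')) (volume.restrict (halfSpace m k)) := by
  rw [volume_restrict_halfSpace]
  unfold gaussKer
  have h2 := Integrable.mul_prod (L := ℂ) (integrable_gauss ht w.2.1) (integrable_gauss ht w.2.2)
  have h1 := Integrable.mul_prod (L := ℂ)
    (integrable_cpow_mul_exp_neg_sq (half_re_pos hp) ht) h2
  exact h1.const_mul ((t : ℂ) ^ (p - 1) * cexp (-(t * (w.1 : ℂ) ^ 2)))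

lemma integral_gaussKer_slice {p : ℂ} (hp : ((m + k : ℕ) : ℝ) / 2 < p.re) (w : Pt m k)
    {t : ℝ} (ht : 0 < t) :
    ∫ w' in halfSpace m k, gaussKer p w (t, w') =
      (Real.pi : ℂ) ^ (((m + k : ℕ) : ℂ) / 2) / 2 * Gamma ((p - (m + k : ℕ) / 2) / 2) *
        ((t : ℂ) ^ ((p - (m + k : ℕ) / 2) / 2 - 1) * cexp (-(((w.1 ^ 2 : ℝ) : ℂ) * t))) := by
  rw [volume_restrict_halfSpace]
  unfold gaussKer
  have e1 := integral_prod_mul (μ := volume.restrict (Ioi (0 : ℝ)))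
    (ν := (volume : Measure (EuclideanSpace ℝ (Fin m) × EuclideanSpace ℝ (Fin k))))
    (fun x : ℝ => (x : ℂ) ^ (2 * ((p - (m + k : ℕ) / 2) / 2) - 1) * cexp (-(t * (x : ℂ) ^ 2)))
    (fun u => cexp (-(t : ℂ) * ‖w.2.1 - u.1‖ ^ 2) * cexp (-(t : ℂ) * ‖w.2.2 - u.2‖ ^ 2))
  have e2 := integral_prod_mul (μ := (volume : Measure (EuclideanSpace ℝ (Fin m))))
    (ν := (volume : Measure (EuclideanSpace ℝ (Fin k))))
    (fun u => cexp (-(t : ℂ) * ‖w.2.1 - u‖ ^ 2)) (fun u => cexp (-(t : ℂ) * ‖w.2.2 - u‖ ^ 2))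
  rw [integral_cpow_mul_exp_neg_sq (half_re_pos hp) ht] at e1
  rw [integral_gauss ht, integral_gauss ht, ← Measure.volume_eq_prod] at e2
  refine (integral_const_mul ((t : ℂ) ^ (p - 1) * cexp (-(t * (w.1 : ℂ) ^ 2))) _).trans
    ((congrArg _ (e1.trans (congrArg _ e2))).trans ?_)
  simp only [finrank_euclideanSpace, Fintype.card_fin]
  have ht0 : (t : ℂ) ≠ 0 := by exact_mod_cast ht.ne'
  have hpi : (Real.pi : ℂ) ≠ 0 := by exact_mod_cast Real.pi_ne_zero
  have hq : (Real.pi / t : ℂ) ≠ 0 := div_ne_zero hpi ht0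
  have hb : ∀ b : ℂ, (1 / t : ℂ) ^ b = (t : ℂ) ^ (-b) := fun b => by
    rw [one_div, Complex.inv_cpow _ _ (by rw [Complex.arg_ofReal_of_nonneg ht.le]; exact Real.pi_ne_zero.symm),
      Complex.cpow_neg]
  have hd : ∀ b : ℂ, (Real.pi / t : ℂ) ^ b = (Real.pi : ℂ) ^ b * (t : ℂ) ^ (-b) := fun b => by
    rw [div_eq_mul_inv, ← Complex.ofReal_inv, Complex.mul_cpow_ofReal_nonneg Real.pi_pos.le
      (by positivity), Complex.ofReal_inv, ← one_div, hb]
  rw [hb, hd, hd]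
  have hpe : (p - 1 : ℂ) = ((p - (m + k : ℕ) / 2) / 2 - 1) + (p - (m + k : ℕ) / 2) / 2 +
      (m : ℂ) / 2 + (k : ℂ) / 2 := by push_cast; ring
  have hpie : (((m + k : ℕ) : ℂ) / 2) = (m : ℂ) / 2 + (k : ℂ) / 2 := by push_cast; ring
  rw [hpe, hpie, Complex.cpow_add _ _ hpi, Complex.cpow_add _ _ ht0, Complex.cpow_add _ _ ht0,
    Complex.cpow_add _ _ ht0, ← hpie]
  have c : ∀ b : ℂ, (t : ℂ) ^ b * (t : ℂ) ^ (-b) = 1 := fun b => by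
    rw [← Complex.cpow_add _ _ ht0]; simp
  have hexp : cexp (-(t * (w.1 : ℂ) ^ 2)) = cexp (-(((w.1 ^ 2 : ℝ) : ℂ) * t)) := by
    congr 1; push_cast; ring
  rw [hexp]
  set b := (p - (m + k : ℕ) / 2) / 2
  linear_combination ((Real.pi : ℂ) ^ ((m : ℂ) / 2) * (Real.pi : ℂ) ^ ((k : ℂ) / 2) / 2 * Gamma b *
        ((t : ℂ) ^ (b - 1) * cexp (-(((w.1 ^ 2 : ℝ) : ℂ) * t)))) *
      (c b * (t : ℂ) ^ ((m : ℂ) / 2) * (t : ℂ) ^ (-((m : ℂ) / 2)) * (t : ℂ) ^ ((k : ℂ) / 2) * (t : ℂ) ^ (-((k : ℂ) / 2))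
        + c ((m : ℂ) / 2) * (t : ℂ) ^ ((k : ℂ) / 2) * (t : ℂ) ^ (-((k : ℂ) / 2)) + c ((k : ℂ) / 2))

lemma norm_gaussKer {p : ℂ} (w : Pt m k) {t : ℝ} (ht : 0 < t) {w' : Pt m k}
    (hw' : w' ∈ halfSpace m k) :
    ((‖gaussKer p w (t, w')‖ : ℝ) : ℂ) = gaussKer (p.re : ℂ) w (t, w') := by
  have hx : 0 < w'.1 := hw'
  have e : ∀ r : ℝ, ‖cexp (r : ℂ)‖ = Real.exp r := fun r => by
    rw [← Complex.ofReal_exp, Complex.norm_of_nonneg (Real.exp_pos _).le]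
  unfold gaussKer
  simp only [norm_mul, Complex.norm_cpow_eq_rpow_re_of_pos hx, Complex.norm_cpow_eq_rpow_re_of_pos ht]
  have h1 : ∀ a b : ℝ, (-((a : ℂ) * (b : ℂ) ^ 2)) = ((-(a * b ^ 2) : ℝ) : ℂ) := fun a b => by
    push_cast; ring
  have h2 : ∀ a b : ℝ, (-(a : ℂ) * (b : ℂ) ^ 2) = ((-a * b ^ 2 : ℝ) : ℂ) := fun a b => by
    push_cast; ring
  have r1 : (p - 1).re = p.re - 1 := by simp
  have r2 : (2 * ((p - (m + k : ℕ) / 2) / 2) - 1).re = p.re - ((m + k : ℕ) : ℝ) / 2 - 1 := by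
    have : (2 * ((p - (m + k : ℕ) / 2) / 2) - 1 : ℂ) = p - ((((m + k : ℕ) : ℝ) / 2 + 1 : ℝ) : ℂ) := by
      push_cast; ring
    rw [this, Complex.sub_re, Complex.ofReal_re]; ring
  rw [r1, r2]
  simp only [h1, h2, e]
  push_cast
  rw [Complex.ofReal_cpow ht.le, Complex.ofReal_cpow hx.le]
  push_cast
  ring_nf

/-- Absolute convergence, which justifies exchanging the integrals over `t` and `w'`. -/
lemma integrable_gaussKer {p : ℂ} (hp : ((m + k : ℕ) : ℝ) / 2 < p.re) {w : Pt m k}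
    (hw : w ∈ halfSpace m k) :
    Integrable (gaussKer p w) ((volume.restrict (Ioi (0 : ℝ))).prod
      (volume.restrict (halfSpace m k))) := by
  have hx : 0 < w.1 := hw
  rw [integrable_prod_iff (measurable_gaussKer p w).aestronglyMeasurable]
  constructor
  · filter_upwards [ae_restrict_mem measurableSet_Ioi] with t ht
    exact integrable_gaussKer_slice hp w ht
  · have hb := half_re_pos (m := m) (k := k) (p := (p.re : ℂ)) (by simpa using hp)
    have h : Integrable (fun t : ℝ => (Real.pi : ℂ) ^ (((m + k : ℕ) : ℂ) / 2) / 2 *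
        Gamma (((p.re : ℂ) - (m + k : ℕ) / 2) / 2) * ((t : ℂ) ^ (((p.re : ℂ) - (m + k : ℕ) / 2) / 2 - 1)
          * cexp (-(((w.1 ^ 2 : ℝ) : ℂ) * t)))) (volume.restrict (Ioi 0)) := by
      refine Integrable.const_mul ?_ _
      -- the integral is a nonzero Gamma value, but would be `0` without integrability
      by_contra hni
      have hv := Complex.integral_cpow_mul_exp_neg_mul_Ioi hb (show 0 < w.1 ^ 2 by positivity)
      rw [integral_undef hni] at hv
      have hg := Complex.Gamma_ne_zero_of_re_pos hb
      have : (1 / ((w.1 ^ 2 : ℝ) : ℂ)) ^ (((p.re : ℂ) - (m + k : ℕ) / 2) / 2) ≠ 0 := by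
        rw [Ne, Complex.cpow_eq_zero_iff]; simp [hx.ne']
      exact mul_ne_zero this hg hv.symm
    refine h.norm.congr ?_
    filter_upwards [ae_restrict_mem measurableSet_Ioi] with t ht
    rw [← integral_gaussKer_slice (p := (p.re : ℂ)) (by simpa using hp) w ht]
    have : ∫ w' in halfSpace m k, gaussKer (p.re : ℂ) w (t, w') =
        ((∫ w' in halfSpace m k, ‖gaussKer p w (t, w')‖ : ℝ) : ℂ) := by
      rw [← integral_complex_ofReal]
      refine setIntegral_congr_fun measurableSet_halfSpace fun w' hw' => ?_
      exact (norm_gaussKer w ht hw').symm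
    rw [this, Complex.norm_of_nonneg]
    exact integral_nonneg fun _ => norm_nonneg _

/-- Integration over `t` recovers the power of `T`. -/
lemma integral_gaussKer_time {p : ℂ} (hp : 0 < p.re) {w w' : Pt m k}
    (hw : w ∈ halfSpace m k) (hw' : w' ∈ halfSpace m k) :
    ∫ t in Ioi (0 : ℝ), gaussKer p w (t, w') =
      Gamma p * (w.1 : ℂ) ^ (-p) * ((((w'.1 ^ (m + k + 1))⁻¹ : ℝ) : ℂ) *
        ((twoCosh w w' : ℂ) ^ (-p) * (w'.1 : ℂ) ^ (((m + k : ℕ) : ℂ) / 2))) := by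
  have hx : 0 < w.1 := hw
  have hx' : 0 < w'.1 := hw'
  have hQ := quad_pos (w' := w') hw
  have h : ∀ t : ℝ, gaussKer p w (t, w') = (w'.1 : ℂ) ^ (2 * ((p - (m + k : ℕ) / 2) / 2) - 1) *
      ((t : ℂ) ^ (p - 1) * cexp (-((quad w w' : ℂ) * t))) := by
    intro t
    unfold gaussKer quad
    have : cexp (-(((w.1 ^ 2 + w'.1 ^ 2 + ‖w.2.1 - w'.2.1‖ ^ 2 + ‖w.2.2 - w'.2.2‖ ^ 2 : ℝ) : ℂ) * t))
        = cexp (-(t * (w.1 : ℂ) ^ 2)) * cexp (-(t * (w'.1 : ℂ) ^ 2)) *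
          cexp (-(t : ℂ) * ‖w.2.1 - w'.2.1‖ ^ 2) * cexp (-(t : ℂ) * ‖w.2.2 - w'.2.2‖ ^ 2) := by
      simp only [← Complex.exp_add]; congr 1; push_cast; ring
    rw [this]; ring
  simp only [h]
  rw [integral_const_mul, Complex.integral_cpow_mul_exp_neg_mul_Ioi hp hQ]
  have hc0 : (w.1 : ℂ) ≠ 0 := by exact_mod_cast hx.ne'
  have hc0' : (w'.1 : ℂ) ≠ 0 := by exact_mod_cast hx'.ne'
  have hT : (twoCosh w w' : ℂ) ^ (-p) = (1 / (quad w w' : ℂ)) ^ p * ((w.1 : ℂ) ^ p * (w'.1 : ℂ) ^ p) := by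
    have hTp : 0 < twoCosh w w' := lt_of_lt_of_le two_pos (two_le_twoCosh hw hw')
    have : (1 / (quad w w' : ℂ)) = (((twoCosh w w')⁻¹ * (w.1⁻¹ * w'.1⁻¹) : ℝ) : ℂ) := by
      rw [twoCosh]; push_cast
      have : (quad w w' : ℂ) ≠ 0 := by exact_mod_cast hQ.ne'
      field_simp
    rw [this, Complex.ofReal_mul, Complex.mul_cpow_ofReal_nonneg (by positivity) (by positivity),
      Complex.ofReal_mul, Complex.mul_cpow_ofReal_nonneg (by positivity) (by positivity)]
    have inv : ∀ r : ℝ, 0 < r → ((r⁻¹ : ℝ) : ℂ) ^ p = ((r : ℂ) ^ p)⁻¹ := fun r hr => by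
      rw [Complex.ofReal_inv, Complex.inv_cpow _ _ (by
        rw [Complex.arg_ofReal_of_nonneg hr.le]; exact Real.pi_ne_zero.symm)]
    rw [inv _ hTp, inv _ hx, inv _ hx', Complex.cpow_neg]
    have a1 : (w.1 : ℂ) ^ p ≠ 0 := by rw [Ne, Complex.cpow_eq_zero_iff]; simp [hx.ne']
    have a2 : (w'.1 : ℂ) ^ p ≠ 0 := by rw [Ne, Complex.cpow_eq_zero_iff]; simp [hx'.ne']
    field_simp
  rw [hT, Complex.cpow_neg]
  have a1 : (w.1 : ℂ) ^ p ≠ 0 := by rw [Ne, Complex.cpow_eq_zero_iff]; simp [hx.ne']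
  have e : (w'.1 : ℂ) ^ (2 * ((p - (m + k : ℕ) / 2) / 2) - 1) =
      (((w'.1 ^ (m + k + 1))⁻¹ : ℝ) : ℂ) * ((w'.1 : ℂ) ^ p * (w'.1 : ℂ) ^ (((m + k : ℕ) : ℂ) / 2)) := by
    rw [← Complex.cpow_add _ _ hc0']
    push_cast
    rw [← Complex.cpow_natCast, ← Complex.cpow_neg, ← Complex.cpow_add _ _ hc0']
    congr 1; push_cast; ring
  rw [e]
  field_simp

/-- The Schur integral of `T^{-p}` against the eigenfunction `x'^{n/2}`. -/
theorem integral_twoCosh_cpow {p : ℂ} (hp : ((m + k : ℕ) : ℝ) / 2 < p.re) {w : Pt m k}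
    (hw : w ∈ halfSpace m k) :
    Integrable (fun w' => (twoCosh w w' : ℂ) ^ (-p) * (w'.1 : ℂ) ^ (((m + k : ℕ) : ℂ) / 2))
      (hypVolume m k) ∧
    ∫ w', (twoCosh w w' : ℂ) ^ (-p) * (w'.1 : ℂ) ^ (((m + k : ℕ) : ℂ) / 2) ∂(hypVolume m k) =
      schurC (m + k) p * (w.1 : ℂ) ^ (((m + k : ℕ) : ℂ) / 2) := by
  have hx : 0 < w.1 := hw
  have hc0 : (w.1 : ℂ) ≠ 0 := by exact_mod_cast hx.ne'
  have hp0 : 0 < p.re := lt_of_le_of_lt (by positivity) hp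
  have hG := Complex.Gamma_ne_zero_of_re_pos hp0
  have hxp : (w.1 : ℂ) ^ (-p) ≠ 0 := by rw [Ne, Complex.cpow_eq_zero_iff]; simp [hx.ne']
  have hb := half_re_pos hp
  have hint := integrable_gaussKer hp hw
  have i1 := hint.integral_prod_right
  have e1 : (fun w' => ∫ t in Ioi (0 : ℝ), gaussKer p w (t, w')) =ᵐ[volume.restrict (halfSpace m k)]
      fun w' => Gamma p * (w.1 : ℂ) ^ (-p) * ((((w'.1 ^ (m + k + 1))⁻¹ : ℝ) : ℂ) *
        ((twoCosh w w' : ℂ) ^ (-p) * (w'.1 : ℂ) ^ (((m + k : ℕ) : ℂ) / 2))) := by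
    filter_upwards [ae_restrict_mem measurableSet_halfSpace] with w' hw'
    exact integral_gaussKer_time hp0 hw hw'
  have i2 := i1.congr e1
  constructor
  · rw [integrable_hypVolume_iff]
    have := i2.const_mul (Gamma p * (w.1 : ℂ) ^ (-p))⁻¹
    refine this.congr (Eventually.of_forall fun w' => ?_)
    simp only
    rw [inv_mul_cancel_left₀ (mul_ne_zero hG hxp)]
  · rw [integral_hypVolume]
    have s1 : ∫ w' in halfSpace m k, (∫ t in Ioi (0 : ℝ), gaussKer p w (t, w')) =
        ∫ t in Ioi (0 : ℝ), ∫ w' in halfSpace m k, gaussKer p w (t, w') :=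
      (integral_integral_swap (f := fun t w' => gaussKer p w (t, w')) hint).symm
    rw [integral_congr_ae e1, integral_const_mul] at s1
    have s2 : ∫ t in Ioi (0 : ℝ), ∫ w' in halfSpace m k, gaussKer p w (t, w') =
        (Real.pi : ℂ) ^ (((m + k : ℕ) : ℂ) / 2) / 2 * Gamma ((p - (m + k : ℕ) / 2) / 2) *
          ((1 / ((w.1 ^ 2 : ℝ) : ℂ)) ^ ((p - (m + k : ℕ) / 2) / 2) * Gamma ((p - (m + k : ℕ) / 2) / 2)) := by
      rw [← Complex.integral_cpow_mul_exp_neg_mul_Ioi hb (show 0 < w.1 ^ 2 by positivity),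
        ← integral_const_mul]
      refine setIntegral_congr_fun measurableSet_Ioi fun t ht => ?_
      exact integral_gaussKer_slice hp w ht
    rw [s2] at s1
    refine mul_left_cancel₀ (mul_ne_zero hG hxp) (s1.trans ?_)
    have e3 : (1 / ((w.1 ^ 2 : ℝ) : ℂ)) ^ ((p - (m + k : ℕ) / 2) / 2) =
        (w.1 : ℂ) ^ (-p) * (w.1 : ℂ) ^ (((m + k : ℕ) : ℂ) / 2) := by
      rw [one_div, Complex.inv_cpow _ _ (by
        rw [Complex.arg_ofReal_of_nonneg (by positivity)]; exact Real.pi_ne_zero.symm),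
        ← Complex.cpow_neg, Complex.ofReal_pow, ← Complex.cpow_add _ _ hc0, sq_cpow_of_pos hx]
      congr 1; ring
    rw [e3]
    unfold schurC
    field_simp

/-- The Schur integral of `T^{-p}` for real `p`, as a Lebesgue integral. -/
theorem lintegral_twoCosh_rpow {p : ℝ} (hp : ((m + k : ℕ) : ℝ) / 2 < p) {w : Pt m k}
    (hw : w ∈ halfSpace m k) :
    ∫⁻ w', ENNReal.ofReal (twoCosh w w' ^ (-p)) * ENNReal.ofReal (w'.1 ^ (((m + k : ℕ) : ℝ) / 2))
      ∂(hypVolume m k) =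
      ENNReal.ofReal (schurR (m + k) p) * ENNReal.ofReal (w.1 ^ (((m + k : ℕ) : ℝ) / 2)) := by
  have hx : 0 < w.1 := hw
  obtain ⟨hi, he⟩ := integral_twoCosh_cpow (p := (p : ℂ)) (by simpa using hp) hw
  have ee : ∀ w' ∈ halfSpace m k, (twoCosh w w' : ℂ) ^ (-(p : ℂ)) * (w'.1 : ℂ) ^ (((m + k : ℕ) : ℂ) / 2)
      = ((twoCosh w w' ^ (-p) * w'.1 ^ (((m + k : ℕ) : ℝ) / 2) : ℝ) : ℂ) := fun w' hw' => by
    have hx' : 0 < w'.1 := hw'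
    have hT := two_le_twoCosh hw hw'
    rw [Complex.ofReal_mul, Complex.ofReal_cpow (by linarith), Complex.ofReal_cpow hx'.le]
    push_cast; rfl
  have hae : (fun w' => (twoCosh w w' : ℂ) ^ (-(p : ℂ)) * (w'.1 : ℂ) ^ (((m + k : ℕ) : ℂ) / 2))
      =ᵐ[hypVolume m k] fun w' =>
        ((twoCosh w w' ^ (-p) * w'.1 ^ (((m + k : ℕ) : ℝ) / 2) : ℝ) : ℂ) := by
    filter_upwards [ae_hypVolume_mem] with w' hw' using ee w' hw'
  have hi2 : Integrable (fun w' => twoCosh w w' ^ (-p) * w'.1 ^ (((m + k : ℕ) : ℝ) / 2))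
      (hypVolume m k) := by
    have := (hi.congr hae).re
    exact this
  rw [integral_congr_ae hae, integral_complex_ofReal, schurC_ofReal] at he
  have he2 : ∫ w', twoCosh w w' ^ (-p) * w'.1 ^ (((m + k : ℕ) : ℝ) / 2) ∂(hypVolume m k) =
      schurR (m + k) p * w.1 ^ (((m + k : ℕ) : ℝ) / 2) := by
    have : ((schurR (m + k) p * w.1 ^ (((m + k : ℕ) : ℝ) / 2) : ℝ) : ℂ) =
        (schurR (m + k) p : ℂ) * (w.1 : ℂ) ^ (((m + k : ℕ) : ℂ) / 2) := by
      rw [Complex.ofReal_mul, Complex.ofReal_cpow hx.le]; push_cast; rfl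
    exact_mod_cast he.trans this.symm
  rw [← ENNReal.ofReal_mul (schurR_pos hp).le, ← he2, ofReal_integral_eq_lintegral_ofReal hi2]
  · refine lintegral_congr_ae ?_
    filter_upwards [ae_hypVolume_mem] with w' hw'
    have hx' : 0 < w'.1 := hw'
    have hT := two_le_twoCosh hw hw'
    rw [ENNReal.ofReal_mul (Real.rpow_nonneg (by linarith) _)]
  · filter_upwards [ae_hypVolume_mem] with w' hw'
    have hx' : 0 < w'.1 := hw'
    have hT := two_le_twoCosh hw hw'
    exact mul_nonneg (Real.rpow_nonneg (by linarith) _) (Real.rpow_nonneg hx'.le _)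

end

end ModelCusp

namespace ModelCusp

section

open Filter Topology MeasureTheory
open scoped NNReal

/-! ### Integral operators with Schur kernels -/

section Schur

variable {α : Type*} [MeasurableSpace α] {μ : Measure α}

/-- The hypothesis of the Schur test, with the same positive test function `θ` in both variables. -/
structure SchurBound (μ : Measure α) (θ : α → ENNReal) (κ : α → α → ENNReal) (C : ℝ≥0) : Prop where
  left : ∀ᵐ x ∂μ, ∫⁻ y, κ x y * θ y ∂μ ≤ C * θ x
  right : ∀ᵐ y ∂μ, ∫⁻ x, κ x y * θ x ∂μ ≤ C * θ y

lemma SchurBound.mono {θ : α → ENNReal} {κ κ' : α → α → ENNReal} {C : ℝ≥0} (h : SchurBound μ θ κ C)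
    (hκ : ∀ᵐ x ∂μ, ∀ᵐ y ∂μ, κ' x y ≤ κ x y) (hκ2 : ∀ᵐ y ∂μ, ∀ᵐ x ∂μ, κ' x y ≤ κ x y) :
    SchurBound μ θ κ' C where
  left := by
    filter_upwards [h.left, hκ] with x hx hk
    refine le_trans (lintegral_mono_ae ?_) hx
    filter_upwards [hk] with y hy
    gcongr
  right := by
    filter_upwards [h.right, hκ2] with x hx hk
    refine le_trans (lintegral_mono_ae ?_) hx
    filter_upwards [hk] with y hy
    gcongr

/-- The Schur test: Cauchy–Schwarz for the splitting of `κ f` into the square roots of `κ θ` and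
`κ f² / θ`. -/
lemma SchurBound.lintegral_sq_le [SFinite μ] {θ : α → ENNReal} {κ : α → α → ENNReal} {C : ℝ≥0}
    (h : SchurBound μ θ κ C) (hκ : Measurable (Function.uncurry κ)) (hθ : Measurable θ)
    (hθ0 : ∀ᵐ x ∂μ, θ x ≠ 0 ∧ θ x ≠ ⊤) {f : α → ENNReal} (hf : Measurable f) :
    ∫⁻ x, (∫⁻ y, κ x y * f y ∂μ) ^ (2 : ℝ) ∂μ ≤ (C : ENNReal) ^ (2 : ℝ) * ∫⁻ y, f y ^ (2 : ℝ) ∂μ := by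
  have hκx : ∀ x, Measurable (κ x) := fun x => hκ.of_uncurry_left
  have half : ∀ a : ENNReal, (a ^ (1 / 2 : ℝ)) ^ (2 : ℝ) = a := fun a => by
    rw [← ENNReal.rpow_mul]; norm_num
  have step : ∀ᵐ x ∂μ, (∫⁻ y, κ x y * f y ∂μ) ^ (2 : ℝ) ≤
      ∫⁻ y, (C * θ x) * (κ x y * ((θ y)⁻¹ * f y ^ (2 : ℝ))) ∂μ := by
    filter_upwards [h.left] with x hx
    have cs := ENNReal.lintegral_mul_le_Lp_mul_Lq μ Real.HolderConjugate.two_two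
      (f := fun y => (κ x y * θ y) ^ (1 / 2 : ℝ))
      (g := fun y => (κ x y * ((θ y)⁻¹ * f y ^ (2 : ℝ))) ^ (1 / 2 : ℝ))
      (((hκx x).mul hθ).pow_const _).aemeasurable
      (((hκx x).mul (hθ.inv.mul (hf.pow_const _))).pow_const _).aemeasurable
    simp only [half] at cs
    have e : ∫⁻ y, κ x y * f y ∂μ = ∫⁻ y, ((fun y => (κ x y * θ y) ^ (1 / 2 : ℝ)) *
        fun y => (κ x y * ((θ y)⁻¹ * f y ^ (2 : ℝ))) ^ (1 / 2 : ℝ)) y ∂μ := by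
      refine lintegral_congr_ae ?_
      filter_upwards [hθ0] with y hy
      simp only [Pi.mul_apply]
      rw [← ENNReal.mul_rpow_of_nonneg _ _ (by norm_num),
        show κ x y * θ y * (κ x y * ((θ y)⁻¹ * f y ^ (2 : ℝ))) =
          (κ x y * κ x y * f y ^ (2 : ℝ)) * (θ y * (θ y)⁻¹) by ring,
        ENNReal.mul_inv_cancel hy.1 hy.2, mul_one]
      have : κ x y * κ x y * f y ^ (2 : ℝ) = (κ x y * f y) ^ (2 : ℝ) := by
        rw [ENNReal.mul_rpow_of_nonneg _ _ (by norm_num), ENNReal.rpow_two, ENNReal.rpow_two,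
          pow_two (κ x y)]
      rw [this, ← ENNReal.rpow_mul]; norm_num
    rw [e, lintegral_const_mul (f := fun y => κ x y * ((θ y)⁻¹ * f y ^ (2 : ℝ))) _
      ((hκx x).mul (hθ.inv.mul (hf.pow_const _)))]
    calc _ ≤ ((∫⁻ y, κ x y * θ y ∂μ) ^ (1 / 2 : ℝ) *
          (∫⁻ y, κ x y * ((θ y)⁻¹ * f y ^ (2 : ℝ)) ∂μ) ^ (1 / 2 : ℝ)) ^ (2 : ℝ) := by gcongr
      _ = (∫⁻ y, κ x y * θ y ∂μ) * (∫⁻ y, κ x y * ((θ y)⁻¹ * f y ^ (2 : ℝ)) ∂μ) := by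
        rw [ENNReal.mul_rpow_of_nonneg _ _ (by norm_num), half, half]
      _ ≤ _ := by gcongr
  refine (lintegral_mono_ae step).trans ?_
  have hm : Measurable (Function.uncurry fun x y => (C * θ x) * (κ x y * ((θ y)⁻¹ * f y ^ (2 : ℝ)))) :=
    ((hθ.comp measurable_fst).const_mul _).mul
      (hκ.mul ((hθ.comp measurable_snd).inv.mul ((hf.comp measurable_snd).pow_const _)))
  rw [lintegral_lintegral_swap hm.aemeasurable]
  have hκy : ∀ y, Measurable (fun x => κ x y) := fun y => hκ.of_uncurry_right
  have hfac : ∀ y, ∫⁻ x, (C * θ x) * (κ x y * ((θ y)⁻¹ * f y ^ (2 : ℝ))) ∂μ =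
      (C * ((θ y)⁻¹ * f y ^ (2 : ℝ))) * ∫⁻ x, κ x y * θ x ∂μ := fun y => by
    rw [← lintegral_const_mul (f := fun x => κ x y * θ x) _ ((hκy y).mul hθ)]
    refine lintegral_congr fun x => by ring
  simp only [hfac]
  rw [← lintegral_const_mul (f := fun y => f y ^ (2 : ℝ)) _ (hf.pow_const _)]
  refine lintegral_mono_ae ?_
  filter_upwards [h.right, hθ0] with y hy hy0
  calc C * ((θ y)⁻¹ * f y ^ (2 : ℝ)) * ∫⁻ x, κ x y * θ x ∂μ
      ≤ C * ((θ y)⁻¹ * f y ^ (2 : ℝ)) * (C * θ y) := by gcongr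
    _ = C * C * f y ^ (2 : ℝ) * (θ y * (θ y)⁻¹) := by ring
    _ = _ := by rw [ENNReal.mul_inv_cancel hy0.1 hy0.2, mul_one, ENNReal.rpow_two, ENNReal.rpow_two,
        pow_two (C : ENNReal)]

lemma eLpNorm_two_le_of_lintegral_sq {u f : α → ℂ} {C : ℝ≥0}
    (h : ∫⁻ x, ‖u x‖ₑ ^ (2 : ℝ) ∂μ ≤ (C : ENNReal) ^ (2 : ℝ) * ∫⁻ y, ‖f y‖ₑ ^ (2 : ℝ) ∂μ) :
    eLpNorm u 2 μ ≤ C * eLpNorm f 2 μ := by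
  rw [eLpNorm_eq_lintegral_rpow_enorm_toReal (by norm_num) (by norm_num),
    eLpNorm_eq_lintegral_rpow_enorm_toReal (by norm_num) (by norm_num)]
  simp only [ENNReal.toReal_ofNat]
  calc _ ≤ ((C : ENNReal) ^ (2 : ℝ) * ∫⁻ y, ‖f y‖ₑ ^ (2 : ℝ) ∂μ) ^ (1 / 2 : ℝ) := by gcongr
    _ = _ := by
      rw [ENNReal.mul_rpow_of_nonneg _ _ (by norm_num), ← ENNReal.rpow_mul]; norm_num

variable [SFinite μ] {θ : α → ENNReal} {κ : α → α → ℂ} {C : ℝ≥0}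

lemma SchurBound.eLpNorm_le (h : SchurBound μ θ (fun x y => ‖κ x y‖ₑ) C)
    (hκ : Measurable (Function.uncurry κ)) (hθ : Measurable θ)
    (hθ0 : ∀ᵐ x ∂μ, θ x ≠ 0 ∧ θ x ≠ ⊤) {f : α → ℂ} (hf : Measurable f) :
    eLpNorm (fun x => ∫ y, κ x y * f y ∂μ) 2 μ ≤ C * eLpNorm f 2 μ := by
  refine eLpNorm_two_le_of_lintegral_sq (le_trans (lintegral_mono fun x => ?_)
    (h.lintegral_sq_le (f := fun y => ‖f y‖ₑ) hκ.enorm hθ hθ0 hf.enorm))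
  refine ENNReal.rpow_le_rpow ((enorm_integral_le_lintegral_enorm _).trans_eq ?_) (by norm_num)
  simp [enorm_mul]

lemma SchurBound.ae_integrable (h : SchurBound μ θ (fun x y => ‖κ x y‖ₑ) C)
    (hκ : Measurable (Function.uncurry κ)) (hθ : Measurable θ)
    (hθ0 : ∀ᵐ x ∂μ, θ x ≠ 0 ∧ θ x ≠ ⊤) {f : α → ℂ} (hf : Measurable f) (hf2 : MemLp f 2 μ) :
    ∀ᵐ x ∂μ, Integrable (fun y => κ x y * f y) μ := by
  have h1 := h.lintegral_sq_le (f := fun y => ‖f y‖ₑ) hκ.enorm hθ hθ0 hf.enorm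
  have fin : ∫⁻ y, ‖f y‖ₑ ^ (2 : ℝ) ∂μ < ⊤ := by
    have := lintegral_rpow_enorm_lt_top_of_eLpNorm_lt_top (p := 2) (by norm_num) (by norm_num)
      hf2.eLpNorm_lt_top
    simpa using this
  have hm : Measurable (fun x => (∫⁻ y, ‖κ x y‖ₑ * ‖f y‖ₑ ∂μ) ^ (2 : ℝ)) :=
    (Measurable.lintegral_prod_right (hκ.enorm.mul (hf.comp measurable_snd).enorm)).pow_const _
  have := ae_lt_top hm (h1.trans_lt (ENNReal.mul_lt_top (by simp) fin)).ne
  filter_upwards [this] with x hx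
  refine ⟨(hκ.of_uncurry_left.mul hf).aestronglyMeasurable, ?_⟩
  rw [hasFiniteIntegral_iff_enorm]
  have : ∫⁻ y, ‖κ x y‖ₑ * ‖f y‖ₑ ∂μ < ⊤ := by
    by_contra hc
    rw [not_lt, top_le_iff] at hc
    rw [hc] at hx
    simp at hx
  simpa [enorm_mul] using this

/-- Schur test: existence of the operator. -/
theorem SchurBound.exists_operator (h : SchurBound μ θ (fun x y => ‖κ x y‖ₑ) C)
    (hκ : Measurable (Function.uncurry κ)) (hθ : Measurable θ)
    (hθ0 : ∀ᵐ x ∂μ, θ x ≠ 0 ∧ θ x ≠ ⊤) :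
    ∃ T : Lp ℂ 2 μ →L[ℂ] Lp ℂ 2 μ, ∀ f : Lp ℂ 2 μ, ∀ᵐ x ∂μ,
      Integrable (fun y => κ x y * f y) μ ∧ T f x = ∫ y, κ x y * f y ∂μ := by
  have mem : ∀ f : Lp ℂ 2 μ, MemLp (fun x => ∫ y, κ x y * f y ∂μ) 2 μ := fun f => by
    refine ⟨?_, ?_⟩
    · refine (StronglyMeasurable.integral_prod_right (f := fun x y => κ x y * f y)
        ?_).aestronglyMeasurable
      exact (hκ.mul ((Lp.stronglyMeasurable f).measurable.comp measurable_snd)).stronglyMeasurable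
    · refine (h.eLpNorm_le hκ hθ hθ0 (Lp.stronglyMeasurable f).measurable).trans_lt ?_
      exact ENNReal.mul_lt_top (by simp) (Lp.eLpNorm_lt_top f)
  have ii : ∀ f : Lp ℂ 2 μ, ∀ᵐ x ∂μ, Integrable (fun y => κ x y * f y) μ := fun f =>
    h.ae_integrable hκ hθ hθ0 (Lp.stronglyMeasurable f).measurable (Lp.memLp f)
  let L : Lp ℂ 2 μ →ₗ[ℂ] Lp ℂ 2 μ :=
    { toFun := fun f => (mem f).toLp
      map_add' := fun f g => by
        refine Lp.ext ?_
        filter_upwards [(mem (f + g)).coeFn_toLp, (mem f).coeFn_toLp, (mem g).coeFn_toLp,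
          Lp.coeFn_add (mem f).toLp (mem g).toLp, ii f, ii g] with x h1 h2 h3 h4 h5 h6
        rw [h1, h4, Pi.add_apply, h2, h3, ← integral_add h5 h6]
        refine integral_congr_ae ?_
        filter_upwards [Lp.coeFn_add f g] with y hy
        rw [hy, Pi.add_apply, mul_add]
      map_smul' := fun c f => by
        refine Lp.ext ?_
        filter_upwards [(mem (c • f)).coeFn_toLp, (mem f).coeFn_toLp,
          Lp.coeFn_smul c (mem f).toLp] with x h1 h2 h4
        rw [RingHom.id_apply, h1, h4, Pi.smul_apply, h2, smul_eq_mul, ← integral_const_mul]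
        refine integral_congr_ae ?_
        filter_upwards [Lp.coeFn_smul c f] with y hy
        rw [hy, Pi.smul_apply, smul_eq_mul]; ring }
  refine ⟨L.mkContinuous C fun f => ?_, fun f => ?_⟩
  · have := h.eLpNorm_le hκ hθ hθ0 (Lp.stronglyMeasurable f).measurable
    change ‖(mem f).toLp‖ ≤ _
    rw [Lp.norm_toLp, Lp.norm_def]
    have h2 := ENNReal.toReal_mono (ENNReal.mul_lt_top (by simp) (Lp.eLpNorm_lt_top f)).ne this
    simpa [ENNReal.toReal_mul] using h2
  · filter_upwards [ii f, (mem f).coeFn_toLp] with x h1 h2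
    exact ⟨h1, h2⟩

/-- Schur test: norm bound for any operator with the given kernel. -/
theorem SchurBound.norm_le (h : SchurBound μ θ (fun x y => ‖κ x y‖ₑ) C)
    (hκ : Measurable (Function.uncurry κ)) (hθ : Measurable θ)
    (hθ0 : ∀ᵐ x ∂μ, θ x ≠ 0 ∧ θ x ≠ ⊤) {T : Lp ℂ 2 μ →L[ℂ] Lp ℂ 2 μ}
    (hT : ∀ f : Lp ℂ 2 μ, ∀ᵐ x ∂μ, T f x = ∫ y, κ x y * f y ∂μ) : ‖T‖ ≤ C := by
  refine T.opNorm_le_bound C.2 fun f => ?_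
  have := h.eLpNorm_le hκ hθ hθ0 (Lp.stronglyMeasurable f).measurable
  rw [Lp.norm_def, Lp.norm_def, eLpNorm_congr_ae (hT f)]
  have h2 := ENNReal.toReal_mono (ENNReal.mul_lt_top (by simp) (Lp.eLpNorm_lt_top f)).ne this
  simpa [ENNReal.toReal_mul] using h2

end Schur

end

end ModelCusp

namespace ModelCusp

section

open Filter Topology MeasureTheory Set
open scoped NNReal

variable {m k : ℕ}

/-! ### Groups of isometries and folded kernels -/

/-- What is used of the group `Γ`, its fundamental domain `F` and the exponent `a`: the elements of
`Γ` are isometries `(x, y, z) ↦ (x, L y, z + t)`, and the orbits are so sparse that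
`∑ (1 + |w - γ w'|²)^{-σ}` converges for `σ > a`, uniformly on bounded sets. -/
structure CuspLike (Γ : Subgroup (Equiv.Perm (Pt m k))) (F : Set (Pt m k)) (a : ℝ) : Prop where
  nonneg : 0 ≤ a
  le_half : a ≤ ((m + k : ℕ) : ℝ) / 2
  dim_pos : 0 < m + k
  isom : ∀ γ ∈ Γ, ∃ L t, γ = cuspIsometry L t
  countable : Countable Γ
  measurableSet : MeasurableSet F
  subset : F ⊆ halfSpace m k
  frontier_null : volume (frontier F) = 0
  fundamental : IsFundamentalDomain Γ F (hypVolume m k)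
  growth : ∃ b : Γ → ℝ, (∀ γ, 1 ≤ b γ) ∧ (∀ σ > a, Summable fun γ => b γ ^ (-σ)) ∧
    ∀ B : ℝ, ∃ c > 0, ∀ γ : Γ, ∀ w w' : Pt m k, ‖w‖ ≤ B → ‖w'‖ ≤ B →
      c * b γ ≤ 1 + quad w (γ.1 w')

section isometries

variable (L : EuclideanSpace ℝ (Fin m) ≃ₗᵢ[ℝ] EuclideanSpace ℝ (Fin m))
  (t : EuclideanSpace ℝ (Fin k))

lemma cuspIsometry_apply (w : Pt m k) : cuspIsometry L t w = (w.1, L w.2.1, w.2.2 + t) := rfl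

lemma quad_cuspIsometry (w w' : Pt m k) :
    quad (cuspIsometry L t w) (cuspIsometry L t w') = quad w w' := by
  simp only [quad, cuspIsometry_apply, add_sub_add_right_eq_sub, ← map_sub,
    LinearIsometryEquiv.norm_map]

lemma continuous_cuspIsometry : Continuous (cuspIsometry L t : Pt m k → Pt m k) := by
  have : (cuspIsometry L t : Pt m k → Pt m k) = fun w => (w.1, L w.2.1, w.2.2 + t) := rfl
  rw [this]
  have hL := L.continuous
  fun_prop

lemma contDiff_cuspIsometry : ContDiff ℝ ∞ (cuspIsometry L t : Pt m k → Pt m k) := by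
  have : (cuspIsometry L t : Pt m k → Pt m k) = fun w => (w.1, L w.2.1, w.2.2 + t) := rfl
  rw [this]
  have hL := L.contDiff (n := ∞)
  exact contDiff_fst.prodMk ((hL.comp (contDiff_fst.comp contDiff_snd)).prodMk
    ((contDiff_snd.comp contDiff_snd).add contDiff_const))

lemma measurePreserving_cuspIsometry :
    MeasurePreserving (cuspIsometry L t : Pt m k → Pt m k) (hypVolume m k) (hypVolume m k) := by
  have hv : MeasurePreserving (cuspIsometry L t : Pt m k → Pt m k) volume volume :=
    (MeasurePreserving.id volume).prod (L.measurePreserving.prod (measurePreserving_add_right volume t))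
  have hr : MeasurePreserving (cuspIsometry L t : Pt m k → Pt m k)
      (volume.restrict (halfSpace m k)) (volume.restrict (halfSpace m k)) :=
    hv.restrict_preimage (s := halfSpace m k) measurableSet_halfSpace
  refine ⟨hv.measurable, ?_⟩
  unfold hypVolume
  ext s hs
  rw [Measure.map_apply hv.measurable hs, withDensity_apply _ (hv.measurable hs),
    withDensity_apply _ hs]
  have := hr.setLIntegral_comp_preimage hs measurable_density
  rw [← this]
  rfl

end isometries

namespace CuspLike

variable {Γ : Subgroup (Equiv.Perm (Pt m k))} {F : Set (Pt m k)} {a : ℝ} (hΓ : CuspLike Γ F a)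
include hΓ

lemma apply_fst {γ : Equiv.Perm (Pt m k)} (hγ : γ ∈ Γ) (w : Pt m k) : (γ w).1 = w.1 := by
  obtain ⟨L, t, rfl⟩ := hΓ.isom γ hγ
  rfl

lemma apply_mem {γ : Equiv.Perm (Pt m k)} (hγ : γ ∈ Γ) {w : Pt m k} :
    γ w ∈ halfSpace m k ↔ w ∈ halfSpace m k := by
  simp only [halfSpace, mem_ofPred_eq, hΓ.apply_fst hγ]

lemma quad_apply {γ : Equiv.Perm (Pt m k)} (hγ : γ ∈ Γ) (w w' : Pt m k) :
    quad (γ w) (γ w') = quad w w' := by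
  obtain ⟨L, t, rfl⟩ := hΓ.isom γ hγ
  exact quad_cuspIsometry L t w w'

lemma quad_apply_left (γ : Γ) (w w' : Pt m k) :
    quad (γ.1 w) w' = quad w (((γ⁻¹ : Γ) : Equiv.Perm (Pt m k)) w') := by
  rw [← hΓ.quad_apply (γ⁻¹ : Γ).2]
  simp

lemma twoCosh_apply {γ : Equiv.Perm (Pt m k)} (hγ : γ ∈ Γ) (w w' : Pt m k) :
    twoCosh (γ w) (γ w') = twoCosh w w' := by
  unfold twoCosh
  rw [hΓ.quad_apply hγ, hΓ.apply_fst hγ, hΓ.apply_fst hγ]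

lemma twoCosh_apply_left (γ : Γ) (w w' : Pt m k) :
    twoCosh (γ.1 w) w' =
      twoCosh w (((γ⁻¹ : Γ) : Equiv.Perm (Pt m k)) w') := by
  rw [← hΓ.twoCosh_apply (γ⁻¹ : Γ).2]
  simp

lemma continuous_apply (γ : Γ) : Continuous γ.1 := by
  obtain ⟨L, t, h⟩ := hΓ.isom γ γ.2
  rw [h]; exact continuous_cuspIsometry L t

lemma contDiff_apply (γ : Γ) : ContDiff ℝ ∞ γ.1 := by
  obtain ⟨L, t, h⟩ := hΓ.isom γ γ.2
  rw [h]; exact contDiff_cuspIsometry L t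

lemma measurableConstSMul : MeasurableConstSMul Γ (Pt m k) :=
  ⟨fun γ => (hΓ.continuous_apply γ).measurable⟩

lemma smulInvariantMeasure : SMulInvariantMeasure Γ (Pt m k) (hypVolume m k) := by
  refine ⟨fun γ s hs => ?_⟩
  obtain ⟨L, t, h⟩ := hΓ.isom γ γ.2
  have := (measurePreserving_cuspIsometry L t).measure_preimage hs.nullMeasurableSet
  rw [← h] at this
  exact this

/-- Unfolding of integrals over the fundamental domain. -/
lemma lintegral_fold {f : Pt m k → ENNReal} (hf : Measurable f) :
    ∫⁻ w, ∑' γ : Γ, f (γ.1 w) ∂(quotVolume F) = ∫⁻ w, f w ∂(hypVolume m k) := by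
  have := hΓ.countable
  have := hΓ.measurableConstSMul
  have := hΓ.smulInvariantMeasure
  rw [hΓ.fundamental.lintegral_eq_tsum'' f, lintegral_tsum]
  · rfl
  · exact fun γ => (hf.comp (hΓ.continuous_apply γ).measurable).aemeasurable

lemma ae_mem : ∀ᵐ w ∂(quotVolume F), w ∈ F := ae_restrict_mem hΓ.measurableSet

/-- Sub-level sets of the distance to a bounded set meet only finitely many translates. -/
lemma finite_near (B R : ℝ) :
    {γ : Γ | ∃ w w' : Pt m k, ‖w‖ ≤ B ∧ ‖w'‖ ≤ B ∧ quad w (γ.1 w') ≤ R}.Finite := by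
  obtain ⟨b, hb1, hb2, hb3⟩ := hΓ.growth
  obtain ⟨c, hc, hb⟩ := hb3 B
  have hs := (hb2 (a + 1) (by linarith)).tendsto_cofinite_zero
  set M := max ((1 + R) / c) 1 with hM
  have hM0 : 0 < M := lt_of_lt_of_le one_pos (le_max_right _ _)
  have ha := hΓ.nonneg
  have := hs.eventually (gt_mem_nhds (show (0 : ℝ) < M ^ (-(a + 1)) by positivity))
  refine Set.Finite.subset this fun γ hγ => ?_
  obtain ⟨w, w', h1, h2, h3⟩ := hγ
  have h4 := hb γ w w' h1 h2
  have h5 : b γ ≤ M := by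
    refine le_trans ?_ (le_max_left _ _)
    rw [le_div_iff₀ hc]; linarith
  simp only [mem_compl_iff, mem_ofPred_eq, not_lt]
  exact Real.rpow_le_rpow_of_nonpos (lt_of_lt_of_le one_pos (hb1 γ)) h5 (by linarith)

/-- Lower bound for `2 cosh d(w, γ w')` in terms of the growth function. -/
lemma exists_twoCosh_growth : ∃ b : Γ → ℝ, (∀ γ, 1 ≤ b γ) ∧
    (∀ σ > a, Summable fun γ => b γ ^ (-σ)) ∧
    ∀ B : ℝ, ∃ c > 0, ∀ γ : Γ, ∀ w ∈ halfSpace m k, ∀ w' ∈ halfSpace m k, ‖w‖ ≤ B → ‖w'‖ ≤ B →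
      c * b γ ≤ twoCosh w (γ.1 w') := by
  obtain ⟨b, hb1, hb2, hb3⟩ := hΓ.growth
  refine ⟨b, hb1, hb2, fun B => ?_⟩
  obtain ⟨c, hc, hb⟩ := hb3 B
  refine ⟨c / (1 + B ^ 2), by positivity, fun γ w hw w' hw' h1 h2 => ?_⟩
  have hγ := (hΓ.apply_mem γ.2).mpr hw'
  have hT := two_le_twoCosh hw hγ
  have h3 := hb γ w w' h1 h2
  have hx : 0 < w.1 := hw
  have hx' : 0 < w'.1 := hw'
  have e : quad w (γ.1 w') =
      twoCosh w (γ.1 w') * (w.1 * w'.1) := by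
    rw [twoCosh, hΓ.apply_fst γ.2, div_mul_cancel₀ _ (by positivity)]
  have n1 : w.1 ≤ B := (le_abs_self _).trans ((norm_fst_le w).trans h1)
  have n2 : w'.1 ≤ B := (le_abs_self _).trans ((norm_fst_le w').trans h2)
  have n3 : w.1 * w'.1 ≤ B ^ 2 := by nlinarith
  rw [div_mul_eq_mul_div, div_le_iff₀ (by positivity)]
  rw [e] at h3
  nlinarith

lemma summable_twoCosh_rpow {σ : ℝ} (hσ : a < σ) {w w' : Pt m k} (hw : w ∈ halfSpace m k)
    (hw' : w' ∈ halfSpace m k) :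
    Summable fun γ : Γ => twoCosh w (γ.1 w') ^ (-σ) := by
  obtain ⟨b, hb1, hb2, hb3⟩ := hΓ.exists_twoCosh_growth
  obtain ⟨c, hc, hb⟩ := hb3 (max ‖w‖ ‖w'‖)
  have ha := hΓ.nonneg
  refine Summable.of_nonneg_of_le (fun γ => ?_) (fun γ => ?_) ((hb2 σ hσ).mul_left (c ^ (-σ)))
  · have := two_le_twoCosh hw ((hΓ.apply_mem γ.2).mpr hw')
    exact Real.rpow_nonneg (by linarith) _
  · have hb0 := hb1 γ
    rw [← Real.mul_rpow hc.le (by linarith)]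
    exact Real.rpow_le_rpow_of_nonpos (by positivity)
      (hb γ w hw w' hw' (le_max_left _ _) (le_max_right _ _)) (by linarith)

end CuspLike

/-! ### Folded point-pair invariants -/

open Classical in
/-- The kernel `∑_γ k(2 cosh d(w, γ w'))` on the quotient, extended by `0`. -/
noncomputable def foldKer (Γ : Subgroup (Equiv.Perm (Pt m k))) (f : ℝ → ℂ) (w w' : Pt m k) : ℂ :=
  ∑' γ : Γ, if 0 < w.1 ∧ 0 < w'.1 then f (twoCosh w (γ.1 w')) else 0

lemma foldKer_eq {Γ : Subgroup (Equiv.Perm (Pt m k))} (f : ℝ → ℂ) {w w' : Pt m k}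
    (hw : w ∈ halfSpace m k) (hw' : w' ∈ halfSpace m k) :
    foldKer Γ f w w' = ∑' γ : Γ, f (twoCosh w (γ.1 w')) := by
  have : 0 < w.1 ∧ 0 < w'.1 := ⟨hw, hw'⟩
  simp only [foldKer, this, and_self, if_true]

/-- Measurable functions on `[2, ∞)` with decay that makes the folded series converge. -/
structure Tame (a : ℝ) (f : ℝ → ℂ) : Prop where
  measurable : Measurable f
  decay : ∃ σ > a, ∃ C : ℝ, ∀ T ≥ (3 : ℝ), ‖f T‖ ≤ C * T ^ (-σ)

/-- The positive eigenfunction `x^{n/2}`, used as test function in the Schur test. -/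
noncomputable def schurWeight (m k : ℕ) (w : Pt m k) : ENNReal :=
  ENNReal.ofReal (w.1 ^ (((m + k : ℕ) : ℝ) / 2))

lemma measurable_schurWeight : Measurable (schurWeight m k) := by
  unfold schurWeight; fun_prop

lemma schurWeight_ne {w : Pt m k} (hw : w ∈ halfSpace m k) :
    schurWeight m k w ≠ 0 ∧ schurWeight m k w ≠ ⊤ := by
  have hx : 0 < w.1 := hw
  have : 0 < w.1 ^ (((m + k : ℕ) : ℝ) / 2) := by positivity
  exact ⟨by simpa [schurWeight] using this, ENNReal.ofReal_ne_top⟩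

/-- `M` is a point-pair invariant that satisfies the Schur test on `ℍⁿ⁺¹` with constant `C`. -/
def SchurKer (m k : ℕ) (M : ℝ → ENNReal) (C : ℝ≥0) : Prop :=
  ∀ w ∈ halfSpace m k,
    ∫⁻ w', M (twoCosh w w') * schurWeight m k w' ∂(hypVolume m k) ≤ C * schurWeight m k w

lemma schurKer_rpow {p : ℝ} (hp : ((m + k : ℕ) : ℝ) / 2 < p) :
    SchurKer m k (fun T => ENNReal.ofReal (T ^ (-p))) (Real.toNNReal (schurR (m + k) p)) :=
  fun _ hw => (lintegral_twoCosh_rpow hp hw).le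

lemma SchurKer.mono {M M' : ℝ → ENNReal} {C : ℝ≥0} (h : SchurKer m k M C)
    (hM : ∀ T ≥ 2, M' T ≤ M T) : SchurKer m k M' C := by
  intro w hw
  refine le_trans (lintegral_mono_ae ?_) (h w hw)
  filter_upwards [ae_hypVolume_mem] with w' hw'
  gcongr
  exact hM _ (two_le_twoCosh hw hw')

lemma SchurKer.const_mul {M : ℝ → ENNReal} {C : ℝ≥0} (h : SchurKer m k M C)
    (A : ℝ≥0) : SchurKer m k (fun T => A * M T) (A * C) := by
  intro w hw
  simp only [mul_assoc]
  rw [lintegral_const_mul' _ _ (by simp)]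
  push_cast
  rw [mul_assoc]
  gcongr
  exact h w hw

namespace CuspLike

variable {Γ : Subgroup (Equiv.Perm (Pt m k))} {F : Set (Pt m k)} {a : ℝ} (hΓ : CuspLike Γ F a)
include hΓ

lemma summable_norm_fold {f : ℝ → ℂ} (hf : Tame a f) {w w' : Pt m k} (hw : w ∈ halfSpace m k)
    (hw' : w' ∈ halfSpace m k) :
    Summable fun γ : Γ => ‖f (twoCosh w (γ.1 w'))‖ := by
  obtain ⟨σ, hσ, C, hC⟩ := hf.decay
  have hx : 0 < w.1 := hw
  have hx' : 0 < w'.1 := hw'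
  have hfin : {γ : Γ | twoCosh w (γ.1 w') < 3}.Finite := by
    refine (hΓ.finite_near (max ‖w‖ ‖w'‖) (3 * (w.1 * w'.1))).subset fun γ hγ => ?_
    refine ⟨w, w', le_max_left _ _, le_max_right _ _, ?_⟩
    have : twoCosh w (γ.1 w') < 3 := hγ
    rw [twoCosh, hΓ.apply_fst γ.2, div_lt_iff₀ (by positivity)] at this
    exact this.le
  refine Summable.of_norm_bounded_eventually ((hΓ.summable_twoCosh_rpow hσ hw hw').mul_left C) ?_
  filter_upwards [hfin.compl_mem_cofinite] with γ hγ
  rw [norm_norm]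
  exact hC _ (not_lt.mp hγ)

lemma foldKer_apply_left (f : ℝ → ℂ) (γ : Γ) (w w' : Pt m k) :
    foldKer Γ f (γ.1 w) w' = foldKer Γ f w w' := by
  unfold foldKer
  rw [hΓ.apply_fst γ.2, ← (Equiv.mulLeft γ).tsum_eq]
  refine tsum_congr fun δ => ?_
  rw [hΓ.twoCosh_apply_left]
  simp

lemma foldKer_apply_right (f : ℝ → ℂ) (γ : Γ) (w w' : Pt m k) :
    foldKer Γ f w (γ.1 w') = foldKer Γ f w w' := by
  unfold foldKer
  rw [hΓ.apply_fst γ.2, ← (Equiv.mulRight γ⁻¹).tsum_eq]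
  refine tsum_congr fun δ => ?_
  simp

lemma measurable_foldKer {f : ℝ → ℂ} (hf : Tame a f) :
    Measurable (Function.uncurry (foldKer Γ f)) := by
  classical
  have := hΓ.countable
  have hm : ∀ γ : Γ, Measurable fun p : Pt m k × Pt m k => if 0 < p.1.1 ∧ 0 < p.2.1 then
      f (twoCosh p.1 (γ.1 p.2)) else 0 := fun γ => by
    refine Measurable.ite ?_ ?_ measurable_const
    · exact (measurableSet_lt measurable_const
        (measurable_fst.comp (measurable_fst (α := Pt m k) (β := Pt m k)))).inter
        (measurableSet_lt measurable_const
          (measurable_fst.comp (measurable_snd (α := Pt m k) (β := Pt m k))))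
    · exact hf.measurable.comp (measurable_twoCosh.comp (measurable_fst.prodMk
        ((hΓ.continuous_apply γ).measurable.comp measurable_snd)))
  refine measurable_of_tendsto_metrizable' (atTop : Filter (Finset Γ))
    (f := fun (s : Finset Γ) (p : Pt m k × Pt m k) => ∑ γ ∈ s, if 0 < p.1.1 ∧ 0 < p.2.1 then
      f (twoCosh p.1 (γ.1 p.2)) else 0)
    (fun s => Finset.measurable_sum s fun γ _ => hm γ) ?_
  rw [tendsto_pi_nhds]
  intro p
  refine Summable.hasSum ?_
  by_cases h : 0 < p.1.1 ∧ 0 < p.2.1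
  · simp only [h, and_self, if_true]
    exact (hΓ.summable_norm_fold hf h.1 h.2).of_norm
  · simp only [h, if_false]
    exact summable_zero

lemma enorm_foldKer_le {f : ℝ → ℂ} (hf : Tame a f) {w w' : Pt m k} (hw : w ∈ halfSpace m k)
    (hw' : w' ∈ halfSpace m k) :
    ‖foldKer Γ f w w'‖ₑ ≤ ∑' γ : Γ, ‖f (twoCosh w (γ.1 w'))‖ₑ := by
  rw [foldKer_eq f hw hw']
  have hs := hΓ.summable_norm_fold hf hw hw'
  have h := norm_tsum_le_tsum_norm hs
  rw [← ofReal_norm]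
  refine (ENNReal.ofReal_le_ofReal h).trans_eq ?_
  rw [ENNReal.ofReal_tsum_of_nonneg (fun _ => norm_nonneg _) hs]
  simp only [ofReal_norm]

lemma schurWeight_apply (γ : Γ) (w : Pt m k) :
    schurWeight m k (γ.1 w) = schurWeight m k w := by
  unfold schurWeight; rw [hΓ.apply_fst γ.2]

/-- The Schur test passes to the quotient. -/
lemma lintegral_fold_schur {M : ℝ → ENNReal} {C : ℝ≥0} (hM : SchurKer m k M C) (hm : Measurable M)
    {w : Pt m k} (hw : w ∈ halfSpace m k) :
    ∫⁻ w', (∑' γ : Γ, M (twoCosh w (γ.1 w'))) * schurWeight m k w'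
      ∂(quotVolume F) ≤ C * schurWeight m k w := by
  refine le_trans (le_of_eq ?_) (hM w hw)
  have hm' : Measurable fun w' => M (twoCosh w w') * schurWeight m k w' :=
    (hm.comp (measurable_twoCosh.comp
      (measurable_const.prodMk measurable_id))).mul measurable_schurWeight
  rw [← hΓ.lintegral_fold hm']
  refine lintegral_congr fun w' => ?_
  rw [← ENNReal.tsum_mul_right]
  refine tsum_congr fun γ => ?_
  rw [hΓ.schurWeight_apply]

lemma ae_schurWeight : ∀ᵐ w ∂(quotVolume F), schurWeight m k w ≠ 0 ∧ schurWeight m k w ≠ ⊤ := by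
  filter_upwards [hΓ.ae_mem] with w hw using schurWeight_ne (hΓ.subset hw)

/-- A kernel on the quotient dominated by a folded Schur kernel satisfies the Schur test. -/
lemma schurBound {M : ℝ → ENNReal} {C : ℝ≥0} (hM : SchurKer m k M C) (hm : Measurable M)
    {κ : Pt m k → Pt m k → ℂ} (hκ : ∀ w ∈ F, ∀ w' ∈ F,
      ‖κ w w'‖ₑ ≤ ∑' γ : Γ, M (twoCosh w (γ.1 w'))) :
    SchurBound (quotVolume F) (schurWeight m k) (fun w w' => ‖κ w w'‖ₑ) C := by
  constructor
  · filter_upwards [hΓ.ae_mem] with w hw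
    refine le_trans (lintegral_mono_ae ?_) (hΓ.lintegral_fold_schur hM hm (hΓ.subset hw))
    filter_upwards [hΓ.ae_mem] with w' hw'
    gcongr
    exact hκ w hw w' hw'
  · filter_upwards [hΓ.ae_mem] with w hw
    refine le_trans (lintegral_mono_ae ?_) (hΓ.lintegral_fold_schur hM hm (hΓ.subset hw))
    filter_upwards [hΓ.ae_mem] with w' hw'
    gcongr
    refine (hκ w' hw' w hw).trans_eq ?_
    rw [← (Equiv.inv Γ).tsum_eq]
    refine tsum_congr fun δ => ?_
    rw [Equiv.inv_apply, ← hΓ.twoCosh_apply_left, twoCosh_comm]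

/-- A tame kernel that satisfies the Schur test defines a bounded operator on the quotient. -/
theorem exists_foldOp {f : ℝ → ℂ} (hf : Tame a f) {C : ℝ≥0}
    (hC : SchurKer m k (fun T => ‖f T‖ₑ) C) :
    ∃ T : L2 F →L[ℂ] L2 F, HasIntegralKernel F T (foldKer Γ f) := by
  have : SFinite (quotVolume F) := by unfold quotVolume hypVolume; infer_instance
  exact (hΓ.schurBound hC hf.measurable.enorm fun w hw w' hw' =>
    hΓ.enorm_foldKer_le hf (hΓ.subset hw) (hΓ.subset hw')).exists_operator
      (hΓ.measurable_foldKer hf) measurable_schurWeight hΓ.ae_schurWeight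

theorem norm_foldOp_le {f : ℝ → ℂ} (hf : Tame a f) {C : ℝ≥0}
    (hC : SchurKer m k (fun T => ‖f T‖ₑ) C) {T : L2 F →L[ℂ] L2 F}
    (hT : HasIntegralKernel F T (foldKer Γ f)) : ‖T‖ ≤ C := by
  have : SFinite (quotVolume F) := by unfold quotVolume hypVolume; infer_instance
  exact (hΓ.schurBound hC hf.measurable.enorm fun w hw w' hw' =>
    hΓ.enorm_foldKer_le hf (hΓ.subset hw) (hΓ.subset hw')).norm_le
      (hΓ.measurable_foldKer hf) measurable_schurWeight hΓ.ae_schurWeight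
      fun g => (hT g).mono fun _ h => h.2

/-- Unfolding of a folded kernel acting on an invariant function. -/
lemma integral_foldKer {f : ℝ → ℂ} {φ : Pt m k → ℂ}
    (hφ : ∀ γ ∈ Γ, ∀ w ∈ halfSpace m k, φ (γ w) = φ w) {w : Pt m k} (hw : w ∈ halfSpace m k)
    (hi : Integrable (fun w' => f (twoCosh w w') * φ w') (hypVolume m k)) :
    ∫ w', foldKer Γ f w w' * φ w' ∂(quotVolume F) =
      ∫ w', f (twoCosh w w') * φ w' ∂(hypVolume m k) := by
  have := hΓ.countable
  have := hΓ.measurableConstSMul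
  have := hΓ.smulInvariantMeasure
  rw [hΓ.fundamental.integral_eq_tsum'' _ hi]
  have hi2 : ∀ γ : Γ, Integrable (fun w' => f (twoCosh w (γ.1 w')) *
      φ (γ.1 w')) (quotVolume F) := fun γ => by
    obtain ⟨L, t, h⟩ := hΓ.isom γ γ.2
    have := (measurePreserving_cuspIsometry L t).integrable_comp_of_integrable hi
    rw [← h] at this
    exact this.mono_measure Measure.restrict_le_self
  have hfin : ∑' γ : Γ, ∫⁻ w', ‖f (twoCosh w (γ.1 w')) *
      φ (γ.1 w')‖ₑ ∂(quotVolume F) ≠ ⊤ := by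
    have h1 := hΓ.fundamental.lintegral_eq_tsum'' (fun w' => ‖f (twoCosh w w') * φ w'‖ₑ)
    have h2 := hi.hasFiniteIntegral
    rw [hasFiniteIntegral_iff_enorm, h1] at h2
    exact h2.ne
  have key := integral_tsum (fun γ : Γ => (hi2 γ).aestronglyMeasurable) hfin
  change _ = ∑' γ : Γ, ∫ w', f (twoCosh w (γ.1 w')) *
      φ (γ.1 w') ∂(quotVolume F)
  rw [← key]
  refine integral_congr_ae ?_
  filter_upwards [hΓ.ae_mem] with w' hw'
  have hw'' := hΓ.subset hw'
  rw [foldKer_eq f hw hw'', ← tsum_mul_right]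
  refine tsum_congr fun γ => ?_
  rw [hφ γ γ.2 w' hw'']

end CuspLike

/-! ### Algebra of integral operators -/

section algebra

variable {F : Set (Pt m k)} {T T' : L2 F →L[ℂ] L2 F} {κ κ' : Pt m k → Pt m k → ℂ}

lemma HasIntegralKernel.ext (h : HasIntegralKernel F T κ) (h' : HasIntegralKernel F T' κ) :
    T = T' := by
  refine ContinuousLinearMap.ext fun f => Lp.ext ?_
  filter_upwards [h f, h' f] with w h1 h2
  rw [h1.2, h2.2]

lemma HasIntegralKernel.congr (h : HasIntegralKernel F T κ) (hF : MeasurableSet F)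
    (hκ : ∀ w ∈ F, ∀ w' ∈ F, κ w w' = κ' w w') : HasIntegralKernel F T κ' := by
  intro f
  filter_upwards [h f, ae_restrict_mem hF] with w h1 hw
  have : (fun w' => κ w w' * f w') =ᵐ[quotVolume F] fun w' => κ' w w' * f w' := by
    filter_upwards [ae_restrict_mem hF] with w' hw'
    rw [hκ w hw w' hw']
  exact ⟨h1.1.congr this, h1.2.trans (integral_congr_ae this)⟩

lemma HasIntegralKernel.add (h : HasIntegralKernel F T κ) (h' : HasIntegralKernel F T' κ') :
    HasIntegralKernel F (T + T') (fun w w' => κ w w' + κ' w w') := by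
  intro f
  filter_upwards [h f, h' f, Lp.coeFn_add (T f) (T' f)] with w h1 h2 h3
  simp only [add_mul]
  refine ⟨h1.1.add h2.1, ?_⟩
  rw [_root_.add_apply, h3, Pi.add_apply, h1.2, h2.2, integral_add h1.1 h2.1]

lemma HasIntegralKernel.smul (h : HasIntegralKernel F T κ) (c : ℂ) :
    HasIntegralKernel F (c • T) (fun w w' => c * κ w w') := by
  intro f
  filter_upwards [h f, Lp.coeFn_smul c (T f)] with w h1 h3
  simp only [mul_assoc]
  refine ⟨h1.1.const_mul c, ?_⟩
  rw [_root_.smul_apply, h3, Pi.smul_apply, h1.2, integral_const_mul, smul_eq_mul]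

end algebra

end

end ModelCusp

namespace ModelCusp

section

open Filter Topology MeasureTheory Set

variable {m k : ℕ}

/-! ### The Laplacian of a point-pair invariant -/

lemma pd_pd (e : Pt m k) (f : Pt m k → ℂ) (w : Pt m k) :
    pd e (pd e f) w = deriv (deriv fun t : ℝ => f (w + t • e)) 0 := by
  have h : (fun t : ℝ => pd e f (w + t • e)) = deriv fun t : ℝ => f (w + t • e) := by
    funext t
    simp only [pd, lineDeriv]
    have := deriv_comp_add_const (fun s : ℝ => f (w + s • e)) t 0
    rw [zero_add] at this
    rw [← this]
    congr 1
    funext s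
    rw [add_smul, add_assoc, add_comm (t • e)]
  rw [← h]
  rfl

lemma pd_eq_deriv (e : Pt m k) (f : Pt m k → ℂ) (w : Pt m k) :
    pd e f w = deriv (fun t : ℝ => f (w + t • e)) 0 := rfl

lemma deriv_deriv_comp {f f₁ f₂ : ℝ → ℂ} (hf : ∀ T > 0, HasDerivAt f (f₁ T) T)
    (hf₁ : ∀ T > 0, HasDerivAt f₁ (f₂ T) T) {g g₁ : ℝ → ℝ} {g₂ : ℝ}
    (hg : ∀ᶠ t in 𝓝 0, 0 < g t ∧ HasDerivAt g (g₁ t) t) (hg₁ : HasDerivAt g₁ g₂ 0) :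
    deriv (fun t => f (g t)) 0 = f₁ (g 0) * g₁ 0 ∧
    deriv (deriv fun t => f (g t)) 0 = f₂ (g 0) * (g₁ 0) ^ 2 + f₁ (g 0) * g₂ := by
  have h1 : ∀ᶠ t in 𝓝 0, HasDerivAt (fun t => f (g t)) (f₁ (g t) * g₁ t) t := by
    filter_upwards [hg] with t ht
    have := (hf (g t) ht.1).scomp t ht.2
    rwa [Complex.real_smul, mul_comm] at this
  refine ⟨h1.self_of_nhds.deriv, ?_⟩
  have h2 : deriv (fun t => f (g t)) =ᶠ[𝓝 0] fun t => f₁ (g t) * g₁ t :=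
    h1.mono fun t ht => ht.deriv
  rw [h2.deriv_eq]
  have h0 := hg.self_of_nhds
  have h3 := (hf₁ (g 0) h0.1).scomp (0 : ℝ) h0.2
  have h4 := h3.mul hg₁.ofReal_comp
  refine h4.deriv.trans ?_
  simp only [Function.comp, Complex.real_smul]
  ring

lemma quad_add_ex (w w' : Pt m k) (t : ℝ) :
    quad (w + t • ex m k) w' = (w.1 + t) ^ 2 + (w'.1 ^ 2 + ‖w.2.1 - w'.2.1‖ ^ 2 + ‖w.2.2 - w'.2.2‖ ^ 2) := by
  simp [quad, ex]; ring

lemma norm_add_single_sq {d : ℕ} (y y' : EuclideanSpace ℝ (Fin d)) (i : Fin d) (t : ℝ) :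
    ‖y + t • EuclideanSpace.single i (1 : ℝ) - y'‖ ^ 2 = ‖y - y'‖ ^ 2 + 2 * t * (y - y') i + t ^ 2 := by
  rw [show y + t • EuclideanSpace.single i (1 : ℝ) - y' = (y - y') + t • EuclideanSpace.single i (1 : ℝ) by abel,
    norm_add_sq_real, inner_smul_right, norm_smul]
  simp [EuclideanSpace.inner_single_right]
  ring

lemma quad_add_ey (w w' : Pt m k) (i : Fin m) (t : ℝ) :
    quad (w + t • ey m k i) w' = quad w w' + 2 * t * (w.2.1 - w'.2.1) i + t ^ 2 := by
  have := norm_add_single_sq w.2.1 w'.2.1 i t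
  simp only [quad, ey, Prod.fst_add, Prod.snd_add, Prod.smul_mk, smul_zero, add_zero, smul_eq_mul, mul_zero]
  rw [this]; ring

lemma quad_add_ez (w w' : Pt m k) (i : Fin k) (t : ℝ) :
    quad (w + t • ez m k i) w' = quad w w' + 2 * t * (w.2.2 - w'.2.2) i + t ^ 2 := by
  have := norm_add_single_sq w.2.2 w'.2.2 i t
  simp only [quad, ez, Prod.fst_add, Prod.snd_add, Prod.smul_mk, smul_zero, add_zero, smul_eq_mul, mul_zero]
  rw [this]; ring

section twoCoshDeriv

variable {f f₁ f₂ : ℝ → ℂ} (hf : ∀ T > 0, HasDerivAt f (f₁ T) T)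
  (hf₁ : ∀ T > 0, HasDerivAt f₁ (f₂ T) T) {w w' : Pt m k} (hw : w ∈ halfSpace m k)
  (hw' : w' ∈ halfSpace m k)
include hf hf₁ hw hw'

lemma pd_ex_twoCosh :
    pd (ex m k) (fun u => f (twoCosh u w')) w =
      f₁ (twoCosh w w') * ((2 * w.1 ^ 2 - quad w w') / (w.1 ^ 2 * w'.1) : ℝ) ∧
    pd (ex m k) (pd (ex m k) (fun u => f (twoCosh u w'))) w =
      f₂ (twoCosh w w') * ((2 * w.1 ^ 2 - quad w w') / (w.1 ^ 2 * w'.1) : ℝ) ^ 2 +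
        f₁ (twoCosh w w') * (2 * (quad w w' - w.1 ^ 2) / (w.1 ^ 3 * w'.1) : ℝ) := by
  have hx : 0 < w.1 := hw
  have hx' : 0 < w'.1 := hw'
  set q := w'.1 ^ 2 + ‖w.2.1 - w'.2.1‖ ^ 2 + ‖w.2.2 - w'.2.2‖ ^ 2 with hq
  have hq0 : 0 < q := by positivity
  have hQ : quad w w' = w.1 ^ 2 + q := by rw [quad, hq]; ring
  have hfun : (fun t : ℝ => f (twoCosh (w + t • ex m k) w')) =
      fun t : ℝ => f (((w.1 + t) ^ 2 + q) / ((w.1 + t) * w'.1)) := by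
    funext t
    rw [twoCosh, quad_add_ex, ← hq]
    simp [ex]
  rw [pd_pd, pd_eq_deriv, hfun]
  have key := deriv_deriv_comp hf hf₁ (g := fun t => ((w.1 + t) ^ 2 + q) / ((w.1 + t) * w'.1))
    (g₁ := fun t => ((w.1 + t) ^ 2 - q) / ((w.1 + t) ^ 2 * w'.1)) (g₂ := 2 * q / (w.1 ^ 3 * w'.1)) ?_ ?_
  · have e0 : ((w.1 + 0) ^ 2 + q) / ((w.1 + 0) * w'.1) = twoCosh w w' := by
      rw [twoCosh, hQ, add_zero]
    have e1 : ((w.1 + 0) ^ 2 - q) / ((w.1 + 0) ^ 2 * w'.1) =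
        (2 * w.1 ^ 2 - quad w w') / (w.1 ^ 2 * w'.1) := by rw [hQ, add_zero]; ring
    simp only [e0, e1] at key
    rw [key.1, key.2, hQ, add_sub_cancel_left]
    exact ⟨rfl, rfl⟩
  · have : ∀ᶠ t : ℝ in 𝓝 0, 0 < w.1 + t := by
      have hc : ContinuousAt (fun t : ℝ => w.1 + t) 0 := by fun_prop
      exact hc.eventually (lt_mem_nhds (by simpa using hx))
    filter_upwards [this] with t ht
    refine ⟨by positivity, ?_⟩
    have h1 : HasDerivAt (fun t : ℝ => w.1 + t) 1 t := (hasDerivAt_id t).const_add _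
    have h2 := ((h1.pow 2).add_const q).div (h1.mul_const w'.1) (by positivity)
    refine h2.congr_deriv ?_
    simp only [Pi.pow_apply]
    field_simp
    ring
  · have h1 : HasDerivAt (fun t : ℝ => w.1 + t) 1 0 := (hasDerivAt_id 0).const_add _
    have h2 := ((h1.pow 2).sub_const q).div ((h1.pow 2).mul_const w'.1)
      (by simp only [Pi.pow_apply, add_zero]; positivity)
    refine h2.congr_deriv ?_
    simp only [Pi.pow_apply, add_zero]
    field_simp
    ring

omit hf hf₁ hw hw' in
lemma line_twoCosh (hf : ∀ T > 0, HasDerivAt f (f₁ T) T) (hf₁ : ∀ T > 0, HasDerivAt f₁ (f₂ T) T)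
    {Q a X : ℝ} (hQ : 0 < Q) (hX : 0 < X) :
    deriv (deriv fun t : ℝ => f ((Q + 2 * t * a + t ^ 2) / X)) 0 =
      f₂ (Q / X) * (2 * a / X : ℝ) ^ 2 + f₁ (Q / X) * (2 / X : ℝ) := by
  have key := deriv_deriv_comp hf hf₁ (g := fun t => (Q + 2 * t * a + t ^ 2) / X)
    (g₁ := fun t => (2 * a + 2 * t) / X) (g₂ := 2 / X) ?_ ?_
  · have := key.2
    simpa using this
  · have hc : ContinuousAt (fun t : ℝ => Q + 2 * t * a + t ^ 2) 0 := by fun_prop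
    filter_upwards [hc.eventually (lt_mem_nhds (by simpa using hQ))] with t ht
    refine ⟨by positivity, ?_⟩
    have h1 : HasDerivAt (fun t : ℝ => Q + 2 * t * a + t ^ 2) (2 * a + 2 * t) t := by
      have h2 := ((((hasDerivAt_id t).const_mul 2).mul_const a).const_add Q).add ((hasDerivAt_id t).pow 2)
      refine h2.congr_deriv ?_
      simp
    exact h1.div_const X
  · have h1 : HasDerivAt (fun t : ℝ => 2 * a + 2 * t) 2 0 := by
      simpa using ((hasDerivAt_id (0 : ℝ)).const_mul 2).const_add (2 * a)
    exact h1.div_const X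

/-- The Laplacian of a function of `2 cosh d`. -/
theorem hypLaplacian_twoCosh :
    hypLaplacian (fun u => f (twoCosh u w')) w =
      -(((twoCosh w w') ^ 2 - 4 : ℝ) * f₂ (twoCosh w w') +
        (((m + k : ℕ) + 1 : ℝ) * twoCosh w w' : ℝ) * f₁ (twoCosh w w')) := by
  have hx : 0 < w.1 := hw
  have hx' : 0 < w'.1 := hw'
  have hQ := quad_pos (w' := w') hw
  have hX : 0 < w.1 * w'.1 := by positivity
  obtain ⟨e1, e2⟩ := pd_ex_twoCosh hf hf₁ hw hw'
  have ey' : ∀ i, pd (ey m k i) (pd (ey m k i) (fun u => f (twoCosh u w'))) w =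
      f₂ (twoCosh w w') * (2 * (w.2.1 - w'.2.1) i / (w.1 * w'.1) : ℝ) ^ 2 +
        f₁ (twoCosh w w') * (2 / (w.1 * w'.1) : ℝ) := fun i => by
    have key := line_twoCosh (a := (w.2.1 - w'.2.1) i) hf hf₁ hQ hX
    have hfun : (fun t : ℝ => f (twoCosh (w + t • ey m k i) w')) = fun t : ℝ =>
        f ((quad w w' + 2 * t * (w.2.1 - w'.2.1) i + t ^ 2) / (w.1 * w'.1)) := by
      funext t
      rw [twoCosh, quad_add_ey]
      simp [ey]
    rw [pd_pd, hfun]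
    exact key
  have ez' : ∀ i, pd (ez m k i) (pd (ez m k i) (fun u => f (twoCosh u w'))) w =
      f₂ (twoCosh w w') * (2 * (w.2.2 - w'.2.2) i / (w.1 * w'.1) : ℝ) ^ 2 +
        f₁ (twoCosh w w') * (2 / (w.1 * w'.1) : ℝ) := fun i => by
    have key := line_twoCosh (a := (w.2.2 - w'.2.2) i) hf hf₁ hQ hX
    have hfun : (fun t : ℝ => f (twoCosh (w + t • ez m k i) w')) = fun t : ℝ =>
        f ((quad w w' + 2 * t * (w.2.2 - w'.2.2) i + t ^ 2) / (w.1 * w'.1)) := by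
      funext t
      rw [twoCosh, quad_add_ez]
      simp [ez]
    rw [pd_pd, hfun]
    exact key
  unfold hypLaplacian
  simp only [ey', ez']
  rw [e1, e2]
  simp only [Finset.sum_add_distrib, ← Finset.mul_sum, Finset.sum_const, Finset.card_univ,
    Fintype.card_fin, nsmul_eq_mul]
  have s1 : ∑ i, ((2 * (w.2.1 - w'.2.1) i / (w.1 * w'.1) : ℝ) : ℂ) ^ 2 =
      ((4 * ‖w.2.1 - w'.2.1‖ ^ 2 / (w.1 * w'.1) ^ 2 : ℝ) : ℂ) := by
    rw [EuclideanSpace.real_norm_sq_eq, Finset.mul_sum, Finset.sum_div, Complex.ofReal_sum]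
    refine Finset.sum_congr rfl fun i _ => ?_
    push_cast; ring
  have s2 : ∑ i, ((2 * (w.2.2 - w'.2.2) i / (w.1 * w'.1) : ℝ) : ℂ) ^ 2 =
      ((4 * ‖w.2.2 - w'.2.2‖ ^ 2 / (w.1 * w'.1) ^ 2 : ℝ) : ℂ) := by
    rw [EuclideanSpace.real_norm_sq_eq, Finset.mul_sum, Finset.sum_div, Complex.ofReal_sum]
    refine Finset.sum_congr rfl fun i _ => ?_
    push_cast; ring
  rw [s1, s2]
  set D1 := ‖w.2.1 - w'.2.1‖ ^ 2
  set D2 := ‖w.2.2 - w'.2.2‖ ^ 2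
  have hT : twoCosh w w' = (w.1 ^ 2 + w'.1 ^ 2 + D1 + D2) / (w.1 * w'.1) := rfl
  have hQ' : quad w w' = w.1 ^ 2 + w'.1 ^ 2 + D1 + D2 := rfl
  have r2 : w.1 ^ 2 * (((2 * w.1 ^ 2 - quad w w') / (w.1 ^ 2 * w'.1)) ^ 2 +
      4 * D1 / (w.1 * w'.1) ^ 2 + 4 * D2 / (w.1 * w'.1) ^ 2) = twoCosh w w' ^ 2 - 4 := by
    rw [hT, hQ']; field_simp; ring
  have r1 : -(w.1 ^ 2) * (2 * (quad w w' - w.1 ^ 2) / (w.1 ^ 3 * w'.1) + m * (2 / (w.1 * w'.1)) +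
      k * (2 / (w.1 * w'.1))) + ((m + k : ℕ) - 1) * w.1 * ((2 * w.1 ^ 2 - quad w w') / (w.1 ^ 2 * w'.1)) =
      -(((m + k : ℕ) + 1) * twoCosh w w') := by
    rw [hT, hQ']; push_cast; field_simp; ring
  rw [← r2]
  have r1' := congrArg (fun r : ℝ => (r : ℂ)) r1
  push_cast at r1' ⊢
  linear_combination f₁ (twoCosh w w') * r1'

end twoCoshDeriv

/-! ### Smooth functions on the half-space -/

lemma ContDiffOn.contDiffAt_half {f : Pt m k → ℂ} (hf : ContDiffOn ℝ ∞ f (halfSpace m k))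
    {w : Pt m k} (hw : w ∈ halfSpace m k) : ContDiffAt ℝ ∞ f w :=
  hf.contDiffAt (isOpen_halfSpace.mem_nhds hw)

lemma pd_eq_fderiv {f : Pt m k → ℂ} {w : Pt m k} (hf : DifferentiableAt ℝ f w) (e : Pt m k) :
    pd e f w = fderiv ℝ f w e := hf.lineDeriv_eq_fderiv

lemma contDiffOn_pd {f : Pt m k → ℂ} {U : Set (Pt m k)} (hU : IsOpen U)
    (hf : ContDiffOn ℝ ∞ f U) (e : Pt m k) : ContDiffOn ℝ ∞ (pd e f) U := by
  have h := (hf.fderiv_of_isOpen hU (m := ∞) (by simp)).clm_apply (contDiffOn_const (c := e))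
  refine h.congr fun w hw => pd_eq_fderiv ?_ e
  exact (hf.contDiffAt (hU.mem_nhds hw)).differentiableAt (by simp)

lemma pd_congr_of_eventuallyEq {f g : Pt m k → ℂ} {w : Pt m k} (h : f =ᶠ[𝓝 w] g) (e : Pt m k) :
    pd e f w = pd e g w := h.lineDeriv_eq

lemma pd_eventuallyEq {f g : Pt m k → ℂ} {w : Pt m k} (h : f =ᶠ[𝓝 w] g) (e : Pt m k) :
    pd e f =ᶠ[𝓝 w] pd e g := by
  filter_upwards [h.eventuallyEq_nhds] with u hu using pd_congr_of_eventuallyEq hu e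

lemma hypLaplacian_congr {f g : Pt m k → ℂ} {w : Pt m k} (h : f =ᶠ[𝓝 w] g) :
    hypLaplacian f w = hypLaplacian g w := by
  unfold hypLaplacian
  have h2 : ∀ e, pd e (pd e f) w = pd e (pd e g) w := fun e =>
    pd_congr_of_eventuallyEq (pd_eventuallyEq h e) e
  simp only [h2, pd_congr_of_eventuallyEq h]

lemma contDiffOn_hypLaplacian {f : Pt m k → ℂ} (hf : ContDiffOn ℝ ∞ f (halfSpace m k)) :
    ContDiffOn ℝ ∞ (hypLaplacian f) (halfSpace m k) := by
  have h2 : ∀ e, ContDiffOn ℝ ∞ (pd e (pd e f)) (halfSpace m k) := fun e =>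
    contDiffOn_pd isOpen_halfSpace (contDiffOn_pd isOpen_halfSpace hf e) e
  have hx : ContDiff ℝ ∞ (fun w : Pt m k => (w.1 : ℂ)) := Complex.ofRealCLM.contDiff.comp contDiff_fst
  unfold hypLaplacian
  refine ContDiffOn.add (ContDiffOn.mul (hx.pow 2).neg.contDiffOn ?_) ?_
  · exact ((h2 _).add (ContDiffOn.sum fun i _ => h2 _)).add (ContDiffOn.sum fun i _ => h2 _)
  · exact (contDiff_const.mul hx).contDiffOn.mul (contDiffOn_pd isOpen_halfSpace hf _)

lemma pd_zero_fun (e w : Pt m k) : pd e (fun _ => (0 : ℂ)) w = 0 := by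
  simp [pd, lineDeriv]

lemma hypLaplacian_eq_zero {f : Pt m k → ℂ} {w : Pt m k} (h : f =ᶠ[𝓝 w] fun _ => 0) :
    hypLaplacian f w = 0 := by
  rw [hypLaplacian_congr h]
  have : ∀ e : Pt m k, pd e (fun _ => (0 : ℂ)) = fun _ => 0 := fun e => funext fun w => pd_zero_fun e w
  simp only [hypLaplacian, this]
  simp

lemma pd_pd_eq {f : Pt m k → ℂ} (hf : ContDiffOn ℝ ∞ f (halfSpace m k)) {w : Pt m k}
    (hw : w ∈ halfSpace m k) (e : Pt m k) :
    pd e (pd e f) w = fderiv ℝ (fderiv ℝ f) w e e := by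
  have h1 : pd e f =ᶠ[𝓝 w] fun u => fderiv ℝ f u e := by
    filter_upwards [isOpen_halfSpace.mem_nhds hw] with u hu
    exact pd_eq_fderiv ((ContDiffOn.contDiffAt_half hf hu).differentiableAt (by simp)) e
  have h2 : DifferentiableAt ℝ (fderiv ℝ f) w :=
    ((ContDiffOn.contDiffAt_half hf hw).fderiv_right (m := 1) (by norm_cast)).differentiableAt (by simp)
  rw [pd_congr_of_eventuallyEq h1, pd_eq_fderiv (h2.clm_apply (differentiableAt_const e)),
    fderiv_clm_apply h2 (differentiableAt_const e)]
  simp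

lemma hypLaplacian_linear {f g : Pt m k → ℂ} (hf : ContDiffOn ℝ ∞ f (halfSpace m k))
    (hg : ContDiffOn ℝ ∞ g (halfSpace m k)) (c : ℂ) {w : Pt m k} (hw : w ∈ halfSpace m k) :
    hypLaplacian (fun u => f u + c * g u) w = hypLaplacian f w + c * hypLaplacian g w := by
  have h1 : ∀ {f g : Pt m k → ℂ}, ContDiffOn ℝ ∞ f (halfSpace m k) →
      ContDiffOn ℝ ∞ g (halfSpace m k) → ∀ e, ∀ u ∈ halfSpace m k,
      pd e (fun u => f u + c * g u) u = pd e f u + c * pd e g u := by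
    intro f g hf hg e u hu
    have d1 := (ContDiffOn.contDiffAt_half hf hu).differentiableAt (by simp)
    have d2 := (ContDiffOn.contDiffAt_half hg hu).differentiableAt (by simp)
    have h3 : HasFDerivAt (fun u => f u + c * g u) (fderiv ℝ f u + c • fderiv ℝ g u) u :=
      d1.hasFDerivAt.add (d2.hasFDerivAt.const_mul c)
    rw [pd_eq_fderiv h3.differentiableAt, pd_eq_fderiv d1, pd_eq_fderiv d2, h3.fderiv]
    simp
  have h2 : ∀ e, pd e (pd e (fun u => f u + c * g u)) w =
      pd e (pd e f) w + c * pd e (pd e g) w := fun e => by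
    have : pd e (fun u => f u + c * g u) =ᶠ[𝓝 w] fun u => pd e f u + c * pd e g u := by
      filter_upwards [isOpen_halfSpace.mem_nhds hw] with u hu using h1 hf hg e u hu
    rw [pd_congr_of_eventuallyEq this]
    exact h1 (contDiffOn_pd isOpen_halfSpace hf e) (contDiffOn_pd isOpen_halfSpace hg e) e w hw
  unfold hypLaplacian
  simp only [h2, h1 hf hg _ w hw, Finset.sum_add_distrib, ← Finset.mul_sum]
  ring

/-! ### Invariance of the Laplacian -/

lemma sum_bilin_orthogonal {d : ℕ} (B : EuclideanSpace ℝ (Fin d) →ₗ[ℝ] EuclideanSpace ℝ (Fin d) →ₗ[ℝ] ℂ)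
    (L : EuclideanSpace ℝ (Fin d) ≃ₗᵢ[ℝ] EuclideanSpace ℝ (Fin d)) :
    ∑ i, B (L (EuclideanSpace.single i 1)) (L (EuclideanSpace.single i 1)) =
      ∑ i, B (EuclideanSpace.single i 1) (EuclideanSpace.single i 1) := by
  have hexp : ∀ v : EuclideanSpace ℝ (Fin d), v = ∑ a, v a • EuclideanSpace.single a (1 : ℝ) := fun v => by
    have := ((EuclideanSpace.basisFun (Fin d) ℝ).sum_repr v).symm
    simp only [EuclideanSpace.basisFun_apply, EuclideanSpace.basisFun_repr] at this
    exact this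
  have hcol : ∀ a c, ∑ i, L (EuclideanSpace.single i 1) a * L (EuclideanSpace.single i 1) c =
      if a = c then (1 : ℝ) else 0 := fun a c => by
    have h : ∀ a i, L (EuclideanSpace.single i 1) a =
        inner ℝ (L.symm (EuclideanSpace.single a (1 : ℝ))) (EuclideanSpace.single i (1 : ℝ)) := fun a i => by
      rw [← L.inner_map_map, L.apply_symm_apply, EuclideanSpace.inner_single_left]; simp
    have h' : ∀ a i, L (EuclideanSpace.single i 1) a =
        inner ℝ (EuclideanSpace.single i (1 : ℝ)) (L.symm (EuclideanSpace.single a (1 : ℝ))) := fun a i => by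
      rw [h, real_inner_comm]
    have := (EuclideanSpace.basisFun (Fin d) ℝ).sum_inner_mul_inner
      (L.symm (EuclideanSpace.single a (1 : ℝ))) (L.symm (EuclideanSpace.single c (1 : ℝ)))
    rw [L.symm.inner_map_map, EuclideanSpace.inner_single_left] at this
    simp only [EuclideanSpace.basisFun_apply, ← h, ← h'] at this
    rw [this]
    simp
  have hB : ∀ v : EuclideanSpace ℝ (Fin d), B v v = ∑ a, ∑ c, ((v a * v c : ℝ) : ℂ) *
      B (EuclideanSpace.single a 1) (EuclideanSpace.single c 1) := fun v => by
    conv_lhs => rw [hexp v]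
    simp only [map_sum, LinearMap.sum_apply, map_smul, LinearMap.smul_apply, Finset.smul_sum]
    rw [Finset.sum_comm]
    refine Finset.sum_congr rfl fun a _ => Finset.sum_congr rfl fun c _ => ?_
    simp only [Complex.real_smul]; push_cast; ring
  have e : ∀ a c : Fin d, ∑ i, ((L (EuclideanSpace.single i 1) a * L (EuclideanSpace.single i 1) c : ℝ) : ℂ) *
      B (EuclideanSpace.single a 1) (EuclideanSpace.single c 1) =
      if a = c then B (EuclideanSpace.single a 1) (EuclideanSpace.single c 1) else 0 := fun a c => by
    rw [← Finset.sum_mul, ← Complex.ofReal_sum, hcol]; split_ifs <;> simp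
  calc _ = ∑ i, ∑ a, ∑ c, ((L (EuclideanSpace.single i 1) a * L (EuclideanSpace.single i 1) c : ℝ) : ℂ) *
      B (EuclideanSpace.single a 1) (EuclideanSpace.single c 1) :=
        Finset.sum_congr rfl fun i _ => hB _
    _ = ∑ a, ∑ c, ∑ i, ((L (EuclideanSpace.single i 1) a * L (EuclideanSpace.single i 1) c : ℝ) : ℂ) *
      B (EuclideanSpace.single a 1) (EuclideanSpace.single c 1) := by
        rw [Finset.sum_comm]
        exact Finset.sum_congr rfl fun a _ => Finset.sum_comm
    _ = _ := by simp only [e]; simp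

lemma line_comp_cuspIsometry (L : EuclideanSpace ℝ (Fin m) ≃ₗᵢ[ℝ] EuclideanSpace ℝ (Fin m))
    (t : EuclideanSpace ℝ (Fin k)) (w e : Pt m k) (r : ℝ) :
    cuspIsometry L t (w + r • e) = cuspIsometry L t w + r • ((e.1, L e.2.1, e.2.2) : Pt m k) := by
  simp only [cuspIsometry_apply]
  refine Prod.ext ?_ (Prod.ext ?_ ?_)
  · simp
  · simp
  · simp; abel

/-- The Laplacian commutes with the isometries `(x, y, z) ↦ (x, L y, z + t)`. -/
theorem hypLaplacian_comp_cuspIsometry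
    (L : EuclideanSpace ℝ (Fin m) ≃ₗᵢ[ℝ] EuclideanSpace ℝ (Fin m)) (t : EuclideanSpace ℝ (Fin k))
    {f : Pt m k → ℂ} (hf : ContDiffOn ℝ ∞ f (halfSpace m k)) {w : Pt m k} (hw : w ∈ halfSpace m k) :
    hypLaplacian (fun u => f (cuspIsometry L t u)) w = hypLaplacian f (cuspIsometry L t w) := by
  have hw' : cuspIsometry L t w ∈ halfSpace m k := hw
  have h1 : ∀ e : Pt m k, pd e (fun u => f (cuspIsometry L t u)) w =
      pd (e.1, L e.2.1, e.2.2) f (cuspIsometry L t w) := fun e => by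
    simp only [pd_eq_deriv, line_comp_cuspIsometry]
  have h2 : ∀ e : Pt m k, pd e (pd e (fun u => f (cuspIsometry L t u))) w =
      pd (e.1, L e.2.1, e.2.2) (pd (e.1, L e.2.1, e.2.2) f) (cuspIsometry L t w) := fun e => by
    simp only [pd_pd, line_comp_cuspIsometry]
  have hey : ∑ i, pd (ey m k i) (pd (ey m k i) (fun u => f (cuspIsometry L t u))) w =
      ∑ i, pd (ey m k i) (pd (ey m k i) f) (cuspIsometry L t w) := by
    simp only [h2]
    simp only [pd_pd_eq hf hw']
    let ι : EuclideanSpace ℝ (Fin m) →ₗ[ℝ] Pt m k :=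
      LinearMap.inr ℝ ℝ (EuclideanSpace ℝ (Fin m) × EuclideanSpace ℝ (Fin k)) ∘ₗ
        LinearMap.inl ℝ (EuclideanSpace ℝ (Fin m)) (EuclideanSpace ℝ (Fin k))
    let B : EuclideanSpace ℝ (Fin m) →ₗ[ℝ] EuclideanSpace ℝ (Fin m) →ₗ[ℝ] ℂ :=
      LinearMap.mk₂ ℝ (fun u v => fderiv ℝ (fderiv ℝ f) (cuspIsometry L t w) (ι u) (ι v))
        (by intros; simp) (by intros; simp) (by intros; simp) (by intros; simp)
    exact sum_bilin_orthogonal B L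
  have hz : ∀ i, (((ez m k i).1, L (ez m k i).2.1, (ez m k i).2.2) : Pt m k) = ez m k i := fun i => by
    simp [ez]
  have hx : (((ex m k).1, L (ex m k).2.1, (ex m k).2.2) : Pt m k) = ex m k := by
    simp [ex]
  unfold hypLaplacian
  rw [hey]
  simp only [h1, h2, hz, hx]
  rfl

end

end ModelCusp

namespace ModelCusp

section

open Filter Topology MeasureTheory Set

variable {m k : ℕ}

/-! ### Compact sets and integrals with smooth parameters -/

lemma hypVolume_lt_top {S : Set (Pt m k)} (hS : IsCompact S) (hSH : S ⊆ halfSpace m k) :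
    hypVolume m k S < ⊤ := by
  have hc : ContinuousOn (fun w : Pt m k => (w.1 ^ (m + k + 1))⁻¹) S :=
    ContinuousOn.inv₀ (by fun_prop) fun w hw => by
      have : 0 < w.1 := hSH hw
      positivity
  obtain ⟨M, hM⟩ := hS.exists_bound_of_continuousOn hc
  unfold hypVolume
  rw [withDensity_apply _ hS.measurableSet]
  calc _ ≤ ∫⁻ _ in S, ENNReal.ofReal M ∂(volume.restrict (halfSpace m k)) := by
        refine setLIntegral_mono measurable_const fun w hw => ?_
        exact ENNReal.ofReal_le_ofReal ((le_abs_self _).trans (hM w hw))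
    _ < ⊤ := by
        rw [setLIntegral_const]
        refine ENNReal.mul_lt_top ENNReal.ofReal_lt_top ?_
        exact (Measure.restrict_apply_le _ _).trans_lt hS.measure_lt_top

lemma integrable_hypVolume_of_compact {E : Type*} [NormedAddCommGroup E] {g : Pt m k → E}
    (hg : ContinuousOn g (halfSpace m k)) {S : Set (Pt m k)} (hS : IsCompact S)
    (hSH : S ⊆ halfSpace m k) (h0 : ∀ w ∈ halfSpace m k, w ∉ S → g w = 0) :
    Integrable g (hypVolume m k) := by
  obtain ⟨M, hM⟩ := hS.exists_bound_of_continuousOn (hg.mono hSH)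
  have h1 : IntegrableOn g S (hypVolume m k) :=
    Measure.integrableOn_of_bounded (hypVolume_lt_top hS hSH).ne
      (by
        have := hg.aestronglyMeasurable (μ := hypVolume m k) measurableSet_halfSpace
        rwa [Measure.restrict_eq_self_of_ae_mem ae_hypVolume_mem] at this)
      ((ae_restrict_iff' hS.measurableSet).mpr (Eventually.of_forall hM))
  refine h1.integrable_of_ae_notMem_eq_zero ?_
  filter_upwards [ae_hypVolume_mem] with w hw using h0 w hw

/-- Smooth kernels on `ℍⁿ⁺¹` whose slices have locally uniformly compact support. -/
structure ParamKer {E : Type} [NormedAddCommGroup E] [NormedSpace ℝ E]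
    (G : Pt m k → Pt m k → E) : Prop where
  smooth : ContDiffOn ℝ ∞ (Function.uncurry G) (halfSpace m k ×ˢ halfSpace m k)
  supp : ∀ w₀ ∈ halfSpace m k, ∃ S ⊆ halfSpace m k, IsCompact S ∧
    ∀ᶠ w in 𝓝 w₀, ∀ w' ∈ halfSpace m k, w' ∉ S → G w w' = 0

section ParamKer

variable {E : Type} [NormedAddCommGroup E] [NormedSpace ℝ E] {G : Pt m k → Pt m k → E}

lemma isOpen_halfSpace_prod : IsOpen (halfSpace m k ×ˢ halfSpace m k) :=
  isOpen_halfSpace.prod isOpen_halfSpace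

lemma ParamKer.hasFDerivAt_slice (hG : ParamKer G) {w w' : Pt m k} (hw : w ∈ halfSpace m k)
    (hw' : w' ∈ halfSpace m k) :
    HasFDerivAt (fun u => G u w')
      ((fderiv ℝ (Function.uncurry G) (w, w')).comp (ContinuousLinearMap.inl ℝ _ _)) w := by
  have h1 : DifferentiableAt ℝ (Function.uncurry G) (w, w') :=
    (hG.smooth.contDiffAt (isOpen_halfSpace_prod.mem_nhds ⟨hw, hw'⟩)).differentiableAt (by simp)
  exact HasFDerivAt.comp (g := Function.uncurry G) (f := fun u => (u, w')) w h1.hasFDerivAt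
    (hasFDerivAt_prodMk_left w w')

lemma ParamKer.continuousOn_slice (hG : ParamKer G) {w : Pt m k} (hw : w ∈ halfSpace m k) :
    ContinuousOn (G w) (halfSpace m k) :=
  hG.smooth.continuousOn.comp (f := fun w' => (w, w')) (by fun_prop) fun _ hw' => ⟨hw, hw'⟩

lemma ParamKer.integrable (hG : ParamKer G) {w : Pt m k} (hw : w ∈ halfSpace m k) :
    Integrable (G w) (hypVolume m k) := by
  obtain ⟨S, hSH, hS, h0⟩ := hG.supp w hw
  exact integrable_hypVolume_of_compact (hG.continuousOn_slice hw) hS hSH h0.self_of_nhds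

lemma ParamKer.fderiv (hG : ParamKer G) :
    ParamKer fun w w' => _root_.fderiv ℝ (fun u => G u w') w where
  smooth := by
    have h1 := (hG.smooth.fderiv_of_isOpen isOpen_halfSpace_prod (m := ∞) (by simp)).clm_comp
      (contDiffOn_const (c := ContinuousLinearMap.inl ℝ (Pt m k) (Pt m k)))
    exact h1.congr fun p hp => (hG.hasFDerivAt_slice hp.1 hp.2).fderiv
  supp w₀ hw₀ := by
    obtain ⟨S, hSH, hS, h0⟩ := hG.supp w₀ hw₀
    refine ⟨S, hSH, hS, ?_⟩
    filter_upwards [h0.eventually_nhds] with w hw w' hw' hS'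
    have : (fun u => G u w') =ᶠ[𝓝 w] fun _ => 0 := by
      filter_upwards [hw] with u hu using hu w' hw' hS'
    rw [this.fderiv_eq]
    simp

lemma ParamKer.hasFDerivAt (hG : ParamKer G) {w : Pt m k} (hw : w ∈ halfSpace m k) :
    HasFDerivAt (fun u => ∫ w', G u w' ∂(hypVolume m k))
      (∫ w', _root_.fderiv ℝ (fun u => G u w') w ∂(hypVolume m k)) w := by
  obtain ⟨S, hSH, hS, h0⟩ := hG.fderiv.supp w hw
  obtain ⟨r, hr, hball⟩ := Metric.nhds_basis_closedBall.mem_iff.mp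
    (inter_mem h0 (isOpen_halfSpace.mem_nhds hw))
  have hcomp : IsCompact (Metric.closedBall w r ×ˢ S) := (isCompact_closedBall w r).prod hS
  obtain ⟨M, hM⟩ := hcomp.exists_bound_of_continuousOn
    (hG.fderiv.smooth.continuousOn.mono (prod_mono (fun u hu => (hball hu).2) hSH))
  refine hasFDerivAt_integral_of_dominated_of_fderiv_le (𝕜 := ℝ) (μ := hypVolume m k) (F := G)
    (F' := fun w w' => _root_.fderiv ℝ (fun u => G u w') w) (x₀ := w)
    (Metric.closedBall_mem_nhds w hr)
    (bound := S.indicator fun _ => M) ?_ (hG.integrable hw) (hG.fderiv.integrable hw).1 ?_ ?_ ?_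
  · filter_upwards [isOpen_halfSpace.mem_nhds hw] with u hu using (hG.integrable hu).1
  · filter_upwards [ae_hypVolume_mem] with w' hw' u hu
    by_cases hS' : w' ∈ S
    · rw [indicator_of_mem hS']
      exact hM (u, w') ⟨hu, hS'⟩
    · rw [indicator_of_notMem hS', (hball hu).1 w' hw' hS', norm_zero]
  · exact (integrable_indicator_iff hS.measurableSet).mpr
      (integrableOn_const (hypVolume_lt_top hS hSH).ne)
  · filter_upwards [ae_hypVolume_mem] with w' hw' u hu
    exact (hG.hasFDerivAt_slice (hball hu).2 hw').differentiableAt.hasFDerivAt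

end ParamKer

lemma ParamKer.contDiffOn_nat (N : ℕ) : ∀ {E : Type} [NormedAddCommGroup E] [NormedSpace ℝ E]
    {G : Pt m k → Pt m k → E}, ParamKer G →
    ContDiffOn ℝ N (fun u => ∫ w', G u w' ∂(hypVolume m k)) (halfSpace m k) := by
  induction N with
  | zero =>
    intro E _ _ G hG
    exact contDiffOn_zero.mpr fun w hw => (hG.hasFDerivAt hw).continuousAt.continuousWithinAt
  | succ N ih =>
    intro E _ _ G hG
    push_cast
    rw [contDiffOn_succ_iff_fderiv_of_isOpen isOpen_halfSpace]
    refine ⟨fun w hw => (hG.hasFDerivAt hw).differentiableAt.differentiableWithinAt, by simp, ?_⟩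
    exact (ih hG.fderiv).congr fun w hw => (hG.hasFDerivAt hw).fderiv

lemma ParamKer.contDiffOn {E : Type} [NormedAddCommGroup E] [NormedSpace ℝ E]
    {G : Pt m k → Pt m k → E} (hG : ParamKer G) :
    ContDiffOn ℝ ∞ (fun u => ∫ w', G u w' ∂(hypVolume m k)) (halfSpace m k) :=
  contDiffOn_infty.mpr fun N => ParamKer.contDiffOn_nat N hG

section

variable {G : Pt m k → Pt m k → ℂ}

lemma ParamKer.clm_apply {E E' : Type} [NormedAddCommGroup E] [NormedSpace ℝ E]
    [NormedAddCommGroup E'] [NormedSpace ℝ E'] {G : Pt m k → Pt m k → E} (hG : ParamKer G)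
    (L : E →L[ℝ] E') : ParamKer fun w w' => L (G w w') where
  smooth := L.contDiff.comp_contDiffOn hG.smooth
  supp w₀ hw₀ := by
    obtain ⟨S, hSH, hS, h0⟩ := hG.supp w₀ hw₀
    refine ⟨S, hSH, hS, h0.mono fun w hw w' hw' hS' => ?_⟩
    rw [hw w' hw' hS', map_zero]

lemma ParamKer.congr {G' : Pt m k → Pt m k → ℂ} (hG : ParamKer G)
    (h : ∀ w ∈ halfSpace m k, ∀ w' ∈ halfSpace m k, G' w w' = G w w') : ParamKer G' where
  smooth := hG.smooth.congr fun p hp => h _ hp.1 _ hp.2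
  supp w₀ hw₀ := by
    obtain ⟨S, hSH, hS, h0⟩ := hG.supp w₀ hw₀
    refine ⟨S, hSH, hS, ?_⟩
    filter_upwards [h0, isOpen_halfSpace.mem_nhds hw₀] with w hw hwH w' hw' hS'
    rw [h w hwH w' hw', hw w' hw' hS']

lemma ParamKer.pd (hG : ParamKer G) (e : Pt m k) :
    ParamKer fun w w' => ModelCusp.pd e (fun u => G u w') w :=
  (hG.fderiv.clm_apply (ContinuousLinearMap.apply ℝ ℂ e)).congr fun _ hw _ hw' =>
    pd_eq_fderiv (hG.hasFDerivAt_slice hw hw').differentiableAt e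

lemma ParamKer.pd_integral (hG : ParamKer G) (e : Pt m k) {w : Pt m k} (hw : w ∈ halfSpace m k) :
    ModelCusp.pd e (fun u => ∫ w', G u w' ∂(hypVolume m k)) w =
      ∫ w', ModelCusp.pd e (fun u => G u w') w ∂(hypVolume m k) := by
  have h := hG.hasFDerivAt hw
  rw [pd_eq_fderiv h.differentiableAt, h.fderiv,
    ContinuousLinearMap.integral_apply (hG.fderiv.integrable hw)]
  refine integral_congr_ae ?_
  filter_upwards [ae_hypVolume_mem] with w' hw'
  exact (pd_eq_fderiv (hG.hasFDerivAt_slice hw hw').differentiableAt e).symm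

lemma ParamKer.pd_pd_integral (hG : ParamKer G) (e : Pt m k) {w : Pt m k}
    (hw : w ∈ halfSpace m k) :
    ModelCusp.pd e (ModelCusp.pd e (fun u => ∫ w', G u w' ∂(hypVolume m k))) w =
      ∫ w', ModelCusp.pd e (ModelCusp.pd e (fun u => G u w')) w ∂(hypVolume m k) := by
  rw [← (hG.pd e).pd_integral e hw]
  refine pd_congr_of_eventuallyEq ?_ e
  filter_upwards [isOpen_halfSpace.mem_nhds hw] with u hu using hG.pd_integral e hu

lemma ParamKer.hypLaplacian_integral (hG : ParamKer G) {w : Pt m k} (hw : w ∈ halfSpace m k) :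
    hypLaplacian (fun u => ∫ w', G u w' ∂(hypVolume m k)) w =
      ∫ w', hypLaplacian (fun u => G u w') w ∂(hypVolume m k) := by
  have h2 : ∀ e, Integrable (fun w' => ModelCusp.pd e (ModelCusp.pd e (fun u => G u w')) w)
      (hypVolume m k) := fun e => ((hG.pd e).pd e).integrable hw
  have h1 := (hG.pd (ex m k)).integrable hw
  have hy := integrable_finsetSum (μ := hypVolume m k) Finset.univ fun i _ => h2 (ey m k i)
  have hz := integrable_finsetSum (μ := hypVolume m k) Finset.univ fun i _ => h2 (ez m k i)
  have hs := ((h2 (ex m k)).add hy).add hz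
  have i1 := integral_finsetSum (μ := hypVolume m k) Finset.univ fun i _ => h2 (ey m k i)
  have i2 := integral_finsetSum (μ := hypVolume m k) Finset.univ fun i _ => h2 (ez m k i)
  have i3 := integral_add ((h2 (ex m k)).add hy) hz
  have i4 := integral_add (h2 (ex m k)) hy
  have i5 := integral_add (hs.const_mul (-((w.1 : ℂ) ^ 2)))
    (h1.const_mul ((((m + k : ℕ) : ℂ) - 1) * (w.1 : ℂ)))
  simp only [Pi.add_apply, integral_const_mul] at i3 i4 i5
  unfold hypLaplacian
  simp only [hG.pd_pd_integral _ hw, hG.pd_integral _ hw]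
  rw [i5, i3, i4, i1, i2]

end

/-! ### Symmetry of the Laplacian -/

lemma isAddHaarMeasure_volume_pt : (volume : Measure (Pt m k)).IsAddHaarMeasure := by
  have : ((volume : Measure (EuclideanSpace ℝ (Fin m))).prod
      (volume : Measure (EuclideanSpace ℝ (Fin k)))).IsAddHaarMeasure := inferInstance
  exact Measure.prod.instIsAddHaarMeasure (volume : Measure ℝ)
    ((volume : Measure (EuclideanSpace ℝ (Fin m))).prod (volume : Measure (EuclideanSpace ℝ (Fin k))))

lemma integral_pd_eq_zero {h : Pt m k → ℂ} (hh : ContDiff ℝ 1 h) (hc : HasCompactSupport h)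
    (e : Pt m k) : ∫ w, pd e h w = 0 := by
  have hd : Differentiable ℝ h := hh.differentiable (by simp)
  have hcont : Continuous fun w => fderiv ℝ h w e :=
    (hh.continuous_fderiv (by simp)).clm_apply continuous_const
  have hpd : pd e h = fun w => fderiv ℝ h w e := funext fun w => pd_eq_fderiv (hd w) e
  have hsupp : HasCompactSupport fun w => fderiv ℝ h w e := hc.fderiv_apply ℝ e
  have := isAddHaarMeasure_volume_pt (m := m) (k := k)
  have := integral_bilinear_hasLineDerivAt_right_eq_neg_left_of_integrable
    (μ := (volume : Measure (Pt m k))) (f := fun _ => (1 : ℝ)) (f' := fun _ => 0) (g := h)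
    (g' := fun w => fderiv ℝ h w e) (v := e) (B := ContinuousLinearMap.lsmul ℝ ℝ)
    (by simp) (by simpa using hcont.integrable_of_hasCompactSupport hsupp)
    (by simpa using hh.continuous.integrable_of_hasCompactSupport hc)
    (fun x _ => by simpa [HasLineDerivAt] using hasDerivAt_const (0 : ℝ) (1 : ℝ)) (fun x _ => (hd x).hasFDerivAt.hasLineDerivAt e)
  rw [hpd]
  simpa using this

/-- The divergence form of `κ Δφ - φ Δκ`. -/
lemma hypLaplacian_green {κ φ : Pt m k → ℂ} (hκ : ContDiffOn ℝ ∞ κ (halfSpace m k))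
    (hφ : ContDiffOn ℝ ∞ φ (halfSpace m k)) (hn : 0 < m + k) {w : Pt m k}
    (hw : w ∈ halfSpace m k) (h : Pt m k → Pt m k → ℂ)
    (hh : ∀ e, ∀ u ∈ halfSpace m k, h e u =
      (((u.1 ^ (m + k - 1))⁻¹ : ℝ) : ℂ) * (κ u * pd e φ u - φ u * pd e κ u)) :
    (((w.1 ^ (m + k + 1))⁻¹ : ℝ) : ℂ) * (κ w * hypLaplacian φ w - φ w * hypLaplacian κ w) =
      -(pd (ex m k) (h (ex m k)) w + ∑ i, pd (ey m k i) (h (ey m k i)) w +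
        ∑ i, pd (ez m k i) (h (ez m k i)) w) := by
  have hx : 0 < w.1 := hw
  have hxc : (w.1 : ℂ) ≠ 0 := by exact_mod_cast hx.ne'
  obtain ⟨N, hN⟩ : ∃ N, m + k = N + 1 := ⟨m + k - 1, by omega⟩
  have hd : ∀ {f : Pt m k → ℂ}, ContDiffOn ℝ ∞ f (halfSpace m k) → DifferentiableAt ℝ f w :=
    fun hf => (ContDiffOn.contDiffAt_half hf hw).differentiableAt (by simp)
  have hpd : ∀ e, pd e (h e) w = (((w.1 ^ (m + k - 1))⁻¹ : ℝ) : ℂ) *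
      (κ w * pd e (pd e φ) w - φ w * pd e (pd e κ) w) +
      ((-(N : ℝ) * (w.1 ^ (N + 1))⁻¹ * e.1 : ℝ) : ℂ) * (κ w * pd e φ w - φ w * pd e κ w) := fun e => by
    have hev : h e =ᶠ[𝓝 w] fun u =>
        (((u.1 ^ (m + k - 1))⁻¹ : ℝ) : ℂ) * (κ u * pd e φ u - φ u * pd e κ u) := by
      filter_upwards [isOpen_halfSpace.mem_nhds hw] with u hu using hh e u hu
    have line : ∀ {f : Pt m k → ℂ}, ContDiffOn ℝ ∞ f (halfSpace m k) →
        HasDerivAt (fun t : ℝ => f (w + t • e)) (pd e f w) 0 := fun hf =>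
      HasDerivAt.congr_deriv ((hd hf).hasFDerivAt.hasLineDerivAt e) (pd_eq_fderiv (hd hf) e).symm
    have lx : HasDerivAt (fun t : ℝ => ((((w + t • e).1 ^ (m + k - 1))⁻¹ : ℝ) : ℂ))
        ((-(N : ℝ) * (w.1 ^ (N + 1))⁻¹ * e.1 : ℝ) : ℂ) 0 := by
      have h1 : HasDerivAt (fun t : ℝ => (w + t • e).1) e.1 0 := by
        simpa using ((hasDerivAt_id (0 : ℝ)).mul_const e.1).const_add w.1
      have h2 := (h1.pow (m + k - 1)).inv (by
        simp only [Pi.pow_apply, zero_smul, add_zero]; exact pow_ne_zero _ hx.ne')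
      refine (h2.congr_deriv ?_).ofReal_comp
      rw [hN, Nat.add_sub_cancel]
      rcases N with _ | N
      · simp
      · simp
        field_simp
        ring
    rw [pd_congr_of_eventuallyEq hev, pd_eq_deriv]
    have l1 := line hκ
    have l2 := line hφ
    have l3 := line (contDiffOn_pd isOpen_halfSpace hκ e)
    have l4 := line (contDiffOn_pd isOpen_halfSpace hφ e)
    have key := lx.mul ((l1.mul l4).sub (l2.mul l3))
    refine (HasDerivAt.deriv (key : HasDerivAt (fun t : ℝ => _) _ _)).trans ?_
    simp only [Pi.sub_apply, Pi.mul_apply, zero_smul, add_zero]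
    ring
  have e1 : (ex m k).1 = 1 := rfl
  have e2 : ∀ i, (ey m k i).1 = 0 := fun _ => rfl
  have e3 : ∀ i, (ez m k i).1 = 0 := fun _ => rfl
  simp only [hpd, e1, e2, e3, mul_zero, Complex.ofReal_zero, zero_mul, add_zero, ← Finset.mul_sum,
    Finset.sum_sub_distrib]
  unfold hypLaplacian
  rw [hN, Nat.add_sub_cancel]
  push_cast
  field_simp
  ring

/-- The Laplacian is symmetric when one of the functions has compact support. -/
theorem integral_mul_hypLaplacian {κ φ : Pt m k → ℂ} (hκ : ContDiffOn ℝ ∞ κ (halfSpace m k))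
    (hφ : ContDiffOn ℝ ∞ φ (halfSpace m k)) (hn : 0 < m + k) {S : Set (Pt m k)} (hS : IsCompact S)
    (hSH : S ⊆ halfSpace m k) (h0 : ∀ w ∈ halfSpace m k, w ∉ S → κ w = 0) :
    ∫ w, κ w * hypLaplacian φ w ∂(hypVolume m k) = ∫ w, hypLaplacian κ w * φ w ∂(hypVolume m k) := by
  classical
  have zero : ∀ w ∈ halfSpace m k, w ∉ S → κ =ᶠ[𝓝 w] fun _ => 0 := fun w hw hwS => by
    filter_upwards [isOpen_halfSpace.mem_nhds hw, hS.isClosed.isOpen_compl.mem_nhds hwS] with u h1 h2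
    exact h0 u h1 h2
  let h : Pt m k → Pt m k → ℂ := fun e => (halfSpace m k).indicator fun u =>
    (((u.1 ^ (m + k - 1))⁻¹ : ℝ) : ℂ) * (κ u * pd e φ u - φ u * pd e κ u)
  have hval : ∀ e, ∀ u ∈ halfSpace m k, h e u =
      (((u.1 ^ (m + k - 1))⁻¹ : ℝ) : ℂ) * (κ u * pd e φ u - φ u * pd e κ u) := fun e u hu =>
    indicator_of_mem hu _
  have hout : ∀ e, ∀ u ∉ S, h e u = 0 := fun e u hu => by
    by_cases huH : u ∈ halfSpace m k
    · rw [hval e u huH, pd_congr_of_eventuallyEq (zero u huH hu), h0 u huH hu, pd_zero_fun]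
      ring
    · exact indicator_of_notMem huH _
  have hsm : ∀ e, ContDiff ℝ 1 (h e) := fun e => by
    rw [contDiff_iff_contDiffAt]
    intro u
    by_cases hu : u ∈ S
    · have huH := hSH hu
      have hx : ContDiffOn ℝ ∞ (fun u : Pt m k => (((u.1 ^ (m + k - 1))⁻¹ : ℝ) : ℂ))
          (halfSpace m k) := by
        refine Complex.ofRealCLM.contDiff.comp_contDiffOn ?_
        exact (contDiff_fst.pow _).contDiffOn.inv fun u hu => pow_ne_zero _ (ne_of_gt hu)
      have := hx.mul ((hκ.mul (contDiffOn_pd isOpen_halfSpace hφ e)).sub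
        (hφ.mul (contDiffOn_pd isOpen_halfSpace hκ e)))
      exact (((this.congr (hval e)).contDiffAt (isOpen_halfSpace.mem_nhds huH))).of_le
        (by norm_cast)
    · have : h e =ᶠ[𝓝 u] fun _ => 0 := by
        filter_upwards [hS.isClosed.isOpen_compl.mem_nhds hu] with v hv using hout e v hv
      exact contDiffAt_const.congr_of_eventuallyEq this
  have hcs : ∀ e, HasCompactSupport (h e) := fun e => HasCompactSupport.intro hS (hout e)
  have hint : ∀ e, Integrable (pd e (h e)) := fun e => by
    have hd : Differentiable ℝ (h e) := (hsm e).differentiable (by simp)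
    have : pd e (h e) = fun w => fderiv ℝ (h e) w e := funext fun w => pd_eq_fderiv (hd w) e
    rw [this]
    exact (((hsm e).continuous_fderiv (by simp)).clm_apply
      continuous_const).integrable_of_hasCompactSupport ((hcs e).fderiv_apply ℝ e)
  have i1 : Integrable (fun w => κ w * hypLaplacian φ w) (hypVolume m k) :=
    integrable_hypVolume_of_compact (hκ.mul (contDiffOn_hypLaplacian hφ)).continuousOn hS hSH
      fun w hw hwS => by rw [h0 w hw hwS, zero_mul]
  have i2 : Integrable (fun w => hypLaplacian κ w * φ w) (hypVolume m k) :=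
    integrable_hypVolume_of_compact ((contDiffOn_hypLaplacian hκ).mul hφ).continuousOn hS hSH
      fun w hw hwS => by rw [hypLaplacian_eq_zero (zero w hw hwS), zero_mul]
  rw [← sub_eq_zero, ← integral_sub i1 i2, integral_hypVolume]
  have : ∀ w ∈ halfSpace m k, (((w.1 ^ (m + k + 1))⁻¹ : ℝ) : ℂ) *
      (κ w * hypLaplacian φ w - hypLaplacian κ w * φ w) =
      -(pd (ex m k) (h (ex m k)) w + ∑ i, pd (ey m k i) (h (ey m k i)) w +
        ∑ i, pd (ez m k i) (h (ez m k i)) w) := fun w hw => by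
    rw [mul_comm (hypLaplacian κ w)]
    exact hypLaplacian_green hκ hφ hn hw h hval
  rw [setIntegral_congr_fun measurableSet_halfSpace this]
  rw [setIntegral_eq_integral_of_forall_compl_eq_zero]
  · have hy := integrable_finsetSum (μ := (volume : Measure (Pt m k))) Finset.univ
      fun i _ => hint (ey m k i)
    have hz := integrable_finsetSum (μ := (volume : Measure (Pt m k))) Finset.univ
      fun i _ => hint (ez m k i)
    have i1 := integral_finsetSum (μ := (volume : Measure (Pt m k))) Finset.univ
      fun i _ => hint (ey m k i)
    have i2 := integral_finsetSum (μ := (volume : Measure (Pt m k))) Finset.univ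
      fun i _ => hint (ez m k i)
    have i3 := integral_add ((hint (ex m k)).add hy) hz
    have i4 := integral_add (hint (ex m k)) hy
    simp only [Pi.add_apply] at i3 i4
    rw [integral_neg, i3, i4, i1, i2]
    simp only [integral_pd_eq_zero (hsm _) (hcs _)]
    simp
  · intro w hw
    have hz : ∀ e, pd e (h e) w = 0 := fun e => by
      have : h e =ᶠ[𝓝 w] fun _ => 0 := by
        filter_upwards [hS.isClosed.isOpen_compl.mem_nhds fun hS' => hw (hSH hS')] with v hv
          using hout e v hv
      rw [pd_congr_of_eventuallyEq this, pd_zero_fun]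
    simp [hz]

end

end ModelCusp

namespace ModelCusp

section

open Filter Topology MeasureTheory Set

open scoped NNReal

variable {m k : ℕ}

/-! ### Slabs -/

/-- The compact set `x ≥ c`, `‖w‖ ≤ B`. -/
def slab (m k : ℕ) (c B : ℝ) : Set (Pt m k) := {w | c ≤ w.1 ∧ ‖w‖ ≤ B}

lemma isCompact_slab (c B : ℝ) : IsCompact (slab m k c B) := by
  refine Metric.isCompact_of_isClosed_isBounded ?_ ?_
  · exact (isClosed_le continuous_const continuous_fst).inter
      (isClosed_le continuous_norm continuous_const)
  · exact (Metric.isBounded_closedBall (x := (0 : Pt m k)) (r := B)).subset fun w hw => by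
      simpa using hw.2

lemma slab_subset {c B : ℝ} (hc : 0 < c) : slab m k c B ⊆ halfSpace m k := fun _ hw =>
  lt_of_lt_of_le hc hw.1

lemma exists_slab {K : Set (Pt m k)} (hK : IsCompact K) (hKH : K ⊆ halfSpace m k) :
    ∃ c > 0, ∃ B > 0, K ⊆ slab m k c B := by
  obtain ⟨B, hB⟩ := hK.exists_bound_of_continuousOn (f := fun w => w) continuousOn_id
  rcases K.eq_empty_or_nonempty with rfl | hne
  · exact ⟨1, one_pos, 1, one_pos, empty_subset _⟩
  obtain ⟨w₀, hw₀, hmin⟩ := hK.exists_isMinOn hne (continuous_fst.continuousOn (s := K))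
  exact ⟨w₀.1, hKH hw₀, max B 1, by positivity, fun w hw => ⟨hmin hw, (hB w hw).trans (le_max_left _ _)⟩⟩

lemma mem_slab_of_twoCosh_le {c B R : ℝ} (hc : 0 < c) {w w' : Pt m k} (hw : w ∈ halfSpace m k)
    (hw' : w' ∈ slab m k c B) (hT : twoCosh w w' ≤ R) : w ∈ slab m k (c / R) (B + R * B) := by
  have hw'H := slab_subset hc hw'
  have hx : 0 < w.1 := hw
  have hx' : 0 < w'.1 := hw'H
  have hR : 0 < R := by linarith [two_le_twoCosh hw hw'H]
  have hB : w'.1 ≤ B := (le_abs_self _).trans ((norm_fst_le w').trans hw'.2)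
  have hB2 : ‖w'.2.1‖ ≤ B := (norm_fst_le w'.2).trans ((norm_snd_le w').trans hw'.2)
  have hB3 : ‖w'.2.2‖ ≤ B := (norm_snd_le w'.2).trans ((norm_snd_le w').trans hw'.2)
  have hq : quad w w' ≤ R * (w.1 * w'.1) := by
    rw [twoCosh, div_le_iff₀ (by positivity)] at hT; exact hT
  have hq' : quad w w' = w.1 ^ 2 + w'.1 ^ 2 + ‖w.2.1 - w'.2.1‖ ^ 2 + ‖w.2.2 - w'.2.2‖ ^ 2 := rfl
  have s1 := sq_nonneg ‖w.2.1 - w'.2.1‖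
  have s2 := sq_nonneg ‖w.2.2 - w'.2.2‖
  have h1 : w.1 ≤ R * w'.1 := by
    by_contra! h
    nlinarith [mul_lt_mul_of_pos_left h hx, sq_nonneg w'.1]
  have h2 : w'.1 ≤ R * w.1 := by
    by_contra! h
    nlinarith [mul_lt_mul_of_pos_left h hx', sq_nonneg w.1]
  have hRB : 0 ≤ R * B := mul_nonneg hR.le (hx'.le.trans hB)
  have h3 : R * (w.1 * w'.1) ≤ (R * B) ^ 2 := by
    have e1 : w.1 ≤ R * B := h1.trans (by gcongr)
    calc R * (w.1 * w'.1) ≤ R * ((R * B) * B) := by gcongr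
      _ = _ := by ring
  have n1 : ‖w.2.1 - w'.2.1‖ ≤ R * B := abs_le_of_sq_le_sq' (by nlinarith) hRB |>.2
  have n2 : ‖w.2.2 - w'.2.2‖ ≤ R * B := abs_le_of_sq_le_sq' (by nlinarith) hRB |>.2
  refine ⟨?_, ?_⟩
  · rw [div_le_iff₀ hR]
    linarith [hw'.1]
  · refine norm_prod_le_iff.mpr ⟨?_, norm_prod_le_iff.mpr ⟨?_, ?_⟩⟩
    · rw [Real.norm_of_nonneg hx.le]
      nlinarith
    · have := norm_le_norm_add_norm_sub' w.2.1 w'.2.1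
      linarith
    · have := norm_le_norm_add_norm_sub' w.2.2 w'.2.2
      linarith

lemma contDiffOn_twoCosh : ContDiffOn ℝ ∞ (fun p : Pt m k × Pt m k => twoCosh p.1 p.2)
    (halfSpace m k ×ˢ halfSpace m k) := by
  have h1 : ContDiff ℝ ∞ fun p : Pt m k × Pt m k => quad p.1 p.2 := by
    unfold quad
    exact (((contDiff_fst.fst.pow 2).add (contDiff_snd.fst.pow 2)).add
      ((contDiff_fst.snd.fst.sub contDiff_snd.snd.fst).norm_sq ℝ)).add
      ((contDiff_fst.snd.snd.sub contDiff_snd.snd.snd).norm_sq ℝ)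
  refine h1.contDiffOn.div (contDiff_fst.fst.mul contDiff_snd.fst).contDiffOn fun p hp => ?_
  exact (mul_pos hp.1 hp.2).ne'

/-- Convolution with a compactly supported point-pair invariant. -/
lemma paramKer_twoCosh {f : ℝ → ℂ} (hf : ContDiffOn ℝ ∞ f (Ioi 0)) {R : ℝ}
    (hR : ∀ T ≥ R, f T = 0) {φ : Pt m k → ℂ} (hφ : ContDiffOn ℝ ∞ φ (halfSpace m k)) :
    ParamKer fun w w' => f (twoCosh w w') * φ w' where
  smooth := by
    refine ContDiffOn.mul (hf.comp contDiffOn_twoCosh fun p hp => ?_)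
      (hφ.comp contDiff_snd.contDiffOn fun p hp => hp.2)
    exact lt_of_lt_of_le two_pos (two_le_twoCosh hp.1 hp.2)
  supp w₀ hw₀ := by
    have hx : 0 < w₀.1 := hw₀
    by_cases hR2 : R ≤ 2
    · refine ⟨∅, empty_subset _, isCompact_empty, ?_⟩
      filter_upwards [isOpen_halfSpace.mem_nhds hw₀] with w hw w' hw' _
      rw [hR _ (hR2.trans (two_le_twoCosh hw hw')), zero_mul]
    have hR0 : 0 < R := by linarith
    refine ⟨slab m k (w₀.1 / 2 / R) ((‖w₀‖ + 1) + R * (‖w₀‖ + 1)), slab_subset (by positivity),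
      isCompact_slab _ _, ?_⟩
    have e1 : ∀ᶠ w : Pt m k in 𝓝 w₀, w₀.1 / 2 < w.1 :=
      continuous_fst.continuousAt.eventually (lt_mem_nhds (by linarith))
    have e2 : ∀ᶠ w : Pt m k in 𝓝 w₀, ‖w‖ < ‖w₀‖ + 1 :=
      continuous_norm.continuousAt.eventually (gt_mem_nhds (by linarith))
    filter_upwards [e1, e2] with w h1 h2 w' hw' hS
    by_cases hT : R ≤ twoCosh w w'
    · rw [hR _ hT, zero_mul]
    · refine absurd (mem_slab_of_twoCosh_le (half_pos hx) hw' (w' := w) ⟨h1.le, h2.le⟩ ?_) hS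
      rw [twoCosh_comm]; linarith

/-! ### Operators with folded kernels -/

/-- Point-pair invariants that satisfy the Schur test with constant `C` and decay. -/
structure SchurFun (m k : ℕ) (a : ℝ) (C : ℝ≥0) (f : ℝ → ℂ) : Prop extends Tame a f where
  schur : SchurKer m k (fun T => ‖f T‖ₑ) C

lemma Tame.add {a : ℝ} {f g : ℝ → ℂ} (hf : Tame a f) (hg : Tame a g) :
    Tame a fun T => f T + g T where
  measurable := hf.measurable.add hg.measurable
  decay := by
    obtain ⟨σ, hσ, C, hC⟩ := hf.decay
    obtain ⟨τ, hτ, D, hD⟩ := hg.decay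
    refine ⟨min σ τ, lt_min hσ hτ, |C| + |D|, fun T hT => ?_⟩
    have h1 : T ^ (-σ) ≤ T ^ (-(min σ τ)) :=
      Real.rpow_le_rpow_of_exponent_le (by linarith) (neg_le_neg (min_le_left _ _))
    have h2 : T ^ (-τ) ≤ T ^ (-(min σ τ)) :=
      Real.rpow_le_rpow_of_exponent_le (by linarith) (neg_le_neg (min_le_right _ _))
    have p1 : 0 ≤ T ^ (-σ) := Real.rpow_nonneg (by linarith) _
    have p2 : 0 ≤ T ^ (-τ) := Real.rpow_nonneg (by linarith) _
    calc ‖f T + g T‖ ≤ C * T ^ (-σ) + D * T ^ (-τ) := (norm_add_le _ _).trans (add_le_add (hC T hT) (hD T hT))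
      _ ≤ |C| * T ^ (-(min σ τ)) + |D| * T ^ (-(min σ τ)) := by
          refine add_le_add ((mul_le_mul_of_nonneg_right (le_abs_self _) p1).trans ?_)
            ((mul_le_mul_of_nonneg_right (le_abs_self _) p2).trans ?_) <;> gcongr
      _ = _ := by ring

lemma Tame.const_mul {a : ℝ} {f : ℝ → ℂ} (hf : Tame a f) (c : ℂ) : Tame a fun T => c * f T where
  measurable := hf.measurable.const_mul c
  decay := by
    obtain ⟨σ, hσ, C, hC⟩ := hf.decay
    refine ⟨σ, hσ, ‖c‖ * C, fun T hT => ?_⟩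
    rw [norm_mul, mul_assoc]
    gcongr
    exact hC T hT

lemma SchurFun.add {a : ℝ} {C D : ℝ≥0} {f g : ℝ → ℂ} (hf : SchurFun m k a C f)
    (hg : SchurFun m k a D g) : SchurFun m k a (C + D) fun T => f T + g T where
  toTame := hf.toTame.add hg.toTame
  schur w hw := by
    push_cast
    rw [add_mul]
    refine le_trans ?_ (add_le_add (hf.schur w hw) (hg.schur w hw))
    rw [← lintegral_add_left]
    · refine lintegral_mono fun w' => ?_
      rw [← add_mul]
      gcongr
      exact enorm_add_le _ _
    · exact (hf.measurable.comp (measurable_twoCosh.comp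
        (measurable_const.prodMk measurable_id))).enorm.mul measurable_schurWeight

lemma SchurFun.const_mul {a : ℝ} {C : ℝ≥0} {f : ℝ → ℂ} (hf : SchurFun m k a C f) (c : ℂ) :
    SchurFun m k a (‖c‖₊ * C) fun T => c * f T where
  toTame := hf.toTame.const_mul c
  schur := by
    have := hf.schur.const_mul ‖c‖₊
    simpa [enorm_mul, enorm_eq_nnnorm] using this

lemma SchurFun.of_le {a : ℝ} (ha : a ≤ ((m + k : ℕ) : ℝ) / 2) {f : ℝ → ℂ} (hf : Measurable f)
    {q C : ℝ} (hq : ((m + k : ℕ) : ℝ) / 2 < q) (hC : 0 ≤ C) (h : ∀ T ≥ 2, ‖f T‖ ≤ C * T ^ (-q)) :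
    SchurFun m k a (C.toNNReal * (schurR (m + k) q).toNNReal) f where
  measurable := hf
  decay := ⟨q, by linarith, C, fun T hT => h T (by linarith)⟩
  schur := by
    refine ((schurKer_rpow hq).const_mul C.toNNReal).mono fun T hT => ?_
    rw [← ofReal_norm]
    refine (ENNReal.ofReal_le_ofReal (h T hT)).trans_eq ?_
    rw [ENNReal.ofReal_mul hC]
    rfl

/-- The operator with kernel `∑_γ f(2 cosh d(w, γ w'))`, or an arbitrary one if no bounded operator has
this kernel. -/
noncomputable def foldOp (Γ : Subgroup (Equiv.Perm (Pt m k))) (F : Set (Pt m k)) (f : ℝ → ℂ) :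
    L2 F →L[ℂ] L2 F :=
  Classical.epsilon fun T => HasIntegralKernel F T (foldKer Γ f)

namespace CuspLike

variable {Γ : Subgroup (Equiv.Perm (Pt m k))} {F : Set (Pt m k)} {a : ℝ} (hΓ : CuspLike Γ F a)
include hΓ

lemma foldOp_spec {f : ℝ → ℂ} {C : ℝ≥0} (hf : SchurFun m k a C f) :
    HasIntegralKernel F (foldOp Γ F f) (foldKer Γ f) :=
  Classical.epsilon_spec (hΓ.exists_foldOp hf.toTame hf.schur)

lemma norm_foldOp {f : ℝ → ℂ} {C : ℝ≥0} (hf : SchurFun m k a C f) : ‖foldOp Γ F f‖ ≤ C :=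
  hΓ.norm_foldOp_le hf.toTame hf.schur (hΓ.foldOp_spec hf)

lemma foldKer_add {f g : ℝ → ℂ} (hf : Tame a f) (hg : Tame a g) {w w' : Pt m k}
    (hw : w ∈ halfSpace m k) (hw' : w' ∈ halfSpace m k) :
    foldKer Γ (fun T => f T + g T) w w' = foldKer Γ f w w' + foldKer Γ g w w' := by
  rw [foldKer_eq _ hw hw', foldKer_eq _ hw hw', foldKer_eq _ hw hw']
  exact (hΓ.summable_norm_fold hf hw hw').of_norm.tsum_add (hΓ.summable_norm_fold hg hw hw').of_norm

omit hΓ in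
lemma foldKer_const_mul (c : ℂ) (f : ℝ → ℂ) {w w' : Pt m k}
    (hw : w ∈ halfSpace m k) (hw' : w' ∈ halfSpace m k) :
    foldKer Γ (fun T => c * f T) w w' = c * foldKer Γ f w w' := by
  rw [foldKer_eq _ hw hw', foldKer_eq _ hw hw']
  exact tsum_mul_left

lemma foldOp_add {f g : ℝ → ℂ} {C D : ℝ≥0} (hf : SchurFun m k a C f) (hg : SchurFun m k a D g) :
    foldOp Γ F (fun T => f T + g T) = foldOp Γ F f + foldOp Γ F g :=
  (hΓ.foldOp_spec (hf.add hg)).ext <| ((hΓ.foldOp_spec hf).add (hΓ.foldOp_spec hg)).congr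
    hΓ.measurableSet fun _ hw _ hw' =>
      (hΓ.foldKer_add hf.toTame hg.toTame (hΓ.subset hw) (hΓ.subset hw')).symm

lemma foldOp_const_mul {f : ℝ → ℂ} {C : ℝ≥0} (hf : SchurFun m k a C f) (c : ℂ) :
    foldOp Γ F (fun T => c * f T) = c • foldOp Γ F f :=
  (hΓ.foldOp_spec (hf.const_mul c)).ext <| ((hΓ.foldOp_spec hf).smul c).congr
    hΓ.measurableSet fun _ hw _ hw' =>
      (foldKer_const_mul c f (hΓ.subset hw) (hΓ.subset hw')).symm

lemma norm_foldOp_sub_le {f g : ℝ → ℂ} {D E : ℝ≥0}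
    (hg : SchurFun m k a D g) (h : SchurFun m k a E fun T => f T - g T) :
    ‖foldOp Γ F f - foldOp Γ F g‖ ≤ E := by
  have h1 := hΓ.foldOp_add h hg
  simp only [sub_add_cancel] at h1
  rw [h1, add_sub_cancel_right]
  exact hΓ.norm_foldOp h

end CuspLike

/-! ### Test functions -/

namespace CuspLike

variable {Γ : Subgroup (Equiv.Perm (Pt m k))} {F : Set (Pt m k)} {a : ℝ} (hΓ : CuspLike Γ F a)
include hΓ

lemma dist_apply {γ : Equiv.Perm (Pt m k)} (hγ : γ ∈ Γ) (w w' : Pt m k) :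
    dist (γ w) (γ w') = dist w w' := by
  obtain ⟨L, t, rfl⟩ := hΓ.isom γ hγ
  simp [cuspIsometry_apply, Prod.dist_eq]

lemma hypLaplacian_apply {γ : Equiv.Perm (Pt m k)} (hγ : γ ∈ Γ) {f : Pt m k → ℂ}
    (hf : ContDiffOn ℝ ∞ f (halfSpace m k)) {w : Pt m k} (hw : w ∈ halfSpace m k) :
    hypLaplacian (fun u => f (γ u)) w = hypLaplacian f (γ w) := by
  obtain ⟨L, t, rfl⟩ := hΓ.isom γ hγ
  exact hypLaplacian_comp_cuspIsometry L t hf hw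

lemma isTestFunction_hypLaplacian {φ : Pt m k → ℂ} (hφ : IsTestFunction Γ φ) :
    IsTestFunction Γ (hypLaplacian φ) := by
  obtain ⟨h1, h2, K, hKH, hK, h3⟩ := hφ
  refine ⟨contDiffOn_hypLaplacian h1, fun γ hγ w hw => ?_, ?_⟩
  · rw [← hΓ.hypLaplacian_apply hγ h1 hw]
    refine hypLaplacian_congr ?_
    filter_upwards [isOpen_halfSpace.mem_nhds hw] with u hu using h2 γ hγ u hu
  · obtain ⟨ε, hε, hεH⟩ := hK.exists_cthickening_subset_open isOpen_halfSpace hKH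
    refine ⟨Metric.cthickening ε K, hεH, hK.cthickening, fun w hw hne => ?_⟩
    by_contra! hcon
    refine hne (hypLaplacian_eq_zero ?_)
    filter_upwards [isOpen_halfSpace.mem_nhds hw, Metric.ball_mem_nhds w hε] with u hu hd
    by_contra hφu
    obtain ⟨γ, hγ, hγK⟩ := h3 u hu hφu
    refine hcon γ hγ (Metric.mem_cthickening_of_dist_le (γ w) (γ u) ε K hγK ?_)
    rw [hΓ.dist_apply hγ, dist_comm]
    exact hd.le

lemma exists_bound {φ : Pt m k → ℂ} (hφ : IsTestFunction Γ φ) :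
    ∃ B > 0, ∀ w ∈ halfSpace m k, ‖φ w‖ ≤ B * w.1 ^ (((m + k : ℕ) : ℝ) / 2) := by
  obtain ⟨h1, h2, K, hKH, hK, h3⟩ := hφ
  have hc : ContinuousOn (fun w : Pt m k => ‖φ w‖ / w.1 ^ (((m + k : ℕ) : ℝ) / 2)) K := by
    refine (h1.continuousOn.mono hKH).norm.div ?_ fun w hw => ?_
    · exact continuous_fst.continuousOn.rpow_const fun w hw => Or.inl (ne_of_gt (hKH hw))
    · exact (Real.rpow_pos_of_pos (hKH hw) _).ne'
  obtain ⟨B, hB⟩ := hK.exists_bound_of_continuousOn hc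
  refine ⟨max B 1, by positivity, fun w hw => ?_⟩
  have hx : 0 < w.1 := hw
  by_cases h0 : φ w = 0
  · rw [h0, norm_zero]; positivity
  obtain ⟨γ, hγ, hγK⟩ := h3 w hw h0
  have := (le_abs_self _).trans (hB _ hγK)
  rw [h2 γ hγ w hw, hΓ.apply_fst hγ, div_le_iff₀ (by positivity)] at this
  exact this.trans (by gcongr; exact le_max_left _ _)

omit hΓ in
lemma exists_bound_const {φ : Pt m k → ℂ} (hφ : IsTestFunction Γ φ) :
    ∃ B > 0, ∀ w ∈ halfSpace m k, ‖φ w‖ ≤ B := by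
  obtain ⟨h1, h2, K, hKH, hK, h3⟩ := hφ
  obtain ⟨B, hB⟩ := hK.exists_bound_of_continuousOn (h1.continuousOn.mono hKH)
  refine ⟨max B 1, by positivity, fun w hw => ?_⟩
  by_cases h0 : φ w = 0
  · rw [h0, norm_zero]; positivity
  obtain ⟨γ, hγ, hγK⟩ := h3 w hw h0
  rw [← h2 γ hγ w hw]
  exact (hB _ hγK).trans (le_max_left _ _)

omit hΓ in
lemma aestronglyMeasurable {φ : Pt m k → ℂ} (hφ : ContinuousOn φ (halfSpace m k)) :
    AEStronglyMeasurable φ (quotVolume F) := by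
  have := hφ.aestronglyMeasurable (μ := hypVolume m k) measurableSet_halfSpace
  rw [Measure.restrict_eq_self_of_ae_mem ae_hypVolume_mem] at this
  exact this.restrict

lemma memLp_testFunction {φ : Pt m k → ℂ} (hφ : IsTestFunction Γ φ) :
    MemLp φ 2 (quotVolume F) := by
  classical
  obtain ⟨B, hB0, hB⟩ := exists_bound_const hφ
  obtain ⟨h1, h2, K, hKH, hK, h3⟩ := hφ
  refine ⟨aestronglyMeasurable h1.continuousOn, ?_⟩
  rw [eLpNorm_lt_top_iff_lintegral_rpow_enorm_lt_top (by norm_num) (by norm_num)]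
  have hm : Measurable (K.indicator fun _ => ENNReal.ofReal B ^ (2 : ℝ)) :=
    measurable_const.indicator hK.measurableSet
  refine lt_of_le_of_lt (lintegral_mono_ae ?_) (lt_of_eq_of_lt (hΓ.lintegral_fold hm) ?_)
  · filter_upwards [hΓ.ae_mem] with w hw
    have hwH := hΓ.subset hw
    by_cases h0 : φ w = 0
    · simp [h0]
    obtain ⟨γ, hγ, hγK⟩ := h3 w hwH h0
    refine le_trans ?_ (ENNReal.le_tsum (⟨γ, hγ⟩ : Γ))
    rw [indicator_of_mem hγK]
    simp only [ENNReal.toReal_ofNat]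
    gcongr
    rw [← ofReal_norm]
    exact ENNReal.ofReal_le_ofReal (hB w hwH)
  · rw [lintegral_indicator_const hK.measurableSet]
    exact ENNReal.mul_lt_top (by simp) (hypVolume_lt_top hK hKH)

/-- A folded operator acts on test functions by integration over `ℍⁿ⁺¹`. -/
lemma integrable_twoCosh_mul {f : ℝ → ℂ} {C : ℝ≥0} (hf : SchurFun m k a C f) {φ : Pt m k → ℂ}
    (hφ : IsTestFunction Γ φ) {w : Pt m k} (hw : w ∈ halfSpace m k) :
    Integrable (fun w' => f (twoCosh w w') * φ w') (hypVolume m k) := by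
  obtain ⟨B, hB0, hB⟩ := hΓ.exists_bound hφ
  have hm : Measurable fun w' => f (twoCosh w w') :=
    hf.measurable.comp (measurable_twoCosh.comp (measurable_const.prodMk measurable_id))
  refine ⟨hm.aestronglyMeasurable.mul ?_, ?_⟩
  · have := hφ.1.continuousOn.aestronglyMeasurable (μ := hypVolume m k) measurableSet_halfSpace
    rwa [Measure.restrict_eq_self_of_ae_mem ae_hypVolume_mem] at this
  · rw [hasFiniteIntegral_iff_enorm]
    refine lt_of_le_of_lt (b := ∫⁻ w', ENNReal.ofReal B *
      (‖f (twoCosh w w')‖ₑ * schurWeight m k w') ∂(hypVolume m k)) (lintegral_mono_ae ?_) ?_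
    · filter_upwards [ae_hypVolume_mem] with w' hw'
      rw [enorm_mul, mul_left_comm]
      gcongr
      rw [← ofReal_norm, schurWeight, ← ENNReal.ofReal_mul hB0.le]
      exact ENNReal.ofReal_le_ofReal (hB w' hw')
    · rw [lintegral_const_mul' _ _ ENNReal.ofReal_ne_top]
      refine ENNReal.mul_lt_top ENNReal.ofReal_lt_top ((hf.schur w hw).trans_lt ?_)
      exact ENNReal.mul_lt_top (by simp) (schurWeight_ne hw).2.lt_top

lemma foldOp_testFunction {f : ℝ → ℂ} {C : ℝ≥0} (hf : SchurFun m k a C f) {φ : Pt m k → ℂ}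
    (hφ : IsTestFunction Γ φ) {u : L2 F} (hu : u =ᵐ[quotVolume F] φ) :
    foldOp Γ F f u =ᵐ[quotVolume F] fun w => ∫ w', f (twoCosh w w') * φ w' ∂(hypVolume m k) := by
  filter_upwards [hΓ.foldOp_spec hf u, hΓ.ae_mem] with w h1 hw
  rw [h1.2, ← hΓ.integral_foldKer hφ.2.1 (hΓ.subset hw)
    (hΓ.integrable_twoCosh_mul hf hφ (hΓ.subset hw))]
  refine integral_congr_ae ?_
  filter_upwards [hu] with w' h
  rw [h]

/-- Convolving a test function with a compactly supported smooth point-pair invariant gives a test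
function. -/
lemma isTestFunction_conv {f : ℝ → ℂ} (hf : ContDiffOn ℝ ∞ f (Ioi 0)) {R : ℝ}
    (hR : ∀ T ≥ R, f T = 0) {φ : Pt m k → ℂ} (hφ : IsTestFunction Γ φ) :
    IsTestFunction Γ fun w => ∫ w', f (twoCosh w w') * φ w' ∂(hypVolume m k) := by
  have hP := paramKer_twoCosh hf hR hφ.1
  obtain ⟨h1, h2, K, hKH, hK, h3⟩ := hφ
  refine ⟨hP.contDiffOn, fun γ hγ w hw => ?_, ?_⟩
  · have hmp : MeasurePreserving γ (hypVolume m k) (hypVolume m k) := by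
      obtain ⟨L, t, rfl⟩ := hΓ.isom γ hγ
      exact measurePreserving_cuspIsometry L t
    have hemb : MeasurableEmbedding γ := by
      have c1 := hΓ.continuous_apply ⟨γ, hγ⟩
      have c2 := hΓ.continuous_apply ⟨γ⁻¹, Γ.inv_mem hγ⟩
      exact (Homeomorph.mk γ c1 c2).measurableEmbedding
    beta_reduce
    rw [← hmp.integral_comp hemb]
    refine integral_congr_ae ?_
    filter_upwards [ae_hypVolume_mem] with w' hw'
    rw [hΓ.twoCosh_apply hγ, h2 γ hγ w' hw']
  · obtain ⟨c, hc, B, hB, hKs⟩ := exists_slab hK hKH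
    by_cases hR2 : R ≤ 0
    · refine ⟨∅, empty_subset _, isCompact_empty, fun w hw hne => (hne ?_).elim⟩
      refine integral_eq_zero_of_ae ?_
      filter_upwards [ae_hypVolume_mem] with w' hw'
      rw [hR _ (by linarith [two_le_twoCosh hw hw']), zero_mul]; rfl
    refine ⟨slab m k (c / R) (B + R * B), slab_subset (by push Not at hR2; positivity),
      isCompact_slab _ _, fun w hw hne => ?_⟩
    by_contra! hcon
    refine hne (integral_eq_zero_of_ae ?_)
    filter_upwards [ae_hypVolume_mem] with w' hw'
    by_contra hne'
    have hφ' : φ w' ≠ 0 := fun h => hne' (by simp [h])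
    have hT : twoCosh w w' < R := by
      by_contra! h
      exact hne' (by simp [hR _ h])
    obtain ⟨γ, hγ, hγK⟩ := h3 w' hw' hφ'
    refine hcon γ hγ (mem_slab_of_twoCosh_le hc ((hΓ.apply_mem hγ).mpr hw) (hKs hγK) ?_)
    rw [hΓ.twoCosh_apply hγ]
    exact hT.le

end CuspLike

end

end ModelCusp

namespace ModelCusp

section

open Filter Topology MeasureTheory Set

open scoped NNReal

variable {m k : ℕ}

/-! ### Truncated powers of the distance function -/

/-- A smooth function that is `1` on `(-∞, 1]` and `0` on `[2, ∞)`. -/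
noncomputable def bump (u : ℝ) : ℝ := Real.smoothTransition (2 - u)

lemma contDiff_bump : ContDiff ℝ ∞ bump :=
  Real.smoothTransition.contDiff.comp (contDiff_const.sub contDiff_id)

lemma bump_eq_one {u : ℝ} (hu : u ≤ 1) : bump u = 1 :=
  Real.smoothTransition.one_of_one_le (by linarith)

lemma bump_eq_zero {u : ℝ} (hu : 2 ≤ u) : bump u = 0 :=
  Real.smoothTransition.zero_of_nonpos (by linarith)

lemma contDiff_deriv_bump : ContDiff ℝ ∞ (deriv bump) :=
  (contDiff_infty_iff_deriv.mp contDiff_bump).2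

lemma contDiff_deriv_deriv_bump : ContDiff ℝ ∞ (deriv (deriv bump)) :=
  (contDiff_infty_iff_deriv.mp contDiff_deriv_bump).2

lemma deriv_bump_eq_zero {u : ℝ} (hu : u < 1 ∨ 2 < u) :
    deriv bump u = 0 ∧ deriv (deriv bump) u = 0 := by
  have h : ∃ c, bump =ᶠ[𝓝 u] fun _ => c := by
    rcases hu with h | h
    · exact ⟨1, by filter_upwards [gt_mem_nhds h] with v hv using bump_eq_one hv.le⟩
    · exact ⟨0, by filter_upwards [lt_mem_nhds h] with v hv using bump_eq_zero hv.le⟩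
  obtain ⟨c, hc⟩ := h
  have h1 : deriv bump =ᶠ[𝓝 u] fun _ => 0 := by
    have := hc.deriv
    rwa [deriv_const'] at this
  refine ⟨h1.self_of_nhds, ?_⟩
  rw [h1.deriv_eq, deriv_const]

lemma exists_bump_bound : ∃ C ≥ 1, ∀ u > 0, |bump u| ≤ C ∧ |u * deriv bump u| ≤ C ∧
    |u ^ 2 * deriv (deriv bump) u| ≤ C := by
  have c1 : Continuous fun u : ℝ => u * deriv bump u :=
    continuous_id.mul contDiff_deriv_bump.continuous
  have c2 : Continuous fun u : ℝ => u ^ 2 * deriv (deriv bump) u :=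
    (continuous_id.pow 2).mul contDiff_deriv_deriv_bump.continuous
  obtain ⟨C1, h1⟩ := (isCompact_Icc (a := (0 : ℝ)) (b := 2)).exists_bound_of_continuousOn c1.continuousOn
  obtain ⟨C2, h2⟩ := (isCompact_Icc (a := (0 : ℝ)) (b := 2)).exists_bound_of_continuousOn c2.continuousOn
  refine ⟨max 1 (max C1 C2), le_max_left _ _, fun u hu => ⟨?_, ?_, ?_⟩⟩
  · rw [bump, abs_of_nonneg (Real.smoothTransition.nonneg _)]
    exact (Real.smoothTransition.le_one _).trans (le_max_left _ _)
  · by_cases h : u ≤ 2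
    · exact (h1 u ⟨hu.le, h⟩).trans ((le_max_left _ _).trans (le_max_right _ _))
    · rw [(deriv_bump_eq_zero (Or.inr (not_le.mp h))).1]; simp
  · by_cases h : u ≤ 2
    · exact (h2 u ⟨hu.le, h⟩).trans ((le_max_right _ _).trans (le_max_right _ _))
    · rw [(deriv_bump_eq_zero (Or.inr (not_le.mp h))).2]; simp

/-- The power `T^{-p}`. -/
noncomputable def powKer (p : ℂ) (T : ℝ) : ℂ := (T : ℂ) ^ (-p)

/-- The Laplacian of `T^{-p}`, where `T = 2 cosh d`. -/
noncomputable def powLap (n : ℕ) (p : ℂ) (T : ℝ) : ℂ :=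
  p * (n - p) * powKer p T + 4 * p * (p + 1) * powKer (p + 2) T

/-- The power `T^{-p}`, cut off at `T ≈ R`. -/
noncomputable def cutKer (p : ℂ) (R T : ℝ) : ℂ := powKer p T * (bump (T / R) : ℂ)

/-- The Laplacian of `cutKer`. -/
noncomputable def cutLap (n : ℕ) (p : ℂ) (R T : ℝ) : ℂ :=
  powKer p T *
    ((-(p * (p + 1) * (bump (T / R) : ℂ) - 2 * p * ((T / R * deriv bump (T / R) : ℝ) : ℂ) +
        (((T / R) ^ 2 * deriv (deriv bump) (T / R) : ℝ) : ℂ)) -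
      (n + 1) * (-p * (bump (T / R) : ℂ) + ((T / R * deriv bump (T / R) : ℝ) : ℂ))) +
    4 * (p * (p + 1) * (bump (T / R) : ℂ) - 2 * p * ((T / R * deriv bump (T / R) : ℝ) : ℂ) +
        (((T / R) ^ 2 * deriv (deriv bump) (T / R) : ℝ) : ℂ)) / (T : ℂ) ^ 2)

lemma powKer_add {T : ℝ} (hT : 0 < T) (p q : ℂ) : powKer (p + q) T = powKer p T * powKer q T := by
  unfold powKer
  rw [neg_add, Complex.cpow_add _ _ (by exact_mod_cast hT.ne')]

lemma powKer_one {T : ℝ} : powKer 1 T = (T : ℂ)⁻¹ := by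
  rw [powKer, Complex.cpow_neg_one]

lemma powKer_two {T : ℝ} : powKer 2 T = ((T : ℂ) ^ 2)⁻¹ := by
  unfold powKer
  rw [Complex.cpow_neg]
  norm_cast

lemma norm_powKer {T : ℝ} (hT : 0 < T) (p : ℂ) : ‖powKer p T‖ = T ^ (-p.re) := by
  rw [powKer, Complex.norm_cpow_eq_rpow_re_of_pos hT, Complex.neg_re]

lemma measurable_powKer (p : ℂ) : Measurable (powKer p) := by
  unfold powKer; fun_prop

lemma hasDerivAt_powKer (p : ℂ) {T : ℝ} (hT : 0 < T) :
    HasDerivAt (powKer p) (-p * powKer (p + 1) T) T := by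
  have h := ((hasDerivAt_id (T : ℂ)).cpow_const (c := -p) (Or.inl (by simpa using hT))).comp_ofReal
  refine h.congr_deriv ?_
  simp only [id, powKer, mul_one]
  congr 2; ring

lemma contDiffOn_powKer (p : ℂ) : ContDiffOn ℝ ∞ (powKer p) (Ioi 0) := by
  have key : ∀ N : ℕ, ∀ p, ContDiffOn ℝ N (powKer p) (Ioi 0) := by
    intro N
    induction N with
    | zero =>
      exact fun p => contDiffOn_zero.mpr fun T hT => (hasDerivAt_powKer p hT).continuousAt.continuousWithinAt
    | succ N ih =>
      intro p
      push_cast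
      rw [contDiffOn_succ_iff_deriv_of_isOpen isOpen_Ioi]
      refine ⟨fun T hT => (hasDerivAt_powKer p hT).differentiableAt.differentiableWithinAt, by simp, ?_⟩
      exact (contDiffOn_const.mul (ih (p + 1))).congr fun T hT => (hasDerivAt_powKer p hT).deriv
  exact contDiffOn_infty.mpr fun N => key N p

lemma contDiffOn_cutKer (p : ℂ) (R : ℝ) : ContDiffOn ℝ ∞ (cutKer p R) (Ioi 0) :=
  (contDiffOn_powKer p).mul (Complex.ofRealCLM.contDiff.comp
    (contDiff_bump.comp (contDiff_id.div_const R))).contDiffOn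

lemma cutKer_eq_zero (p : ℂ) {R T : ℝ} (hR : 0 < R) (hT : 2 * R ≤ T) : cutKer p R T = 0 := by
  rw [cutKer, bump_eq_zero (by rw [le_div_iff₀ hR]; exact hT)]; simp

lemma hypLaplacian_cutKer (p : ℂ) {R : ℝ} (hR : 0 < R) {w w' : Pt m k} (hw : w ∈ halfSpace m k)
    (hw' : w' ∈ halfSpace m k) :
    hypLaplacian (fun u => cutKer p R (twoCosh u w')) w = cutLap (m + k) p R (twoCosh w w') := by
  have hb : ∀ T, HasDerivAt (fun T : ℝ => (bump (T / R) : ℂ)) ((deriv bump (T / R) / R : ℝ) : ℂ) T :=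
    fun T => by
    have h1 : HasDerivAt bump (deriv bump (T / R)) (T / R) :=
      (contDiff_bump.differentiable (by simp) _).hasDerivAt
    have := (h1.comp T ((hasDerivAt_id T).div_const R)).ofReal_comp
    simpa [div_eq_mul_inv] using this
  have hb' : ∀ T, HasDerivAt (fun T : ℝ => ((deriv bump (T / R) / R : ℝ) : ℂ))
      ((deriv (deriv bump) (T / R) / R / R : ℝ) : ℂ) T :=
    fun T => by
    have h1 : HasDerivAt (deriv bump) (deriv (deriv bump) (T / R)) (T / R) :=
      (contDiff_deriv_bump.differentiable (by simp) _).hasDerivAt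
    have := ((h1.comp T ((hasDerivAt_id T).div_const R)).div_const R).ofReal_comp
    simpa [div_eq_mul_inv] using this
  rw [hypLaplacian_twoCosh (f := cutKer p R)
    (f₁ := fun T => -p * powKer (p + 1) T * (bump (T / R) : ℂ) +
      powKer p T * ((deriv bump (T / R) / R : ℝ) : ℂ))
    (f₂ := fun T => (-p * (-(p + 1) * powKer (p + 1 + 1) T) * (bump (T / R) : ℂ) +
      -p * powKer (p + 1) T * ((deriv bump (T / R) / R : ℝ) : ℂ)) +
      (-p * powKer (p + 1) T * ((deriv bump (T / R) / R : ℝ) : ℂ) +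
        powKer p T * ((deriv (deriv bump) (T / R) / R / R : ℝ) : ℂ)))
    (fun T hT => (hasDerivAt_powKer p hT).mul (hb T))
    (fun T hT => (((hasDerivAt_powKer (p + 1) hT).const_mul (-p)).mul (hb T)).add
      ((hasDerivAt_powKer p hT).mul (hb' T))) hw hw']
  have hT : 0 < twoCosh w w' := by linarith [two_le_twoCosh hw hw']
  set T := twoCosh w w'
  have hTc : (T : ℂ) ≠ 0 := by exact_mod_cast hT.ne'
  have hRc : (R : ℂ) ≠ 0 := by exact_mod_cast hR.ne'
  simp only [powKer_add hT, powKer_one, cutLap]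
  push_cast
  field_simp
  ring

lemma cutKer_of_lt (p : ℂ) {R T : ℝ} (hR : 0 < R) (hT : T < R) : cutKer p R T = powKer p T := by
  rw [cutKer, bump_eq_one (by rw [div_le_one hR]; exact hT.le)]; simp

lemma cutLap_of_lt (n : ℕ) (p : ℂ) {R T : ℝ} (hR : 0 < R) (hT0 : 0 < T) (hT : T < R) :
    cutLap n p R T = powLap n p T := by
  have h1 : T / R < 1 := by rw [div_lt_one hR]; exact hT
  obtain ⟨e1, e2⟩ := deriv_bump_eq_zero (Or.inl h1)
  rw [cutLap, bump_eq_one h1.le, e1, e2, powLap, powKer_add hT0, powKer_two]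
  push_cast
  field_simp
  ring

lemma measurable_bump : Measurable bump := contDiff_bump.continuous.measurable

lemma measurable_cutKer (p : ℂ) (R : ℝ) : Measurable (cutKer p R) := by
  have := measurable_powKer p
  have := measurable_bump
  unfold cutKer; fun_prop

lemma measurable_cutLap (n : ℕ) (p : ℂ) (R : ℝ) : Measurable (cutLap n p R) := by
  have := measurable_powKer p
  have := measurable_bump
  have := contDiff_deriv_bump.continuous.measurable
  have := contDiff_deriv_deriv_bump.continuous.measurable
  unfold cutLap; fun_prop

lemma measurable_powLap (n : ℕ) (p : ℂ) : Measurable (powLap n p) := by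
  have h1 := measurable_powKer p
  have h2 := measurable_powKer (p + 2)
  unfold powLap; fun_prop

/-- The cut-off powers and their Laplacians decay as the powers do, uniformly in the cut-off radius. -/
lemma exists_cut_bound (n : ℕ) (p : ℂ) : ∃ C > 0, ∀ R > 0, ∀ T ≥ 2,
    ‖powKer p T‖ ≤ C * T ^ (-p.re) ∧ ‖cutKer p R T‖ ≤ C * T ^ (-p.re) ∧
    ‖cutLap n p R T‖ ≤ C * T ^ (-p.re) ∧ ‖powLap n p T‖ ≤ C * T ^ (-p.re) := by
  obtain ⟨B, hB1, hB⟩ := exists_bump_bound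
  set P := ‖p‖ with hP
  have hP0 : 0 ≤ P := norm_nonneg _
  set A := P * (P + 1) * B + 2 * P * B + B with hA
  have hA0 : 0 ≤ A := by positivity
  refine ⟨A + (n + 1) * (P * B + B) + 4 * A + P * (n + P) + 4 * P * (P + 1) + B, by positivity,
    fun R hR T hT => ?_⟩
  have hT0 : 0 < T := by linarith
  obtain ⟨b0, b1, b2⟩ := hB (T / R) (by positivity)
  have nk := norm_powKer hT0 p
  have nk2 : ‖powKer (p + 2) T‖ ≤ T ^ (-p.re) := by
    rw [norm_powKer hT0]
    exact Real.rpow_le_rpow_of_exponent_le (by linarith) (by simp)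
  have hpos : 0 ≤ T ^ (-p.re) := by positivity
  have hp1 : ‖p + 1‖ ≤ P + 1 := (norm_add_le _ _).trans (by simp [hP])
  have n0 : ‖(bump (T / R) : ℂ)‖ ≤ B := by rw [Complex.norm_real]; exact b0
  have n1 : ‖((T / R * deriv bump (T / R) : ℝ) : ℂ)‖ ≤ B := by rw [Complex.norm_real]; exact b1
  have n2 : ‖(((T / R) ^ 2 * deriv (deriv bump) (T / R) : ℝ) : ℂ)‖ ≤ B := by
    rw [Complex.norm_real]; exact b2
  have nA : ‖p * (p + 1) * (bump (T / R) : ℂ) - 2 * p * ((T / R * deriv bump (T / R) : ℝ) : ℂ) +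
        (((T / R) ^ 2 * deriv (deriv bump) (T / R) : ℝ) : ℂ)‖ ≤ A := by
    refine (norm_add_le _ _).trans (add_le_add ((norm_sub_le _ _).trans (add_le_add ?_ ?_)) n2)
    · rw [norm_mul, norm_mul]; gcongr
    · rw [norm_mul, norm_mul, Complex.norm_ofNat]; gcongr
  have hn : ‖((n : ℂ) + 1)‖ = n + 1 := by
    have : ((n : ℂ) + 1) = ((n + 1 : ℝ) : ℂ) := by push_cast; rfl
    rw [this, Complex.norm_of_nonneg (by positivity)]
  have hn' : ‖(n : ℂ) - p‖ ≤ n + P := (norm_sub_le _ _).trans (by simp [hP])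
  refine ⟨?_, ?_, ?_, ?_⟩
  · rw [nk]
    refine le_mul_of_one_le_left hpos ?_
    have : 0 ≤ (n + 1) * (P * B + B) + P * (n + P) + 4 * P * (P + 1) := by positivity
    linarith
  · rw [cutKer, norm_mul, nk, mul_comm]
    refine mul_le_mul_of_nonneg_right (n0.trans ?_) hpos
    have : 0 ≤ (n + 1) * (P * B + B) + P * (n + P) + 4 * P * (P + 1) := by positivity
    linarith
  · rw [cutLap, norm_mul, nk, mul_comm]
    refine mul_le_mul_of_nonneg_right ?_ hpos
    have e1 : ‖((n : ℂ) + 1) * (-p * (bump (T / R) : ℂ) + ((T / R * deriv bump (T / R) : ℝ) : ℂ))‖ ≤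
        (n + 1) * (P * B + B) := by
      rw [norm_mul, hn]
      gcongr
      refine (norm_add_le _ _).trans (add_le_add ?_ n1)
      rw [norm_mul, norm_neg]; gcongr
    have e2 : ‖4 * (p * (p + 1) * (bump (T / R) : ℂ) - 2 * p * ((T / R * deriv bump (T / R) : ℝ) : ℂ) +
        (((T / R) ^ 2 * deriv (deriv bump) (T / R) : ℝ) : ℂ)) / (T : ℂ) ^ 2‖ ≤ 4 * A := by
      rw [norm_div, norm_mul, norm_pow, Complex.norm_of_nonneg hT0.le]
      refine (div_le_self (by positivity) (one_le_pow₀ (by linarith))).trans ?_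
      rw [Complex.norm_ofNat]; gcongr
    refine (norm_add_le _ _).trans ((add_le_add ((norm_sub_le _ _).trans
      (add_le_add ((norm_neg _).trans_le nA) e1)) e2).trans ?_)
    have : 0 ≤ P * (n + P) + 4 * P * (P + 1) := by positivity
    linarith
  · have e1 : ‖p * (n - p) * powKer p T‖ ≤ P * (n + P) * T ^ (-p.re) := by
      rw [norm_mul, norm_mul, nk]; gcongr
    have e2 : ‖4 * p * (p + 1) * powKer (p + 2) T‖ ≤ 4 * P * (P + 1) * T ^ (-p.re) := by
      rw [norm_mul, norm_mul, norm_mul]; norm_num; gcongr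
    refine (norm_add_le _ _).trans ((add_le_add e1 e2).trans ?_)
    rw [← add_mul]
    refine mul_le_mul_of_nonneg_right ?_ hpos
    have : 0 ≤ (n + 1) * (P * B + B) := by positivity
    linarith

lemma rpow_tail {T R q η : ℝ} (hR : 0 < R) (hT : R ≤ T) (hη : 0 ≤ η) :
    T ^ (-(q + η)) ≤ R ^ (-η) * T ^ (-q) := by
  have hT0 : 0 < T := by linarith
  rw [neg_add, add_comm, Real.rpow_add hT0]
  gcongr ?_ * _
  exact Real.rpow_le_rpow_of_nonpos hR hT (by linarith)

namespace CuspLike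

variable {Γ : Subgroup (Equiv.Perm (Pt m k))} {F : Set (Pt m k)} {a : ℝ} (hΓ : CuspLike Γ F a)
include hΓ

lemma schurFun_of_re {f : ℝ → ℂ} (hf : Measurable f) {q C : ℝ}
    (hq : ((m + k : ℕ) : ℝ) / 2 < q) (hC : 0 ≤ C) (h : ∀ T ≥ 2, ‖f T‖ ≤ C * T ^ (-q)) :
    SchurFun m k a (C.toNNReal * (schurR (m + k) q).toNNReal) f :=
  SchurFun.of_le hΓ.le_half hf hq hC h

/-- Truncated kernels converge in operator norm. -/
lemma tendsto_foldOp_truncation {p : ℂ} (hp : ((m + k : ℕ) : ℝ) / 2 < p.re) {f : ℝ → ℂ}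
    {g : ℝ → ℝ → ℂ} (hf : Measurable f) (hg : ∀ R, Measurable (g R)) {C : ℝ} (hC : 0 < C)
    (h1 : ∀ T ≥ 2, ‖f T‖ ≤ C * T ^ (-p.re))
    (h2 : ∀ R > 0, ∀ T ≥ 2, ‖g R T‖ ≤ C * T ^ (-p.re))
    (h3 : ∀ R > 0, ∀ T ≥ 2, T < R → g R T = f T) :
    Tendsto (fun J : ℕ => foldOp Γ F (g (J + 1))) atTop (𝓝 (foldOp Γ F f)) := by
  set η := (p.re - ((m + k : ℕ) : ℝ) / 2) / 2 with hη
  have hη0 : 0 < η := by rw [hη]; linarith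
  set q := p.re - η with hq
  have hq0 : ((m + k : ℕ) : ℝ) / 2 < q := by rw [hq, hη]; linarith
  rw [tendsto_iff_norm_sub_tendsto_zero]
  have bound : ∀ J : ℕ, ‖foldOp Γ F (g (J + 1)) - foldOp Γ F f‖ ≤
      2 * C * ((J : ℝ) + 1) ^ (-η) * max (schurR (m + k) q) 0 := fun J => by
    have hR : (0 : ℝ) < (J : ℝ) + 1 := by positivity
    have hd : SchurFun m k a ((2 * C * ((J : ℝ) + 1) ^ (-η)).toNNReal * (schurR (m + k) q).toNNReal)
        fun T => g (J + 1) T - f T := by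
      refine hΓ.schurFun_of_re (f := fun T => g (J + 1) T - f T) ((hg _).sub hf) hq0 (by positivity) fun T hT => ?_
      have hT0 : 0 < T := by linarith
      by_cases hTR : T < (J : ℝ) + 1
      · rw [h3 _ hR T hT hTR, sub_self, norm_zero]; positivity
      · refine (norm_sub_le _ _).trans ((add_le_add (h2 _ hR T hT) (h1 T hT)).trans ?_)
        have := rpow_tail (q := q) hR (not_lt.mp hTR) hη0.le
        rw [show q + η = p.re by rw [hq]; ring] at this
        calc _ = 2 * C * T ^ (-p.re) := by ring
          _ ≤ 2 * C * (((J : ℝ) + 1) ^ (-η) * T ^ (-q)) := by gcongr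
          _ = _ := by ring
    have := hΓ.norm_foldOp_sub_le (hΓ.schurFun_of_re hf hp hC.le h1) hd
    refine this.trans_eq ?_
    rw [NNReal.coe_mul, Real.coe_toNNReal _ (by positivity)]
    rfl
  refine squeeze_zero (fun _ => norm_nonneg _) bound ?_
  have h0 : Tendsto (fun J : ℕ => ((J : ℝ) + 1) ^ (-η)) atTop (𝓝 0) :=
    (tendsto_rpow_neg_atTop hη0).comp (tendsto_atTop_add_const_right _ _ tendsto_natCast_atTop_atTop)
  simpa using (h0.const_mul (2 * C)).mul_const (max (schurR (m + k) q) 0)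

/-- The class in `L²(X)` of a test function. -/
noncomputable def toL2 {φ : Pt m k → ℂ} (hφ : IsTestFunction Γ φ) : L2 F :=
  (hΓ.memLp_testFunction hφ).toLp φ

lemma coeFn_toL2 {φ : Pt m k → ℂ} (hφ : IsTestFunction Γ φ) :
    (hΓ.toL2 hφ : Pt m k → ℂ) =ᵐ[quotVolume F] φ := MemLp.coeFn_toLp _

/-- For a compactly supported kernel the Laplacian can be moved out of the integral and, by symmetry,
onto the other factor. -/
lemma conv_cutKer {p : ℂ} {R : ℝ} (hR : 0 < R) {φ : Pt m k → ℂ} (hφ : IsTestFunction Γ φ)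
    {w : Pt m k} (hw : w ∈ halfSpace m k) :
    hypLaplacian (fun w => ∫ w', cutKer p R (twoCosh w w') * φ w' ∂(hypVolume m k)) w =
      ∫ w', cutLap (m + k) p R (twoCosh w w') * φ w' ∂(hypVolume m k) ∧
    ∫ w', cutKer p R (twoCosh w w') * hypLaplacian φ w' ∂(hypVolume m k) =
      ∫ w', cutLap (m + k) p R (twoCosh w w') * φ w' ∂(hypVolume m k) := by
  have hz : ∀ T ≥ 2 * R, cutKer p R T = 0 := fun T hT => cutKer_eq_zero p hR hT
  have hP := paramKer_twoCosh (contDiffOn_cutKer p R) hz hφ.1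
  constructor
  · rw [hP.hypLaplacian_integral hw]
    refine integral_congr_ae ?_
    filter_upwards [ae_hypVolume_mem] with w' hw'
    rw [← hypLaplacian_cutKer p hR hw hw']
    have hs : ContDiffOn ℝ ∞ (fun u => cutKer p R (twoCosh u w')) (halfSpace m k) :=
      (contDiffOn_cutKer p R).comp (contDiffOn_twoCosh.comp
        (contDiff_prodMk_left w').contDiffOn fun u hu => ⟨hu, hw'⟩)
        fun u hu => lt_of_lt_of_le two_pos (two_le_twoCosh hu hw')
    have := hypLaplacian_linear (contDiffOn_const (c := (0 : ℂ))) hs (φ w') hw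
    rw [hypLaplacian_eq_zero (f := fun _ => 0) (by rfl)] at this
    simp only [zero_add] at this
    rw [mul_comm, ← this]
    simp only [mul_comm]
  · have hs : ContDiffOn ℝ ∞ (fun u => cutKer p R (twoCosh w u)) (halfSpace m k) :=
      (contDiffOn_cutKer p R).comp (contDiffOn_twoCosh.comp
        (contDiff_prodMk_right w).contDiffOn fun u hu => ⟨hw, hu⟩)
        fun u hu => lt_of_lt_of_le two_pos (two_le_twoCosh hw hu)
    have hx : 0 < w.1 := hw
    rw [integral_mul_hypLaplacian hs hφ.1 hΓ.dim_pos (S := slab m k (w.1 / (2 * R)) (‖w‖ + 2 * R * ‖w‖))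
      (isCompact_slab _ _) (slab_subset (by positivity)) fun w' hw' hS => ?_]
    · refine integral_congr_ae ?_
      filter_upwards [ae_hypVolume_mem] with w' hw'
      rw [twoCosh_comm w w', ← hypLaplacian_cutKer p hR hw' hw]
      simp only [twoCosh_comm w]
    · refine hz _ ?_
      by_contra! h
      refine hS (mem_slab_of_twoCosh_le (w' := w) hx hw' ⟨le_rfl, le_rfl⟩ ?_)
      rw [twoCosh_comm]; exact h.le

/-- Powers of the distance function: moving the Laplacian, and regularity. -/
theorem powKer_graph {p : ℂ} (hp : ((m + k : ℕ) : ℝ) / 2 < p.re) {φ : Pt m k → ℂ}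
    (hφ : IsTestFunction Γ φ) :
    foldOp Γ F (powKer p) (hΓ.toL2 (hΓ.isTestFunction_hypLaplacian hφ)) =
      foldOp Γ F (powLap (m + k) p) (hΓ.toL2 hφ) ∧
    (foldOp Γ F (powKer p) (hΓ.toL2 hφ), foldOp Γ F (powLap (m + k) p) (hΓ.toL2 hφ)) ∈
      laplacianGraph Γ F := by
  obtain ⟨C, hC, hb⟩ := exists_cut_bound (m + k) p
  have t1 := hΓ.tendsto_foldOp_truncation hp (g := cutKer p) (measurable_powKer p)
    (measurable_cutKer p) hC (fun T hT => (hb 1 one_pos T hT).1) (fun R hR T hT => (hb R hR T hT).2.1)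
    fun R hR T _ h => cutKer_of_lt p hR h
  have t2 := hΓ.tendsto_foldOp_truncation hp (g := cutLap (m + k) p) (measurable_powLap (m + k) p)
    (measurable_cutLap (m + k) p) hC (fun T hT => (hb 1 one_pos T hT).2.2.2)
    (fun R hR T hT => (hb R hR T hT).2.2.1)
    fun R hR T hT h => cutLap_of_lt (m + k) p hR (by linarith) h
  have ap : ∀ {g : ℕ → L2 F →L[ℂ] L2 F} {g' : L2 F →L[ℂ] L2 F}, Tendsto g atTop (𝓝 g') → ∀ u : L2 F,
      Tendsto (fun J => g J u) atTop (𝓝 (g' u)) := fun h u =>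
    ((ContinuousLinearMap.apply ℂ (L2 F) u).continuous.tendsto _).comp h
  have hR : ∀ J : ℕ, (0 : ℝ) < (J : ℝ) + 1 := fun J => by positivity
  have s1 : ∀ J : ℕ, SchurFun m k a _ (cutKer p (J + 1)) := fun J =>
    hΓ.schurFun_of_re (measurable_cutKer p _) hp hC.le fun T hT => (hb _ (hR J) T hT).2.1
  have s2 : ∀ J : ℕ, SchurFun m k a _ (cutLap (m + k) p (J + 1)) := fun J =>
    hΓ.schurFun_of_re (measurable_cutLap (m + k) p _) hp hC.le fun T hT => (hb _ (hR J) T hT).2.2.1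
  have hΔ := hΓ.isTestFunction_hypLaplacian hφ
  constructor
  · refine tendsto_nhds_unique (ap t1 _) ((ap t2 (hΓ.toL2 hφ)).congr fun J => Lp.ext ?_)
    filter_upwards [hΓ.foldOp_testFunction (s1 J) hΔ (hΓ.coeFn_toL2 hΔ),
      hΓ.foldOp_testFunction (s2 J) hφ (hΓ.coeFn_toL2 hφ), hΓ.ae_mem] with w h1 h2 hw
    rw [h1, h2, (hΓ.conv_cutKer (hR J) hφ (hΓ.subset hw)).2]
  · refine mem_closure_of_tendsto ((ap t1 (hΓ.toL2 hφ)).prodMk_nhds (ap t2 (hΓ.toL2 hφ)))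
      (Eventually.of_forall fun J => ?_)
    have hz : ∀ T ≥ 2 * ((J : ℝ) + 1), cutKer p (J + 1) T = 0 := fun T hT => cutKer_eq_zero p (hR J) hT
    refine ⟨_, hΓ.isTestFunction_conv (contDiffOn_cutKer p _) hz hφ,
      hΓ.foldOp_testFunction (s1 J) hφ (hΓ.coeFn_toL2 hφ), ?_⟩
    filter_upwards [hΓ.foldOp_testFunction (s2 J) hφ (hΓ.coeFn_toL2 hφ), hΓ.ae_mem] with w h1 hw
    rw [h1, (hΓ.conv_cutKer (hR J) hφ (hΓ.subset hw)).1]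

end CuspLike

end

end ModelCusp

namespace ModelCusp

section

open Filter Topology MeasureTheory Set

open scoped NNReal

variable {m k : ℕ}

/-! ### The resolvent kernel as a function of the distance -/

/-- The resolvent kernel of `ℍⁿ⁺¹` as a function of `T = 2 cosh d > 2`. -/
noncomputable def resFun (n : ℕ) (s : ℂ) (T : ℝ) : ℂ :=
  if 2 < T then ∑' j : ℕ, coef n s j * powKer (s + 2 * j) T else 0

/-- Locally uniform geometric bounds for the terms of the series. -/
lemma exists_term_bound {n : ℕ} (hn : 0 < n) {S : Set ℂ} (hS : IsCompact S)
    (hS0 : ∀ s ∈ S, 0 < s.re) {r : ℝ} (hr : 2 < r) :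
    ∃ D : ℕ → ℝ, Summable D ∧ (∀ j, 0 ≤ D j) ∧ ∀ s ∈ S, ∀ T ≥ r, ∀ j,
      ‖coef n s j * powKer (s + 2 * j) T‖ ≤ D j * T ^ (-s.re) := by
  obtain ⟨B, hB0, hB⟩ := exists_coef_bound_geom n hn hS hS0
  refine ⟨fun j => B * (4 ^ j * ((j : ℝ) + 1) ^ n) * (r ^ (2 * j))⁻¹, ?_, fun j => by positivity,
    fun s hs T hT j => ?_⟩
  · have h1 : 4 / r ^ 2 < 1 := by rw [div_lt_one (by positivity)]; nlinarith
    have h2 := summable_pow_mul_geometric_of_norm_lt_one (R := ℝ) n (r := 4 / r ^ 2)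
      (by rw [Real.norm_of_nonneg (by positivity)]; exact h1)
    have h3 := ((summable_nat_add_iff 1).mpr h2).mul_left (B * (r ^ 2 / 4))
    refine h3.congr fun j => ?_
    push_cast
    rw [pow_mul, div_pow, pow_succ (4 : ℝ), pow_succ (r ^ 2)]
    field_simp
  · have hT0 : 0 < T := by linarith
    rw [norm_mul, norm_powKer hT0]
    have e : T ^ (-(s + 2 * (j : ℂ)).re) = (T ^ (2 * j))⁻¹ * T ^ (-s.re) := by
      have : (s + 2 * (j : ℂ)).re = s.re + (2 * j : ℕ) := by simp
      rw [this, neg_add, add_comm, Real.rpow_add hT0, Real.rpow_neg hT0.le, Real.rpow_natCast]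
    rw [e, ← mul_assoc]
    have h0 : (T ^ (2 * j))⁻¹ ≤ (r ^ (2 * j))⁻¹ := by
      apply inv_anti₀ (by positivity)
      gcongr
    exact mul_le_mul_of_nonneg_right (mul_le_mul (hB s hs j) h0 (by positivity) (by positivity))
      (by positivity)

lemma summable_resFun {n : ℕ} (hn : 0 < n) {s : ℂ} (hs : 0 < s.re) {T : ℝ} (hT : 2 < T) :
    Summable fun j : ℕ => ‖coef n s j * powKer (s + 2 * j) T‖ := by
  obtain ⟨D, hD, -, hb⟩ := exists_term_bound hn (S := {s}) isCompact_singleton (by simpa using hs) hT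
  exact (hD.mul_right (T ^ (-s.re))).of_nonneg_of_le (fun _ => norm_nonneg _)
    fun j => hb s rfl T le_rfl j

lemma exists_resFun_bound {n : ℕ} (hn : 0 < n) {S : Set ℂ} (hS : IsCompact S)
    (hS0 : ∀ s ∈ S, 0 < s.re) {r : ℝ} (hr : 2 < r) :
    ∃ C > 0, ∀ s ∈ S, ∀ T ≥ r, ‖resFun n s T‖ ≤ C * T ^ (-s.re) := by
  obtain ⟨D, hD, hD0, hb⟩ := exists_term_bound hn hS hS0 hr
  refine ⟨∑' j, D j + 1, add_pos_of_nonneg_of_pos (tsum_nonneg hD0) one_pos, fun s hs T hT => ?_⟩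
  have hT0 : 0 < T := by linarith
  rw [resFun, if_pos (by linarith)]
  refine (tsum_of_norm_bounded (hD.mul_right (T ^ (-s.re))).hasSum fun j => hb s hs T hT j).trans ?_
  rw [tsum_mul_right]
  gcongr
  linarith

/-- Partial sums of the resolvent kernel. -/
noncomputable def resSum (n : ℕ) (s : ℂ) (J : ℕ) (T : ℝ) : ℂ :=
  ∑ j ∈ Finset.range J, coef n s j * powKer (s + 2 * j) T

lemma measurable_resSum (n : ℕ) (s : ℂ) (J : ℕ) : Measurable (resSum n s J) := by
  unfold resSum
  exact Finset.measurable_fun_sum _ fun j _ => (measurable_powKer _).const_mul _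

lemma measurable_resFun {n : ℕ} (hn : 0 < n) {s : ℂ} (hs : 0 < s.re) : Measurable (resFun n s) := by
  classical
  refine measurable_of_tendsto_metrizable (f := fun J T => if 2 < T then resSum n s J T else 0)
    (fun J => Measurable.ite measurableSet_Ioi (measurable_resSum n s J) measurable_const) ?_
  refine tendsto_pi_nhds.mpr fun T => ?_
  unfold resFun
  split_ifs with h
  · exact (summable_resFun hn hs h).of_norm.hasSum.tendsto_sum_nat
  · exact tendsto_const_nhds

lemma tame_resFun {n : ℕ} (hn : 0 < n) {s : ℂ} (hs : 0 < s.re) {a : ℝ} (ha : a < s.re) :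
    Tame a (resFun n s) where
  measurable := measurable_resFun hn hs
  decay := by
    obtain ⟨C, -, hC⟩ := exists_resFun_bound hn (S := {s}) isCompact_singleton (by simpa using hs)
      (r := 3) (by norm_num)
    exact ⟨s.re, ha, C, fun T hT => hC s rfl T hT⟩

/-! ### Schur bounds for series of powers -/

lemma SchurKer.mono_of_gt {M M' : ℝ → ENNReal} {C : ℝ≥0} (h : SchurKer m k M C)
    (hM : ∀ T > 2, M' T ≤ M T) : SchurKer m k M' C := by
  intro w hw
  refine le_trans (lintegral_mono_ae ?_) (h w hw)
  have hnull : ∀ᵐ w' ∂(hypVolume m k), w' ≠ w := by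
    have : (hypVolume m k) ≪ volume :=
      (withDensity_absolutelyContinuous _ _).trans Measure.restrict_le_self.absolutelyContinuous
    have h2 : ∀ᵐ w' ∂(volume : Measure (Pt m k)), w' ≠ w := by
      have h3 : (volume : Measure (Pt m k)) (Prod.fst ⁻¹' {w.1}) = 0 :=
        (Measure.quasiMeasurePreserving_fst (μ := (volume : Measure ℝ))
          (ν := (volume : Measure (EuclideanSpace ℝ (Fin m) × EuclideanSpace ℝ (Fin k))))).preimage_null
          (measure_singleton w.1)
      have h4 : {w} ⊆ (Prod.fst ⁻¹' {w.1} : Set (Pt m k)) := by simp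
      exact compl_mem_ae_iff.mpr (measure_mono_null h4 h3)
    exact this.ae_le h2
  filter_upwards [ae_hypVolume_mem, hnull] with w' hw' hne
  gcongr
  exact hM _ (two_lt_twoCosh hw hw' hne.symm)

lemma schurKer_series {D b : ℕ → ℝ} {p : ℝ} (hp : ((m + k : ℕ) : ℝ) / 2 < p) (hD : ∀ j, 0 ≤ D j)
    (hb : Summable b) (h : ∀ j : ℕ, D j * schurR (m + k) (p + 2 * j) ≤ b j) :
    SchurKer m k (fun T => ∑' j : ℕ, ENNReal.ofReal (D j * T ^ (-(p + 2 * j)))) (∑' j, b j).toNNReal := by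
  intro w hw
  have hpj : ∀ j : ℕ, ((m + k : ℕ) : ℝ) / 2 < p + 2 * j := fun j => by
    have : (0 : ℝ) ≤ j := by positivity
    linarith
  have hb0 : ∀ j, 0 ≤ b j := fun j => (mul_nonneg (hD j) (schurR_pos (hpj j)).le).trans (h j)
  have hm : ∀ p : ℝ, Measurable fun w' : Pt m k => twoCosh w w' ^ p := fun p =>
    (measurable_twoCosh.comp (measurable_const.prodMk measurable_id)).pow_const p
  simp only [← ENNReal.tsum_mul_right]
  rw [lintegral_tsum (f := fun (j : ℕ) w' => ENNReal.ofReal (D j * twoCosh w w' ^ (-(p + 2 * j))) *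
    schurWeight m k w') fun j => (((hm _).const_mul _).ennreal_ofReal.mul measurable_schurWeight).aemeasurable]
  have hj : ∀ j : ℕ, ∫⁻ w', ENNReal.ofReal (D j * twoCosh w w' ^ (-(p + 2 * j))) *
      schurWeight m k w' ∂(hypVolume m k) ≤ ENNReal.ofReal (b j) * schurWeight m k w := fun j => by
    simp only [ENNReal.ofReal_mul (hD j), mul_assoc]
    rw [lintegral_const_mul' _ _ ENNReal.ofReal_ne_top]
    have := schurKer_rpow (hpj j) w hw
    refine (mul_le_mul_right this _).trans ?_
    rw [← mul_assoc]
    gcongr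
    have : ((schurR (m + k) (p + 2 * j)).toNNReal : ENNReal) = ENNReal.ofReal (schurR (m + k) (p + 2 * j)) := rfl
    rw [this, ← ENNReal.ofReal_mul (hD j)]
    exact ENNReal.ofReal_le_ofReal (h j)
  refine (ENNReal.tsum_le_tsum hj).trans_eq ?_
  rw [ENNReal.tsum_mul_right, ← ENNReal.ofReal_tsum_of_nonneg hb0 hb]
  rfl

lemma summable_inv_sq : Summable fun j : ℕ => 1 / ((j : ℝ) + 1) ^ 2 := by
  have := (summable_nat_add_iff 1).mpr (Real.summable_one_div_nat_pow.mpr (by norm_num : 1 < 2))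
  simpa using this

lemma resFun_eq_sum_add {n : ℕ} (hn : 0 < n) {s : ℂ} (hs : 0 < s.re) {T : ℝ} (hT : 2 < T) (J : ℕ) :
    resFun n s T - resSum n s J T = ∑' j : ℕ, coef n s (j + J) * powKer (s + 2 * (j + J : ℕ)) T := by
  rw [resFun, if_pos hT, ← (summable_resFun hn hs hT).of_norm.sum_add_tsum_nat_add J, resSum,
    add_sub_cancel_left]

/-- The tails of the series satisfy the Schur test with constants tending to `0`. -/
lemma schurFun_resFun_tail (hn : 0 < m + k) {a : ℝ} (ha : a ≤ ((m + k : ℕ) : ℝ) / 2)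
    {s : ℂ} (hs : ((m + k : ℕ) : ℝ) / 2 < s.re) :
    ∃ B > 0, ∀ J, SchurFun m k a (∑' j : ℕ, B / (((j + J : ℕ) : ℝ) + 1) ^ 2).toNNReal
      fun T => resFun (m + k) s T - resSum (m + k) s J T := by
  have hs0 : 0 < s.re := lt_of_le_of_lt (by positivity) hs
  obtain ⟨B, hB0, hB⟩ := exists_coef_bound_schur (m + k) hn (S := {s}) isCompact_singleton
    (by simpa using hs0) hs
  refine ⟨B, hB0, fun J => ⟨⟨(measurable_resFun hn hs0).sub (measurable_resSum _ s J), ?_⟩, ?_⟩⟩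
  · obtain ⟨D, hD, hD0, hb⟩ := exists_term_bound hn (S := {s}) isCompact_singleton
      (by simpa using hs0) (r := 3) (by norm_num)
    have hD' : Summable fun j => D (j + J) := (summable_nat_add_iff J).mpr hD
    refine ⟨s.re, lt_of_le_of_lt ha hs, ∑' j, D (j + J), fun T hT => ?_⟩
    rw [resFun_eq_sum_add hn hs0 (by linarith)]
    rw [← tsum_mul_right]
    exact tsum_of_norm_bounded (hD'.mul_right _).hasSum fun j => hb s rfl T hT (j + J)
  · have hsum : Summable fun j : ℕ => B / (((j + J : ℕ) : ℝ) + 1) ^ 2 := by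
      have h2 : Summable fun j : ℕ => B / ((j : ℝ) + 1) ^ 2 := by
        simpa [div_eq_mul_inv] using summable_inv_sq.mul_left B
      exact (summable_nat_add_iff J).mpr h2
    have key := schurKer_series (m := m) (k := k) (p := s.re + 2 * J)
      (D := fun j => ‖coef (m + k) s (j + J)‖)
      (by have : (0 : ℝ) ≤ J := by positivity
          linarith) (fun j => norm_nonneg _) hsum fun j => ?_
    · refine key.mono_of_gt fun T hT => ?_
      have hT0 : 0 < T := by linarith
      rw [resFun_eq_sum_add hn hs0 hT]
      have hsm := (summable_nat_add_iff J).mpr (summable_resFun hn hs0 hT)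
      rw [← ofReal_norm, ← ENNReal.ofReal_tsum_of_nonneg (fun j => by positivity)]
      · refine ENNReal.ofReal_le_ofReal ((norm_tsum_le_tsum_norm hsm).trans_eq ?_)
        refine tsum_congr fun j => ?_
        rw [norm_mul, norm_powKer hT0]
        congr 2
        simp; ring
      · refine hsm.congr fun j => ?_
        rw [norm_mul, norm_powKer hT0]
        congr 2
        simp; ring
    · have := hB s rfl (j + J)
      refine le_trans (le_of_eq ?_) this
      congr 2
      push_cast; ring

lemma schurFun_resFun (hn : 0 < m + k) {a : ℝ} (ha : a ≤ ((m + k : ℕ) : ℝ) / 2)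
    {s : ℂ} (hs : ((m + k : ℕ) : ℝ) / 2 < s.re) : ∃ C, SchurFun m k a C (resFun (m + k) s) := by
  obtain ⟨B, -, h⟩ := schurFun_resFun_tail hn ha hs
  have := h 0
  simp only [resSum, Finset.range_zero, Finset.sum_empty, sub_zero] at this
  exact ⟨_, this⟩

/-- Small sub-level sets of the distance are small. -/
lemma exists_twoCosh_nhds {w : Pt m k} (hw : w ∈ halfSpace m k) {U : Set (Pt m k)} (hU : U ∈ 𝓝 w) :
    ∃ r > 2, ∀ w' ∈ halfSpace m k, twoCosh w w' < r → w' ∈ U := by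
  obtain ⟨δ, hδ, hball⟩ := Metric.mem_nhds_iff.mp hU
  have hx : 0 < w.1 := hw
  refine ⟨2 + min 1 (δ ^ 2 / (3 * w.1 ^ 2)), by linarith [lt_min one_pos (show 0 < δ ^ 2 / (3 * w.1 ^ 2) by positivity)],
    fun w' hw' hT => hball ?_⟩
  have hx' : 0 < w'.1 := hw'
  have hT' : quad w w' < (2 + min 1 (δ ^ 2 / (3 * w.1 ^ 2))) * (w.1 * w'.1) := by
    rw [twoCosh, div_lt_iff₀ (by positivity)] at hT; exact hT
  have hq : quad w w' = w.1 ^ 2 + w'.1 ^ 2 + ‖w.2.1 - w'.2.1‖ ^ 2 + ‖w.2.2 - w'.2.2‖ ^ 2 := rfl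
  have s1 := sq_nonneg ‖w.2.1 - w'.2.1‖
  have s2 := sq_nonneg ‖w.2.2 - w'.2.2‖
  have h3 : w'.1 ≤ 3 * w.1 := by
    have : quad w w' ≤ 3 * (w.1 * w'.1) := hT'.le.trans (by
      gcongr; linarith [min_le_left 1 (δ ^ 2 / (3 * w.1 ^ 2))])
    nlinarith [sq_nonneg w.1]
  have h4 : (w.1 - w'.1) ^ 2 + ‖w.2.1 - w'.2.1‖ ^ 2 + ‖w.2.2 - w'.2.2‖ ^ 2 < δ ^ 2 := by
    have e1 : min 1 (δ ^ 2 / (3 * w.1 ^ 2)) * (w.1 * w'.1) ≤ δ ^ 2 := by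
      calc _ ≤ δ ^ 2 / (3 * w.1 ^ 2) * (w.1 * (3 * w.1)) := by
            gcongr; exact min_le_right _ _
        _ = δ ^ 2 := by field_simp
    nlinarith
  have s0 := sq_nonneg (w.1 - w'.1)
  rw [Metric.mem_ball, dist_comm, Prod.dist_eq, Prod.dist_eq, max_lt_iff, max_lt_iff,
    dist_eq_norm, dist_eq_norm, dist_eq_norm]
  refine ⟨?_, ?_, ?_⟩
  · rw [Real.norm_eq_abs]; exact abs_lt_of_sq_lt_sq (by linarith) hδ.le
  · exact lt_of_pow_lt_pow_left₀ 2 hδ.le (by linarith)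
  · exact lt_of_pow_lt_pow_left₀ 2 hδ.le (by linarith)

namespace CuspLike

variable {Γ : Subgroup (Equiv.Perm (Pt m k))} {F : Set (Pt m k)} {a : ℝ} (hΓ : CuspLike Γ F a)
include hΓ

lemma schurFun_powKer {p : ℂ} (hp : ((m + k : ℕ) : ℝ) / 2 < p.re) : ∃ C, SchurFun m k a C (powKer p) :=
  ⟨_, hΓ.schurFun_of_re (measurable_powKer p) hp zero_le_one fun T hT => by
    rw [norm_powKer (by linarith), one_mul]⟩

omit hΓ in
lemma re_add_two_mul {s : ℂ} (hs : ((m + k : ℕ) : ℝ) / 2 < s.re) (j : ℕ) :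
    ((m + k : ℕ) : ℝ) / 2 < (s + 2 * (j : ℂ)).re := by
  have : (s + 2 * (j : ℂ)).re = s.re + 2 * (j : ℝ) := by simp
  rw [this]
  have : (0 : ℝ) ≤ j := by positivity
  linarith

omit hΓ in
lemma re_add_two {p : ℂ} (hp : ((m + k : ℕ) : ℝ) / 2 < p.re) :
    ((m + k : ℕ) : ℝ) / 2 < (p + 2).re := by
  simp only [Complex.add_re, Complex.re_ofNat]; linarith

lemma foldOp_resSum {s : ℂ} (hs : ((m + k : ℕ) : ℝ) / 2 < s.re) (J : ℕ) :
    (∃ C, SchurFun m k a C (resSum (m + k) s J)) ∧ foldOp Γ F (resSum (m + k) s J) =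
      ∑ j ∈ Finset.range J, coef (m + k) s j • foldOp Γ F (powKer (s + 2 * j)) := by
  induction J with
  | zero =>
    have h0 : SchurFun m k a _ (fun _ => (0 : ℂ)) := hΓ.schurFun_of_re measurable_const hs le_rfl
      (fun T hT => by simp)
    have e : resSum (m + k) s 0 = fun _ => 0 := by funext T; simp [resSum]
    rw [e]
    refine ⟨⟨_, h0⟩, ?_⟩
    have := hΓ.norm_foldOp h0
    simpa using this
  | succ J ih =>
    obtain ⟨⟨C, hC⟩, ih⟩ := ih
    obtain ⟨D, hD⟩ := hΓ.schurFun_powKer (re_add_two_mul hs J)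
    have e : resSum (m + k) s (J + 1) = fun T => resSum (m + k) s J T +
        coef (m + k) s J * powKer (s + 2 * J) T := by
      funext T; simp [resSum, Finset.sum_range_succ]
    rw [e]
    refine ⟨⟨_, hC.add (hD.const_mul _)⟩, ?_⟩
    rw [hΓ.foldOp_add hC (hD.const_mul _), hΓ.foldOp_const_mul hD, ih, Finset.sum_range_succ]

lemma tendsto_foldOp_resSum {s : ℂ} (hs : ((m + k : ℕ) : ℝ) / 2 < s.re) :
    Tendsto (fun J : ℕ => ∑ j ∈ Finset.range (J + 1), coef (m + k) s j • foldOp Γ F (powKer (s + 2 * j)))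
      atTop (𝓝 (foldOp Γ F (resFun (m + k) s))) := by
  rw [tendsto_iff_norm_sub_tendsto_zero]
  obtain ⟨B, hB0, hB⟩ := schurFun_resFun_tail hΓ.dim_pos hΓ.le_half hs
  have hz := tendsto_sum_nat_add fun j : ℕ => B / ((j : ℝ) + 1) ^ 2
  refine squeeze_zero (fun _ => norm_nonneg _) (fun J => ?_) ((tendsto_add_atTop_iff_nat 1).mpr hz)
  obtain ⟨⟨C, hC⟩, e⟩ := hΓ.foldOp_resSum hs (J + 1)
  rw [← e, norm_sub_rev]
  refine (hΓ.norm_foldOp_sub_le hC (hB (J + 1))).trans_eq ?_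
  rw [Real.coe_toNNReal _ (tsum_nonneg fun j => by positivity)]

/-- The identity `Δ T^{-p} = p (n - p) T^{-p} + 4 p (p + 1) T^{-p-2}` for the operators. -/
lemma foldOp_powLap {p : ℂ} (hp : ((m + k : ℕ) : ℝ) / 2 < p.re) :
    foldOp Γ F (powLap (m + k) p) = (p * ((m + k : ℕ) - p)) • foldOp Γ F (powKer p) +
      (4 * p * (p + 1)) • foldOp Γ F (powKer (p + 2)) := by
  obtain ⟨C, hC⟩ := hΓ.schurFun_powKer hp
  obtain ⟨D, hD⟩ := hΓ.schurFun_powKer (re_add_two hp)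
  have := hΓ.foldOp_add (hC.const_mul (p * ((m + k : ℕ) - p))) (hD.const_mul (4 * p * (p + 1)))
  rw [hΓ.foldOp_const_mul hC, hΓ.foldOp_const_mul hD] at this
  exact this

/-- The telescoping identity behind the series for the resolvent. -/
lemma telescope {s : ℂ} (hs : ((m + k : ℕ) : ℝ) / 2 < s.re) (J : ℕ) :
    ∑ j ∈ Finset.range (J + 1), coef (m + k) s j •
      (foldOp Γ F (powLap (m + k) (s + 2 * j)) -
        (s * ((m + k : ℕ) - s)) • foldOp Γ F (powKer (s + 2 * j))) =
    (4 * (s + 2 * J) * (s + 2 * J + 1) * coef (m + k) s J) • foldOp Γ F (powKer (s + 2 * J + 2)) := by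
  have hs0 : 0 < s.re := lt_of_le_of_lt (by positivity) hs
  induction J with
  | zero =>
    have := hΓ.foldOp_powLap hs
    simp only [zero_add, Finset.range_one, Finset.sum_singleton, Nat.cast_zero, mul_zero, add_zero]
    rw [this, add_sub_cancel_left, smul_smul]
    congr 1; ring
  | succ J ih =>
    have hc := coef_succ (n := m + k) hs0 J
    rw [Finset.sum_range_succ, ih, hΓ.foldOp_powLap (re_add_two_mul hs (J + 1)), ← hc]
    have e : (s + 2 * (J : ℂ) + 2) = s + 2 * ((J + 1 : ℕ) : ℂ) := by push_cast; ring
    rw [e]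
    module

/-- The powers `T^{-s-2J-2}`, suitably normalised, are an approximate identity. -/
lemma tendsto_approx_identity {s : ℂ} (hs : ((m + k : ℕ) : ℝ) / 2 < s.re) {φ : Pt m k → ℂ}
    (hφ : IsTestFunction Γ φ) {w : Pt m k} (hw : w ∈ halfSpace m k) :
    Tendsto (fun J : ℕ => (4 * (s + 2 * J) * (s + 2 * J + 1) * coef (m + k) s J) *
      ∫ w', powKer (s + 2 * J + 2) (twoCosh w w') * φ w' ∂(hypVolume m k)) atTop (𝓝 (φ w)) := by
  have hs0 : 0 < s.re := lt_of_le_of_lt (by positivity) hs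
  have hx : 0 < w.1 := hw
  set ν : ℝ := ((m + k : ℕ) : ℝ) / 2 with hν
  obtain ⟨B, hB0, hB⟩ := hΓ.exists_bound hφ
  obtain ⟨E, hE0, hE⟩ := exists_defect_bound hΓ.dim_pos hs
  -- subtracting a multiple of the eigenfunction `x^ν` leaves a function `g` with `g w = 0`
  set c : ℂ := φ w * ((w.1 ^ (-ν) : ℝ) : ℂ) with hc
  set g : Pt m k → ℂ := fun w' => φ w' - c * ((w'.1 ^ ν : ℝ) : ℂ) with hg
  set CJ : ℕ → ℂ := fun J => 4 * (s + 2 * J) * (s + 2 * J + 1) * coef (m + k) s J with hCJ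
  have hp : ∀ J : ℕ, ν < (s + 2 * (J : ℂ) + 2).re := fun J => re_add_two (re_add_two_mul hs J)
  have hw1 : ∀ w' ∈ halfSpace m k, (w'.1 : ℂ) ^ (((m + k : ℕ) : ℂ) / 2) = ((w'.1 ^ ν : ℝ) : ℂ) :=
    fun w' hw' => by
    rw [Complex.ofReal_cpow (le_of_lt hw'), hν]; push_cast; rfl
  have hmain : ∀ J : ℕ, Integrable (fun w' => powKer (s + 2 * J + 2) (twoCosh w w') *
      ((w'.1 ^ ν : ℝ) : ℂ)) (hypVolume m k) ∧
      ∫ w', powKer (s + 2 * J + 2) (twoCosh w w') * ((w'.1 ^ ν : ℝ) : ℂ) ∂(hypVolume m k) =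
        schurC (m + k) (s + 2 * J + 2) * ((w.1 ^ ν : ℝ) : ℂ) := fun J => by
    obtain ⟨i1, i2⟩ := integral_twoCosh_cpow (hp J) hw
    have hae : (fun w' => (twoCosh w w' : ℂ) ^ (-(s + 2 * (J : ℂ) + 2)) * (w'.1 : ℂ) ^ (((m + k : ℕ) : ℂ) / 2))
        =ᵐ[hypVolume m k] fun w' => powKer (s + 2 * J + 2) (twoCosh w w') * ((w'.1 ^ ν : ℝ) : ℂ) := by
      filter_upwards [ae_hypVolume_mem] with w' hw'
      rw [hw1 w' hw']; rfl
    refine ⟨i1.congr hae, ?_⟩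
    rw [← integral_congr_ae hae, i2, hw1 w hw]
  have hsplit : ∀ J : ℕ, CJ J * ∫ w', powKer (s + 2 * J + 2) (twoCosh w w') * φ w' ∂(hypVolume m k) =
      φ w * (CJ J * schurC (m + k) (s + 2 * J + 2)) +
        CJ J * ∫ w', powKer (s + 2 * J + 2) (twoCosh w w') * g w' ∂(hypVolume m k) := fun J => by
    obtain ⟨i1, i2⟩ := hmain J
    obtain ⟨C, hC⟩ := hΓ.schurFun_powKer (hp J)
    have i3 := hΓ.integrable_twoCosh_mul hC hφ hw
    have e1 : (fun w' => powKer (s + 2 * J + 2) (twoCosh w w') * g w') = fun w' =>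
        powKer (s + 2 * J + 2) (twoCosh w w') * φ w' -
        c * (powKer (s + 2 * J + 2) (twoCosh w w') * ((w'.1 ^ ν : ℝ) : ℂ)) := by
      funext w'; simp only [hg]; ring
    rw [e1, integral_sub i3 (i1.const_mul c), integral_const_mul, i2, hc]
    have : ((w.1 ^ (-ν) : ℝ) : ℂ) * ((w.1 ^ ν : ℝ) : ℂ) = 1 := by
      rw [← Complex.ofReal_mul, ← Real.rpow_add hx]; simp
    linear_combination φ w * CJ J * schurC (m + k) (s + 2 * J + 2) * this
  have hlim1 : Tendsto (fun J : ℕ => φ w * (CJ J * schurC (m + k) (s + 2 * J + 2))) atTop (𝓝 (φ w)) := by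
    simpa using (tendsto_coef_mul_schurC hs).const_mul (φ w)
  have hgB : ∀ w' ∈ halfSpace m k, ‖g w'‖ ≤ (B + ‖c‖) * w'.1 ^ ν := fun w' hw' => by
    have hx' : 0 < w'.1 := hw'
    refine (norm_sub_le _ _).trans ?_
    rw [add_mul, norm_mul, Complex.norm_of_nonneg (by positivity)]
    exact add_le_add (hB w' hw') le_rfl
  have hlim2 : Tendsto (fun J : ℕ => CJ J *
      ∫ w', powKer (s + 2 * J + 2) (twoCosh w w') * g w' ∂(hypVolume m k)) atTop (𝓝 0) := by
    rw [Metric.tendsto_atTop]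
    intro ε hε
    set ε' := ε / (2 * (E * w.1 ^ ν)) with hε'
    have hε'0 : 0 < ε' := by positivity
    -- near `w` the function `g` is small
    have hU : {w' : Pt m k | w' ∈ halfSpace m k ∧ ‖g w'‖ < ε' * w'.1 ^ ν} ∈ 𝓝 w := by
      have hcont : ContinuousAt (fun w' : Pt m k => ‖g w'‖ - ε' * w'.1 ^ ν) w := by
        have c1 : ContinuousAt φ w := (ContDiffOn.contDiffAt_half hφ.1 hw).continuousAt
        have c2 : ContinuousAt (fun w' : Pt m k => w'.1 ^ ν) w :=
          continuous_fst.continuousAt.rpow_const (Or.inl hx.ne')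
        exact ((c1.sub (continuousAt_const.mul (Complex.continuous_ofReal.continuousAt.comp c2))).norm).sub
          (continuousAt_const.mul c2)
      have hneg : ‖g w‖ - ε' * w.1 ^ ν < 0 := by
        have : g w = 0 := by
          simp only [hg, hc]
          rw [mul_assoc, ← Complex.ofReal_mul, ← Real.rpow_add hx]; simp
        rw [this, norm_zero, zero_sub]
        have : 0 < ε' * w.1 ^ ν := by positivity
        linarith
      filter_upwards [hcont.eventually (gt_mem_nhds hneg), isOpen_halfSpace.mem_nhds hw] with w' h1 h2
      exact ⟨h2, by linarith⟩
    obtain ⟨r, hr, hrU⟩ := exists_twoCosh_nhds hw hU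
    have hr0 : 0 < r := by linarith
    set A := (B + ‖c‖) * schurR (m + k) (s.re + 2) * w.1 ^ ν with hA
    have hν2 : ν < s.re + 2 := by linarith
    have hA0 : 0 ≤ A := by
      have := schurR_pos hν2
      positivity
    have hz := (tendsto_defect_zero hΓ.dim_pos hs0 hr).const_mul A
    rw [mul_zero] at hz
    obtain ⟨N, hN⟩ := (Metric.tendsto_atTop.mp hz) (ε / 2) (by positivity)
    refine ⟨N, fun J hJ => ?_⟩
    have hN' : A * (‖CJ J‖ * (r ^ (2 * J))⁻¹) < ε / 2 := by
      have := hN J hJ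
      rw [dist_zero_right] at this
      exact (le_abs_self _).trans_lt this
    rw [dist_zero_right, norm_mul]
    have hJ0 : (0 : ℝ) ≤ J := by positivity
    have hre : (s + 2 * (J : ℂ) + 2).re = s.re + 2 * J + 2 := by simp
    have hνJ : ν < s.re + 2 * J + 2 := by linarith
    have hsJ := schurR_pos hνJ
    have hs2 := schurR_pos hν2
    have hint : ‖∫ w', powKer (s + 2 * J + 2) (twoCosh w w') * g w' ∂(hypVolume m k)‖ ≤
        (ε' * schurR (m + k) (s.re + 2 * J + 2) +
          (B + ‖c‖) * (r ^ (2 * J))⁻¹ * schurR (m + k) (s.re + 2)) * w.1 ^ ν := by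
      have hR0 : 0 ≤ (ε' * schurR (m + k) (s.re + 2 * J + 2) +
          (B + ‖c‖) * (r ^ (2 * J))⁻¹ * schurR (m + k) (s.re + 2)) * w.1 ^ ν := by positivity
      rw [← ENNReal.ofReal_le_ofReal_iff hR0, ofReal_norm]
      refine (enorm_integral_le_lintegral_enorm _).trans ?_
      refine le_trans (b := ∫⁻ w', (ENNReal.ofReal ε' * (ENNReal.ofReal (twoCosh w w' ^ (-(s.re + 2 * J + 2))) *
          schurWeight m k w') + ENNReal.ofReal ((B + ‖c‖) * (r ^ (2 * J))⁻¹) *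
          (ENNReal.ofReal (twoCosh w w' ^ (-(s.re + 2))) * schurWeight m k w')) ∂(hypVolume m k))
        (lintegral_mono_ae ?_) ?_
      · filter_upwards [ae_hypVolume_mem] with w' hw'
        have hT := two_le_twoCosh hw hw'
        have hT0 : 0 < twoCosh w w' := by linarith
        have hx' : 0 < w'.1 := hw'
        rw [schurWeight, ← ENNReal.ofReal_mul (by positivity), ← ENNReal.ofReal_mul (by positivity),
          ← ENNReal.ofReal_mul (by positivity), ← ENNReal.ofReal_mul (by positivity),
          ← ENNReal.ofReal_add (by positivity) (by positivity), ← ofReal_norm]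
        refine ENNReal.ofReal_le_ofReal ?_
        rw [norm_mul, norm_powKer hT0, hre]
        -- near `w` smallness of `g` is used, and away from `w` that of the power
        by_cases hTr : twoCosh w w' < r
        · have h1 := (hrU w' hw' hTr).2.le
          have h2 : 0 ≤ (B + ‖c‖) * (r ^ (2 * J))⁻¹ * (twoCosh w w' ^ (-(s.re + 2)) *
            w'.1 ^ (((m + k : ℕ) : ℝ) / 2)) := by positivity
          calc _ ≤ twoCosh w w' ^ (-(s.re + 2 * J + 2)) * (ε' * w'.1 ^ ν) := by gcongr
            _ = ε' * (twoCosh w w' ^ (-(s.re + 2 * J + 2)) * w'.1 ^ ν) := by ring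
            _ ≤ _ := by linarith
        · push Not at hTr
          have h1 := hgB w' hw'
          have h2 : 0 ≤ ε' * (twoCosh w w' ^ (-(s.re + 2 * J + 2)) *
            w'.1 ^ (((m + k : ℕ) : ℝ) / 2)) := by positivity
          have h3 : twoCosh w w' ^ (-(s.re + 2 * J + 2)) ≤
              (r ^ (2 * J))⁻¹ * twoCosh w w' ^ (-(s.re + 2)) := by
            have := rpow_tail (q := s.re + 2) (η := 2 * J) hr0 hTr (by positivity)
            rw [show s.re + 2 * (J : ℝ) + 2 = s.re + 2 + 2 * J by ring]
            refine this.trans_eq ?_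
            rw [Real.rpow_neg hr0.le, ← Real.rpow_natCast]
            push_cast; rfl
          calc _ ≤ ((r ^ (2 * J))⁻¹ * twoCosh w w' ^ (-(s.re + 2))) * ((B + ‖c‖) * w'.1 ^ ν) := by gcongr
            _ = (B + ‖c‖) * (r ^ (2 * J))⁻¹ * (twoCosh w w' ^ (-(s.re + 2)) * w'.1 ^ ν) := by ring
            _ ≤ _ := by linarith
      · have hm : ∀ p : ℝ, Measurable fun w' : Pt m k => ENNReal.ofReal (twoCosh w w' ^ p) * schurWeight m k w' := fun p =>
          ((measurable_twoCosh.comp (measurable_const.prodMk measurable_id)).pow_const p).ennreal_ofReal.mul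
            measurable_schurWeight
        rw [lintegral_add_left ((hm _).const_mul _), lintegral_const_mul' _ _ ENNReal.ofReal_ne_top,
          lintegral_const_mul' _ _ ENNReal.ofReal_ne_top]
        have l1 := lintegral_twoCosh_rpow (m := m) (k := k) hνJ hw
        have l2 := lintegral_twoCosh_rpow (m := m) (k := k) hν2 hw
        simp only [schurWeight]
        rw [l1, l2, ← ENNReal.ofReal_mul (by positivity), ← ENNReal.ofReal_mul (by positivity),
          ← ENNReal.ofReal_mul (by positivity), ← ENNReal.ofReal_mul (by positivity),
          ← ENNReal.ofReal_add (by positivity) (by positivity)]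
        refine ENNReal.ofReal_le_ofReal (le_of_eq ?_)
        ring
    have hEJ := hE J
    calc ‖CJ J‖ * ‖∫ w', powKer (s + 2 * J + 2) (twoCosh w w') * g w' ∂(hypVolume m k)‖
        ≤ ‖CJ J‖ * ((ε' * schurR (m + k) (s.re + 2 * J + 2) +
          (B + ‖c‖) * (r ^ (2 * J))⁻¹ * schurR (m + k) (s.re + 2)) * w.1 ^ ν) := by gcongr
      _ = ε' * w.1 ^ ν * (‖CJ J‖ * schurR (m + k) (s.re + 2 * J + 2)) +
          A * (‖CJ J‖ * (r ^ (2 * J))⁻¹) := by rw [hA]; ring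
      _ < ε' * w.1 ^ ν * E + ε / 2 := by
          refine add_lt_add_of_le_of_lt ?_ hN'
          gcongr
      _ = ε := by rw [hε']; field_simp; ring
  have := hlim1.add hlim2
  rw [add_zero] at this
  exact this.congr fun J => (hsplit J).symm

end CuspLike

end

end ModelCusp

namespace ModelCusp

section

open Filter Topology MeasureTheory Set

open scoped NNReal Pointwise

variable {m k : ℕ}

namespace CuspLike

variable {Γ : Subgroup (Equiv.Perm (Pt m k))} {F : Set (Pt m k)} {a : ℝ} (hΓ : CuspLike Γ F a)
include hΓ

/-! ### Density of the test functions -/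

omit hΓ in
lemma isTestFunction_linear {φ ψ : Pt m k → ℂ} (hφ : IsTestFunction Γ φ)
    (hψ : IsTestFunction Γ ψ) (c : ℂ) : IsTestFunction Γ fun w => φ w + c * ψ w := by
  obtain ⟨h1, h2, K, hKH, hK, h3⟩ := hφ
  obtain ⟨g1, g2, L, hLH, hL, g3⟩ := hψ
  refine ⟨h1.add (contDiffOn_const.mul g1), fun γ hγ w hw => by
    beta_reduce; rw [h2 γ hγ w hw, g2 γ hγ w hw],
    K ∪ L, union_subset hKH hLH, hK.union hL, fun w hw hne => ?_⟩
  by_cases h : φ w = 0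
  · have : ψ w ≠ 0 := fun h' => hne (by simp [h, h'])
    obtain ⟨γ, hγ, hm⟩ := g3 w hw this
    exact ⟨γ, hγ, Or.inr hm⟩
  · obtain ⟨γ, hγ, hm⟩ := h3 w hw h
    exact ⟨γ, hγ, Or.inl hm⟩

omit hΓ in
lemma isTestFunction_zero : IsTestFunction Γ fun _ => 0 :=
  ⟨contDiffOn_const, fun _ _ _ _ => rfl, ∅, empty_subset _, isCompact_empty, fun _ _ h => (h rfl).elim⟩

/-- The graph of the Laplacian on test functions, as a subspace. -/
noncomputable def testGraph : Submodule ℂ (L2 F × L2 F) where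
  carrier := {p | ∃ φ : Pt m k → ℂ, IsTestFunction Γ φ ∧
    p.1 =ᵐ[quotVolume F] φ ∧ p.2 =ᵐ[quotVolume F] hypLaplacian φ}
  add_mem' := by
    rintro p q ⟨φ, hφ, h1, h2⟩ ⟨ψ, hψ, g1, g2⟩
    refine ⟨_, isTestFunction_linear hφ hψ 1, ?_, ?_⟩
    · filter_upwards [h1, g1, Lp.coeFn_add p.1 q.1] with w e1 e2 e3
      rw [Prod.fst_add, e3, Pi.add_apply, e1, e2, one_mul]
    · filter_upwards [h2, g2, Lp.coeFn_add p.2 q.2, hΓ.ae_mem] with w e1 e2 e3 hw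
      rw [Prod.snd_add, e3, Pi.add_apply, e1, e2, hypLaplacian_linear hφ.1 hψ.1 1 (hΓ.subset hw), one_mul]
  zero_mem' := by
    refine ⟨_, isTestFunction_zero, Lp.coeFn_zero _ _ _, ?_⟩
    filter_upwards [Lp.coeFn_zero ℂ 2 (quotVolume F)] with w e1
    rw [Prod.snd_zero, e1, hypLaplacian_eq_zero (f := fun _ => 0) (by rfl)]
    rfl
  smul_mem' := by
    rintro c p ⟨φ, hφ, h1, h2⟩
    refine ⟨_, isTestFunction_linear isTestFunction_zero hφ c, ?_, ?_⟩
    · filter_upwards [h1, Lp.coeFn_smul c p.1] with w e1 e3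
      rw [Prod.smul_fst, e3, Pi.smul_apply, e1, zero_add, smul_eq_mul]
    · filter_upwards [h2, Lp.coeFn_smul c p.2, hΓ.ae_mem] with w e1 e3 hw
      rw [Prod.smul_snd, e3, Pi.smul_apply, e1,
        hypLaplacian_linear contDiffOn_const hφ.1 c (hΓ.subset hw),
        hypLaplacian_eq_zero (f := fun _ => 0) (by rfl), zero_add, smul_eq_mul]

lemma laplacianGraph_eq : laplacianGraph Γ F = (hΓ.testGraph.topologicalClosure : Set (L2 F × L2 F)) := by
  rw [Submodule.topologicalClosure_coe]; rfl

/-- Periodisation of a compactly supported function. -/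
lemma isTestFunction_periodize {g : Pt m k → ℝ} (hg : ContDiff ℝ ∞ g) (hc : HasCompactSupport g)
    (hs : tsupport g ⊆ halfSpace m k) :
    IsTestFunction Γ fun w => ∑' γ : Γ, (g (γ.1 w) : ℂ) := by
  refine ⟨fun w₀ hw₀ => ?_, fun γ hγ w hw => ?_, tsupport g, hs, hc, fun w hw hne => ?_⟩
  · obtain ⟨B, hB⟩ := hc.isCompact.exists_bound_of_continuousOn (f := fun w => w) continuousOn_id
    set M := max B (‖w₀‖ + 1) with hM
    have hfin := hΓ.finite_near M (2 * M ^ 2)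
    set I := hfin.toFinset with hI
    have hev : (fun w => ∑' γ : Γ, (g (γ.1 w) : ℂ)) =ᶠ[𝓝 w₀]
        fun w => ∑ γ ∈ I, (g (γ.1 w) : ℂ) := by
      have e2 : ∀ᶠ w : Pt m k in 𝓝 w₀, ‖w‖ < ‖w₀‖ + 1 :=
        continuous_norm.continuousAt.eventually (gt_mem_nhds (by linarith))
      filter_upwards [e2] with w hw
      refine tsum_eq_sum fun γ hγ => ?_
      by_contra hne
      refine hγ (hfin.mem_toFinset.mpr ⟨γ.1 w, w, ?_, hw.le.trans (le_max_right _ _), ?_⟩)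
      · have : γ.1 w ∈ tsupport g := subset_tsupport _ fun h => hne (by simp [h])
        exact (hB _ this).trans (le_max_left _ _)
      · have hmem : γ.1 w ∈ tsupport g := subset_tsupport _ fun h => hne (by simp [h])
        have h1 : |(γ.1 w).1| ≤ M :=
          ((norm_fst_le _).trans (hB _ hmem)).trans (le_max_left _ _)
        have h2 := sq_le_sq' (abs_le.mp h1).1 (abs_le.mp h1).2
        simp only [quad, sub_self, norm_zero]
        nlinarith
    refine ContDiffAt.contDiffWithinAt (ContDiffAt.congr_of_eventuallyEq ?_ hev)
    exact ContDiffAt.sum fun γ _ =>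
      (Complex.ofRealCLM.contDiff.comp (hg.comp (hΓ.contDiff_apply γ))).contDiffAt
  · exact (Equiv.mulRight (⟨γ, hγ⟩ : Γ)).tsum_eq
      fun δ : Γ => (g ((δ : Equiv.Perm (Pt m k)) w) : ℂ)
  · by_contra! hcon
    refine hne ?_
    have : ∀ γ : Γ, (g (γ.1 w) : ℂ) = 0 := fun γ => by
      rw [image_eq_zero_of_notMem_tsupport (hcon γ γ.2)]; rfl
    simp [this]

lemma periodize_ae_eq {g : Pt m k → ℝ} (hs : tsupport g ⊆ F) :
    (fun w => ∑' γ : Γ, (g (γ.1 w) : ℂ)) =ᵐ[quotVolume F] fun w => (g w : ℂ) := by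
  have := hΓ.countable
  have hdis : ∀ᵐ w ∂(quotVolume F), ∀ γ : Γ, γ ≠ 1 → γ.1 w ∉ F := by
    rw [ae_all_iff]
    intro γ
    by_cases h1 : γ = 1
    · simp [h1]
    have hd := hΓ.fundamental.aedisjoint (show γ⁻¹ ≠ 1 by simpa using h1)
    have hd' : hypVolume m k ((γ⁻¹ • F) ∩ ((1 : Γ) • F)) = 0 := hd
    rw [one_smul] at hd'
    unfold quotVolume
    rw [ae_restrict_iff' hΓ.measurableSet]
    filter_upwards [compl_mem_ae_iff.mpr hd'] with w hw hwF _ hγF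
    refine hw ⟨?_, hwF⟩
    rw [Set.mem_inv_smul_set_iff]
    exact hγF
  filter_upwards [hdis] with w hw
  rw [tsum_eq_single (1 : Γ)]
  · simp
  · intro γ hγ
    rw [image_eq_zero_of_notMem_tsupport fun h => hw γ hγ (hs h)]; rfl

lemma ae_mem_interior : ∀ᵐ w ∂(quotVolume F), w ∈ interior F := by
  have h0 : quotVolume F (frontier F) = 0 := by
    have : quotVolume F ≪ volume := Measure.restrict_le_self.absolutelyContinuous.trans
      ((withDensity_absolutelyContinuous _ _).trans Measure.restrict_le_self.absolutelyContinuous)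
    exact this hΓ.frontier_null
  filter_upwards [hΓ.ae_mem, compl_mem_ae_iff.mpr h0] with w h1 h2
  by_contra h
  exact h2 ⟨subset_closure h1, h⟩

/-- A function orthogonal to the periodisations of all bumps supported inside `F` vanishes a.e. on the
interior of `F`, whose boundary is a null set. -/
lemma dense_testFunctions : Dense {u : L2 F | ∃ φ : Pt m k → ℂ, IsTestFunction Γ φ ∧
    u =ᵐ[quotVolume F] φ} := by
  set V : Submodule ℂ (L2 F) := hΓ.testGraph.map (LinearMap.fst ℂ (L2 F) (L2 F)) with hV
  have hVs : (V : Set (L2 F)) ⊆ {u : L2 F | ∃ φ : Pt m k → ℂ, IsTestFunction Γ φ ∧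
      u =ᵐ[quotVolume F] φ} := by
    rintro _ ⟨p, ⟨φ, hφ, h1, -⟩, rfl⟩
    exact ⟨φ, hφ, h1⟩
  have hVm : ∀ {φ : Pt m k → ℂ} (hφ : IsTestFunction Γ φ), hΓ.toL2 hφ ∈ V := fun hφ =>
    ⟨(hΓ.toL2 hφ, hΓ.toL2 (hΓ.isTestFunction_hypLaplacian hφ)),
      ⟨_, hφ, hΓ.coeFn_toL2 hφ, hΓ.coeFn_toL2 (hΓ.isTestFunction_hypLaplacian hφ)⟩, rfl⟩
  refine Dense.mono hVs ?_
  rw [Submodule.dense_iff_topologicalClosure_eq_top, Submodule.topologicalClosure_eq_top_iff,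
    Submodule.eq_bot_iff]
  intro f hf
  have hloc : LocallyIntegrableOn f (interior F) (quotVolume F) := by
    intro x hx
    have hxH : x ∈ halfSpace m k := hΓ.subset (interior_subset hx)
    obtain ⟨K, hKc, hxK, hKH⟩ := exists_compact_subset isOpen_halfSpace hxH
    refine ⟨K, mem_nhdsWithin_of_mem_nhds (mem_interior_iff_mem_nhds.mp hxK), ?_⟩
    have hfinite : quotVolume F K < ⊤ :=
      (Measure.restrict_apply_le _ _).trans_lt (hypVolume_lt_top hKc hKH)
    have : IsFiniteMeasure ((quotVolume F).restrict K) := ⟨by simpa using hfinite⟩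
    exact ((Lp.memLp f).restrict K).integrable (by norm_num)
  have hz := isOpen_interior.ae_eq_zero_of_integral_contDiff_smul_eq_zero hloc fun g hg hgc hgs => ?_
  · refine Lp.ext ?_
    filter_upwards [hz, hΓ.ae_mem_interior, Lp.coeFn_zero ℂ 2 (quotVolume F)] with w h1 h2 h3
    rw [h1 h2, h3]; rfl
  · have hgF : tsupport g ⊆ F := hgs.trans interior_subset
    have hT := hΓ.isTestFunction_periodize hg hgc (hgF.trans hΓ.subset)
    have h0 := (Submodule.mem_orthogonal V f).mp hf _ (hVm hT)
    rw [L2.inner_def] at h0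
    rw [← h0]
    refine integral_congr_ae ?_
    filter_upwards [hΓ.coeFn_toL2 hT, hΓ.periodize_ae_eq hgF] with w h1 h2
    rw [h1, h2, RCLike.inner_apply, Complex.conj_ofReal, Complex.real_smul, mul_comm]

/-! ### The resolvent -/

/-- The series of powers inverts the Laplacian on test functions. -/
lemma resolvent_testFunction {s : ℂ} (hs : ((m + k : ℕ) : ℝ) / 2 < s.re) {φ : Pt m k → ℂ}
    (hφ : IsTestFunction Γ φ) :
    foldOp Γ F (resFun (m + k) s) (hΓ.toL2 (hΓ.isTestFunction_hypLaplacian hφ) -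
      (s * ((m + k : ℕ) - s)) • hΓ.toL2 hφ) = hΓ.toL2 hφ ∧
    Tendsto (fun J : ℕ => (4 * (s + 2 * J) * (s + 2 * J + 1) * coef (m + k) s J) •
      foldOp Γ F (powKer (s + 2 * J + 2)) (hΓ.toL2 hφ)) atTop (𝓝 (hΓ.toL2 hφ)) := by
  have hΔ := hΓ.isTestFunction_hypLaplacian hφ
  set X : ℕ → L2 F := fun J => (4 * (s + 2 * J) * (s + 2 * J + 1) * coef (m + k) s J) •
      foldOp Γ F (powKer (s + 2 * J + 2)) (hΓ.toL2 hφ) with hX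
  -- the telescoping identity, with the Laplacian moved onto the test function
  have hXs : ∀ J, X J = (∑ j ∈ Finset.range (J + 1), coef (m + k) s j • foldOp Γ F (powKer (s + 2 * j)))
      (hΓ.toL2 hΔ - (s * ((m + k : ℕ) - s)) • hΓ.toL2 hφ) := fun J => by
    have ht := congrArg (fun T : L2 F →L[ℂ] L2 F => T (hΓ.toL2 hφ)) (hΓ.telescope hs J)
    simp only [_root_.smul_apply] at ht
    rw [hX]
    simp only
    rw [← ht, _root_.sum_apply, _root_.sum_apply]
    refine Finset.sum_congr rfl fun j _ => ?_
    rw [_root_.smul_apply, _root_.smul_apply, _root_.sub_apply, _root_.smul_apply, map_sub, map_smul,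
      (hΓ.powKer_graph (re_add_two_mul hs j) hφ).1]
  have hlim : Tendsto X atTop (𝓝 (foldOp Γ F (resFun (m + k) s)
      (hΓ.toL2 hΔ - (s * ((m + k : ℕ) - s)) • hΓ.toL2 hφ))) := by
    have := ((ContinuousLinearMap.apply ℂ (L2 F)
      (hΓ.toL2 hΔ - (s * ((m + k : ℕ) - s)) • hΓ.toL2 hφ)).continuous.tendsto _).comp
      (hΓ.tendsto_foldOp_resSum hs)
    exact this.congr fun J => (hXs J).symm
  have hpt : ∀ᵐ w ∂(quotVolume F), Tendsto (fun J => X J w) atTop (𝓝 (φ w)) := by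
    have hJ : ∀ᵐ w ∂(quotVolume F), ∀ J : ℕ, X J w =
        (4 * (s + 2 * J) * (s + 2 * J + 1) * coef (m + k) s J) *
        ∫ w', powKer (s + 2 * J + 2) (twoCosh w w') * φ w' ∂(hypVolume m k) := by
      rw [ae_all_iff]
      intro J
      obtain ⟨C, hC⟩ := hΓ.schurFun_powKer (re_add_two (re_add_two_mul hs J))
      filter_upwards [hΓ.foldOp_testFunction hC hφ (hΓ.coeFn_toL2 hφ),
        Lp.coeFn_smul (4 * (s + 2 * J) * (s + 2 * J + 1) * coef (m + k) s J)
          (foldOp Γ F (powKer (s + 2 * J + 2)) (hΓ.toL2 hφ))] with w h1 h2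
      rw [hX]
      simp only
      rw [h2, Pi.smul_apply, h1, smul_eq_mul]
    filter_upwards [hJ, hΓ.ae_mem] with w h1 hw
    exact (hΓ.tendsto_approx_identity hs hφ (hΓ.subset hw)).congr fun J => (h1 J).symm
  -- the limit in `L²` and the pointwise limit agree almost everywhere
  have heq : foldOp Γ F (resFun (m + k) s) (hΓ.toL2 hΔ - (s * ((m + k : ℕ) - s)) • hΓ.toL2 hφ) =
      hΓ.toL2 hφ := by
    obtain ⟨ns, hns, hae⟩ := (tendstoInMeasure_of_tendsto_Lp hlim).exists_seq_tendsto_ae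
    refine Lp.ext ?_
    filter_upwards [hae, hpt, hΓ.coeFn_toL2 hφ] with w h1 h2 h3
    rw [h3]
    exact tendsto_nhds_unique h1 (h2.comp hns.tendsto_atTop)
  exact ⟨heq, heq ▸ hlim⟩

/-- For `Re s > n / 2` the operator with kernel `∑_γ R(s; w, γ w')` is the resolvent. -/
theorem isResolvent_foldOp {s : ℂ} (hs : ((m + k : ℕ) : ℝ) / 2 < s.re) :
    IsResolvent Γ F s (foldOp Γ F (resFun (m + k) s)) := by
  set R := foldOp Γ F (resFun (m + k) s) with hR
  set c := s * (((m + k : ℕ) : ℂ) - s) with hc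
  have hclosed : IsClosed (laplacianGraph Γ F) := isClosed_closure
  -- the partial sums give pairs in the closed graph; on test functions the defects converge to `φ`
  have hA : ∀ f : L2 F, (R f, f + c • R f) ∈ laplacianGraph Γ F := by
    have hcl : IsClosed {f : L2 F | (R f, f + c • R f) ∈ laplacianGraph Γ F} :=
      hclosed.preimage (by fun_prop)
    intro f
    have hsub : {u : L2 F | ∃ φ : Pt m k → ℂ, IsTestFunction Γ φ ∧ u =ᵐ[quotVolume F] φ} ⊆
        {f : L2 F | (R f, f + c • R f) ∈ laplacianGraph Γ F} := by
      rintro u ⟨φ, hφ, hu⟩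
      have hu' : u = hΓ.toL2 hφ := Lp.ext (hu.trans (hΓ.coeFn_toL2 hφ).symm)
      rw [hu']
      have hS : Tendsto (fun J : ℕ => (∑ j ∈ Finset.range (J + 1),
          coef (m + k) s j • foldOp Γ F (powKer (s + 2 * j))) (hΓ.toL2 hφ)) atTop
          (𝓝 (R (hΓ.toL2 hφ))) :=
        ((ContinuousLinearMap.apply ℂ (L2 F) (hΓ.toL2 hφ)).continuous.tendsto _).comp
          (hΓ.tendsto_foldOp_resSum hs)
      refine hclosed.mem_of_tendsto (hS.prodMk_nhds
        ((hΓ.resolvent_testFunction hs hφ).2.add (hS.const_smul c))) (Eventually.of_forall fun J => ?_)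
      rw [hΓ.laplacianGraph_eq]
      have hterm : ∀ j : ℕ, coef (m + k) s j • (foldOp Γ F (powKer (s + 2 * j)) (hΓ.toL2 hφ),
          foldOp Γ F (powLap (m + k) (s + 2 * j)) (hΓ.toL2 hφ)) ∈ hΓ.testGraph.topologicalClosure :=
        fun j => by
        refine Submodule.smul_mem _ _ ?_
        have := (hΓ.powKer_graph (re_add_two_mul hs j) hφ).2
        rw [hΓ.laplacianGraph_eq] at this
        exact this
      have hsum := Submodule.sum_mem hΓ.testGraph.topologicalClosure
        (t := Finset.range (J + 1)) fun j _ => hterm j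
      refine Set.mem_of_eq_of_mem (Prod.ext ?_ ?_) hsum
      · rw [Prod.fst_sum, _root_.sum_apply]
        rfl
      · rw [Prod.snd_sum]
        have ht := congrArg (fun T : L2 F →L[ℂ] L2 F => T (hΓ.toL2 hφ)) (hΓ.telescope hs J)
        simp only [_root_.smul_apply, _root_.sum_apply, _root_.sub_apply, smul_sub,
          Finset.sum_sub_distrib] at ht
        simp only [_root_.sum_apply, _root_.smul_apply, Prod.smul_snd]
        rw [← ht, Finset.smul_sum]
        rw [sub_add_eq_add_sub, sub_eq_iff_eq_add]
        congr 1
        refine Finset.sum_congr rfl fun j _ => ?_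
        rw [smul_comm]
    have := hcl.closure_subset_iff.mpr hsub
    exact this (hΓ.dense_testFunctions f)
  -- left inverse: known on test functions, and preserved under closure
  have hB : ∀ p ∈ laplacianGraph Γ F, R (p.2 - c • p.1) = p.1 := by
    have hcl : IsClosed {p : L2 F × L2 F | R (p.2 - c • p.1) = p.1} :=
      isClosed_eq (by fun_prop) (by fun_prop)
    refine fun p hp => (hcl.closure_subset_iff.mpr ?_) hp
    rintro p ⟨φ, hφ, h1, h2⟩
    have e1 : p.1 = hΓ.toL2 hφ := Lp.ext (h1.trans (hΓ.coeFn_toL2 hφ).symm)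
    have e2 : p.2 = hΓ.toL2 (hΓ.isTestFunction_hypLaplacian hφ) :=
      Lp.ext (h2.trans (hΓ.coeFn_toL2 (hΓ.isTestFunction_hypLaplacian hφ)).symm)
    change R (p.2 - c • p.1) = p.1
    rw [e1, e2]
    exact (hΓ.resolvent_testFunction hs hφ).1
  intro f u
  constructor
  · rintro rfl
    exact hA f
  · intro h
    have h2 : R (f + c • u - c • u) = u := hB _ h
    rwa [add_sub_cancel_right] at h2

end CuspLike

end

end ModelCusp

namespace ModelCusp

section

open Filter Topology MeasureTheory Set

open scoped NNReal

/-! ### Holomorphic families of Schur operators -/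

/-- Cauchy's estimates for the derivative and the second order Taylor remainder, with constants that
make them uniform in families of functions. -/
lemma norm_sub_taylor_le {f : ℂ → ℂ} {s₀ : ℂ} {r M : ℝ} (hr : 0 < r)
    (hf : DifferentiableOn ℂ f (Metric.ball s₀ (4 * r))) (hM : ∀ z ∈ Metric.ball s₀ (4 * r), ‖f z‖ ≤ M) :
    ‖deriv f s₀‖ ≤ M / r ∧ ∀ s ∈ Metric.ball s₀ r,
      ‖f s - f s₀ - (s - s₀) * deriv f s₀‖ ≤ M / r / r * ‖s - s₀‖ ^ 2 := by
  have hd : ∀ z ∈ Metric.ball s₀ (4 * r), DifferentiableAt ℂ f z := fun z hz =>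
    (hf z hz).differentiableAt (Metric.isOpen_ball.mem_nhds hz)
  have cauchy : ∀ {g : ℂ → ℂ} {ρ K : ℝ}, DifferentiableOn ℂ g (Metric.ball s₀ (ρ + r)) →
      (∀ z ∈ Metric.ball s₀ (ρ + r), ‖g z‖ ≤ K) → 0 < ρ → ∀ z ∈ Metric.ball s₀ ρ, ‖deriv g z‖ ≤ K / r := by
    intro g ρ K hg hK hρ z hz
    -- Cauchy's estimate on a slightly smaller circle, then a limit
    have hzr : Metric.ball z r ⊆ Metric.ball s₀ (ρ + r) :=
      Metric.ball_subset_ball' (by rw [Metric.mem_ball] at hz; linarith)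
    have key : ∀ q ∈ Ioo 0 r, ‖deriv g z‖ ≤ K / q := fun q hq => by
      refine Complex.norm_deriv_le_of_forall_mem_sphere_norm_le hq.1 ?_ fun w hw => hK w (hzr ?_)
      · refine (hg.mono ((Metric.closedBall_subset_ball hq.2).trans hzr)).diffContOnCl_ball subset_rfl
      · exact Metric.sphere_subset_closedBall.trans (Metric.closedBall_subset_ball hq.2) hw
    have hlim : Tendsto (fun q => K / q) (𝓝[<] r) (𝓝 (K / r)) :=
      (tendsto_const_nhds.div tendsto_id hr.ne').mono_left nhdsWithin_le_nhds
    refine ge_of_tendsto hlim ?_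
    filter_upwards [Ioo_mem_nhdsLT hr] with q hq using key q hq
  have h1 : ∀ z ∈ Metric.ball s₀ (2 * r), ‖deriv f z‖ ≤ M / r :=
    cauchy (hf.mono (Metric.ball_subset_ball (by linarith)))
      (fun z hz => hM z (Metric.ball_subset_ball (by linarith) hz)) (by linarith)
  have hf' : DifferentiableOn ℂ (deriv f) (Metric.ball s₀ (4 * r)) := hf.deriv Metric.isOpen_ball
  have h2 : ∀ z ∈ Metric.ball s₀ r, ‖deriv (deriv f) z‖ ≤ M / r / r :=
    cauchy (hf'.mono (Metric.ball_subset_ball (by linarith)))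
      (fun z hz => h1 z (Metric.ball_subset_ball (by linarith) hz)) hr
  refine ⟨h1 s₀ (Metric.mem_ball_self (by linarith)), fun s hs => ?_⟩
  set K := M / r / r
  have hsub : Metric.closedBall s₀ ‖s - s₀‖ ⊆ Metric.ball s₀ r :=
    Metric.closedBall_subset_ball (by rwa [Metric.mem_ball, dist_eq_norm] at hs)
  have hsub4 : Metric.closedBall s₀ ‖s - s₀‖ ⊆ Metric.ball s₀ (4 * r) :=
    hsub.trans (Metric.ball_subset_ball (by linarith))
  have hs₀ : s₀ ∈ Metric.closedBall s₀ ‖s - s₀‖ := Metric.mem_closedBall_self (norm_nonneg _)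
  have hsm : s ∈ Metric.closedBall s₀ ‖s - s₀‖ := by rw [Metric.mem_closedBall, dist_eq_norm]
  have h3 : ∀ z ∈ Metric.closedBall s₀ ‖s - s₀‖, ‖deriv f z - deriv f s₀‖ ≤ K * ‖s - s₀‖ := fun z hz => by
    refine ((convex_closedBall s₀ _).norm_image_sub_le_of_norm_deriv_le
      (fun w hw => (hf' w (hsub4 hw)).differentiableAt (Metric.isOpen_ball.mem_nhds (hsub4 hw)))
      (fun w hw => h2 w (hsub hw)) hs₀ hz).trans ?_
    have hK0 : 0 ≤ K := (norm_nonneg _).trans (h2 s₀ (Metric.mem_ball_self hr))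
    rw [Metric.mem_closedBall, dist_eq_norm] at hz
    gcongr
  have h4 := (convex_closedBall s₀ ‖s - s₀‖).norm_image_sub_le_of_norm_hasDerivWithin_le
    (f := fun z => f z - (z - s₀) * deriv f s₀) (f' := fun z => deriv f z - 1 * deriv f s₀)
    (C := K * ‖s - s₀‖)
    (fun z hz => ((hd z (hsub4 hz)).hasDerivAt.sub
      (((hasDerivAt_id z).sub_const s₀).mul_const (deriv f s₀))).hasDerivWithinAt)
    (fun z hz => by rw [one_mul]; exact h3 z hz) hs₀ hsm
  have e : f s - f s₀ - (s - s₀) * deriv f s₀ =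
      (f s - (s - s₀) * deriv f s₀) - (f s₀ - (s₀ - s₀) * deriv f s₀) := by ring
  rw [e]
  refine h4.trans_eq ?_
  ring

section abstract

variable {α : Type*} [MeasurableSpace α] {μ : Measure α}

lemma SchurBound.const_mul {θ : α → ENNReal} {κ : α → α → ENNReal} {C : ℝ≥0}
    (h : SchurBound μ θ κ C) (A : ℝ≥0) : SchurBound μ θ (fun x y => A * κ x y) (A * C) where
  left := by
    filter_upwards [h.left] with x hx
    simp only [mul_assoc]
    rw [lintegral_const_mul' _ _ (by simp)]
    push_cast
    rw [mul_assoc]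
    gcongr
  right := by
    filter_upwards [h.right] with x hx
    simp only [mul_assoc]
    rw [lintegral_const_mul' _ _ (by simp)]
    push_cast
    rw [mul_assoc]
    gcongr

/-- A family of integral operators whose kernels are holomorphic in a parameter and dominated by a
kernel that satisfies the Schur test is holomorphic in operator norm. -/
theorem SchurBound.differentiableAt [SFinite μ] {θ : α → ENNReal} {M : α → α → ENNReal} {C : ℝ≥0}
    (hM : SchurBound μ θ M C) (hθ : Measurable θ) (hθ0 : ∀ᵐ x ∂μ, θ x ≠ 0 ∧ θ x ≠ ⊤)
    {κ : ℂ → α → α → ℂ} {s₀ : ℂ} {r : ℝ} (hr : 0 < r)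
    (hmeas : ∀ s ∈ Metric.ball s₀ (4 * r), Measurable (Function.uncurry (κ s)))
    (hhol : ∀ x y, DifferentiableOn ℂ (fun s => κ s x y) (Metric.ball s₀ (4 * r)))
    (hbd : ∀ s ∈ Metric.ball s₀ (4 * r), ∀ x y, ‖κ s x y‖ₑ ≤ M x y)
    {T : ℂ → Lp ℂ 2 μ →L[ℂ] Lp ℂ 2 μ} (hT : ∀ s ∈ Metric.ball s₀ (4 * r), ∀ f : Lp ℂ 2 μ, ∀ᵐ x ∂μ,
      Integrable (fun y => κ s x y * f y) μ ∧ T s f x = ∫ y, κ s x y * f y ∂μ) :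
    DifferentiableAt ℂ T s₀ := by
  have hs₀ : s₀ ∈ Metric.ball s₀ (4 * r) := Metric.mem_ball_self (by linarith)
  set κ' : α → α → ℂ := fun x y => deriv (fun s => κ s x y) s₀ with hκ'
  have hderiv : ∀ x y, HasDerivAt (fun s => κ s x y) (κ' x y) s₀ := fun x y =>
    ((hhol x y s₀ hs₀).differentiableAt (Metric.isOpen_ball.mem_nhds hs₀)).hasDerivAt
  -- the derivative in `s` is measurable as a limit of difference quotients
  have hm' : Measurable (Function.uncurry κ') := by
    have hz : Tendsto (fun N : ℕ => ((r / ((N : ℝ) + 1) : ℝ) : ℂ)) atTop (𝓝[≠] 0) := by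
      refine tendsto_nhdsWithin_iff.mpr ⟨?_, Eventually.of_forall fun N => ?_⟩
      · have : Tendsto (fun N : ℕ => r / ((N : ℝ) + 1)) atTop (𝓝 0) :=
          tendsto_const_nhds.div_atTop (tendsto_atTop_add_const_right _ _ tendsto_natCast_atTop_atTop)
        exact_mod_cast (Complex.continuous_ofReal.tendsto 0).comp this
      · have : r / ((N : ℝ) + 1) ≠ 0 := by positivity
        exact Complex.ofReal_ne_zero.mpr this
    refine measurable_of_tendsto_metrizable
      (f := fun (N : ℕ) p => ((r / ((N : ℝ) + 1) : ℝ) : ℂ)⁻¹ *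
        (κ (s₀ + ((r / ((N : ℝ) + 1) : ℝ) : ℂ)) p.1 p.2 - κ s₀ p.1 p.2)) (fun N => ?_) ?_
    · refine ((hmeas _ ?_).sub (hmeas _ hs₀)).const_mul _
      rw [Metric.mem_ball, dist_eq_norm, add_sub_cancel_left, Complex.norm_of_nonneg (by positivity)]
      have : r / ((N : ℝ) + 1) ≤ r := div_le_self hr.le (by
        have : (0 : ℝ) ≤ N := by positivity
        linarith)
      linarith
    · refine tendsto_pi_nhds.mpr fun p => ?_
      have := (hasDerivAt_iff_tendsto_slope_zero.mp (hderiv p.1 p.2)).comp hz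
      change Tendsto _ _ (𝓝 (κ' p.1 p.2))
      simpa [Function.comp_def] using this
  -- bounds linear in the supremum over the ball carry over to the majorant, also where it is infinite
  have hE : ∀ {A : ℝ}, 0 ≤ A → ∀ {z : ℂ} {x y : α}, (∀ K : ℝ, (∀ s ∈ Metric.ball s₀ (4 * r), ‖κ s x y‖ ≤ K) →
      ‖z‖ ≤ A * K) → 0 < A → ‖z‖ₑ ≤ A.toNNReal * M x y := by
    intro A hA z x y h hA0
    by_cases hMt : M x y = ⊤
    · rw [hMt, ENNReal.mul_top (by simpa using hA0)]; exact le_top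
    have hK := h (M x y).toReal fun s hs => by
      have := hbd s hs x y
      rw [← ofReal_norm] at this
      exact (ENNReal.ofReal_le_iff_le_toReal hMt).mp this
    rw [← ofReal_norm]
    refine (ENNReal.ofReal_le_ofReal hK).trans_eq ?_
    rw [ENNReal.ofReal_mul hA, ENNReal.ofReal_toReal hMt]
    rfl
  have hb' : ∀ x y, ‖κ' x y‖ₑ ≤ (r⁻¹).toNNReal * M x y := fun x y =>
    hE (by positivity) (fun K hK => by
      have := (norm_sub_taylor_le hr (hhol x y) hK).1
      rwa [div_eq_inv_mul] at this) (by positivity)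
  obtain ⟨T', hT'⟩ := ((hM.const_mul (r⁻¹).toNNReal).mono (κ' := fun x y => ‖κ' x y‖ₑ)
    (Eventually.of_forall fun x => Eventually.of_forall fun y => hb' x y)
    (Eventually.of_forall fun x => Eventually.of_forall fun y => hb' y x)).exists_operator hm' hθ hθ0
  have hest : ∀ s ∈ Metric.ball s₀ r, ‖T s - T s₀ - (s - s₀) • T'‖ ≤ (C : ℝ) / r ^ 2 * ‖s - s₀‖ ^ 2 := by
    intro s hs
    by_cases hss : s = s₀
    · simp [hss]
    have hs4 : s ∈ Metric.ball s₀ (4 * r) := Metric.ball_subset_ball (by linarith) hs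
    have hpos : 0 < ‖s - s₀‖ := norm_pos_iff.mpr (sub_ne_zero.mpr hss)
    set κ₂ : α → α → ℂ := fun x y => κ s x y - κ s₀ x y - (s - s₀) * κ' x y with hκ₂
    have hm2 : Measurable (Function.uncurry κ₂) :=
      ((hmeas s hs4).sub (hmeas s₀ hs₀)).sub (hm'.const_mul _)
    have hb2 : ∀ x y, ‖κ₂ x y‖ₑ ≤ (‖s - s₀‖ ^ 2 / r ^ 2).toNNReal * M x y := fun x y =>
      hE (by positivity) (fun K hK => by
        refine ((norm_sub_taylor_le hr (hhol x y) hK).2 s hs).trans_eq ?_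
        field_simp) (by positivity)
    have := ((hM.const_mul _).mono (κ' := fun x y => ‖κ₂ x y‖ₑ)
      (Eventually.of_forall fun x => Eventually.of_forall fun y => hb2 x y)
      (Eventually.of_forall fun x => Eventually.of_forall fun y => hb2 y x)).norm_le hm2 hθ hθ0
      (T := T s - T s₀ - (s - s₀) • T') fun f => ?_
    · refine this.trans_eq ?_
      rw [NNReal.coe_mul, Real.coe_toNNReal _ (by positivity)]
      ring
    · filter_upwards [hT s hs4 f, hT s₀ hs₀ f, hT' f, Lp.coeFn_sub (T s f - T s₀ f) ((s - s₀) • T' f),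
        Lp.coeFn_sub (T s f) (T s₀ f), Lp.coeFn_smul (s - s₀) (T' f)] with x h1 h2 h3 h4 h5 h6
      have e : (T s - T s₀ - (s - s₀) • T') f = T s f - T s₀ f - (s - s₀) • T' f := rfl
      rw [e, h4, Pi.sub_apply, h5, Pi.sub_apply, h6, Pi.smul_apply, h1.2, h2.2, h3.2, smul_eq_mul,
        ← integral_const_mul, ← integral_sub h1.1 h2.1]
      have h7 := integral_sub (h1.1.sub h2.1) (h3.1.const_mul (s - s₀))
      simp only [Pi.sub_apply] at h7
      rw [← h7]
      refine integral_congr_ae (Eventually.of_forall fun y => ?_)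
      simp only [hκ₂]
      ring
  refine HasDerivAt.differentiableAt (f' := T') ?_
  rw [hasDerivAt_iff_isLittleO]
  have hO : (fun s => T s - T s₀ - (s - s₀) • T') =O[𝓝 s₀] fun s => ‖s - s₀‖ ^ 2 := by
    refine Asymptotics.IsBigO.of_bound ((C : ℝ) / r ^ 2) ?_
    filter_upwards [Metric.ball_mem_nhds s₀ hr] with s hs
    rw [Real.norm_of_nonneg (by positivity : (0 : ℝ) ≤ ‖s - s₀‖ ^ 2)]
    exact hest s hs
  refine hO.trans_isLittleO ?_
  have h1 : Tendsto (fun s : ℂ => ‖s - s₀‖) (𝓝 s₀) (𝓝 0) := by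
    have : Continuous fun s : ℂ => ‖s - s₀‖ := by fun_prop
    simpa using this.tendsto s₀
  refine Asymptotics.isLittleO_iff.mpr fun c hc => ?_
  filter_upwards [h1.eventually (gt_mem_nhds hc)] with s hs
  rw [Real.norm_of_nonneg (by positivity), pow_two]
  gcongr

end abstract

/-! ### Holomorphy of the kernels -/

lemma differentiableOn_powKer {T : ℝ} (hT : 0 < T) (j : ℕ) :
    Differentiable ℂ fun s => powKer (s + 2 * j) T := by
  unfold powKer
  have : (T : ℂ) ≠ 0 := by exact_mod_cast hT.ne'
  exact fun s => DifferentiableAt.const_cpow (by fun_prop) (Or.inl this)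

lemma differentiableOn_resFun {n : ℕ} (hn : 0 < n) (T : ℝ) :
    DifferentiableOn ℂ (fun s => resFun n s T) {s | 0 < s.re} := by
  by_cases hT : 2 < T
  · intro s₀ hs₀
    have hopen : IsOpen {s : ℂ | 0 < s.re} := isOpen_lt continuous_const Complex.continuous_re
    obtain ⟨ε, hε, hball⟩ := Metric.nhds_basis_closedBall.mem_iff.mp (hopen.mem_nhds hs₀)
    obtain ⟨D, hD, hD0, hb⟩ := exists_term_bound hn (isCompact_closedBall s₀ ε) (fun s hs => hball hs) hT
    have hT0 : 0 < T := by linarith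
    have h := Complex.differentiableOn_tsum_of_summable_norm (F := fun (j : ℕ) s => coef n s j * powKer (s + 2 * j) T)
      (U := Metric.ball s₀ ε) hD (fun j s hs => ?_) Metric.isOpen_ball fun j s hs => ?_
    · have := (h s₀ (Metric.mem_ball_self hε)).differentiableAt (Metric.ball_mem_nhds s₀ hε)
      simp only [resFun, if_pos hT]
      exact this.differentiableWithinAt
    · exact ((coef_differentiableAt (hball (Metric.ball_subset_closedBall hs)) j).mul
        (differentiableOn_powKer hT0 j s)).differentiableWithinAt
    · have hs' := Metric.ball_subset_closedBall hs
      refine (hb s hs' T le_rfl j).trans (mul_le_of_le_one_right (hD0 j) ?_)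
      exact Real.rpow_le_one_of_one_le_of_nonpos (by linarith)
        (by have : 0 < s.re := hball hs'
            linarith)
  · simp only [resFun, if_neg hT]
    exact differentiableOn_const 0

namespace CuspLike

variable {m k : ℕ} {Γ : Subgroup (Equiv.Perm (Pt m k))} {F : Set (Pt m k)} {a : ℝ} (hΓ : CuspLike Γ F a)
include hΓ

/-- The folded kernel is holomorphic for `Re s > a`; on the diagonal this relies on the value `0`
given to singular terms. -/
lemma differentiableOn_foldKer (w w' : Pt m k) :
    DifferentiableOn ℂ (fun s => foldKer Γ (resFun (m + k) s) w w') {s | a < s.re} := by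
  by_cases hww : 0 < w.1 ∧ 0 < w'.1
  swap
  · simp only [foldKer, hww, if_false, tsum_zero]
    exact differentiableOn_const 0
  have hw : w ∈ halfSpace m k := hww.1
  have hw' : w' ∈ halfSpace m k := hww.2
  have hT : ∀ γ : Γ, 2 ≤ twoCosh w (γ.1 w') := fun γ =>
    two_le_twoCosh hw ((hΓ.apply_mem γ.2).mpr hw')
  intro s₀ hs₀
  have hs₀' : a < s₀.re := hs₀
  have ha := hΓ.nonneg
  set σ := (a + s₀.re) / 2 with hσ
  have hopen : IsOpen {s : ℂ | σ < s.re} := isOpen_lt continuous_const Complex.continuous_re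
  obtain ⟨ε, hε, hball⟩ := Metric.nhds_basis_closedBall.mem_iff.mp
    (hopen.mem_nhds (show σ < s₀.re by rw [hσ]; linarith))
  have hpos : ∀ s ∈ Metric.closedBall s₀ ε, 0 < s.re := fun s hs => by
    have : σ < s.re := hball hs
    linarith
  obtain ⟨C, hC0, hC⟩ := exists_resFun_bound hΓ.dim_pos (isCompact_closedBall s₀ ε) hpos
    (r := 3) (by norm_num)
  have hcpt : ∀ γ : Γ, ∃ B : ℝ, ∀ s ∈ Metric.closedBall s₀ ε,
      ‖resFun (m + k) s (twoCosh w (γ.1 w'))‖ ≤ B := fun γ =>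
    (isCompact_closedBall s₀ ε).exists_bound_of_continuousOn
      (((differentiableOn_resFun hΓ.dim_pos _).mono hpos).continuousOn)
  choose B hB using hcpt
  have hfin : {γ : Γ | twoCosh w (γ.1 w') < 3}.Finite := by
    refine (hΓ.finite_near (max ‖w‖ ‖w'‖) (3 * (w.1 * w'.1))).subset fun γ hγ => ?_
    refine ⟨w, w', le_max_left _ _, le_max_right _ _, ?_⟩
    have : twoCosh w (γ.1 w') < 3 := hγ
    have e : (γ.1 w').1 = w'.1 := hΓ.apply_fst γ.2 w'
    rw [twoCosh, e, div_lt_iff₀ (mul_pos hww.1 hww.2)] at this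
    exact this.le
  classical
  have hu : Summable fun γ : Γ => C * twoCosh w (γ.1 w') ^ (-σ) +
      (if twoCosh w (γ.1 w') < 3 then |B γ| else 0) := by
    refine ((hΓ.summable_twoCosh_rpow (by rw [hσ]; linarith) hw hw').mul_left C).add ?_
    refine summable_of_hasFiniteSupport (hfin.subset fun γ hγ => ?_)
    by_contra h
    exact hγ (if_neg h)
  have h := Complex.differentiableOn_tsum_of_summable_norm
    (F := fun (γ : Γ) s => resFun (m + k) s (twoCosh w (γ.1 w')))
    (U := Metric.ball s₀ ε) hu (fun γ => (differentiableOn_resFun hΓ.dim_pos _).mono fun s hs =>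
      hpos s (Metric.ball_subset_closedBall hs)) Metric.isOpen_ball fun γ s hs => ?_
  · have := (h s₀ (Metric.mem_ball_self hε)).differentiableAt (Metric.ball_mem_nhds s₀ hε)
    simp only [foldKer_eq _ hw hw']
    exact this.differentiableWithinAt
  · have hs' := Metric.ball_subset_closedBall hs
    have hTγ := hT γ
    split_ifs with h3
    · have : 0 ≤ C * twoCosh w (γ.1 w') ^ (-σ) :=
        mul_nonneg hC0.le (Real.rpow_nonneg (by linarith) _)
      exact (hB γ s hs').trans ((le_abs_self _).trans (by linarith))
    · rw [add_zero]
      refine (hC s hs' _ (not_lt.mp h3)).trans ?_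
      refine mul_le_mul_of_nonneg_left (Real.rpow_le_rpow_of_exponent_le (by linarith) ?_) hC0.le
      have : σ < s.re := hball hs'
      linarith

end CuspLike

end

end ModelCusp

namespace ModelCusp

section

open Filter Topology MeasureTheory Set

open scoped NNReal

variable {m k : ℕ}

/-! ### Continuation of the resolvent in weighted spaces -/

/-- The points of `ℍⁿ⁺¹` with a translate in the ball of radius `B`. -/
def nearSet (Γ : Subgroup (Equiv.Perm (Pt m k))) (B : ℝ) : Set (Pt m k) :=
  {w | w ∈ halfSpace m k ∧ ∃ γ : Γ, ‖γ.1 w‖ ≤ B}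

/-- The weight `ρ^N χ`, extended by zero from `ℍⁿ⁺¹` to a measurable function. -/
noncomputable def weightInd (N : ℝ) (χ : Pt m k → ℂ) : Pt m k → ℂ :=
  (halfSpace m k).indicator (weight N χ)

/-- The continued kernel with weights on both sides. -/
noncomputable def weightedKer (Γ : Subgroup (Equiv.Perm (Pt m k))) (N : ℝ) (χ : Pt m k → ℂ) (s : ℂ)
    (w w' : Pt m k) : ℂ :=
  weightInd N χ w * foldKer Γ (resFun (m + k) s) w w' * weightInd N χ w'

namespace CuspLike

variable {Γ : Subgroup (Equiv.Perm (Pt m k))} {F : Set (Pt m k)} {a : ℝ} (hΓ : CuspLike Γ F a)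
include hΓ

lemma measurableSet_nearSet (B : ℝ) : MeasurableSet (nearSet Γ B) := by
  have := hΓ.countable
  have e : nearSet Γ B = halfSpace m k ∩ ⋃ γ : Γ, γ.1 ⁻¹' Metric.closedBall 0 B := by
    ext w
    simp only [nearSet, mem_inter_iff, mem_iUnion, mem_preimage, mem_closedBall_zero_iff]
    rfl
  rw [e]
  exact measurableSet_halfSpace.inter (MeasurableSet.iUnion fun γ =>
    (hΓ.continuous_apply γ).measurable Metric.isClosed_closedBall.measurableSet)

lemma fst_le_of_nearSet {B : ℝ} {w : Pt m k} (hw : w ∈ nearSet Γ B) : w.1 ≤ B := by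
  obtain ⟨-, γ, h⟩ := hw
  rw [← hΓ.apply_fst γ.2 w]
  exact (le_abs_self _).trans ((norm_fst_le _).trans h)

/-- A cut-off is bounded and lives on the translates of a ball. -/
lemma exists_cutoff_bound {χ : Pt m k → ℂ} (hχ : IsCutoff Γ χ) : ∃ B ≥ 1,
    (∀ w ∈ halfSpace m k, χ w ≠ 0 → w ∈ nearSet Γ B) ∧ ∀ w ∈ closedHalfSpace m k, ‖χ w‖ ≤ B := by
  obtain ⟨⟨hc, hinv⟩, K, hKH, hK, hsupp⟩ := hχ
  obtain ⟨B₁, hB₁⟩ := hK.exists_bound_of_continuousOn (hc.continuousOn.mono hKH)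
  obtain ⟨B₂, hB₂⟩ := hK.isBounded.exists_norm_le
  refine ⟨max 1 (max B₁ B₂), le_max_left _ _, fun w hw h => ?_, fun w hw => ?_⟩
  · obtain ⟨γ, hγ, hK'⟩ := hsupp w (show 0 ≤ w.1 from le_of_lt hw) h
    exact ⟨hw, ⟨γ, hγ⟩, (hB₂ _ hK').trans ((le_max_right _ _).trans (le_max_right _ _))⟩
  · by_cases h : χ w = 0
    · rw [h, norm_zero]; positivity
    · obtain ⟨γ, hγ, hK'⟩ := hsupp w hw h
      rw [← hinv γ hγ w hw]
      exact (hB₁ _ hK').trans ((le_max_left _ _).trans (le_max_right _ _))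

omit hΓ in
lemma measurable_weightInd (N : ℝ) {χ : Pt m k → ℂ} (hχ : IsCutoff Γ χ) : Measurable (weightInd N χ) := by
  classical
  rw [weightInd, ← piecewise_eq_indicator]
  refine ContinuousOn.measurable_piecewise ?_ continuousOn_const measurableSet_halfSpace
  have h1 : ContinuousOn χ (halfSpace m k) := hχ.1.1.continuousOn.mono fun w hw => show 0 ≤ w.1 from le_of_lt hw
  refine ContinuousOn.mul (Complex.continuous_ofReal.comp_continuousOn ?_) h1
  have h2 : ∀ w ∈ halfSpace m k, w.1 + 1 ≠ 0 := fun w hw => by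
    have : 0 < w.1 := hw
    positivity
  refine ContinuousOn.rpow_const (continuousOn_fst.div (by fun_prop) h2) fun w hw => Or.inl ?_
  have : 0 < w.1 := hw
  positivity

omit hΓ in
lemma norm_weightInd_le {N B : ℝ} (hN : 0 < N) {χ : Pt m k → ℂ} (hB : ∀ w ∈ closedHalfSpace m k, ‖χ w‖ ≤ B)
    {w : Pt m k} (hw : w ∈ halfSpace m k) : ‖weightInd N χ w‖ ≤ B * w.1 ^ N := by
  have hx : 0 < w.1 := hw
  rw [weightInd, indicator_of_mem hw, weight, norm_mul, Complex.norm_of_nonneg (by positivity), mul_comm]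
  have : w.1 / (w.1 + 1) ≤ w.1 := div_le_self hx.le (by linarith)
  have hb := hB w hx.le
  have : 0 ≤ B := (norm_nonneg _).trans hb
  gcongr

/-- The part of the orbit sum away from the diagonal is bounded on bounded sets and their
translates. -/
lemma exists_far_bound {σ : ℝ} (hσ : a < σ) (B : ℝ) : ∃ A : ℝ, 0 < A ∧ ∀ w ∈ nearSet Γ B, ∀ w' ∈ nearSet Γ B,
    ∑' γ : Γ, (Ioi (1 : ℝ)).indicator (fun q => ENNReal.ofReal (q ^ (-σ)))
      (quad w (γ.1 w')) ≤ ENNReal.ofReal A := by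
  obtain ⟨b, hb1, hb2, hb3⟩ := hΓ.growth
  obtain ⟨c, hc, hb⟩ := hb3 B
  have ha := hΓ.nonneg
  have hsum := (hb2 σ hσ).mul_left ((c / 2) ^ (-σ))
  have hb0 : ∀ γ, 0 < b γ := fun γ => lt_of_lt_of_le one_pos (hb1 γ)
  refine ⟨∑' γ, (c / 2) ^ (-σ) * b γ ^ (-σ) + 1,
    add_pos_of_nonneg_of_pos (tsum_nonneg fun γ => by have := hb0 γ; positivity) one_pos, ?_⟩
  rintro w ⟨hw, δ, hδ⟩ w' ⟨hw', δ', hδ'⟩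
  have e : ∀ f : ℝ → ENNReal, ∑' γ : Γ, f (quad w (γ.1 w')) =
      ∑' γ : Γ, f (quad ((δ : Equiv.Perm (Pt m k)) w) (γ.1
        ((δ' : Equiv.Perm (Pt m k)) w'))) := fun f => by
    rw [← ((Equiv.mulLeft δ⁻¹).trans (Equiv.mulRight δ')).tsum_eq]
    refine tsum_congr fun γ => ?_
    rw [hΓ.quad_apply_left]
    simp
  rw [e]
  refine le_trans ?_ (ENNReal.ofReal_le_ofReal (le_add_of_nonneg_right zero_le_one))
  rw [ENNReal.ofReal_tsum_of_nonneg (fun γ => by have := hb0 γ; positivity) hsum]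
  refine ENNReal.tsum_le_tsum fun γ => ?_
  have hq := hb γ _ _ hδ hδ'
  by_cases h1 : 1 < quad ((δ : Equiv.Perm (Pt m k)) w) (γ.1
        ((δ' : Equiv.Perm (Pt m k)) w'))
  · rw [indicator_of_mem (show _ ∈ Ioi (1 : ℝ) from h1)]
    refine ENNReal.ofReal_le_ofReal ?_
    have := hb0 γ
    rw [← Real.mul_rpow (by positivity) (by positivity)]
    exact Real.rpow_le_rpow_of_nonpos (by positivity) (by linarith) (by linarith)
  · rw [indicator_of_notMem (show _ ∉ Ioi (1 : ℝ) from h1)]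
    exact zero_le

/-- `x^p` is integrable against `x^{n/2}` over the image in the quotient of a bounded set. -/
lemma lintegral_nearSet {p : ℝ} (hp : ((m + k : ℕ) : ℝ) / 2 < p) (B : ℝ) :
    ∫⁻ w, (nearSet Γ B).indicator (fun w => ENNReal.ofReal (w.1 ^ p)) w * schurWeight m k w
      ∂(quotVolume F) ≠ ⊤ := by
  have hp0 : 0 ≤ p := le_trans (by positivity) hp.le
  set f : Pt m k → ENNReal := (Metric.closedBall 0 B).indicator (fun w => ENNReal.ofReal (w.1 ^ p) * schurWeight m k w)
  have hf : Measurable f := ((measurable_fst.pow_const p).ennreal_ofReal.mul measurable_schurWeight).indicator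
    Metric.isClosed_closedBall.measurableSet
  have h1 : ∫⁻ w, (nearSet Γ B).indicator (fun w => ENNReal.ofReal (w.1 ^ p)) w * schurWeight m k w
      ∂(quotVolume F) ≤ ∫⁻ w, f w ∂(hypVolume m k) := by
    rw [← hΓ.lintegral_fold hf]
    refine lintegral_mono fun w => ?_
    by_cases hw : w ∈ nearSet Γ B
    · rw [indicator_of_mem hw]
      obtain ⟨-, γ, hγ⟩ := hw
      refine le_trans (le_of_eq ?_) (ENNReal.le_tsum γ)
      simp only [f]
      rw [indicator_of_mem (mem_closedBall_zero_iff.mpr hγ), hΓ.schurWeight_apply, hΓ.apply_fst γ.2]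
    · rw [indicator_of_notMem hw, zero_mul]; exact zero_le
  refine ne_top_of_le_ne_top ?_ h1
  set w₀ : Pt m k := (1, 0, 0)
  have hw₀ : w₀ ∈ halfSpace m k := one_pos (α := ℝ)
  have h2 : ∫⁻ w, f w ∂(hypVolume m k) ≤ ∫⁻ w, ENNReal.ofReal ((1 + 3 * B ^ 2) ^ p) *
      (ENNReal.ofReal (twoCosh w₀ w ^ (-p)) * ENNReal.ofReal (w.1 ^ (((m + k : ℕ) : ℝ) / 2))) ∂(hypVolume m k) := by
    refine lintegral_mono_ae ?_
    filter_upwards [ae_hypVolume_mem] with w hw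
    by_cases hB : w ∈ Metric.closedBall (0 : Pt m k) B
    · simp only [f]
      rw [indicator_of_mem hB, ← mul_assoc, ← ENNReal.ofReal_mul (by positivity)]
      unfold schurWeight
      gcongr
      have hx : 0 < w.1 := hw
      have hT := two_le_twoCosh hw₀ hw
      rw [mem_closedBall_zero_iff] at hB
      have n1 : ‖w.1‖ ≤ B := (norm_fst_le w).trans hB
      have n2 : ‖w.2.1‖ ≤ B := (norm_fst_le w.2).trans ((norm_snd_le w).trans hB)
      have n3 : ‖w.2.2‖ ≤ B := (norm_snd_le w.2).trans ((norm_snd_le w).trans hB)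
      have hq : w.1 * twoCosh w₀ w ≤ 1 + 3 * B ^ 2 := by
        have e : w.1 * twoCosh w₀ w = 1 + ‖w.1‖ ^ 2 + ‖w.2.1‖ ^ 2 + ‖w.2.2‖ ^ 2 := by
          simp only [twoCosh, quad, w₀, one_mul, zero_sub, norm_neg, one_pow, Real.norm_eq_abs, sq_abs]
          field_simp
        rw [e]
        have m1 := pow_le_pow_left₀ (norm_nonneg _) n1 2
        have m2 := pow_le_pow_left₀ (norm_nonneg _) n2 2
        have m3 := pow_le_pow_left₀ (norm_nonneg _) n3 2
        linarith
      calc w.1 ^ p = (w.1 * twoCosh w₀ w) ^ p * twoCosh w₀ w ^ (-p) := by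
            rw [Real.mul_rpow hx.le (by linarith), Real.rpow_neg (by linarith)]
            have : twoCosh w₀ w ^ p ≠ 0 := (Real.rpow_pos_of_pos (by linarith) _).ne'
            field_simp
        _ ≤ _ := by
            have : 0 ≤ w.1 * twoCosh w₀ w := by positivity
            have : 0 ≤ twoCosh w₀ w ^ (-p) := Real.rpow_nonneg (by linarith) _
            gcongr
    · simp only [f]
      rw [indicator_of_notMem hB]
      exact zero_le
  refine ne_top_of_le_ne_top ?_ h2
  rw [lintegral_const_mul' _ _ ENNReal.ofReal_ne_top, lintegral_twoCosh_rpow hp hw₀]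
  exact ENNReal.mul_ne_top ENNReal.ofReal_ne_top (ENNReal.mul_ne_top ENNReal.ofReal_ne_top ENNReal.ofReal_ne_top)

omit hΓ in
/-- A bound for one term: close to the diagonal `(x x')^N` improves the decay in `2 cosh d`, away
from it the kernel is bounded by a product. -/
lemma enorm_resFun_mul_le {s : ℂ} {σ N C R : ℝ} {D : ℕ → ℝ} (hN : 0 < N) (hs : σ ≤ s.re) (hC : 0 ≤ C)
    (hR : 1 ≤ R) (hD : ∀ j, ‖coef (m + k) s j‖ ≤ D j) (hn : 0 < m + k) (hs0 : 0 < s.re)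
    (hb : ∀ T ≥ 3, ‖resFun (m + k) s T‖ ≤ C * T ^ (-s.re)) {T X : ℝ} (hX : 0 < X) (hXR : X ≤ R) :
    ‖resFun (m + k) s T‖ₑ * ENNReal.ofReal (X ^ N) ≤
      ENNReal.ofReal ((3 * R) ^ N) * ∑' j : ℕ, ENNReal.ofReal (D j * T ^ (-(N + σ + 2 * j))) +
      ENNReal.ofReal (C * X ^ (N + σ)) * (Ioi (1 : ℝ)).indicator (fun q => ENNReal.ofReal (q ^ (-σ))) (T * X) := by
  by_cases hT : 2 < T
  swap
  · simp [resFun, hT]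
  have hT0 : 0 < T := by linarith
  have hD0 : ∀ j, 0 ≤ D j := fun j => (norm_nonneg _).trans (hD j)
  -- `T X` is the quadratic form `Q`; where it is bounded, `X^N` is at most a constant times `T^{-N}`
  by_cases hQ : T * X ≤ 3 * R
  · refine le_trans ?_ (le_add_of_nonneg_right zero_le)
    have hsm := summable_resFun hn hs0 hT
    have h1 : ‖resFun (m + k) s T‖ₑ ≤ ∑' j : ℕ, ENNReal.ofReal (D j * T ^ (-(σ + 2 * j))) := by
      rw [resFun, if_pos hT, ← ofReal_norm]
      refine (ENNReal.ofReal_le_ofReal (norm_tsum_le_tsum_norm hsm)).trans ?_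
      rw [ENNReal.ofReal_tsum_of_nonneg (fun _ => norm_nonneg _) hsm]
      refine ENNReal.tsum_le_tsum fun j => ENNReal.ofReal_le_ofReal ?_
      rw [norm_mul, norm_powKer hT0]
      have e : (s + 2 * j).re = s.re + 2 * j := by simp
      rw [e]
      have hj := hD j
      have hj0 := hD0 j
      have : (1 : ℝ) ≤ T := by linarith
      gcongr
    refine (mul_le_mul_left h1 _).trans ?_
    rw [mul_comm, ← ENNReal.tsum_mul_left, ← ENNReal.tsum_mul_left]
    refine ENNReal.tsum_le_tsum fun j => ?_
    rw [← ENNReal.ofReal_mul (by positivity), ← ENNReal.ofReal_mul (by positivity)]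
    refine ENNReal.ofReal_le_ofReal ?_
    have e : X ^ N = (T * X) ^ N * T ^ (-N) := by
      rw [Real.mul_rpow hT0.le hX.le, Real.rpow_neg hT0.le]
      have : T ^ N ≠ 0 := (Real.rpow_pos_of_pos hT0 _).ne'
      field_simp
    have e2 : T ^ (-(N + σ + 2 * j)) = T ^ (-N) * T ^ (-(σ + 2 * j)) := by
      rw [← Real.rpow_add hT0]; congr 1; ring
    rw [e, e2]
    have h0 := hD0 j
    calc _ = (T * X) ^ N * (D j * (T ^ (-N) * T ^ (-(σ + 2 * j)))) := by ring
      _ ≤ _ := by gcongr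
  · push Not at hQ
    refine le_trans ?_ (le_add_of_nonneg_left zero_le)
    have hT3 : 3 ≤ T := by
      by_contra h
      push Not at h
      have : T * X ≤ 3 * R := by gcongr
      linarith
    rw [indicator_of_mem (show T * X ∈ Ioi (1 : ℝ) from lt_of_le_of_lt (by linarith) hQ), ← ofReal_norm,
      ← ENNReal.ofReal_mul (norm_nonneg _), ← ENNReal.ofReal_mul (by positivity)]
    refine ENNReal.ofReal_le_ofReal ?_
    calc ‖resFun (m + k) s T‖ * X ^ N ≤ (C * T ^ (-σ)) * X ^ N := by
          refine mul_le_mul_of_nonneg_right ((hb T hT3).trans ?_) (by positivity)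
          have : (1 : ℝ) ≤ T := by linarith
          gcongr
      _ = C * X ^ (N + σ) * (T * X) ^ (-σ) := by
          have : X ^ σ * X ^ (-σ) = 1 := by rw [← Real.rpow_add hX]; simp
          rw [Real.mul_rpow hT0.le hX.le, Real.rpow_add hX]
          linear_combination (- C * T ^ (-σ) * X ^ N) * this

/-- The weighted kernels are, locally uniformly in `s`, dominated by a kernel that satisfies the
Schur test. -/
lemma exists_weighted_majorant {N : ℝ} (hN : 0 < N) {χ : Pt m k → ℂ} (hχ : IsCutoff Γ χ) {s₀ : ℂ}
    (h₁ : a < s₀.re) (h₂ : ((m + k : ℕ) : ℝ) / 2 - N < s₀.re) :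
    ∃ r > 0, ∃ (C : ℝ≥0) (M : Pt m k → Pt m k → ENNReal), SchurBound (quotVolume F) (schurWeight m k) M C ∧
      ∀ s ∈ Metric.ball s₀ (4 * r), a < s.re ∧ ((m + k : ℕ) : ℝ) / 2 - N < s.re ∧
        ∀ w w', ‖weightedKer Γ N χ s w w'‖ₑ ≤ M w w' := by
  have ha := hΓ.nonneg
  obtain ⟨σ, hσ, hσ₀⟩ := exists_between (max_lt h₁ h₂)
  rw [max_lt_iff] at hσ
  set p := N + σ with hp
  have hpn : ((m + k : ℕ) : ℝ) / 2 < p := by linarith [hσ.2]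
  have hp0 : 0 ≤ p := le_trans (by positivity) hpn.le
  have hopen : IsOpen {s : ℂ | σ < s.re} := isOpen_lt continuous_const Complex.continuous_re
  obtain ⟨ε, hε, hball⟩ := Metric.nhds_basis_closedBall.mem_iff.mp (hopen.mem_nhds hσ₀)
  have hre : ∀ s ∈ Metric.closedBall s₀ ε, 0 < s.re := fun s hs => by
    have : σ < s.re := hball hs
    linarith [hσ.1]
  obtain ⟨B₁, hB₁, hcoef⟩ := exists_coef_bound_schur (m + k) hΓ.dim_pos (isCompact_closedBall s₀ ε) hre hpn
  obtain ⟨C₁, hC₁, hres⟩ := exists_resFun_bound hΓ.dim_pos (isCompact_closedBall s₀ ε) hre (r := 3) (by norm_num)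
  obtain ⟨B, hB, hsupp, hχB⟩ := hΓ.exists_cutoff_bound hχ
  obtain ⟨A, hA, hfar⟩ := hΓ.exists_far_bound hσ.1 B
  have hschur : ∀ j : ℕ, 0 < schurR (m + k) (p + 2 * j) := fun j => schurR_pos (by
    have : (0 : ℝ) ≤ j := by positivity
    linarith)
  set D : ℕ → ℝ := fun j => B₁ / ((j : ℝ) + 1) ^ 2 / schurR (m + k) (p + 2 * j) with hDdef
  have hD0 : ∀ j, 0 ≤ D j := fun j => by have := hschur j; positivity
  have hD : ∀ s ∈ Metric.closedBall s₀ ε, ∀ j, ‖coef (m + k) s j‖ ≤ D j := fun s hs j => by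
    rw [hDdef, le_div_iff₀ (hschur j)]; exact hcoef s hs j
  have hb : Summable fun j : ℕ => B₁ / ((j : ℝ) + 1) ^ 2 := by
    simpa [div_eq_mul_inv] using summable_inv_sq.mul_left B₁
  set mE : ℝ → ENNReal := fun T => ∑' j : ℕ, ENNReal.ofReal (D j * T ^ (-(p + 2 * j))) with hmE
  have hmEm : Measurable mE := Measurable.tsum fun j => by fun_prop
  have hSK := schurKer_series (m := m) (k := k) hpn hD0 hb fun j => (div_mul_cancel₀ _ (hschur j).ne').le
  set C₂ := (∑' j : ℕ, B₁ / ((j : ℝ) + 1) ^ 2).toNNReal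
  set U := nearSet Γ B with hU
  set g : Pt m k → ENNReal := U.indicator fun w => ENNReal.ofReal (w.1 ^ p) with hg
  have hgm : Measurable g := ((measurable_fst.pow_const p).ennreal_ofReal).indicator (hΓ.measurableSet_nearSet B)
  set I := ∫⁻ w, g w * schurWeight m k w ∂(quotVolume F)
  have hI : I ≠ ⊤ := hΓ.lintegral_nearSet hpn B
  have hgθ : ∀ w, g w ≤ ENNReal.ofReal (B ^ (p - ((m + k : ℕ) : ℝ) / 2)) * schurWeight m k w := fun w => by
    by_cases hw : w ∈ U
    · rw [hg, indicator_of_mem hw, schurWeight, ← ENNReal.ofReal_mul (by positivity)]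
      have hx : 0 < w.1 := hw.1
      have := hΓ.fst_le_of_nearSet hw
      refine ENNReal.ofReal_le_ofReal ?_
      have e : w.1 ^ p = w.1 ^ (p - ((m + k : ℕ) : ℝ) / 2) * w.1 ^ (((m + k : ℕ) : ℝ) / 2) := by
        rw [← Real.rpow_add hx]; congr 1; ring
      rw [e]
      have : 0 ≤ p - ((m + k : ℕ) : ℝ) / 2 := by linarith
      gcongr
    · rw [hg, indicator_of_notMem hw]; exact zero_le
  set A₁ : ℝ≥0 := (B ^ 2 * (3 * B ^ 2) ^ N).toNNReal with hA₁
  set A₂ : ℝ≥0 := (B ^ 2 * (C₁ * A)).toNNReal with hA₂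
  set A₃ : ℝ≥0 := (B ^ (p - ((m + k : ℕ) : ℝ) / 2)).toNNReal with hA₃
  -- a folded Schur kernel for the part near the diagonal plus a kernel of rank one for the rest
  refine ⟨ε / 4, by positivity, A₁ * C₂ + A₂ * A₃ * I.toNNReal, fun w w' => A₁ * (∑' γ : Γ,
    mE (twoCosh w (γ.1 w'))) + A₂ * (g w * g w'), ?_, ?_⟩
  · have hleft : ∀ w ∈ F, ∫⁻ w', (A₁ * (∑' γ : Γ, mE (twoCosh w (γ.1 w'))) +
        A₂ * (g w * g w')) * schurWeight m k w' ∂(quotVolume F) ≤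
        ((A₁ * C₂ + A₂ * A₃ * I.toNNReal : ℝ≥0) : ENNReal) * schurWeight m k w := by
      intro w hw
      simp only [add_mul, mul_assoc]
      rw [lintegral_add_right (f := fun w' => (A₁ : ENNReal) * ((∑' γ : Γ, mE (twoCosh w (γ.1 w'))) *
          schurWeight m k w')) (g := fun w' => (A₂ : ENNReal) * (g w * (g w' * schurWeight m k w')))
          (((hgm.mul measurable_schurWeight).const_mul (g w)).const_mul (A₂ : ENNReal)),
        lintegral_const_mul' _ _ ENNReal.coe_ne_top, lintegral_const_mul' _ _ ENNReal.coe_ne_top,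
        lintegral_const_mul (f := fun w' => g w' * schurWeight m k w') _ (hgm.mul measurable_schurWeight)]
      have h1 := hΓ.lintegral_fold_schur hSK hmEm (hΓ.subset hw)
      push_cast
      rw [ENNReal.coe_toNNReal hI, add_mul]
      refine add_le_add ?_ ?_
      · rw [mul_assoc]; gcongr
      · calc _ ≤ (A₂ : ENNReal) * ((ENNReal.ofReal (B ^ (p - ((m + k : ℕ) : ℝ) / 2)) * schurWeight m k w) * I) := by
              gcongr; exact hgθ w
          _ = _ := by rw [hA₃]; simp only [ENNReal.ofReal]; ring
    refine ⟨hΓ.ae_mem.mono fun w hw => hleft w hw, hΓ.ae_mem.mono fun w hw => ?_⟩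
    refine le_trans (le_of_eq ?_) (hleft w hw)
    refine lintegral_congr fun w' => ?_
    congr 2
    · congr 1
      rw [← (Equiv.inv Γ).tsum_eq]
      refine tsum_congr fun δ => ?_
      rw [Equiv.inv_apply, ← hΓ.twoCosh_apply_left, twoCosh_comm]
    · ring
  · intro s hs
    rw [show 4 * (ε / 4) = ε by ring] at hs
    have hs' := Metric.ball_subset_closedBall hs
    have hsσ : σ < s.re := hball hs'
    refine ⟨hσ.1.trans hsσ, hσ.2.trans hsσ, fun w w' => ?_⟩
    by_cases hw : w ∈ U ∧ w' ∈ U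
    swap
    · have hz : weightInd N χ w = 0 ∨ weightInd N χ w' = 0 := by
        have : ∀ w, w ∉ U → weightInd N χ w = 0 := fun w hwU => by
          by_cases h : w ∈ halfSpace m k
          · rw [weightInd, indicator_of_mem h, weight]
            have : χ w = 0 := by
              by_contra h0
              exact hwU (hsupp w h h0)
            rw [this, mul_zero]
          · rw [weightInd, indicator_of_notMem h]
        rcases not_and_or.mp hw with h | h
        · exact Or.inl (this _ h)
        · exact Or.inr (this _ h)
      have : weightedKer Γ N χ s w w' = 0 := by
        unfold weightedKer
        rcases hz with h | h <;> rw [h] <;> simp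
      rw [this, enorm_zero]
      exact zero_le
    obtain ⟨hwU, hwU'⟩ := hw
    have hx : 0 < w.1 := hwU.1
    have hx' : 0 < w'.1 := hwU'.1
    have b1 := hΓ.fst_le_of_nearSet hwU
    have b2 := hΓ.fst_le_of_nearSet hwU'
    have hX : 0 < w.1 * w'.1 := by positivity
    have hXB : w.1 * w'.1 ≤ B ^ 2 := by nlinarith
    have htame := tame_resFun hΓ.dim_pos (hre s hs') (hσ.1.trans hsσ)
    have hW : ‖weightInd N χ w‖ * ‖weightInd N χ w'‖ ≤ B ^ 2 * (w.1 * w'.1) ^ N := by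
      rw [Real.mul_rpow hx.le hx'.le]
      calc _ ≤ (B * w.1 ^ N) * (B * w'.1 ^ N) := by
            gcongr
            · exact norm_weightInd_le hN hχB hwU.1
            · exact norm_weightInd_le hN hχB hwU'.1
        _ = _ := by ring
    have hsum : (∑' γ : Γ, ‖resFun (m + k) s (twoCosh w (γ.1 w'))‖ₑ) *
        ENNReal.ofReal ((w.1 * w'.1) ^ N) ≤
        ENNReal.ofReal ((3 * B ^ 2) ^ N) * (∑' γ : Γ, mE (twoCosh w (γ.1 w'))) +
        ENNReal.ofReal (C₁ * (w.1 * w'.1) ^ p) * ENNReal.ofReal A := by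
      refine le_trans ?_ (add_le_add le_rfl (mul_le_mul_right (hfar w hwU w' hwU') _))
      rw [← ENNReal.tsum_mul_right, ← ENNReal.tsum_mul_left, ← ENNReal.tsum_mul_left, ← ENNReal.tsum_add]
      refine ENNReal.tsum_le_tsum fun γ => ?_
      refine (enorm_resFun_mul_le (R := B ^ 2) hN hsσ.le hC₁.le (by nlinarith) (hD s hs')
        hΓ.dim_pos (hre s hs') (hres s hs') hX hXB).trans_eq ?_
      rw [twoCosh, hΓ.apply_fst γ.2, div_mul_cancel₀ _ hX.ne']
    have e1 : ‖weightedKer Γ N χ s w w'‖ₑ =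
        ENNReal.ofReal (‖weightInd N χ w‖ * ‖weightInd N χ w'‖) * ‖foldKer Γ (resFun (m + k) s) w w'‖ₑ := by
      rw [weightedKer, enorm_mul, enorm_mul, ENNReal.ofReal_mul (norm_nonneg _), ofReal_norm, ofReal_norm]
      ring
    rw [e1]
    calc _ ≤ ENNReal.ofReal (B ^ 2 * (w.1 * w'.1) ^ N) *
            (∑' γ : Γ, ‖resFun (m + k) s (twoCosh w (γ.1 w'))‖ₑ) := by
          gcongr
          exact hΓ.enorm_foldKer_le htame hwU.1 hwU'.1
      _ = ENNReal.ofReal (B ^ 2) * ((∑' γ : Γ, ‖resFun (m + k) s (twoCosh w (γ.1 w'))‖ₑ) *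
            ENNReal.ofReal ((w.1 * w'.1) ^ N)) := by
          rw [ENNReal.ofReal_mul (by positivity)]; ring
      _ ≤ ENNReal.ofReal (B ^ 2) * _ := mul_le_mul_right hsum _
      _ = _ := by
          have e2 : g w * g w' = ENNReal.ofReal ((w.1 * w'.1) ^ p) := by
            rw [hg, indicator_of_mem hwU, indicator_of_mem hwU', Real.mul_rpow hx.le hx'.le,
              ENNReal.ofReal_mul (by positivity)]
          have e3 : (A₁ : ENNReal) = ENNReal.ofReal (B ^ 2) * ENNReal.ofReal ((3 * B ^ 2) ^ N) := by
            rw [← ENNReal.ofReal_mul (by positivity)]; rfl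
          have e4 : (A₂ : ENNReal) = ENNReal.ofReal (B ^ 2) * (ENNReal.ofReal C₁ * ENNReal.ofReal A) := by
            rw [← ENNReal.ofReal_mul (by positivity), ← ENNReal.ofReal_mul (by positivity)]; rfl
          beta_reduce
          rw [e2, e3, e4, ENNReal.ofReal_mul hC₁.le]
          ring

/-- The continuation of the resolvent in weighted spaces. -/
theorem exists_weighted_continuation {N : ℝ} (hN : 0 < N) {χ : Pt m k → ℂ} (hχ : IsCutoff Γ χ) :
    ∃ T : ℂ → (L2 F →L[ℂ] L2 F),
      DifferentiableOn ℂ T {s | a < s.re ∧ ((m + k : ℕ) : ℝ) / 2 - N < s.re} ∧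
      (∀ s : ℂ, a < s.re → ((m + k : ℕ) : ℝ) / 2 < s.re → ∀ f g : L2 F,
        g =ᵐ[quotVolume F] (fun w => weight N χ w * f w) →
          T s f =ᵐ[quotVolume F] (fun w => weight N χ w * foldOp Γ F (resFun (m + k) s) g w)) ∧
      (∀ s : ℂ, a < s.re → ((m + k : ℕ) : ℝ) / 2 - N < s.re → HasIntegralKernel F (T s)
        (fun w w' => weight N χ w * foldKer Γ (resFun (m + k) s) w w' * weight N χ w')) := by
  have : SFinite (quotVolume F) := by unfold quotVolume hypVolume; infer_instance
  have ha := hΓ.nonneg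
  have hmeas : ∀ s : ℂ, a < s.re → Measurable (Function.uncurry (weightedKer Γ N χ s)) := fun s hs =>
    (((measurable_weightInd N hχ).comp measurable_fst).mul (hΓ.measurable_foldKer
      (tame_resFun hΓ.dim_pos (ha.trans_lt hs) hs))).mul ((measurable_weightInd N hχ).comp measurable_snd)
  have hex : ∀ s : ℂ, ∃ T : L2 F →L[ℂ] L2 F, a < s.re → ((m + k : ℕ) : ℝ) / 2 - N < s.re →
      HasIntegralKernel F T (weightedKer Γ N χ s) := fun s => by
    by_cases h : a < s.re ∧ ((m + k : ℕ) : ℝ) / 2 - N < s.re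
    · obtain ⟨r, hr, C, M, hM, hbd⟩ := hΓ.exists_weighted_majorant hN hχ h.1 h.2
      have hb := (hbd s (Metric.mem_ball_self (by linarith))).2.2
      obtain ⟨T, hT⟩ := (hM.mono (κ' := fun x y => ‖weightedKer Γ N χ s x y‖ₑ)
        (Eventually.of_forall fun x => Eventually.of_forall fun y => hb x y)
        (Eventually.of_forall fun x => Eventually.of_forall fun y => hb y x)).exists_operator
          (hmeas s h.1) measurable_schurWeight hΓ.ae_schurWeight
      exact ⟨T, fun _ _ => hT⟩
    · exact ⟨0, fun h1 h2 => absurd ⟨h1, h2⟩ h⟩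
  choose T hT using hex
  have hind : ∀ w ∈ F, weightInd N χ w = weight N χ w := fun w hw => by
    rw [weightInd, indicator_of_mem (hΓ.subset hw)]
  have hker : ∀ s : ℂ, a < s.re → ((m + k : ℕ) : ℝ) / 2 - N < s.re → HasIntegralKernel F (T s)
      (fun w w' => weight N χ w * foldKer Γ (resFun (m + k) s) w w' * weight N χ w') := fun s h1 h2 =>
    (hT s h1 h2).congr hΓ.measurableSet fun w hw w' hw' => by
      rw [weightedKer, hind w hw, hind w' hw']
  refine ⟨T, ?_, ?_, hker⟩
  · rintro s₀ ⟨h1, h2⟩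
    obtain ⟨r, hr, C, M, hM, hbd⟩ := hΓ.exists_weighted_majorant hN hχ h1 h2
    refine (hM.differentiableAt measurable_schurWeight hΓ.ae_schurWeight hr
      (fun s hs => hmeas s (hbd s hs).1) (fun w w' => ?_) (fun s hs => (hbd s hs).2.2)
      (fun s hs => hT s (hbd s hs).1 (hbd s hs).2.1)).differentiableWithinAt
    exact (((hΓ.differentiableOn_foldKer w w').mono fun s hs => (hbd s hs).1).const_mul _).mul_const _
  · intro s h1 h2 f g hg
    obtain ⟨C, hC⟩ := schurFun_resFun hΓ.dim_pos hΓ.le_half h2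
    filter_upwards [hker s h1 (by linarith) f, hΓ.foldOp_spec hC g] with w h3 h4
    rw [h3.2, h4.2, ← integral_const_mul]
    refine integral_congr_ae ?_
    filter_upwards [hg] with w' hw'
    rw [hw']
    ring

end CuspLike

end

end ModelCusp

namespace ModelCusp

section

open Filter Topology MeasureTheory Set

variable {m k : ℕ}

/-! ### The resolvent kernel as a homogeneous function -/

section affine

variable {E V : Type*} [NormedAddCommGroup E] [NormedSpace ℝ E] [NormedAddCommGroup V] [NormedSpace ℝ V]

lemma norm_iteratedFDeriv_comp_affine {f : V → ℂ} {U : Set V} (hU : IsOpen U) (hf : ContDiffOn ℝ ∞ f U)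
    (A : E →L[ℝ] V) (c : V) {p : E} (hp : A p + c ∈ U) (r : ℕ) :
    ‖iteratedFDeriv ℝ r (fun p => f (A p + c)) p‖ ≤ ‖iteratedFDeriv ℝ r f (A p + c)‖ * ‖A‖ ^ r := by
  set f' : V → ℂ := fun v => f (v + c)
  set U' : Set V := (fun v => v + c) ⁻¹' U
  have hU' : IsOpen U' := hU.preimage (by fun_prop)
  have hf' : ContDiffOn ℝ ∞ f' U' := hf.comp (by fun_prop) fun v hv => hv
  have hA : IsOpen (A ⁻¹' U') := hU'.preimage A.continuous
  have h := A.iteratedFDerivWithin_comp_right hf' hU'.uniqueDiffOn hA.uniqueDiffOn (x := p) hp (i := r)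
    (by exact_mod_cast le_top)
  rw [iteratedFDerivWithin_of_isOpen r hA hp, iteratedFDerivWithin_of_isOpen r hU' hp] at h
  have e : (fun p => f (A p + c)) = f' ∘ A := rfl
  rw [e, h, ← iteratedFDeriv_comp_add_right r c]
  refine (ContinuousMultilinearMap.norm_compContinuousLinearMap_le _ _).trans_eq ?_
  rw [Finset.prod_const, Finset.card_univ, Fintype.card_fin]

end affine

/-- The coordinates `(x', x, y - y', z - z')` of a pair of points. -/
abbrev Rel (m k : ℕ) : Type := ℝ × Pt m k

/-- The linear map that takes a pair of points to `(x', x, y - y', z - z')`. -/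
noncomputable def relMap (m k : ℕ) : (Pt m k × Pt m k) →L[ℝ] Rel m k :=
  LinearMap.toContinuousLinearMap
    { toFun := fun p => (p.2.1, p.1.1, p.1.2 - p.2.2)
      map_add' := fun p q => by simp only [Prod.fst_add, Prod.snd_add, Prod.mk_add_mk, add_sub_add_comm]
      map_smul' := fun c p => by
        simp only [Prod.smul_fst, Prod.smul_snd, RingHom.id_apply, Prod.smul_mk, smul_sub] }

lemma relMap_apply (p : Pt m k × Pt m k) : relMap m k p = (p.2.1, p.1.1, p.1.2 - p.2.2) := rfl

/-- The sum of squares of the coordinates. -/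
noncomputable def relQuad (v : Rel m k) : ℝ := v.1 ^ 2 + v.2.1 ^ 2 + ‖v.2.2.1‖ ^ 2 + ‖v.2.2.2‖ ^ 2

/-- The cone `Q > 2 |x x'|`; on pairs of points of `ℍⁿ⁺¹` this is the complement of the diagonal. -/
def relCone (m k : ℕ) : Set (Rel m k) := {v | 2 * |v.1 * v.2.1| < relQuad v}

lemma relQuad_relMap (w w' : Pt m k) : relQuad (relMap m k (w, w')) = quad w w' := by
  simp only [relQuad, relMap_apply, quad, Prod.fst_sub, Prod.snd_sub]; ring

lemma contDiff_relQuad : ContDiff ℝ ∞ (relQuad : Rel m k → ℝ) := by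
  unfold relQuad
  have h1 : ContDiff ℝ ∞ fun v : Rel m k => v.2.2.1 := contDiff_fst.comp (contDiff_snd.comp contDiff_snd)
  have h2 : ContDiff ℝ ∞ fun v : Rel m k => v.2.2.2 := contDiff_snd.comp (contDiff_snd.comp contDiff_snd)
  have h3 : ContDiff ℝ ∞ fun v : Rel m k => v.2.1 := contDiff_fst.comp contDiff_snd
  exact (((contDiff_fst.pow 2).add (h3.pow 2)).add (h1.norm_sq ℝ)).add (h2.norm_sq ℝ)

lemma isOpen_relCone : IsOpen (relCone m k) := by
  have := (contDiff_relQuad (m := m) (k := k)).continuous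
  exact isOpen_lt (by fun_prop) this

lemma relQuad_pos {v : Rel m k} (hv : v ∈ relCone m k) : 0 < relQuad v :=
  lt_of_le_of_lt (by positivity) (show 2 * |v.1 * v.2.1| < relQuad v from hv)

lemma relQuad_smul (c : ℝ) (v : Rel m k) : relQuad (c • v) = c ^ 2 * relQuad v := by
  simp only [relQuad, Prod.smul_fst, Prod.smul_snd, norm_smul, smul_eq_mul, Real.norm_eq_abs, mul_pow, sq_abs]
  ring

/-- The power series `∑ c_j(s) τ^j`. -/
noncomputable def resProfile (n : ℕ) (s τ : ℂ) : ℂ := ∑' j : ℕ, coef n s j * τ ^ j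

lemma differentiableOn_resProfile {n : ℕ} (hn : 0 < n) {s : ℂ} (hs : 0 < s.re) :
    DifferentiableOn ℂ (resProfile n s) (Metric.ball 0 (1 / 4)) := by
  intro τ₀ hτ₀
  obtain ⟨ρ, hρ, hρ4⟩ := exists_between (mem_ball_zero_iff.mp hτ₀)
  have hρ0 : 0 ≤ ρ := (norm_nonneg _).trans hρ.le
  obtain ⟨B, hB0, hB⟩ := exists_coef_bound_geom n hn (S := {s}) isCompact_singleton (by simpa using hs)
  have h2 := summable_pow_mul_geometric_of_norm_lt_one (R := ℝ) n (r := 4 * ρ)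
    (by rw [Real.norm_of_nonneg (by positivity)]; linarith)
  have hu : Summable fun j : ℕ => B * (4 ^ j * ((j : ℝ) + 1) ^ n) * ρ ^ j := by
    have h3 : Summable fun j : ℕ => (2 : ℝ) ^ n * ((j : ℝ) ^ n * (4 * ρ) ^ j) + 2 ^ n * (4 * ρ) ^ j :=
      (h2.mul_left _).add ((summable_geometric_of_lt_one (by positivity) (by linarith)).mul_left _)
    refine Summable.of_nonneg_of_le (fun j => by positivity) (fun j => ?_) (h3.mul_left B)
    have h4 : ((j : ℝ) + 1) ^ n ≤ 2 ^ n * (j : ℝ) ^ n + 2 ^ n := by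
      rcases Nat.eq_zero_or_pos j with rfl | hj
      · have : (1 : ℝ) ≤ 2 ^ n := one_le_pow₀ (by norm_num)
        have h0 : (0 : ℝ) ≤ 2 ^ n * ((0 : ℕ) : ℝ) ^ n := by positivity
        simpa using this.trans (le_add_of_nonneg_left h0)
      · have : (1 : ℝ) ≤ j := by exact_mod_cast hj
        rw [← mul_pow]
        have h5 : ((j : ℝ) + 1) ^ n ≤ (2 * (j : ℝ)) ^ n := by gcongr; linarith
        linarith [show (0 : ℝ) ≤ 2 ^ n by positivity]
    calc B * (4 ^ j * ((j : ℝ) + 1) ^ n) * ρ ^ j = B * (((j : ℝ) + 1) ^ n * (4 * ρ) ^ j) := by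
          rw [mul_pow]; ring
      _ ≤ B * ((2 ^ n * (j : ℝ) ^ n + 2 ^ n) * (4 * ρ) ^ j) := by gcongr
      _ = _ := by ring
  have h := Complex.differentiableOn_tsum_of_summable_norm (F := fun (j : ℕ) τ => coef n s j * τ ^ j)
    (U := Metric.ball 0 ρ) hu (fun j => by fun_prop) Metric.isOpen_ball fun j τ hτ => by
      rw [norm_mul, norm_pow]
      have h1 := hB s rfl j
      have h2 := (mem_ball_zero_iff.mp hτ).le
      gcongr
  exact ((h τ₀ (mem_ball_zero_iff.mpr hρ)).differentiableAt (Metric.isOpen_ball.mem_nhds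
    (mem_ball_zero_iff.mpr hρ))).differentiableWithinAt

/-- `(x x')^{-s}` times the resolvent kernel, as a function on the cone `Q > 2 |x x'|`: it is
homogeneous of degree `-2 s` and smooth also across `x = 0` and `x' = 0`. -/
noncomputable def coneFun (s : ℂ) (v : Rel m k) : ℂ :=
  powKer s (relQuad v) * resProfile (m + k) s ((((v.1 * v.2.1) / relQuad v) ^ 2 : ℝ) : ℂ)

lemma contDiffOn_coneFun (hn : 0 < m + k) {s : ℂ} (hs : 0 < s.re) :
    ContDiffOn ℝ ∞ (coneFun s : Rel m k → ℂ) (relCone m k) := by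
  have hq : ContDiffOn ℝ ∞ (relQuad : Rel m k → ℝ) (relCone m k) := contDiff_relQuad.contDiffOn
  refine ((contDiffOn_powKer s).comp hq fun v hv => relQuad_pos hv).mul ?_
  have h1 : ContDiffOn ℝ ∞ (resProfile (m + k) s) (Metric.ball 0 (1 / 4)) :=
    ((differentiableOn_resProfile hn hs).contDiffOn Metric.isOpen_ball).restrict_scalars ℝ
  have h2 : ContDiff ℝ ∞ fun v : Rel m k => v.1 * v.2.1 := contDiff_fst.mul (contDiff_fst.comp contDiff_snd)
  have h3 : ContDiffOn ℝ ∞ (fun v : Rel m k => ((v.1 * v.2.1) / relQuad v) ^ 2) (relCone m k) :=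
    (h2.contDiffOn.div hq fun v hv => (relQuad_pos hv).ne').pow 2
  refine h1.comp (Complex.ofRealCLM.contDiff.comp_contDiffOn h3) fun v hv => ?_
  have hq0 := relQuad_pos hv
  have hv' : 2 * |v.1 * v.2.1| < relQuad v := hv
  rw [mem_ball_zero_iff, Complex.norm_real, Real.norm_eq_abs, abs_pow,
    abs_div, abs_of_pos hq0]
  have : |v.1 * v.2.1| / relQuad v < 1 / 2 := by rw [div_lt_iff₀ hq0]; linarith
  calc _ < (1 / 2 : ℝ) ^ 2 := by gcongr
    _ = _ := by norm_num

lemma relMap_mem_relCone {w w' : Pt m k} (hw : w ∈ halfSpace m k) (hw' : w' ∈ halfSpace m k) :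
    relMap m k (w, w') ∈ relCone m k ↔ 2 < twoCosh w w' := by
  have hx : 0 < w.1 := hw
  have hx' : 0 < w'.1 := hw'
  have e : relMap m k (w, w') ∈ relCone m k ↔ 2 * |w'.1 * w.1| < quad w w' := by
    rw [← relQuad_relMap]; rfl
  rw [e, abs_of_pos (by positivity), twoCosh, lt_div_iff₀ (by positivity), mul_comm w'.1]

/-- The resolvent kernel of hyperbolic space is `(x x')^s` times a homogeneous function. -/
lemma resFun_twoCosh (s : ℂ) {w w' : Pt m k} (hw : w ∈ halfSpace m k) (hw' : w' ∈ halfSpace m k)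
    (hT : 2 < twoCosh w w') :
    resFun (m + k) s (twoCosh w w') = powKer (-s) (w.1 * w'.1) * coneFun s (relMap m k (w, w')) := by
  have hx : 0 < w.1 := hw
  have hx' : 0 < w'.1 := hw'
  have hX : 0 < w.1 * w'.1 := by positivity
  have hQ : 0 < quad w w' := quad_pos hw
  have hT0 : 0 < twoCosh w w' := by linarith
  rw [resFun, if_pos hT, coneFun, relQuad_relMap, resProfile, ← mul_assoc, ← tsum_mul_left]
  refine tsum_congr fun j => ?_
  have e1 : powKer (-s) (w.1 * w'.1) * powKer s (quad w w') = powKer s (twoCosh w w') := by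
    have : quad w w' = twoCosh w w' * (w.1 * w'.1) := by rw [twoCosh, div_mul_cancel₀ _ hX.ne']
    rw [this]
    unfold powKer
    rw [Complex.ofReal_mul (twoCosh w w'), Complex.mul_cpow_ofReal_nonneg hT0.le hX.le, neg_neg, mul_left_comm,
      ← Complex.cpow_add _ _ (by exact_mod_cast hX.ne')]
    simp
  have e2 : powKer (2 * j) (twoCosh w w') = ((((w'.1 * w.1) / quad w w') ^ 2 : ℝ) : ℂ) ^ j := by
    have : ((w'.1 * w.1) / quad w w') = (twoCosh w w')⁻¹ := by rw [twoCosh, inv_div, mul_comm]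
    rw [this, powKer, Complex.cpow_neg]
    have h2 : (2 * (j : ℂ)) = ((2 * j : ℕ) : ℂ) := by push_cast; ring
    rw [h2, Complex.cpow_natCast]
    push_cast
    rw [← pow_mul, inv_pow]
  rw [e1, relMap_apply, powKer_add hT0, e2]
  ring

/-- Homogeneity of degree `-2 s`. -/
lemma coneFun_smul (s : ℂ) {c : ℝ} (hc : 0 < c) {v : Rel m k} (hv : v ∈ relCone m k) :
    coneFun s (c • v) = powKer (2 * s) c * coneFun s v := by
  have hq := relQuad_pos hv
  have e : (c • v).1 * (c • v).2.1 / relQuad (c • v) = v.1 * v.2.1 / relQuad v := by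
    rw [relQuad_smul]
    simp only [Prod.smul_fst, Prod.smul_snd, smul_eq_mul]
    field_simp
  rw [coneFun, e, coneFun, relQuad_smul, ← mul_assoc]
  congr 1
  have hc' : (c : ℂ) ≠ 0 := by exact_mod_cast hc.ne'
  unfold powKer
  rw [Complex.ofReal_mul, Complex.mul_cpow_ofReal_nonneg (by positivity) hq.le]
  congr 1
  rw [show -(2 * s) = -s + -s by ring, Complex.cpow_add _ _ hc', pow_two, Complex.ofReal_mul,
    Complex.mul_cpow_ofReal_nonneg hc.le hc.le]

/-- Derivatives of `coneFun` on closed subcones: homogeneity reduces the bound to compactness of the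
unit sphere. -/
theorem exists_coneFun_bound (hn : 0 < m + k) {s : ℂ} (hs : 0 < s.re) {c : ℝ} (hc : 0 < c) (r : ℕ) :
    ∃ C > 0, ∀ v : Rel m k, 0 < relQuad v → 2 * |v.1 * v.2.1| + c * relQuad v ≤ relQuad v →
      ‖iteratedFDeriv ℝ r (coneFun s) v‖ ≤ C * relQuad v ^ (-(s.re + (r : ℝ) / 2)) := by
  set S : Set (Rel m k) := {v | relQuad v = 1 ∧ 2 * |v.1 * v.2.1| + c ≤ 1} with hS
  have hqc := (contDiff_relQuad (m := m) (k := k)).continuous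
  have hScone : S ⊆ relCone m k := fun v hv => by
    obtain ⟨h1, h2⟩ : relQuad v = 1 ∧ 2 * |v.1 * v.2.1| + c ≤ 1 := hv
    show 2 * |v.1 * v.2.1| < relQuad v
    linarith
  have hcpt : IsCompact S := by
    refine Metric.isCompact_of_isClosed_isBounded ?_ ((Metric.isBounded_closedBall (x := 0) (r := 1)).subset ?_)
    · exact (isClosed_eq hqc continuous_const).inter (isClosed_le (f := fun v : Rel m k => 2 * |v.1 * v.2.1| + c) (by fun_prop) continuous_const)
    · intro v hv
      have h1 : relQuad v = 1 := hv.1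
      unfold relQuad at h1
      have a1 := sq_nonneg v.1
      have a2 := sq_nonneg v.2.1
      have a3 := sq_nonneg ‖v.2.2.1‖
      have a4 := sq_nonneg ‖v.2.2.2‖
      rw [mem_closedBall_zero_iff, Prod.norm_def, Prod.norm_def, Prod.norm_def]
      refine max_le ?_ (max_le ?_ (max_le ?_ ?_))
      · exact abs_le_one_iff_mul_self_le_one.mpr (by nlinarith)
      · exact abs_le_one_iff_mul_self_le_one.mpr (by nlinarith)
      · nlinarith [norm_nonneg v.2.2.1]
      · nlinarith [norm_nonneg v.2.2.2]
  have hsm := contDiffOn_coneFun hn hs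
  obtain ⟨C, hC⟩ := hcpt.exists_bound_of_continuousOn
    ((ContinuousOn.continuousOn_iteratedFDeriv hsm isOpen_relCone (k := r) (by exact_mod_cast le_top)).mono hScone)
  refine ⟨max C 1, by positivity, fun v hq hv => ?_⟩
  have hvc : v ∈ relCone m k := by
    show 2 * |v.1 * v.2.1| < relQuad v
    have : 0 < c * relQuad v := by positivity
    linarith
  -- the scaling that normalises `relQuad` to `1`
  set lam : ℝ := (relQuad v) ^ (-(1 / 2) : ℝ) with hlam
  have hl0 : 0 < lam := by positivity
  have hl2 : lam ^ 2 * relQuad v = 1 := by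
    rw [hlam, ← Real.rpow_natCast, ← Real.rpow_mul hq.le]
    norm_num
    rw [Real.rpow_neg_one, inv_mul_cancel₀ hq.ne']
  have hmem : lam • v ∈ S := by
    refine ⟨by rw [relQuad_smul, hl2], ?_⟩
    simp only [Prod.smul_fst, Prod.smul_snd, smul_eq_mul]
    have e : |lam * v.1 * (lam * v.2.1)| = lam ^ 2 * |v.1 * v.2.1| := by
      rw [show lam * v.1 * (lam * v.2.1) = lam ^ 2 * (v.1 * v.2.1) by ring, abs_mul, abs_of_pos (by positivity)]
    rw [e]
    have := mul_le_mul_of_nonneg_left hv (sq_nonneg lam)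
    nlinarith
  have h1 := norm_iteratedFDeriv_comp_affine isOpen_relCone hsm
    (lam • ContinuousLinearMap.id ℝ (Rel m k)) 0 (p := v) (by simpa using hScone hmem) r
  have h2 : (fun p => coneFun s ((lam • ContinuousLinearMap.id ℝ (Rel m k)) p + 0)) =ᶠ[𝓝 v]
      fun p => powKer (2 * s) lam • coneFun s p := by
    filter_upwards [isOpen_relCone.mem_nhds hvc] with p hp
    rw [add_zero, smul_eq_mul, ← coneFun_smul s hl0 hp]
    rfl
  have h3 : iteratedFDeriv ℝ r (fun p => powKer (2 * s) lam • coneFun s p) v =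
      powKer (2 * s) lam • iteratedFDeriv ℝ r (coneFun s) v :=
    iteratedFDeriv_const_smul_apply' ((hsm.contDiffAt (isOpen_relCone.mem_nhds hvc)).of_le
      (by exact_mod_cast le_top))
  rw [(Filter.EventuallyEq.iteratedFDeriv ℝ h2 r).eq_of_nhds, h3, norm_smul, norm_powKer hl0, add_zero] at h1
  have h4 : ‖lam • ContinuousLinearMap.id ℝ (Rel m k)‖ ≤ lam := by
    refine (norm_smul_le lam (ContinuousLinearMap.id ℝ (Rel m k))).trans ?_
    rw [Real.norm_of_nonneg hl0.le]
    exact mul_le_of_le_one_right hl0.le ContinuousLinearMap.norm_id_le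
  have h5 : lam ^ (-(2 * s).re) * ‖iteratedFDeriv ℝ r (coneFun s) v‖ ≤ max C 1 * lam ^ r :=
    h1.trans (mul_le_mul ((hC _ hmem).trans (le_max_left _ _)) (pow_le_pow_left₀ (norm_nonneg _) h4 r)
      (by positivity) (by positivity))
  have h6 : lam ^ (-(2 * s).re) = relQuad v ^ s.re := by
    rw [hlam, ← Real.rpow_mul hq.le]; congr 1; simp
  have h7 : lam ^ r = relQuad v ^ (-((r : ℝ) / 2)) := by
    rw [hlam, ← Real.rpow_natCast, ← Real.rpow_mul hq.le]; congr 1; ring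
  rw [h6, h7] at h5
  rw [neg_add, Real.rpow_add hq, Real.rpow_neg hq.le s.re, mul_comm (relQuad v ^ s.re)⁻¹, ← mul_assoc,
    ← div_eq_mul_inv, le_div_iff₀ (by positivity)]
  linarith

end

end ModelCusp

namespace ModelCusp

section

open Filter Topology MeasureTheory Set

variable {m k : ℕ}

/-! ### Smooth convergence of the series over the group -/

section series

variable {ι E : Type*} [NormedAddCommGroup E] [NormedSpace ℝ E]

/-- Term by term differentiation on an open set. -/
lemma iteratedFDeriv_tsum_of_isOpen {f : ι → E → ℂ} {U : Set E} (hU : IsOpen U)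
    (hf : ∀ i, ContDiffOn ℝ ∞ (f i) U) {u : ℕ → ι → ℝ} (hu : ∀ r, Summable (u r))
    (hb : ∀ r i, ∀ p ∈ U, ‖iteratedFDeriv ℝ r (f i) p‖ ≤ u r i) (r : ℕ) :
    ∀ p ∈ U, iteratedFDeriv ℝ r (fun q => ∑' i, f i q) p = ∑' i, iteratedFDeriv ℝ r (f i) p ∧
      DifferentiableAt ℝ (iteratedFDeriv ℝ r (fun q => ∑' i, f i q)) p := by
  have hdiff : ∀ r i, ∀ p ∈ U, DifferentiableAt ℝ (iteratedFDeriv ℝ r (f i)) p := fun r i p hp =>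
    ((hf i).contDiffAt (hU.mem_nhds hp)).differentiableAt_iteratedFDeriv (by exact_mod_cast ENat.natCast_lt_top r)
  have hfd : ∀ r, ∀ p ∈ U, HasFDerivAt (fun q => ∑' i, iteratedFDeriv ℝ r (f i) q)
      (∑' i, fderiv ℝ (iteratedFDeriv ℝ r (f i)) p) p := fun r p hp => by
    obtain ⟨ε, hε, hball⟩ := Metric.isOpen_iff.mp hU p hp
    refine hasFDerivAt_tsum_of_isPreconnected (hu (r + 1)) Metric.isOpen_ball
      (convex_ball p ε).isPreconnected (fun i q hq => (hdiff r i q (hball hq)).hasFDerivAt) (fun i q hq => ?_)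
      (Metric.mem_ball_self hε) ?_ (Metric.mem_ball_self hε)
    · rw [norm_fderiv_iteratedFDeriv]
      exact hb (r + 1) i q (hball hq)
    · exact (hu r).of_norm_bounded fun i => hb r i p hp
  have key : ∀ r, ∀ p ∈ U, iteratedFDeriv ℝ r (fun q => ∑' i, f i q) p = ∑' i, iteratedFDeriv ℝ r (f i) p := by
    intro r
    induction r with
    | zero =>
      intro p hp
      simp only [iteratedFDeriv_zero_eq_comp, Function.comp_apply]
      exact (continuousMultilinearCurryFin0 ℝ E ℂ).symm.toContinuousLinearEquiv.map_tsum
    | succ r ih =>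
      intro p hp
      have h1 : iteratedFDeriv ℝ r (fun q => ∑' i, f i q) =ᶠ[𝓝 p] fun q => ∑' i, iteratedFDeriv ℝ r (f i) q := by
        filter_upwards [hU.mem_nhds hp] with q hq using ih q hq
      simp only [iteratedFDeriv_succ_eq_comp_left, Function.comp_apply]
      rw [h1.fderiv_eq, (hfd r p hp).fderiv]
      exact (continuousMultilinearCurryLeftEquiv ℝ (fun _ : Fin (r + 1) => E) ℂ).symm.toContinuousLinearEquiv.map_tsum
  intro p hp
  refine ⟨key r p hp, (hfd r p hp).differentiableAt.congr_of_eventuallyEq ?_⟩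
  filter_upwards [hU.mem_nhds hp] with q hq using key r q hq

lemma contDiffOn_tsum_of_isOpen {f : ι → E → ℂ} {U : Set E} (hU : IsOpen U)
    (hf : ∀ i, ContDiffOn ℝ ∞ (f i) U) {u : ℕ → ι → ℝ} (hu : ∀ r, Summable (u r))
    (hb : ∀ r i, ∀ p ∈ U, ‖iteratedFDeriv ℝ r (f i) p‖ ≤ u r i) :
    ContDiffOn ℝ ∞ (fun q => ∑' i, f i q) U := by
  refine contDiffOn_of_differentiableOn fun r _ => ?_
  refine DifferentiableOn.congr (fun p hp =>
    (iteratedFDeriv_tsum_of_isOpen hU hf hu hb r p hp).2.differentiableWithinAt) fun p hp => ?_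
  exact iteratedFDerivWithin_of_isOpen r hU hp

lemma convergesSmoothlyOn_of_isOpen {f : ι → E → ℂ} {U K : Set E} (hU : IsOpen U) (hK : K ⊆ U)
    (hf : ∀ i, ContDiffOn ℝ ∞ (f i) U) {u : ℕ → ι → ℝ} (hu : ∀ r, Summable (u r))
    (hb : ∀ r i, ∀ p ∈ U, ‖iteratedFDeriv ℝ r (f i) p‖ ≤ u r i) : ConvergesSmoothlyOn f K := by
  refine ⟨fun i p hp => (hf i).contDiffAt (hU.mem_nhds (hK hp)), fun p hp =>
    (contDiffOn_tsum_of_isOpen hU hf hu hb).contDiffAt (hU.mem_nhds (hK hp)), fun r => ?_⟩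
  have h := HasSumUniformlyOn.of_norm_le_summable (hu r) (s := K)
    (f := fun i => iteratedFDeriv ℝ r (f i)) fun i p hp => hb r i p (hK hp)
  exact h.congr_right fun p hp => ((iteratedFDeriv_tsum_of_isOpen hU hf hu hb r p (hK hp)).1).symm

end series

namespace CuspLike

variable {Γ : Subgroup (Equiv.Perm (Pt m k))} {F : Set (Pt m k)} {a : ℝ} (hΓ : CuspLike Γ F a)
include hΓ

lemma exists_relMap_affine (γ : Γ) : ∃ (A : (Pt m k × Pt m k) →L[ℝ] Rel m k) (c : Rel m k),
    (∀ p, relMap m k (p.1, γ.1 p.2) = A p + c) ∧ ‖A‖ ≤ ‖relMap m k‖ := by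
  obtain ⟨L, t, h⟩ := hΓ.isom γ γ.2
  set G : (Pt m k × Pt m k) →L[ℝ] (Pt m k × Pt m k) := (ContinuousLinearMap.id ℝ (Pt m k)).prodMap
    ((ContinuousLinearMap.id ℝ ℝ).prodMap ((L : EuclideanSpace ℝ (Fin m) →L[ℝ] EuclideanSpace ℝ (Fin m)).prodMap
      (ContinuousLinearMap.id ℝ (EuclideanSpace ℝ (Fin k))))) with hG
  have hGp : ∀ p : Pt m k × Pt m k, G p = (p.1, (p.2.1, L p.2.2.1, p.2.2.2)) := fun p => rfl
  refine ⟨(relMap m k).comp G, relMap m k (0, (0, 0, t)), fun p => ?_, ?_⟩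
  · rw [ContinuousLinearMap.comp_apply, ← map_add, hGp, h, cuspIsometry_apply]
    simp
  · refine ContinuousLinearMap.opNorm_le_bound _ (norm_nonneg _) fun p => ?_
    refine ((relMap m k).le_opNorm (G p)).trans_eq ?_
    congr 1
    rw [hGp]
    simp only [Prod.norm_def, LinearIsometryEquiv.norm_map]

lemma isOpen_relCone_preimage (γ : Γ) : IsOpen {p : Pt m k × Pt m k |
    p ∈ halfSpace m k ×ˢ halfSpace m k ∧ relMap m k (p.1, γ.1 p.2) ∈ relCone m k} := by
  have h := hΓ.continuous_apply γ
  exact isOpen_halfSpace_prod.inter (isOpen_relCone.preimage ((relMap m k).continuous.comp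
    (continuous_fst.prodMk (h.comp continuous_snd))))

/-- On a neighbourhood of a compact set the terms of the series that are not singular there are
smooth, and their derivatives have summable bounds. -/
lemma exists_series_bound {s : ℂ} (hs : a < s.re) {G : Pt m k → Pt m k → ℂ}
    (hG : ∀ w ∈ halfSpace m k, ∀ w' ∈ halfSpace m k, w ≠ w' → G w w' = resFun (m + k) s (twoCosh w w'))
    {K : Set (Pt m k × Pt m k)} (hK : IsCompact K) (hKH : K ⊆ halfSpace m k ×ˢ halfSpace m k) :
    (singularElements Γ K).Finite ∧ ∃ U, IsOpen U ∧ K ⊆ U ∧ U ⊆ halfSpace m k ×ˢ halfSpace m k ∧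
      (∀ γ : {γ : Γ // γ ∉ singularElements Γ K}, ∀ p ∈ U, p.1 ≠ (γ.1 : Equiv.Perm (Pt m k)) p.2) ∧
      (∀ γ : {γ : Γ // γ ∉ singularElements Γ K},
        ContDiffOn ℝ ∞ (fun p => G p.1 ((γ.1 : Equiv.Perm (Pt m k)) p.2)) U) ∧
      ∃ u : ℕ → {γ : Γ // γ ∉ singularElements Γ K} → ℝ, (∀ r, Summable (u r)) ∧ ∀ r γ, ∀ p ∈ U,
        ‖iteratedFDeriv ℝ r (fun p => G p.1 ((γ.1 : Equiv.Perm (Pt m k)) p.2)) p‖ ≤ u r γ := by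
  classical
  have ha := hΓ.nonneg
  have hs0 : 0 < s.re := ha.trans_lt hs
  have htc : ∀ (γ : Γ) (p : Pt m k × Pt m k), p ∈ halfSpace m k ×ˢ halfSpace m k →
      (relMap m k (p.1, γ.1 p.2) ∈ relCone m k ↔ p.1 ≠ γ.1 p.2) := by
    intro γ p hp
    have h2 := (hΓ.apply_mem γ.2).mpr hp.2
    rw [relMap_mem_relCone hp.1 h2]
    refine ⟨fun h e => ?_, fun h => two_lt_twoCosh hp.1 h2 h⟩
    have hx : 0 < p.1.1 := hp.1
    rw [← e, twoCosh, quad] at h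
    simp only [sub_self, norm_zero] at h
    rw [lt_div_iff₀ (by positivity)] at h
    nlinarith
  obtain ⟨K', hK'c, hKK', hK'H⟩ := exists_compact_between hK isOpen_halfSpace_prod hKH
  obtain ⟨B, hB⟩ := hK'c.isBounded.exists_norm_le
  obtain ⟨b, hb1, hb2, hb3⟩ := hΓ.growth
  obtain ⟨c, hc, hcb⟩ := hb3 B
  have hB1 : ∀ p ∈ K', ‖p.1‖ ≤ B ∧ ‖p.2‖ ≤ B := fun p hp =>
    ⟨(norm_fst_le p).trans (hB p hp), (norm_snd_le p).trans (hB p hp)⟩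
  have hX : ∀ p ∈ K', p.1.1 * p.2.1 ≤ B ^ 2 := fun p hp => by
    have h1 : p.1.1 ≤ B := (le_abs_self _).trans ((norm_fst_le p.1).trans (hB1 p hp).1)
    have h2 : p.2.1 ≤ B := (le_abs_self _).trans ((norm_fst_le p.2).trans (hB1 p hp).2)
    have h3 : 0 < p.1.1 := (hK'H hp).1
    have h4 : 0 < p.2.1 := (hK'H hp).2
    nlinarith
  set R := max (4 * B ^ 2) 1 with hR
  have hfin := hΓ.finite_near B R
  -- the finitely many translates that come close are treated by compactness, the others by homogeneity
  set Φ := {γ : Γ | ∃ w w' : Pt m k, ‖w‖ ≤ B ∧ ‖w'‖ ≤ B ∧ quad w (γ.1 w') ≤ R} with hΦ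
  have hKK : K ⊆ K' := hKK'.trans interior_subset
  have hSΦ : singularElements Γ K ⊆ Φ := by
    rintro γ ⟨p, hp, he⟩
    refine ⟨p.1, p.2, (hB1 p (hKK hp)).1, (hB1 p (hKK hp)).2, ?_⟩
    have e1 : p.2.1 = p.1.1 := by rw [he, hΓ.apply_fst γ.2]
    have h := hX p (hKK hp)
    rw [← he, quad]
    simp only [sub_self, norm_zero]
    rw [e1] at h
    refine le_trans ?_ (le_max_left _ _)
    nlinarith [sq_nonneg B]
  have hSfin := hfin.subset hSΦ
  refine ⟨hSfin, ?_⟩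
  set O : Γ → Set (Pt m k × Pt m k) := fun γ => {p | p ∈ halfSpace m k ×ˢ halfSpace m k ∧
    relMap m k (p.1, γ.1 p.2) ∈ relCone m k} with hO
  have hOo : ∀ γ, IsOpen (O γ) := fun γ => hΓ.isOpen_relCone_preimage γ
  set V := interior K' ∩ ⋂ γ ∈ Φ \ singularElements Γ K, O γ with hV
  have hVo : IsOpen V := isOpen_interior.inter (hfin.sdiff.isOpen_biInter fun γ _ => hOo γ)
  have hKV : K ⊆ V := fun p hp => by
    refine ⟨hKK' hp, mem_iInter₂.mpr fun γ hγ => ⟨hKH hp, (htc γ p (hKH hp)).mpr fun h => hγ.2 ⟨p, hp, h⟩⟩⟩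
  obtain ⟨K₂, hK₂c, hKK₂, hK₂V⟩ := exists_compact_between hK hVo hKV
  have hK₂K' : K₂ ⊆ K' := fun p hp => interior_subset (hK₂V hp).1
  have hbig : ∀ γ, γ ∉ Φ → ∀ p ∈ K', R < quad p.1 (γ.1 p.2) := fun γ hγ p hp => by
    by_contra h
    exact hγ ⟨p.1, p.2, (hB1 p hp).1, (hB1 p hp).2, not_lt.mp h⟩
  have hsub : ∀ γ, γ ∉ Φ → ∀ p ∈ K', 2 * |(relMap m k (p.1, γ.1 p.2)).1 *
      (relMap m k (p.1, γ.1 p.2)).2.1| +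
      1 / 2 * relQuad (relMap m k (p.1, γ.1 p.2)) ≤
      relQuad (relMap m k (p.1, γ.1 p.2)) := fun γ hγ p hp => by
    have h1 : 0 < p.1.1 := (hK'H hp).1
    have h2 : 0 < p.2.1 := (hK'H hp).2
    have h3 := hbig γ hγ p hp
    have h4 := hX p hp
    have h5 : 4 * B ^ 2 ≤ R := le_max_left _ _
    rw [relQuad_relMap, relMap_apply]
    simp only
    rw [hΓ.apply_fst γ.2, abs_of_pos (by positivity), mul_comm p.2.1]
    linarith
  have hmem : ∀ γ, γ ∉ singularElements Γ K → K₂ ⊆ O γ := fun γ hγ p hp => by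
    by_cases h : γ ∈ Φ
    · exact mem_iInter₂.mp (hK₂V hp).2 γ ⟨h, hγ⟩
    · refine ⟨hK'H (hK₂K' hp), ?_⟩
      have h1 := hsub γ h p (hK₂K' hp)
      have h2 := hbig γ h p (hK₂K' hp)
      have h3 : 1 ≤ R := le_max_right _ _
      rw [relQuad_relMap] at h1
      show 2 * |_| < relQuad _
      rw [relQuad_relMap]
      linarith
  -- the terms on the open sets where they are smooth
  set P : Pt m k × Pt m k → ℂ := fun p => powKer (-s) (p.1.1 * p.2.1) with hP
  have hPs : ContDiffOn ℝ ∞ P (halfSpace m k ×ˢ halfSpace m k) := by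
    have h1 : ContDiff ℝ ∞ fun p : Pt m k × Pt m k => p.1.1 * p.2.1 :=
      (contDiff_fst.comp contDiff_fst).mul (contDiff_fst.comp contDiff_snd)
    exact (contDiffOn_powKer (-s)).comp h1.contDiffOn fun p hp => mul_pos (a := p.1.1) hp.1 hp.2
  set g : Γ → Pt m k × Pt m k → ℂ := fun γ p => coneFun s (relMap m k (p.1, γ.1 p.2)) with hg
  have hcf := contDiffOn_coneFun (m := m) (k := k) hΓ.dim_pos hs0
  have hgs : ∀ γ, ContDiffOn ℝ ∞ (g γ) (O γ) := fun γ => by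
    refine hcf.comp ?_ fun p hp => hp.2
    have := hΓ.contDiff_apply γ
    exact ((relMap m k).contDiff.comp (contDiff_fst.prodMk (this.comp contDiff_snd))).contDiffOn
  have heq : ∀ γ, ∀ p ∈ O γ, G p.1 (γ.1 p.2) = P p * g γ p := fun γ p hp => by
    have h2 := (hΓ.apply_mem γ.2).mpr hp.1.2
    rw [hG _ hp.1.1 _ h2 ((htc γ p hp.1).mp hp.2),
      resFun_twoCosh s hp.1.1 h2 ((relMap_mem_relCone hp.1.1 h2).mp hp.2), hΓ.apply_fst γ.2]
  have hfs : ∀ γ : Γ, ContDiffOn ℝ ∞ (fun p => G p.1 (γ.1 p.2)) (O γ) := fun γ =>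
    ((hPs.mono fun p hp => hp.1).mul (hgs γ)).congr fun p hp => heq γ p hp
  have hcont : ∀ (γ : Γ) (r : ℕ), ContinuousOn (iteratedFDeriv ℝ r fun p => G p.1 (γ.1 p.2)) (O γ) :=
    fun γ r => ContinuousOn.continuousOn_iteratedFDeriv (hfs γ) (hOo γ) (by exact_mod_cast le_top)
  have hcase : ∀ r, ∃ u : {γ : Γ // γ ∉ singularElements Γ K} → ℝ, Summable u ∧ ∀ γ, ∀ p ∈ K₂,
      ‖iteratedFDeriv ℝ r (fun p => G p.1 ((γ.1 : Equiv.Perm (Pt m k)) p.2)) p‖ ≤ u γ := by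
    intro r
    have h1 : ∀ i, ∃ C, ∀ p ∈ K₂, ‖iteratedFDeriv ℝ i P p‖ ≤ C := fun i =>
      hK₂c.exists_bound_of_continuousOn ((ContinuousOn.continuousOn_iteratedFDeriv hPs isOpen_halfSpace_prod
        (by exact_mod_cast le_top)).mono (hK₂K'.trans hK'H))
    choose CP hCP using h1
    have h2 := fun i => exists_coneFun_bound (m := m) (k := k) hΓ.dim_pos hs0 (c := 1 / 2) (by norm_num) i
    choose CG hCG0 hCG using h2
    have h3 : ∀ γ : {γ : Γ // γ ∉ singularElements Γ K}, ∃ C, ∀ p ∈ K₂,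
        ‖iteratedFDeriv ℝ r (fun p => G p.1 ((γ.1 : Equiv.Perm (Pt m k)) p.2)) p‖ ≤ C := fun γ =>
      hK₂c.exists_bound_of_continuousOn ((hcont γ.1 r).mono (hmem γ.1 γ.2))
    choose D hD using h3
    set M := ∑ i ∈ Finset.range (r + 1), (r.choose i : ℝ) * CP i * (CG (r - i) * ‖relMap m k‖ ^ (r - i)) with hM
    refine ⟨fun γ => M * ((c / 2) ^ (-s.re) * b γ.1 ^ (-s.re)) + if γ.1 ∈ Φ then
      |D γ| + |M * ((c / 2) ^ (-s.re) * b γ.1 ^ (-s.re))| else 0, ?_, fun γ p hp => ?_⟩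
    · refine (((hb2 s.re hs).subtype _).mul_left _ |>.mul_left M).add ?_
      refine summable_of_hasFiniteSupport ((hfin.preimage Subtype.val_injective.injOn).subset fun γ hγ => ?_)
      by_contra h
      exact hγ (if_neg h)
    · have hpO := hmem γ.1 γ.2 hp
      by_cases h : γ.1 ∈ Φ
      · simp only [h, if_true]
        have d1 := (hD γ p hp).trans (le_abs_self _)
        have d2 := neg_abs_le (M * ((c / 2) ^ (-s.re) * b γ.1 ^ (-s.re)))
        linarith
      · simp only [h, if_false, add_zero]
        have e1 : (fun p => G p.1 ((γ.1 : Equiv.Perm (Pt m k)) p.2)) =ᶠ[𝓝 p] fun p => P p * g γ.1 p := by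
          filter_upwards [(hOo γ.1).mem_nhds hpO] with q hq using heq γ.1 q hq
        rw [(Filter.EventuallyEq.iteratedFDeriv ℝ e1 r).eq_of_nhds, ← iteratedFDerivWithin_of_isOpen r (hOo γ.1) hpO]
        refine (norm_iteratedFDerivWithin_mul_le (hPs.mono fun p hp => hp.1) (hgs γ.1) (hOo γ.1).uniqueDiffOn hpO
          (by exact_mod_cast le_top)).trans ?_
        rw [hM, Finset.sum_mul]
        refine Finset.sum_le_sum fun i _ => ?_
        rw [iteratedFDerivWithin_of_isOpen _ (hOo γ.1) hpO, iteratedFDerivWithin_of_isOpen _ (hOo γ.1) hpO]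
        obtain ⟨A, d, hA, hAn⟩ := hΓ.exists_relMap_affine γ.1
        have hq := hbig γ.1 h p (hK₂K' hp)
        have hR1 : 1 ≤ R := le_max_right _ _
        have hg1 : ‖iteratedFDeriv ℝ (r - i) (g γ.1) p‖ ≤ CG (r - i) * ‖relMap m k‖ ^ (r - i) *
            ((c / 2) ^ (-s.re) * b γ.1 ^ (-s.re)) := by
          have e2 : g γ.1 = fun p => coneFun s (A p + d) := funext fun p => by rw [hg]; simp only [hA]
          have hin : A p + d ∈ relCone m k := by rw [← hA]; exact hpO.2
          rw [e2]
          refine (norm_iteratedFDeriv_comp_affine isOpen_relCone hcf A d hin _).trans ?_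
          have h5 := hCG (r - i) (relMap m k (p.1, (γ.1 : Equiv.Perm (Pt m k)) p.2))
            (by rw [relQuad_relMap]; linarith) (hsub γ.1 h p (hK₂K' hp))
          rw [relQuad_relMap, hA] at h5
          have h6 : quad p.1 ((γ.1 : Equiv.Perm (Pt m k)) p.2) ^ (-(s.re + ((r - i : ℕ) : ℝ) / 2)) ≤
              (c / 2) ^ (-s.re) * b γ.1 ^ (-s.re) := by
            have hbγ := hb1 γ.1
            have h7 := hcb γ.1 p.1 p.2 (hB1 p (hK₂K' hp)).1 (hB1 p (hK₂K' hp)).2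
            rw [← Real.mul_rpow (by positivity) (by linarith)]
            refine (Real.rpow_le_rpow_of_exponent_le (by linarith) (show _ ≤ -s.re by
              have : (0 : ℝ) ≤ ((r - i : ℕ) : ℝ) / 2 := by positivity
              linarith)).trans ?_
            exact Real.rpow_le_rpow_of_nonpos (by positivity) (by linarith) (by linarith)
          have hCG0' := (hCG0 (r - i)).le
          have hbγ := hb1 γ.1
          calc _ ≤ (CG (r - i) * ((c / 2) ^ (-s.re) * b γ.1 ^ (-s.re))) * ‖relMap m k‖ ^ (r - i) := by
                refine mul_le_mul_of_nonneg_right (h5.trans ?_) (by positivity) |>.trans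
                  (mul_le_mul_of_nonneg_left (pow_le_pow_left₀ (norm_nonneg _) hAn _) (by positivity))
                exact mul_le_mul_of_nonneg_left h6 hCG0'
            _ = _ := by ring
        have hCP0 : 0 ≤ CP i := (norm_nonneg _).trans (hCP i p hp)
        calc _ ≤ (r.choose i : ℝ) * CP i * (CG (r - i) * ‖relMap m k‖ ^ (r - i) *
            ((c / 2) ^ (-s.re) * b γ.1 ^ (-s.re))) := by
              gcongr
              exact hCP i p hp
          _ = _ := by ring
  choose u hu hub using hcase
  refine ⟨interior K₂, isOpen_interior, hKK₂, (interior_subset.trans hK₂K').trans hK'H, fun γ p hp => ?_,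
    fun γ => (hfs γ.1).mono (interior_subset.trans (hmem γ.1 γ.2)), u, hu, fun r γ p hp => hub r γ p (interior_subset hp)⟩
  have h1 := hmem γ.1 γ.2 (interior_subset hp)
  exact (htc γ.1 p h1.1).mp h1.2

/-- The series over the group converges in `C^∞` on compact sets, apart from its finitely many
singular terms. -/
theorem convergesSmoothlyOn {s : ℂ} (hs : a < s.re) {G : Pt m k → Pt m k → ℂ}
    (hG : ∀ w ∈ halfSpace m k, ∀ w' ∈ halfSpace m k, w ≠ w' → G w w' = resFun (m + k) s (twoCosh w w'))
    {K : Set (Pt m k × Pt m k)} (hK : IsCompact K) (hKH : K ⊆ halfSpace m k ×ˢ halfSpace m k) :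
    (singularElements Γ K).Finite ∧ ConvergesSmoothlyOn
      (fun (γ : {γ : Γ // γ ∉ singularElements Γ K}) (p : Pt m k × Pt m k) =>
        G p.1 ((γ.1 : Equiv.Perm (Pt m k)) p.2)) K := by
  obtain ⟨h1, U, hU, hKU, -, -, hsm, u, hu, hb⟩ := hΓ.exists_series_bound hs hG hK hKH
  exact ⟨h1, convergesSmoothlyOn_of_isOpen hU hKU hsm hu hb⟩

lemma contDiffOn_foldKer {s : ℂ} (hs : a < s.re) :
    ContDiffOn ℝ ∞ (fun p : Pt m k × Pt m k => foldKer Γ (resFun (m + k) s) p.1 p.2) (offDiagonal Γ) := by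
  intro p hp
  have hKH : {p} ⊆ halfSpace m k ×ˢ halfSpace m k := singleton_subset_iff.mpr ⟨hp.1, hp.2.1⟩
  obtain ⟨-, U, hU, hKU, hUH, -, hsm, u, hu, hb⟩ := hΓ.exists_series_bound hs
    (G := fun w w' => resFun (m + k) s (twoCosh w w')) (fun _ _ _ _ _ => rfl) isCompact_singleton hKH
  have hS : ∀ γ : Γ, γ ∉ singularElements Γ {p} := by
    rintro γ ⟨q, rfl, h⟩
    exact hp.2.2 γ γ.2 h
  have hpU : p ∈ U := hKU rfl
  have h := (contDiffOn_tsum_of_isOpen hU hsm hu hb).contDiffAt (hU.mem_nhds hpU)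
  refine (h.congr_of_eventuallyEq ?_).contDiffWithinAt
  filter_upwards [hU.mem_nhds hpU] with q hq
  rw [foldKer_eq _ (hUH hq).1 (hUH hq).2]
  exact ((Equiv.subtypeUnivEquiv hS).tsum_eq fun γ : Γ =>
    resFun (m + k) s (twoCosh q.1 (γ.1 q.2))).symm

end CuspLike

end

end ModelCusp

namespace ModelCusp

section

open Filter Topology MeasureTheory Set

variable {m k : ℕ}

/-! ### Existence and uniqueness of the resolvent kernel -/

lemma hypVolume_pos {A : Set (Pt m k)} (hA : IsOpen A) (hne : A.Nonempty) (hAH : A ⊆ halfSpace m k) :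
    hypVolume m k A ≠ 0 := by
  intro h
  rw [hypVolume, withDensity_apply_eq_zero (by fun_prop)] at h
  have e : {w : Pt m k | ENNReal.ofReal ((w.1 ^ (m + k + 1))⁻¹) ≠ 0} ∩ A = A := by
    refine inter_eq_right.mpr fun w hw => ?_
    have hx : 0 < w.1 := hAH hw
    have : 0 < (w.1 ^ (m + k + 1))⁻¹ := by positivity
    simpa using this
  rw [e, Measure.restrict_apply hA.measurableSet, inter_eq_left.mpr hAH] at h
  exact (hA.measure_pos volume hne).ne' h

namespace CuspLike

variable {Γ : Subgroup (Equiv.Perm (Pt m k))} {F : Set (Pt m k)} {a : ℝ} (hΓ : CuspLike Γ F a)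
include hΓ

/-- Existence of the resolvent kernel and of its continuation. -/
theorem isResolventKernel_foldKer : IsResolventKernel Γ F a fun s => foldKer Γ (resFun (m + k) s) where
  invariant _ _ w _ w' _ γ hγ := ⟨hΓ.foldKer_apply_left _ ⟨γ, hγ⟩ w w', hΓ.foldKer_apply_right _ ⟨γ, hγ⟩ w w'⟩
  smooth _ hs := hΓ.contDiffOn_foldKer hs
  holomorphic p _ := hΓ.differentiableOn_foldKer p.1 p.2
  resolvent := ⟨fun s => foldOp Γ F (resFun (m + k) s), fun _ _ hs =>
    ⟨hΓ.isResolvent_foldOp hs, hΓ.foldOp_spec (schurFun_resFun hΓ.dim_pos hΓ.le_half hs).choose_spec⟩,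
    fun _ _ hN hχ => hΓ.exists_weighted_continuation hN hχ⟩

lemma isOpen_offDiagonal : IsOpen (offDiagonal Γ) := by
  rw [isOpen_iff_mem_nhds]
  intro p hp
  have hKH : {p} ⊆ halfSpace m k ×ˢ halfSpace m k := singleton_subset_iff.mpr ⟨hp.1, hp.2.1⟩
  have hS : ∀ γ : Γ, γ ∉ singularElements Γ {p} := by
    rintro γ ⟨q, rfl, h⟩
    exact hp.2.2 γ γ.2 h
  obtain ⟨-, U, hU, hKU, hUH, hne, -⟩ := hΓ.exists_series_bound (s := (a + 1 : ℝ)) (by simp)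
    (G := fun w w' => resFun (m + k) (a + 1 : ℝ) (twoCosh w w')) (fun _ _ _ _ _ => rfl) isCompact_singleton hKH
  filter_upwards [hU.mem_nhds (hKU rfl)] with q hq
  exact ⟨(hUH hq).1, (hUH hq).2, fun γ hγ => hne ⟨⟨γ, hγ⟩, hS ⟨γ, hγ⟩⟩ q hq⟩

/-- A nonempty open set has a translate that meets the fundamental domain in positive measure. -/
lemma exists_translate {A : Set (Pt m k)} (hA : IsOpen A) (hne : A.Nonempty) (hAH : A ⊆ halfSpace m k) :
    ∃ γ : Γ, quotVolume F (γ.1 ⁻¹' A) ≠ 0 := by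
  have := hΓ.countable
  by_contra! h
  refine hypVolume_pos hA hne hAH ?_
  have hm : ∀ γ : Γ, MeasurableSet (γ.1 ⁻¹' A) := fun γ =>
    (hΓ.continuous_apply γ).measurable hA.measurableSet
  rw [← lintegral_indicator_one hA.measurableSet, ← hΓ.lintegral_fold (measurable_one.indicator hA.measurableSet),
    lintegral_tsum (f := fun (γ : Γ) w => A.indicator (1 : Pt m k → ENNReal) (γ.1 w))
      fun γ => ((measurable_one.indicator hA.measurableSet).comp (hΓ.continuous_apply γ).measurable).aemeasurable,
    ENNReal.tsum_eq_zero]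
  intro γ
  have e : (fun w => A.indicator (1 : Pt m k → ENNReal) (γ.1 w)) =
      (γ.1 ⁻¹' A).indicator 1 := rfl
  rw [e, lintegral_indicator_one (hm γ), h γ]

/-- An integral operator on `L²(X)` determines its kernel off the diagonal, for kernels that are
invariant and continuous there. -/
lemma kernel_eq_of_hasIntegralKernel {T : L2 F →L[ℂ] L2 F} {κ κ' : Pt m k → Pt m k → ℂ}
    (h : HasIntegralKernel F T κ) (h' : HasIntegralKernel F T κ')
    (hinv : ∀ γ : Γ, ∀ w ∈ halfSpace m k, ∀ w' ∈ halfSpace m k,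
      κ (γ.1 w) w' = κ w w' ∧ κ w (γ.1 w') = κ w w')
    (hinv' : ∀ γ : Γ, ∀ w ∈ halfSpace m k, ∀ w' ∈ halfSpace m k,
      κ' (γ.1 w) w' = κ' w w' ∧ κ' w (γ.1 w') = κ' w w')
    (hc : ContinuousOn (fun p : Pt m k × Pt m k => κ p.1 p.2) (offDiagonal Γ))
    (hc' : ContinuousOn (fun p : Pt m k × Pt m k => κ' p.1 p.2) (offDiagonal Γ))
    {p : Pt m k × Pt m k} (hp : p ∈ offDiagonal Γ) : κ p.1 p.2 = κ' p.1 p.2 := by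
  by_contra hne
  set δ : Pt m k → Pt m k → ℂ := fun w w' => κ w w' - κ' w w' with hδ
  set z := δ p.1 p.2 with hz
  have hz0 : z ≠ 0 := sub_ne_zero.mpr hne
  have hδc : ContinuousAt (fun q : Pt m k × Pt m k => (starRingEnd ℂ z * δ q.1 q.2).re) p :=
    Complex.continuous_re.continuousAt.comp (continuousAt_const.mul
      ((hc.sub hc').continuousAt (hΓ.isOpen_offDiagonal.mem_nhds hp)))
  have hpos : 0 < (starRingEnd ℂ z * δ p.1 p.2).re := by
    rw [← hz, mul_comm, Complex.mul_conj, Complex.ofReal_re]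
    exact Complex.normSq_pos.mpr hz0
  have hev := (hδc.eventually (lt_mem_nhds hpos)).and (isOpen_halfSpace_prod.mem_nhds
    (show p ∈ halfSpace m k ×ˢ halfSpace m k from ⟨hp.1, hp.2.1⟩))
  rw [show p = (p.1, p.2) from rfl, nhds_prod_eq] at hev
  obtain ⟨A, hA, A', hA', hAA⟩ := Filter.mem_prod_iff.mp hev
  obtain ⟨U, hUA, hU, hpU⟩ := mem_nhds_iff.mp hA
  obtain ⟨Kc, hKc, hKA', hKcpt⟩ := local_compact_nhds hA'
  obtain ⟨U', hU'K, hU', hpU'⟩ := mem_nhds_iff.mp hKc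
  have hAH : ∀ w ∈ A, w ∈ halfSpace m k := fun w hw =>
    (hAA (show (w, p.2) ∈ A ×ˢ A' from ⟨hw, mem_of_mem_nhds hA'⟩)).2.1
  have hAH' : ∀ w ∈ A', w ∈ halfSpace m k := fun w hw =>
    (hAA (show (p.1, w) ∈ A ×ˢ A' from ⟨mem_of_mem_nhds hA, hw⟩)).2.2
  obtain ⟨γ, hγ⟩ := hΓ.exists_translate hU ⟨_, hpU⟩ fun w hw => hAH w (hUA hw)
  obtain ⟨γ', hγ'⟩ := hΓ.exists_translate hU' ⟨_, hpU'⟩ fun w hw => hAH' w (hKA' (hU'K hw))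
  set S := γ.1 ⁻¹' U with hS
  set S' := (γ' : Equiv.Perm (Pt m k)) ⁻¹' U' with hS'
  have hS'm : MeasurableSet S' := (hΓ.continuous_apply γ').measurable hU'.measurableSet
  have hfin : quotVolume F S' ≠ ⊤ := by
    have h1 : quotVolume F S' ≤ hypVolume m k S' := Measure.restrict_apply_le _ _
    obtain ⟨L, t, hL⟩ := hΓ.isom γ' γ'.2
    have h2 : hypVolume m k S' = hypVolume m k U' := by
      rw [hS', hL]
      exact (measurePreserving_cuspIsometry L t).measure_preimage hU'.measurableSet.nullMeasurableSet
    refine ne_top_of_le_ne_top ?_ (h1.trans (h2.le.trans (measure_mono hU'K)))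
    exact (hypVolume_lt_top hKcpt fun w hw => hAH' w (hKA' hw)).ne
  -- both kernels applied to the indicator of `S'` agree, although their difference, multiplied by
  -- the conjugate of `z`, has positive real part on `S × S'`
  set f : L2 F := indicatorConstLp 2 hS'm hfin (1 : ℂ)
  have hf : f =ᵐ[quotVolume F] S'.indicator fun _ => (1 : ℂ) := indicatorConstLp_coeFn
  have hpos2 : ∀ w ∈ S, ∀ w' ∈ S', 0 < (starRingEnd ℂ z * δ w w').re := fun w hw w' hw' => by
    have hw0 : γ.1 w ∈ A := hUA hw
    have hw0' : (γ' : Equiv.Perm (Pt m k)) w' ∈ A' := hKA' (hU'K hw')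
    have hwH := (hΓ.apply_mem γ.2).mp (hAH _ hw0)
    have hwH' := (hΓ.apply_mem γ'.2).mp (hAH' _ hw0')
    have h1 := (hAA (show (γ.1 w, (γ' : Equiv.Perm (Pt m k)) w') ∈ A ×ˢ A' from
      ⟨hw0, hw0'⟩)).1
    have e : δ (γ.1 w) ((γ' : Equiv.Perm (Pt m k)) w') = δ w w' := by
      simp only [hδ]
      rw [(hinv γ w hwH _ (hAH' _ hw0')).1, (hinv' γ w hwH _ (hAH' _ hw0')).1, (hinv γ' w hwH w' hwH').2,
        (hinv' γ' w hwH w' hwH').2]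
    rw [← e]
    exact h1
  have hzero : ∀ᵐ w ∂(quotVolume F), w ∉ S := by
    filter_upwards [h f, h' f] with w h1 h2 hwS
    have hi : Integrable (fun w' => starRingEnd ℂ z * (κ w w' * f w' - κ' w w' * f w')) (quotVolume F) :=
      (h1.1.sub h2.1).const_mul _
    have h3 : ∫ w', starRingEnd ℂ z * (κ w w' * f w' - κ' w w' * f w') ∂(quotVolume F) = 0 := by
      rw [integral_const_mul, integral_sub h1.1 h2.1, ← h1.2, ← h2.2, sub_self, mul_zero]
    have h4 : ∫ w', (starRingEnd ℂ z * (κ w w' * f w' - κ' w w' * f w')).re ∂(quotVolume F) = 0 := by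
      have := integral_re hi
      simp only [RCLike.re_to_complex] at this
      rw [this, h3, Complex.zero_re]
    have hval : ∀ᵐ w' ∂(quotVolume F), (starRingEnd ℂ z * (κ w w' * f w' - κ' w w' * f w')).re =
        S'.indicator (fun w' => (starRingEnd ℂ z * δ w w').re) w' := by
      filter_upwards [hf] with w' hw'
      rw [hw']
      by_cases hm : w' ∈ S'
      · rw [indicator_of_mem hm, indicator_of_mem hm, mul_one, mul_one]
      · rw [indicator_of_notMem hm, indicator_of_notMem hm]; simp
    have hnn : 0 ≤ᵐ[quotVolume F] fun w' => (starRingEnd ℂ z * (κ w w' * f w' - κ' w w' * f w')).re := by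
      filter_upwards [hval] with w' hw'
      rw [hw']
      exact indicator_nonneg (fun w' hw' => (hpos2 w hwS w' hw').le) w'
    have h5 := (integral_eq_zero_iff_of_nonneg_ae hnn hi.re).mp h4
    refine hγ' (measure_eq_zero_iff_ae_notMem.mpr ?_)
    filter_upwards [h5, hval] with w' h6 h7 hm
    rw [h7, indicator_of_mem hm] at h6
    exact (hpos2 w hwS w' hm).ne' h6
  exact hγ (measure_eq_zero_iff_ae_notMem.mpr hzero)

/-- The resolvent kernel is unique off the diagonal. -/
theorem resolventKernel_unique {K : ℂ → Pt m k → Pt m k → ℂ} (hK : IsResolventKernel Γ F a K) {s : ℂ}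
    (hs : a < s.re) {p : Pt m k × Pt m k} (hp : p ∈ offDiagonal Γ) :
    K s p.1 p.2 = foldKer Γ (resFun (m + k) s) p.1 p.2 := by
  obtain ⟨R, hR, -⟩ := hK.resolvent
  have hK' := hΓ.isResolventKernel_foldKer
  -- in the half-plane of the resolvent both kernels belong to the same operator
  have hlarge : ∀ s : ℂ, ((m + k : ℕ) : ℝ) / 2 < s.re → K s p.1 p.2 = foldKer Γ (resFun (m + k) s) p.1 p.2 := by
    intro s hs
    have has := hΓ.le_half.trans_lt hs
    obtain ⟨h1, h2⟩ := hR s has hs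
    have h3 := hΓ.isResolvent_foldOp hs
    have e : R s = foldOp Γ F (resFun (m + k) s) :=
      ContinuousLinearMap.ext fun f => (h1 f _).mpr ((h3 f _).mp rfl)
    have h4 : HasIntegralKernel F (R s) (foldKer Γ (resFun (m + k) s)) := by
      rw [e]; exact hΓ.foldOp_spec (schurFun_resFun hΓ.dim_pos hΓ.le_half hs).choose_spec
    exact hΓ.kernel_eq_of_hasIntegralKernel h2 h4
      (fun γ w hw w' hw' => hK.invariant s has w hw w' hw' γ γ.2)
      (fun γ w hw w' hw' => hK'.invariant s has w hw w' hw' γ γ.2)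
      (hK.smooth s has).continuousOn (hK'.smooth s has).continuousOn hp
  have hopen : IsOpen {s : ℂ | a < s.re} := isOpen_lt continuous_const Complex.continuous_re
  have hconn : IsPreconnected {s : ℂ | a < s.re} := (convex_halfSpace_re_gt a).isPreconnected
  set s₁ : ℂ := ((((m + k : ℕ) : ℝ) / 2 + 1 : ℝ) : ℂ) with hs₁
  have hs₁re : s₁.re = ((m + k : ℕ) : ℝ) / 2 + 1 := Complex.ofReal_re _
  have hmem : s₁ ∈ {s : ℂ | a < s.re} := by
    show a < s₁.re
    rw [hs₁re]; linarith [hΓ.le_half]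
  -- the identity theorem on the half-plane `Re s > a`
  refine (((hK.holomorphic p hp).analyticOnNhd hopen).eqOn_of_preconnected_of_eventuallyEq
    ((hK'.holomorphic p hp).analyticOnNhd hopen) hconn hmem ?_) hs
  have : {s : ℂ | ((m + k : ℕ) : ℝ) / 2 < s.re} ∈ 𝓝 s₁ :=
    (isOpen_lt continuous_const Complex.continuous_re).mem_nhds (by
      show ((m + k : ℕ) : ℝ) / 2 < s₁.re
      rw [hs₁re]; linarith)
  filter_upwards [this] with s hs using hlarge s hs

/-- The chosen kernel has the defining properties, because a kernel with these properties exists. -/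
theorem isResolventKernel_resolventKernel : IsResolventKernel Γ F a (resolventKernel Γ F a) :=
  Classical.epsilon_spec (p := fun K => IsResolventKernel Γ F a K) ⟨_, hΓ.isResolventKernel_foldKer⟩

lemma resolventKernel_eq {s : ℂ} (hs : a < s.re) {p : Pt m k × Pt m k} (hp : p ∈ offDiagonal Γ) :
    resolventKernel Γ F a s p.1 p.2 = foldKer Γ (resFun (m + k) s) p.1 p.2 :=
  hΓ.resolventKernel_unique hΓ.isResolventKernel_resolventKernel hs hp

end CuspLike

end

end ModelCusp

namespace ModelCusp

section

open Filter Topology MeasureTheory Set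

variable {m k : ℕ}

/-! ### Lattice sums -/

lemma integral_quad_rpow {q : ℝ} (hq : (k : ℝ) / 2 < q) {r : ℝ} (hr : 1 ≤ r) :
    Integrable (fun x : EuclideanSpace ℝ (Fin k) => (r ^ 2 + ‖x‖ ^ 2) ^ (-q)) ∧
      ∫ x : EuclideanSpace ℝ (Fin k), (r ^ 2 + ‖x‖ ^ 2) ^ (-q) =
        r ^ ((k : ℝ) - 2 * q) * ∫ x : EuclideanSpace ℝ (Fin k), (1 + ‖x‖ ^ 2) ^ (-q) := by
  have h1 : Integrable (fun x : EuclideanSpace ℝ (Fin k) => (1 + ‖x‖ ^ 2) ^ (-q)) := by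
    have := integrable_rpow_neg_one_add_norm_sq (E := EuclideanSpace ℝ (Fin k)) (μ := volume) (r := 2 * q)
      (by rw [finrank_euclideanSpace_fin]; linarith)
    simpa [neg_div] using this
  have hr0 : 0 < r := by linarith
  have hq0 : 0 ≤ q := le_trans (by positivity) hq.le
  constructor
  · refine h1.mono' (((measurable_norm.pow_const 2).const_add _).pow_const _).aestronglyMeasurable (Eventually.of_forall fun x => ?_)
    rw [Real.norm_of_nonneg (by positivity)]
    exact Real.rpow_le_rpow_of_nonpos (by positivity) (by nlinarith) (by linarith)
  · have h2 := Measure.integral_comp_inv_smul_of_nonneg (volume : Measure (EuclideanSpace ℝ (Fin k)))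
      (fun x => (1 + ‖x‖ ^ 2) ^ (-q)) hr0.le
    rw [finrank_euclideanSpace_fin, smul_eq_mul] at h2
    have e : ∀ x : EuclideanSpace ℝ (Fin k), (r ^ 2 + ‖x‖ ^ 2) ^ (-q) =
        r ^ (-(2 * q)) * (1 + ‖r⁻¹ • x‖ ^ 2) ^ (-q) := fun x => by
      have : r ^ 2 + ‖x‖ ^ 2 = r ^ 2 * (1 + ‖r⁻¹ • x‖ ^ 2) := by
        rw [norm_smul, Real.norm_of_nonneg (by positivity)]; field_simp
      rw [this, Real.mul_rpow (by positivity) (by positivity), ← Real.rpow_natCast, ← Real.rpow_mul hr0.le]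
      congr 2; push_cast; ring
    simp only [e]
    rw [integral_const_mul, h2, ← mul_assoc, ← Real.rpow_natCast, ← Real.rpow_add hr0]
    congr 2; ring

/-- Comparison of a lattice sum with an integral. -/
theorem exists_lattice_sum_bound (b : Module.Basis (Fin k) ℝ (EuclideanSpace ℝ (Fin k))) {q : ℝ}
    (hq : (k : ℝ) / 2 < q) : ∃ C > 0, ∀ r ≥ 1, ∀ z : EuclideanSpace ℝ (Fin k),
      Summable (fun g : Submodule.span ℤ (Set.range b) => (r ^ 2 + ‖z - g‖ ^ 2) ^ (-q)) ∧
      ∑' g : Submodule.span ℤ (Set.range b), (r ^ 2 + ‖z - g‖ ^ 2) ^ (-q) ≤ C * r ^ ((k : ℝ) - 2 * q) := by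
  obtain ⟨d, hd⟩ := (ZSpan.fundamentalDomain_isBounded b).exists_norm_le
  set D := ZSpan.fundamentalDomain b with hD
  have hq0 : 0 ≤ q := le_trans (by positivity) hq.le
  have hDfin : volume D ≠ ⊤ := (ZSpan.fundamentalDomain_isBounded b).measure_lt_top.ne
  have hDpos : volume D ≠ 0 := ZSpan.measure_fundamentalDomain_ne_zero b
  set V := (volume D).toReal with hV
  have hV0 : 0 < V := ENNReal.toReal_pos hDpos hDfin
  set I := ∫ x : EuclideanSpace ℝ (Fin k), (1 + ‖x‖ ^ 2) ^ (-q) with hI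
  have hI0 : 0 ≤ I := integral_nonneg fun x => by positivity
  refine ⟨(2 + 2 * d ^ 2) ^ q / V * I + 1, by positivity, fun r hr z => ?_⟩
  have hr0 : 0 < r := by linarith
  obtain ⟨hint, hval⟩ := integral_quad_rpow hq hr
  set f : EuclideanSpace ℝ (Fin k) → ENNReal := fun x => ENNReal.ofReal ((r ^ 2 + ‖z - x‖ ^ 2) ^ (-q)) with hf
  have h1 : ∫⁻ x, f x = ENNReal.ofReal (r ^ ((k : ℝ) - 2 * q) * I) := by
    rw [hf, lintegral_sub_left_eq_self (fun x : EuclideanSpace ℝ (Fin k) =>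
      ENNReal.ofReal ((r ^ 2 + ‖x‖ ^ 2) ^ (-q))) z, ← hval,
      ofReal_integral_eq_lintegral_ofReal hint (Eventually.of_forall fun x => by positivity)]
  have : VAddInvariantMeasure (Submodule.span ℤ (Set.range b)) (EuclideanSpace ℝ (Fin k)) volume :=
    ⟨fun g S _ => measure_preimage_add volume (g : EuclideanSpace ℝ (Fin k)) S⟩
  have h2 := (ZSpan.isAddFundamentalDomain b volume).lintegral_eq_tsum'' f
  -- each term is comparable with the integral over its translate of the fundamental cell
  have h3 : ∀ g : Submodule.span ℤ (Set.range b), ENNReal.ofReal (V / (2 + 2 * d ^ 2) ^ q) *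
      ENNReal.ofReal ((r ^ 2 + ‖z - g‖ ^ 2) ^ (-q)) ≤ ∫⁻ x in D, f (g +ᵥ x) := fun g => by
    calc _ = ∫⁻ _ in D, ENNReal.ofReal (((2 + 2 * d ^ 2) ^ q)⁻¹ * (r ^ 2 + ‖z - g‖ ^ 2) ^ (-q)) := by
          rw [lintegral_const, Measure.restrict_apply_univ, ← ENNReal.ofReal_toReal hDfin,
            ← ENNReal.ofReal_mul (by positivity), ← ENNReal.ofReal_mul (by positivity)]
          congr 1; ring
      _ ≤ _ := by
          refine setLIntegral_mono' (ZSpan.fundamentalDomain_measurableSet b) fun x hx => ENNReal.ofReal_le_ofReal ?_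
          have hxd := hd x hx
          have h4 : ‖z - (g +ᵥ x)‖ ≤ ‖z - g‖ + d := by
            have : z - (g +ᵥ x) = (z - g) - x := by
              rw [Submodule.vadd_def, vadd_eq_add]; abel
            rw [this]
            exact (norm_sub_le _ _).trans (by gcongr)
          have h5 : r ^ 2 + ‖z - (g +ᵥ x)‖ ^ 2 ≤ (2 + 2 * d ^ 2) * (r ^ 2 + ‖z - g‖ ^ 2) := by
            have h6 := pow_le_pow_left₀ (norm_nonneg _) h4 2
            have h7 : 1 ≤ r ^ 2 := one_le_pow₀ hr
            nlinarith [sq_nonneg (‖z - g‖ - d), sq_nonneg d, mul_nonneg (sq_nonneg d) (sq_nonneg ‖z - g‖)]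
          rw [← Real.rpow_neg (by positivity), ← Real.mul_rpow (by positivity) (by positivity)]
          exact Real.rpow_le_rpow_of_nonpos (by positivity) h5 (by linarith)
  have h4 : ENNReal.ofReal (V / (2 + 2 * d ^ 2) ^ q) * ∑' g : Submodule.span ℤ (Set.range b),
      ENNReal.ofReal ((r ^ 2 + ‖z - g‖ ^ 2) ^ (-q)) ≤ ENNReal.ofReal (r ^ ((k : ℝ) - 2 * q) * I) := by
    rw [← h1, h2, ← ENNReal.tsum_mul_left]
    exact ENNReal.tsum_le_tsum h3
  set S := ∑' g : Submodule.span ℤ (Set.range b), ENNReal.ofReal ((r ^ 2 + ‖z - g‖ ^ 2) ^ (-q)) with hS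
  have h5 : S ≤ ENNReal.ofReal ((2 + 2 * d ^ 2) ^ q / V * (r ^ ((k : ℝ) - 2 * q) * I)) := by
    have h6 := mul_le_mul_right h4 (ENNReal.ofReal ((2 + 2 * d ^ 2) ^ q / V))
    rw [← mul_assoc, ← ENNReal.ofReal_mul (by positivity), ← ENNReal.ofReal_mul (by positivity)] at h6
    have : (2 + 2 * d ^ 2) ^ q / V * (V / (2 + 2 * d ^ 2) ^ q) = 1 := by
      have : 0 < (2 + 2 * d ^ 2) ^ q := by positivity
      field_simp
    rwa [this, ENNReal.ofReal_one, one_mul] at h6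
  have hsum : Summable fun g : Submodule.span ℤ (Set.range b) => (r ^ 2 + ‖z - g‖ ^ 2) ^ (-q) := by
    have := ENNReal.summable_toReal (f := fun g : Submodule.span ℤ (Set.range b) =>
      ENNReal.ofReal ((r ^ 2 + ‖z - g‖ ^ 2) ^ (-q))) (ne_top_of_le_ne_top ENNReal.ofReal_ne_top h5)
    exact this.congr fun g => ENNReal.toReal_ofReal (by positivity)
  refine ⟨hsum, ?_⟩
  rw [hS, ← ENNReal.ofReal_tsum_of_nonneg (fun g => by positivity) hsum] at h5
  have h6 := (ENNReal.ofReal_le_ofReal_iff (by positivity)).mp h5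
  have h7 : 0 ≤ r ^ ((k : ℝ) - 2 * q) := by positivity
  nlinarith

/-! ### Hyperbolic space and the model cusps -/

lemma hypVolume_absolutelyContinuous : hypVolume m k ≪ volume :=
  (withDensity_absolutelyContinuous _ _).trans Measure.restrict_le_self.absolutelyContinuous

/-- Hyperbolic space itself is the case of the trivial group, with `F` the whole half-space and `a = 0`. -/
theorem cuspLike_bot (hn : 0 < m + k) :
    CuspLike (⊥ : Subgroup (Equiv.Perm (Pt m k))) (halfSpace m k) 0 where
  nonneg := le_rfl
  le_half := by positivity
  dim_pos := hn
  isom γ hγ := by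
    refine ⟨LinearIsometryEquiv.refl ℝ _, 0, ?_⟩
    rw [Subgroup.mem_bot.mp hγ]
    ext w : 1
    rw [cuspIsometry_apply]
    simp
  countable := inferInstance
  measurableSet := measurableSet_halfSpace
  subset := subset_rfl
  frontier_null := by
    have := isAddHaarMeasure_volume_pt (m := m) (k := k)
    refine Convex.addHaar_frontier _ ?_
    exact (convex_Ioi (0 : ℝ)).is_linear_preimage (f := fun w : Pt m k => w.1) ⟨fun _ _ => rfl, fun _ _ => rfl⟩
  fundamental :=
    { nullMeasurableSet := measurableSet_halfSpace.nullMeasurableSet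
      ae_covers := ae_hypVolume_mem.mono fun w hw => ⟨1, by simpa using hw⟩
      aedisjoint := fun g h hgh => absurd (Subsingleton.elim g h) hgh }
  growth := ⟨fun _ => 1, fun _ => le_rfl, fun _ _ => summable_of_hasFiniteSupport (Set.toFinite _), fun B =>
    ⟨1, one_pos, fun γ w w' _ _ => by
      have : 0 ≤ quad w (γ.1 w') := by unfold quad; positivity
      linarith⟩⟩

section cusp

variable {A : Fin k → (EuclideanSpace ℝ (Fin m) ≃ₗᵢ[ℝ] EuclideanSpace ℝ (Fin m))}
  {v : Fin k → EuclideanSpace ℝ (Fin k)}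

/-- The elements of `Γ_c` correspond to the lattice vectors by which they translate. -/
theorem exists_cuspGroup_equiv (hA : ∀ i j, Commute (A i) (A j)) (hv : LinearIndependent ℝ v) :
    ∃ e : cuspGroup A v ≃ Submodule.span ℤ (Set.range v), ∀ γ : cuspGroup A v, ∃ L,
      γ.1 = cuspIsometry L (e γ).1 := by
  have hcomm : Pairwise fun i j => ∀ x y : Multiplicative ℤ,
      Commute (zpowersHom _ (A i) x) (zpowersHom _ (A j) y) := fun i j _ x y => by
    rw [zpowersHom_apply, zpowersHom_apply]
    exact (hA i j).zpow_zpow _ _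
  set P : (Fin k → Multiplicative ℤ) →* (EuclideanSpace ℝ (Fin m) ≃ₗᵢ[ℝ] EuclideanSpace ℝ (Fin m)) :=
    MonoidHom.noncommPiCoprod (fun j => zpowersHom _ (A j)) hcomm with hP
  set τ : (Fin k → Multiplicative ℤ) → EuclideanSpace ℝ (Fin k) := fun l => ∑ j, Multiplicative.toAdd (l j) • v j with hτ
  have hτmul : ∀ l l', τ (l * l') = τ l + τ l' := fun l l' => by
    simp only [hτ, Pi.mul_apply, toAdd_mul, add_smul, Finset.sum_add_distrib]
  -- `Γ_c` is the image of `ℤᵏ` under this homomorphism, which exists because the `A_j` commute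
  set Ψ : (Fin k → Multiplicative ℤ) →* Equiv.Perm (Pt m k) :=
    MonoidHom.mk' (fun l => cuspIsometry (P l) (τ l)) (fun l l' => by
      ext w : 1
      rw [Equiv.Perm.mul_apply, cuspIsometry_apply, cuspIsometry_apply, cuspIsometry_apply, map_mul, hτmul,
        add_comm (τ l), ← add_assoc]
      rfl) with hΨ
  have hΨ_apply : ∀ l, Ψ l = cuspIsometry (P l) (τ l) := fun l => rfl
  have hgen : ∀ j, Ψ (Pi.mulSingle j (Multiplicative.ofAdd 1)) = cuspIsometry (A j) (v j) := fun j => by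
    have h1 : P (Pi.mulSingle j (Multiplicative.ofAdd 1)) = A j := by
      rw [hP, MonoidHom.noncommPiCoprod_mulSingle, zpowersHom_apply, toAdd_ofAdd, zpow_one]
    have h2 : τ (Pi.mulSingle j (Multiplicative.ofAdd 1)) = v j := by
      rw [hτ]
      simp only
      rw [Finset.sum_eq_single j (fun i _ hij => by rw [Pi.mulSingle_eq_of_ne hij, toAdd_one, zero_smul]) (by simp),
        Pi.mulSingle_eq_same, toAdd_ofAdd, one_smul]
    rw [hΨ_apply, h1, h2]
  have hrange : Ψ.range = cuspGroup A v := by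
    refine le_antisymm ?_ ((Subgroup.closure_le _).mpr ?_)
    · rintro _ ⟨l, rfl⟩
      refine Subgroup.pi_mem_of_mulSingle_mem (H := (cuspGroup A v).comap Ψ) l fun j => ?_
      have e : Pi.mulSingle j (l j) = (Pi.mulSingle j (Multiplicative.ofAdd 1) : Fin k → Multiplicative ℤ) ^
          (Multiplicative.toAdd (l j)) := by
        rw [← Pi.mulSingle_zpow, ← ofAdd_zsmul, smul_eq_mul, mul_one, ofAdd_toAdd]
      rw [e]
      refine Subgroup.zpow_mem _ ?_ _
      rw [Subgroup.mem_comap, hgen]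
      exact Subgroup.subset_closure ⟨j, rfl⟩
    · rintro _ ⟨j, rfl⟩
      exact ⟨_, hgen j⟩
  have hl : ∀ γ : cuspGroup A v, ∃ l, Ψ l = γ := fun γ =>
    (SetLike.ext_iff.mp hrange _).mpr γ.2
  choose l hl using hl
  have hτmem : ∀ l, τ l ∈ Submodule.span ℤ (Set.range v) := fun l =>
    (Submodule.mem_span_range_iff_exists_fun ℤ).mpr ⟨fun j => Multiplicative.toAdd (l j), rfl⟩
  have hτinj : Function.Injective τ := fun l l' h => by
    have hZ : LinearIndependent ℤ v := hv.restrict_scalars' ℤ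
    funext j
    exact congrFun (Fintype.linearIndependent_iffₛ.mp hZ (fun j => Multiplicative.toAdd (l j))
      (fun j => Multiplicative.toAdd (l' j)) h |> funext) j
  refine ⟨Equiv.ofBijective (fun γ => ⟨τ (l γ), hτmem _⟩) ⟨fun γ γ' h => ?_, fun x => ?_⟩, fun γ =>
    ⟨P (l γ), ((hl γ).symm.trans (hΨ_apply _))⟩⟩
  · have := hτinj (Subtype.ext_iff.mp h)
    exact Subtype.ext (by rw [← hl γ, ← hl γ', this])
  · obtain ⟨c, hc⟩ := (Submodule.mem_span_range_iff_exists_fun ℤ).mp x.2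
    have hmem : Ψ (fun j => Multiplicative.ofAdd (c j)) ∈ cuspGroup A v := by rw [← hrange]; exact ⟨_, rfl⟩
    refine ⟨⟨_, hmem⟩, Subtype.ext ?_⟩
    have h1 := hl ⟨_, hmem⟩
    have h2 : τ (l ⟨_, hmem⟩) = τ (fun j => Multiplicative.ofAdd (c j)) := by
      have := congrArg (fun γ : Equiv.Perm (Pt m k) => (γ 0).2.2) h1
      simpa [hΨ_apply, cuspIsometry_apply] using this
    show τ _ = _
    rw [h2, ← hc]
    rfl

/-- The basis given by the translation vectors. -/
noncomputable def cuspBasis (hv : LinearIndependent ℝ v) :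
    Module.Basis (Fin k) ℝ (EuclideanSpace ℝ (Fin k)) :=
  Module.Basis.mk hv (hv.span_eq_top_of_card_eq_finrank' (by simp)).ge

/-- A model cusp of rank `k` is the case `a = k / 2`: a growth function is `1 + |t|²` for the
translation by `t`, and the lattice sum of its powers `-σ` converges exactly for `σ > k / 2`. -/
theorem cuspLike_cuspGroup (hk : 0 < k) (hA : ∀ i j, Commute (A i) (A j)) (hv : LinearIndependent ℝ v) :
    CuspLike (cuspGroup A v) (cuspDomain m v) ((k : ℝ) / 2) := by
  obtain ⟨e, he⟩ := exists_cuspGroup_equiv (m := m) hA hv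
  choose L hL using he
  have hcv : ⇑(cuspBasis hv) = v := Module.Basis.coe_mk _ _
  have hlat : ∀ q : ℝ, (k : ℝ) / 2 < q → ∀ z : EuclideanSpace ℝ (Fin k),
      Summable fun g : Submodule.span ℤ (Set.range v) => (1 + ‖z - g‖ ^ 2) ^ (-q) := fun q hq z => by
    obtain ⟨C, -, hC⟩ := exists_lattice_sum_bound (cuspBasis hv) hq
    have := (hC 1 le_rfl z).1
    rw [hcv] at this
    simpa using this
  have hmemspan : ∀ l, l ∈ AddSubgroup.closure (Set.range v) ↔ l ∈ Submodule.span ℤ (Set.range v) := fun l => by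
    rw [← Submodule.span_int_eq_addSubgroupClosure]; rfl
  have hcount : Countable (cuspGroup A v) := by
    have : Countable (Submodule.span ℤ (Set.range v)) := by
      rw [← hcv]; infer_instance
    exact e.injective.countable
  have happ : ∀ (γ : cuspGroup A v) (w : Pt m k), γ.1 w =
      (w.1, L γ w.2.1, w.2.2 + (e γ).1) := fun γ w => by
    rw [hL γ]; rfl
  have hclosed : IsClosed {w : Pt m k | ∀ l ∈ AddSubgroup.closure (Set.range v), ‖w.2.2‖ ≤ ‖w.2.2 - l‖} := by
    simp only [ofPred_forall]
    exact isClosed_iInter fun l => isClosed_iInter fun _ => isClosed_le (by fun_prop) (by fun_prop)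
  have hmeas : MeasurableSet (cuspDomain m v) := measurableSet_halfSpace.inter hclosed.measurableSet
  -- the Dirichlet domain is an intersection of half-spaces; a convex set has null frontier
  have hconv : Convex ℝ (cuspDomain m v) := by
    have h1 : ∀ (w : Pt m k) l, ‖w.2.2‖ ≤ ‖w.2.2 - l‖ ↔ inner ℝ l w.2.2 ≤ ‖l‖ ^ 2 / 2 := fun w l => by
      rw [← sq_le_sq₀ (norm_nonneg _) (norm_nonneg _), norm_sub_sq_real, real_inner_comm]
      constructor <;> intro h <;> linarith
    intro w hw w' hw' s t hs ht hst
    refine ⟨(convex_Ioi (0 : ℝ)) hw.1 hw'.1 hs ht hst, fun l hl => ?_⟩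
    have a1 := (h1 w l).mp (hw.2 l hl)
    have a2 := (h1 w' l).mp (hw'.2 l hl)
    rw [h1]
    simp only [Prod.snd_add, Prod.smul_snd, inner_add_right, inner_smul_right]
    have b1 := mul_le_mul_of_nonneg_left a1 hs
    have b2 := mul_le_mul_of_nonneg_left a2 ht
    have : s * (‖l‖ ^ 2 / 2) + t * (‖l‖ ^ 2 / 2) = ‖l‖ ^ 2 / 2 := by rw [← add_mul, hst, one_mul]
    linarith
  have hfront : volume (frontier (cuspDomain m v)) = 0 := by
    have := isAddHaarMeasure_volume_pt (m := m) (k := k)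
    exact Convex.addHaar_frontier _ hconv
  refine ⟨by positivity, ?_, by omega, fun γ hγ => ⟨_, _, hL ⟨γ, hγ⟩⟩, hcount, hmeas, fun w hw => hw.1, hfront, ?_, ?_⟩
  · push_cast
    have : (0 : ℝ) ≤ m := by positivity
    linarith
  · refine IsFundamentalDomain.mk'' hmeas.nullMeasurableSet ?_ ?_ ?_
    · filter_upwards [ae_hypVolume_mem] with w hw
      -- a lattice vector closest to `z`
      have hfin : {g : Submodule.span ℤ (Set.range v) | ‖w.2.2 - g‖ ≤ ‖w.2.2‖}.Finite := by
        have h1 := (hlat (k + 1) (by have : (0 : ℝ) ≤ k := by positivity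
                                     linarith) w.2.2).tendsto_cofinite_zero
        have h2 := h1.eventually (gt_mem_nhds
          (show (0 : ℝ) < (1 + ‖w.2.2‖ ^ 2) ^ (-((k : ℝ) + 1)) by positivity))
        refine Set.Finite.subset h2 fun g hg => ?_
        simp only [mem_compl_iff, mem_ofPred_eq, not_lt]
        have hg' : ‖w.2.2 - g‖ ≤ ‖w.2.2‖ := hg
        exact Real.rpow_le_rpow_of_nonpos (by positivity) (by gcongr) (by
          have : (0 : ℝ) ≤ k := by positivity
          linarith)
      obtain ⟨g, hg, hmin⟩ := Set.exists_min_image _ (fun g : Submodule.span ℤ (Set.range v) => ‖w.2.2 - g‖) hfin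
        ⟨0, by simp⟩
      have hmin' : ∀ g' : Submodule.span ℤ (Set.range v), ‖w.2.2 - g‖ ≤ ‖w.2.2 - g'‖ := fun g' => by
        by_cases h : ‖w.2.2 - g'‖ ≤ ‖w.2.2‖
        · exact hmin g' h
        · exact (show ‖w.2.2 - g‖ ≤ ‖w.2.2‖ from hg).trans (not_le.mp h).le
      refine ⟨e.symm (-g), ?_⟩
      show (e.symm (-g) : Equiv.Perm (Pt m k)) w ∈ _
      rw [happ, Equiv.apply_symm_apply]
      refine ⟨hw, fun l hl => ?_⟩
      have h3 := hmin' (g + ⟨l, (hmemspan l).mp hl⟩)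
      simp only [Submodule.coe_neg, Submodule.coe_add, ← sub_eq_add_neg] at h3 ⊢
      rwa [sub_sub]
    · intro γ hγ
      have ht : (e γ).1 ≠ 0 := fun h => hγ (by
        have h1 : e γ = e 1 := by
          have h2 := happ 1 (0 : Pt m k)
          have h3 : (e 1 : EuclideanSpace ℝ (Fin k)) = 0 := by
            have := congrArg (fun w : Pt m k => w.2.2) h2
            simpa using this.symm
          exact Subtype.ext (h.trans h3.symm)
        exact e.injective h1)
      refine measure_mono_null ?_ (hypVolume_absolutelyContinuous hfront)
      rintro w ⟨⟨w₀, hw₀, rfl⟩, hw⟩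
      -- points of two translates lie on the boundary: a shift along the lattice vector leaves the domain
      refine ⟨subset_closure hw, fun hint => ?_⟩
      set t : EuclideanSpace ℝ (Fin k) := (e γ).1
      change γ.1 w₀ ∈ _ at hw
      change γ.1 w₀ ∈ _ at hint
      set w := γ.1 w₀ with hwdef
      have hz : w.2.2 - t = w₀.2.2 := by rw [hwdef, happ]; exact add_sub_cancel_right _ _
      have hle : ‖w.2.2 - t‖ ≤ ‖w.2.2‖ := by
        have := hw₀.2 (-t) ((hmemspan _).mpr (neg_mem (e γ).2))
        rw [← hz] at this
        simpa using this
      have hc : ContinuousAt (fun ε : ℝ => w + ε • ((0, 0, t) : Pt m k)) 0 := by fun_prop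
      have hev : ∀ᶠ ε in 𝓝 (0 : ℝ), w + ε • ((0, 0, t) : Pt m k) ∈ cuspDomain m v :=
        hc.eventually (by simpa using mem_interior_iff_mem_nhds.mp hint)
      obtain ⟨ε, hε, hε0⟩ := ((hev.filter_mono nhdsWithin_le_nhds).and
        (self_mem_nhdsWithin (s := Ioi (0 : ℝ)))).exists
      have hε0' : 0 < ε := hε0
      have h5 := hε.2 t ((hmemspan _).mpr (e γ).2)
      simp only [Prod.snd_add, Prod.smul_snd] at h5
      have h6 : w.2.2 + ε • t - t = (w.2.2 - t) + ε • t := by abel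
      rw [h6, ← sq_le_sq₀ (norm_nonneg _) (norm_nonneg _), norm_add_sq_real, norm_add_sq_real, inner_smul_right,
        inner_smul_right, inner_sub_left, real_inner_self_eq_norm_sq] at h5
      have h7 := pow_le_pow_left₀ (norm_nonneg _) hle 2
      have h8 : 0 < ε * ‖t‖ ^ 2 := by have := norm_pos_iff.mpr ht; positivity
      nlinarith
    · intro γ
      have := measurePreserving_cuspIsometry (L γ) (e γ).1
      rw [← hL γ] at this
      exact this.quasiMeasurePreserving
  · refine ⟨fun γ => 1 + ‖(e γ).1‖ ^ 2, fun γ => by linarith [sq_nonneg ‖(e γ).1‖],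
      fun σ hσ => ?_, fun B => ⟨1 / (2 + 8 * B ^ 2), by positivity, fun γ w w' hw hw' => ?_⟩⟩
    · have := (e.summable_iff.mpr (hlat σ hσ 0))
      refine this.congr fun γ => ?_
      simp
    · set t : EuclideanSpace ℝ (Fin k) := (e γ).1
      have h1 : ‖w.2.2 - (w'.2.2 + t)‖ ^ 2 ≤ quad w (γ.1 w') := by
        rw [happ, quad]
        have := sq_nonneg w.1
        have := sq_nonneg w'.1
        have := sq_nonneg ‖w.2.1 - L γ w'.2.1‖
        simp only
        linarith
      have n1 : ‖w.2.2‖ ≤ B := (norm_snd_le w.2).trans ((norm_snd_le w).trans hw)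
      have n2 : ‖w'.2.2‖ ≤ B := (norm_snd_le w'.2).trans ((norm_snd_le w').trans hw')
      have h2 : ‖t‖ ≤ ‖w.2.2 - (w'.2.2 + t)‖ + 2 * B := by
        have : t = -(w.2.2 - (w'.2.2 + t)) + (w.2.2 - w'.2.2) := by abel
        calc ‖t‖ = ‖-(w.2.2 - (w'.2.2 + t)) + (w.2.2 - w'.2.2)‖ := by rw [← this]
          _ ≤ ‖-(w.2.2 - (w'.2.2 + t))‖ + ‖w.2.2 - w'.2.2‖ := norm_add_le _ _
          _ ≤ _ := by rw [norm_neg]; linarith [norm_sub_le w.2.2 w'.2.2]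
      set X := ‖w.2.2 - (w'.2.2 + t)‖
      have h3 := pow_le_pow_left₀ (norm_nonneg _) h2 2
      rw [one_div_mul_eq_div, div_le_iff₀ (by positivity)]
      nlinarith [sq_nonneg (X - 2 * B), sq_nonneg B, mul_nonneg (sq_nonneg B) (sq_nonneg X)]

end cusp

end

end ModelCusp

namespace ModelCusp

section

open Filter Topology MeasureTheory Set

variable {m k : ℕ}

/-! ### Words in the partial derivatives -/

/-- The derivative along the directions in a list, the last one first. -/
noncomputable def pdList (l : List (Pt m k)) (f : Pt m k → ℂ) : Pt m k → ℂ := l.foldr pd f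

lemma pdList_append (l l' : List (Pt m k)) (f : Pt m k → ℂ) : pdList (l ++ l') f = pdList l (pdList l' f) :=
  List.foldr_append

lemma pdList_replicate (n : ℕ) (e : Pt m k) (f : Pt m k → ℂ) :
    pdList (List.replicate n e) f = (pd e)^[n] f := by
  induction n with
  | zero => rfl
  | succ n ih => rw [List.replicate_succ, Function.iterate_succ_apply', ← ih]; rfl

/-- The word of the multi-index `α` in the directions `e i`, `i ∈ L`. -/
def multiWord {ι : Type*} (e : ι → Pt m k) (α : ι → ℕ) (L : List ι) : List (Pt m k) :=
  L.flatMap fun i => List.replicate (α i) (e i)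

lemma pdList_multiWord {ι : Type*} (e : ι → Pt m k) (α : ι → ℕ) (L : List ι) (f : Pt m k → ℂ) :
    pdList (multiWord e α L) f = L.foldr (fun i g => (pd (e i))^[α i] g) f := by
  induction L with
  | nil => rfl
  | cons i L ih =>
    rw [List.foldr_cons, ← ih, multiWord, List.flatMap_cons, pdList_append, pdList_replicate]
    rfl

lemma exists_multiWord_of_sublist {ι : Type*} [DecidableEq ι] (e : ι → Pt m k) (α : ι → ℕ) {L : List ι}
    (hL : L.Nodup) {S : List (Pt m k)} (hS : S.Sublist (multiWord e α L)) :
    ∃ α' ≤ α, S = multiWord e α' L := by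
  induction L generalizing S with
  | nil => exact ⟨α, le_rfl, by simpa [multiWord] using hS⟩
  | cons i L ih =>
    rw [multiWord, List.flatMap_cons, List.sublist_append_iff] at hS
    obtain ⟨S₁, S₂, rfl, h1, h2⟩ := hS
    obtain ⟨n, hn, rfl⟩ := List.sublist_replicate_iff.mp h1
    obtain ⟨α', hα', rfl⟩ := ih (List.nodup_cons.mp hL).2 h2
    refine ⟨Function.update α' i n, fun j => ?_, ?_⟩
    · rcases eq_or_ne j i with rfl | h
      · simpa using hn
      · simpa [Function.update_of_ne h] using hα' j
    rw [multiWord, multiWord, List.flatMap_cons, Function.update_self]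
    congr 1
    refine List.flatMap_congr fun j hj => ?_
    have hji : j ≠ i := fun h => (List.nodup_cons.mp hL).1 (h ▸ hj)
    rw [Function.update_of_ne hji]

/-- The word of `∂_x^j ∂_y^α ∂_z^β`. -/
noncomputable def mixedWord (j : ℕ) (α : Fin m → ℕ) (β : Fin k → ℕ) : List (Pt m k) :=
  List.replicate j (ex m k) ++ (multiWord (ey m k) α (List.finRange m) ++
    multiWord (ez m k) β (List.finRange k))

lemma mixedDeriv_eq_pdList (j : ℕ) (α : Fin m → ℕ) (β : Fin k → ℕ) (f : Pt m k → ℂ) :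
    mixedDeriv j α β f = pdList (mixedWord j α β) f := by
  rw [mixedWord, pdList_append, pdList_append, pdList_replicate, pdList_multiWord, pdList_multiWord]
  rfl

lemma length_mixedWord (j : ℕ) (α : Fin m → ℕ) (β : Fin k → ℕ) :
    (mixedWord j α β).length = j + (∑ i, α i + ∑ i, β i) := by
  have h : ∀ {d : ℕ} (e : Fin d → Pt m k) (α : Fin d → ℕ), (multiWord e α (List.finRange d)).length = ∑ i, α i := by
    intro d e α
    rw [multiWord, List.length_flatMap]
    simp only [List.length_replicate]
    rw [← List.ofFn_eq_map, List.sum_ofFn]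
  rw [mixedWord, List.length_append, List.length_append, h, h, List.length_replicate]

lemma exists_mixedWord_of_sublist {j : ℕ} {α : Fin m → ℕ} {β : Fin k → ℕ} {S : List (Pt m k)}
    (hS : S.Sublist (mixedWord j α β)) : ∃ j' ≤ j, ∃ α' ≤ α, ∃ β' ≤ β, S = mixedWord j' α' β' := by
  rw [mixedWord, List.sublist_append_iff] at hS
  obtain ⟨S₁, S₂, rfl, h1, h2⟩ := hS
  obtain ⟨S₃, S₄, rfl, h3, h4⟩ := List.sublist_append_iff.mp h2
  obtain ⟨n, hn, rfl⟩ := List.sublist_replicate_iff.mp h1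
  obtain ⟨α', hα', rfl⟩ := exists_multiWord_of_sublist _ _ (List.nodup_finRange m) h3
  obtain ⟨β', hβ', rfl⟩ := exists_multiWord_of_sublist _ _ (List.nodup_finRange k) h4
  exact ⟨n, hn, α', hα', β', hβ', rfl⟩

lemma norm_le_one_of_mem_mixedWord {j : ℕ} {α : Fin m → ℕ} {β : Fin k → ℕ} :
    ∀ e ∈ mixedWord j α β, ‖e‖ ≤ 1 := by
  intro e he
  simp only [mixedWord, multiWord, List.mem_append, List.mem_flatMap, List.mem_replicate] at he
  rcases he with ⟨-, rfl⟩ | ⟨i, -, -, rfl⟩ | ⟨i, -, -, rfl⟩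
  · simp [ex, Prod.norm_def]
  · simp [ey, Prod.norm_def]
  · simp [ez, Prod.norm_def]

section calculus

variable {U : Set (Pt m k)}

lemma pdList_eq_iteratedFDeriv (hU : IsOpen U) {f : Pt m k → ℂ} (hf : ContDiffOn ℝ ∞ f U) (l : List (Pt m k)) :
    ∀ w ∈ U, pdList l f w = iteratedFDeriv ℝ l.length f w l.get := by
  induction l with
  | nil => intro w _; exact (iteratedFDeriv_zero_apply _).symm
  | cons e l ih =>
    intro w hw
    have h1 : pdList l f =ᶠ[𝓝 w] fun u => iteratedFDeriv ℝ l.length f u l.get := by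
      filter_upwards [hU.mem_nhds hw] with u hu using ih u hu
    have h2 : DifferentiableAt ℝ (iteratedFDeriv ℝ l.length f) w :=
      (hf.contDiffAt (hU.mem_nhds hw)).differentiableAt_iteratedFDeriv (by exact_mod_cast ENat.natCast_lt_top _)
    have h3 := h2.hasFDerivAt.continuousMultilinear_apply_const l.get
    have h4 : pdList (e :: l) f w = lineDeriv ℝ (fun u => iteratedFDeriv ℝ l.length f u l.get) w e :=
      h1.lineDeriv_eq
    rw [h4, (h3.hasLineDerivAt e).lineDeriv]
    exact (iteratedFDeriv_succ_apply_left (n := l.length) (e :: l).get).symm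

lemma norm_pdList_le (hU : IsOpen U) {f : Pt m k → ℂ} (hf : ContDiffOn ℝ ∞ f U) {l : List (Pt m k)}
    (hl : ∀ e ∈ l, ‖e‖ ≤ 1) {w : Pt m k} (hw : w ∈ U) : ‖pdList l f w‖ ≤ ‖iteratedFDeriv ℝ l.length f w‖ := by
  rw [pdList_eq_iteratedFDeriv hU hf l w hw]
  refine (ContinuousMultilinearMap.le_opNorm _ _).trans (mul_le_of_le_one_right (norm_nonneg _) ?_)
  exact Finset.prod_le_one (fun _ _ => norm_nonneg _) fun i _ => hl _ (List.get_mem l i)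

lemma pdList_eqOn (hU : IsOpen U) {f g : Pt m k → ℂ} (h : EqOn f g U) (l : List (Pt m k)) :
    EqOn (pdList l f) (pdList l g) U := by
  induction l with
  | nil => exact h
  | cons e l ih =>
    intro w hw
    have : pdList l f =ᶠ[𝓝 w] pdList l g := by filter_upwards [hU.mem_nhds hw] with u hu using ih hu
    exact this.lineDeriv_eq

lemma pdList_mul_const (f : Pt m k → ℂ) (c : ℂ) (l : List (Pt m k)) :
    pdList l (fun u => f u * c) = fun u => pdList l f u * c := by
  induction l with
  | nil => rfl
  | cons e l ih =>
    have h1 : pdList (e :: l) (fun u => f u * c) = pd e (pdList l fun u => f u * c) := rfl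
    rw [h1, ih]
    funext w
    exact deriv_mul_const_field c

lemma pdList_add (hU : IsOpen U) {f g : Pt m k → ℂ} (hf : ContDiffOn ℝ ∞ f U) (hg : ContDiffOn ℝ ∞ g U)
    (l : List (Pt m k)) : EqOn (pdList l fun u => f u + g u) (fun u => pdList l f u + pdList l g u) U := by
  intro w hw
  have h : ∀ {h : Pt m k → ℂ}, ContDiffOn ℝ ∞ h U → ContDiffAt ℝ l.length h w := fun hh =>
    (hh.contDiffAt (hU.mem_nhds hw)).of_le (by exact_mod_cast le_top)
  beta_reduce
  rw [pdList_eq_iteratedFDeriv hU (hf.add hg) l w hw, pdList_eq_iteratedFDeriv hU hf l w hw,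
    pdList_eq_iteratedFDeriv hU hg l w hw]
  exact congrArg (fun L => L l.get) (iteratedFDeriv_add_apply (h hf) (h hg))

lemma pd_mul (hU : IsOpen U) {f g : Pt m k → ℂ} (hf : ContDiffOn ℝ ∞ f U) (hg : ContDiffOn ℝ ∞ g U)
    (e : Pt m k) : EqOn (pd e fun u => f u * g u) (fun u => pd e f u * g u + f u * pd e g u) U := by
  intro w hw
  have h : ∀ {h : Pt m k → ℂ}, ContDiffOn ℝ ∞ h U → DifferentiableAt ℝ h w := fun hh =>
    (hh.contDiffAt (hU.mem_nhds hw)).differentiableAt (by simp)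
  have h1 := ((h hf).hasFDerivAt.mul (h hg).hasFDerivAt).hasLineDerivAt e
  have h2 : lineDeriv ℝ (fun u => f u * g u) w e = _ := h1.lineDeriv
  unfold pd
  beta_reduce
  rw [h2, (h hf).lineDeriv_eq_fderiv, (h hg).lineDeriv_eq_fderiv]
  simp only [_root_.add_apply, _root_.smul_apply, smul_eq_mul]
  ring

/-- A bound for the derivatives of a product: in the Leibniz rule only the subwords of the given
word occur. -/
lemma norm_pdList_mul_le (hU : IsOpen U) {w : Pt m k} (hw : w ∈ U) {ρ : ℝ} (l : List (Pt m k)) :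
    ∀ {f g : Pt m k → ℂ} {a b : ℝ}, ContDiffOn ℝ ∞ f U → ContDiffOn ℝ ∞ g U →
      (∀ S, S.Sublist l → ‖pdList S f w‖ ≤ a * ρ ^ S.length) →
      (∀ S, S.Sublist l → ‖pdList S g w‖ ≤ b * ρ ^ S.length) →
      ‖pdList l (fun u => f u * g u) w‖ ≤ 2 ^ l.length * (a * b * ρ ^ l.length) := by
  induction l using List.reverseRecOn with
  | nil =>
    intro f g a b _ _ ha hb
    have h1 := ha [] List.Sublist.slnil
    have h2 := hb [] List.Sublist.slnil
    simp only [List.length_nil, pow_zero, mul_one, pdList, List.foldr_nil, one_mul] at h1 h2 ⊢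
    rw [norm_mul]
    gcongr
    exact (norm_nonneg _).trans h1
  | append_singleton l e ih =>
    intro f g a b hf hg ha hb
    have hf' := contDiffOn_pd hU hf e
    have hg' := contDiffOn_pd hU hg e
    have e1 : ∀ (S : List (Pt m k)) (h : Pt m k → ℂ), pdList S (pd e h) = pdList (S ++ [e]) h := fun S h => by
      rw [pdList_append]; rfl
    have hsub : ∀ S : List (Pt m k), S.Sublist l → S.Sublist (l ++ [e]) := fun S h => h.trans (List.sublist_append_left l [e])
    have hsub' : ∀ S : List (Pt m k), S.Sublist l → (S ++ [e]).Sublist (l ++ [e]) := fun S h => h.append_right _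
    have key : ∀ {h : Pt m k → ℂ} {a : ℝ}, (∀ S : List (Pt m k), S.Sublist (l ++ [e]) → ‖pdList S h w‖ ≤ a * ρ ^ S.length) →
        ∀ S : List (Pt m k), S.Sublist l → ‖pdList S (pd e h) w‖ ≤ a * ρ * ρ ^ S.length := fun ha S hS => by
      rw [e1]
      refine (ha _ (hsub' _ hS)).trans_eq ?_
      rw [List.length_append, List.length_singleton, pow_succ]; ring
    have i1 := ih hf' hg (key ha) fun S hS => hb S (hsub S hS)
    have i2 := ih hf hg' (fun S hS => ha S (hsub S hS)) (key hb)
    rw [← e1, pdList_eqOn hU (pd_mul hU hf hg e) l hw, pdList_add hU (hf'.mul hg) (hf.mul hg') l hw]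
    refine (norm_add_le _ _).trans ((add_le_add i1 i2).trans_eq ?_)
    rw [List.length_append, List.length_singleton, pow_succ, pow_succ]
    ring

end calculus

end

end ModelCusp

namespace ModelCusp

section

open Filter Topology MeasureTheory Set

variable {m k : ℕ}

/-! ### Decay of the kernel of a model cusp -/

/-- Away from `p = (x', η, ζ + t)` with bounded `(x', η, ζ)`, the quadratic form dominates the square
of the distance to `(0, 0, t)`, and `u`, `p` stay in a smaller cone. -/
lemma exists_quad_lower_bound (B : ℝ) {δ : ℝ} (hδ : 0 < δ) : ∃ M ≥ 1, ∀ (u p : Pt m k) (t : EuclideanSpace ℝ (Fin k)),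
    0 ≤ u.1 → 0 ≤ p.1 → p.1 ≤ B → ‖p.2.1‖ ≤ B → ‖p.2.2 - t‖ ≤ B → δ ≤ dist u p →
    1 + u.1 ^ 2 + ‖u.2.1‖ ^ 2 + ‖u.2.2 - t‖ ^ 2 ≤ M * quad u p ∧ 2 * (p.1 * u.1) + M⁻¹ * quad u p ≤ quad u p := by
  refine ⟨3 + (6 * B ^ 2 + 1) / δ ^ 2, by
    have : 0 ≤ (6 * B ^ 2 + 1) / δ ^ 2 := by positivity
    linarith, fun u p t hu hp h1 h2 h3 hd => ?_⟩
  set M := 3 + (6 * B ^ 2 + 1) / δ ^ 2 with hM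
  have hM0 : 0 < M := by positivity
  set D := (u.1 - p.1) ^ 2 + ‖u.2.1 - p.2.1‖ ^ 2 + ‖u.2.2 - p.2.2‖ ^ 2 with hD
  have hQ : quad u p = D + 2 * (p.1 * u.1) := by rw [quad, hD]; ring
  have hDδ : δ ^ 2 ≤ D := by
    rw [Prod.dist_eq, Prod.dist_eq, Real.dist_eq, dist_eq_norm, dist_eq_norm, le_max_iff, le_max_iff] at hd
    rcases hd with h | h | h
    · have := pow_le_pow_left₀ hδ.le h 2
      rw [sq_abs] at this
      nlinarith [sq_nonneg ‖u.2.1 - p.2.1‖, sq_nonneg ‖u.2.2 - p.2.2‖]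
    · nlinarith [sq_nonneg (u.1 - p.1), sq_nonneg ‖u.2.2 - p.2.2‖, pow_le_pow_left₀ hδ.le h 2]
    · nlinarith [sq_nonneg (u.1 - p.1), sq_nonneg ‖u.2.1 - p.2.1‖, pow_le_pow_left₀ hδ.le h 2]
  have hMD : 3 * D + (6 * B ^ 2 + 1) ≤ M * D := by
    have : (6 * B ^ 2 + 1) / δ ^ 2 * δ ^ 2 ≤ (6 * B ^ 2 + 1) / δ ^ 2 * D := by gcongr
    rw [div_mul_cancel₀ _ (by positivity)] at this
    rw [hM]; linarith
  have sq2 : ∀ {a b : ℝ}, 0 ≤ a → a ≤ b + B → 0 ≤ b → a ^ 2 ≤ 2 * b ^ 2 + 2 * B ^ 2 := fun {a b} ha h hb => by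
    nlinarith [sq_nonneg (b - B)]
  have hy : ‖u.2.1‖ ^ 2 ≤ 2 * ‖u.2.1 - p.2.1‖ ^ 2 + 2 * B ^ 2 := by
    refine sq2 (norm_nonneg _) ?_ (norm_nonneg _)
    have := norm_add_le (u.2.1 - p.2.1) p.2.1
    rw [sub_add_cancel] at this; linarith
  have hz : ‖u.2.2 - t‖ ^ 2 ≤ 2 * ‖u.2.2 - p.2.2‖ ^ 2 + 2 * B ^ 2 := by
    refine sq2 (norm_nonneg _) ?_ (norm_nonneg _)
    have := norm_add_le (u.2.2 - p.2.2) (p.2.2 - t)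
    rw [sub_add_sub_cancel] at this; linarith
  have hx : u.1 ^ 2 ≤ 2 * (u.1 - p.1) ^ 2 + 2 * B ^ 2 := by
    nlinarith [sq_nonneg (u.1 - 2 * p.1), mul_nonneg hp (sub_nonneg.mpr h1)]
  have hpu : 0 ≤ p.1 * u.1 := mul_nonneg hp hu
  have hB : p.1 ^ 2 ≤ B ^ 2 := by nlinarith
  have hD0 : 0 ≤ D := (sq_nonneg δ).trans hDδ
  constructor
  · rw [hQ]; nlinarith [mul_nonneg hM0.le hpu]
  · have h4 : quad u p ≤ M * D := by
      rw [hQ]; nlinarith [sq_nonneg (u.1 - p.1), sq_nonneg ‖u.2.1 - p.2.1‖, sq_nonneg ‖u.2.2 - p.2.2‖]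
    have h5 : M⁻¹ * quad u p ≤ D := by rw [inv_mul_le_iff₀ hM0]; exact h4
    linarith

lemma rpow_neg_le_of_le_mul {c x y q : ℝ} (hc : 0 < c) (hx : 0 < x) (hq : 0 ≤ q) (h : x ≤ c * y) :
    y ^ (-q) ≤ c ^ q * x ^ (-q) := by
  have h1 : c⁻¹ * x ≤ y := by rwa [inv_mul_le_iff₀ hc]
  refine (Real.rpow_le_rpow_of_nonpos (by positivity) h1 (neg_nonpos.mpr hq)).trans_eq ?_
  rw [Real.mul_rpow (by positivity) hx.le, Real.inv_rpow hc.le, Real.rpow_neg hc.le, inv_inv]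

section

variable {A : Fin k → (EuclideanSpace ℝ (Fin m) ≃ₗᵢ[ℝ] EuclideanSpace ℝ (Fin m))}
  {v : Fin k → EuclideanSpace ℝ (Fin k)}

/-- The kernel of a model cusp, divided by `(x x')^s`. -/
noncomputable def scaledKernel (A : Fin k → (EuclideanSpace ℝ (Fin m) ≃ₗᵢ[ℝ] EuclideanSpace ℝ (Fin m)))
    (v : Fin k → EuclideanSpace ℝ (Fin k)) (s : ℂ) (w' u : Pt m k) : ℂ :=
  ((u.1 * w'.1 : ℝ) : ℂ) ^ (-s) * cuspKernel A v s u w'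

lemma scaledKernel_eq (hk : 0 < k) (hA : ∀ i j, Commute (A i) (A j)) (hv : LinearIndependent ℝ v) {s : ℂ}
    (hs : (k : ℝ) / 2 < s.re) {u w' : Pt m k} (hu : u ∈ halfSpace m k) (hw' : w' ∈ halfSpace m k)
    (hne : ∀ γ : cuspGroup A v, u ≠ γ.1 w') :
    scaledKernel A v s w' u =
      ∑' γ : cuspGroup A v, coneFun s (relMap m k (u, γ.1 w')) := by
  have hΓ := cuspLike_cuspGroup hk hA hv
  have h1 : cuspKernel A v s u w' = _ := hΓ.resolventKernel_eq hs (p := (u, w')) ⟨hu, hw', fun γ hγ => hne ⟨γ, hγ⟩⟩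
  have h2 : ∀ γ : cuspGroup A v, resFun (m + k) s (twoCosh u (γ.1 w')) =
      powKer (-s) (u.1 * w'.1) * coneFun s (relMap m k (u, γ.1 w')) := fun γ => by
    have h := (hΓ.apply_mem γ.2).mpr hw'
    rw [resFun_twoCosh s hu h (two_lt_twoCosh hu h (hne γ)), hΓ.apply_fst γ.2]
  have hpos : 0 < u.1 * w'.1 := mul_pos hu hw'
  rw [scaledKernel, h1, foldKer_eq _ hu hw', tsum_congr h2, tsum_mul_left, ← mul_assoc]
  have h3 : ((u.1 * w'.1 : ℝ) : ℂ) ^ (-s) * powKer (-s) (u.1 * w'.1) = 1 := by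
    rw [powKer, ← Complex.cpow_add _ _ (by exact_mod_cast hpos.ne'), neg_neg, neg_add_cancel, Complex.cpow_zero]
  rw [h3, one_mul]

/-- Away from the orbit of a bounded `w'`, each derivative of the scaled kernel decays like the sum over the
lattice of the corresponding bounds for the kernel of hyperbolic space. -/
lemma exists_scaledKernel_bound (hk : 0 < k) (hA : ∀ i j, Commute (A i) (A j)) (hv : LinearIndependent ℝ v) {s : ℂ}
    (hs : (k : ℝ) / 2 < s.re) (B : ℝ) {δ : ℝ} (hδ : 0 < δ) :
    ∃ C : ℕ → ℝ, (∀ r, 0 < C r) ∧ ∀ w' ∈ halfSpace m k, ‖w'‖ ≤ B → ∀ U, IsOpen U → U ⊆ halfSpace m k →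
      (∀ u ∈ U, ∀ γ : cuspGroup A v, δ ≤ dist u (γ.1 w')) →
      ContDiffOn ℝ ∞ (scaledKernel A v s w') U ∧ ∀ r, ∀ u ∈ U, ‖iteratedFDeriv ℝ r (scaledKernel A v s w') u‖ ≤
        C r * (1 + u.1 ^ 2 + ‖u.2.1‖ ^ 2) ^ (((k : ℝ) - r) / 2 - s.re) := by
  have hΓ := cuspLike_cuspGroup hk hA hv
  have hs0 : 0 < s.re := hΓ.nonneg.trans_lt hs
  obtain ⟨e, he⟩ := exists_cuspGroup_equiv (m := m) hA hv
  obtain ⟨M, hM1, hM⟩ := exists_quad_lower_bound (m := m) (k := k) B hδ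
  have hM0 : 0 < M := by linarith
  have h1 := fun r => exists_coneFun_bound (m := m) (k := k) hΓ.dim_pos hs0 (inv_pos.mpr hM0) r
  choose CG hCG0 hCG using h1
  have hσ : ∀ r : ℕ, (k : ℝ) / 2 < s.re + r / 2 := fun r => hs.trans_le (le_add_of_nonneg_right (by positivity))
  have h2 := fun r => exists_lattice_sum_bound (cuspBasis hv) (hσ r)
  rw [show ⇑(cuspBasis hv) = v from Module.Basis.coe_mk _ _] at h2
  choose CS hCS0 hCS using h2
  set a : Pt m k →L[ℝ] Rel m k := (relMap m k).comp (ContinuousLinearMap.inl ℝ _ _) with ha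
  set q : ℕ → ℝ := fun r => s.re + r / 2 with hq
  have hq0 : ∀ r, 0 < q r := fun r => by rw [hq]; positivity
  set K : ℕ → ℝ := fun r => CG r * M ^ q r * ‖a‖ ^ r with hK
  have hK0 : ∀ r, 0 ≤ K r := fun r => by have := hCG0 r; rw [hK]; positivity
  refine ⟨fun r => (K r + 1) * CS r, fun r => by have := hCS0 r; have := hK0 r; positivity,
    fun w' hw' hB U hU hUH hd => ?_⟩
  set f : cuspGroup A v → Pt m k → ℂ := fun γ u => coneFun s (relMap m k (u, γ.1 w')) with hf
  have hfe : ∀ (γ : cuspGroup A v) (u : Pt m k), relMap m k (u, γ.1 w') =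
      a u + relMap m k (0, γ.1 w') := fun γ u => by
    rw [ha, ContinuousLinearMap.comp_apply, ← map_add]; simp
  have hcf := contDiffOn_coneFun (m := m) (k := k) hΓ.dim_pos hs0
  have hgeo : ∀ u ∈ U, ∀ γ : cuspGroup A v, 1 + u.1 ^ 2 + ‖u.2.1‖ ^ 2 + ‖u.2.2 - (e γ).1‖ ^ 2 ≤
        M * quad u (γ.1 w') ∧
      2 * (w'.1 * u.1) + M⁻¹ * quad u (γ.1 w') ≤ quad u (γ.1 w') := by
    intro u hu γ
    have h := hd u hu γ
    obtain ⟨L, hL⟩ := he γ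
    have hn := hB
    rw [Prod.norm_def, Prod.norm_def, max_le_iff, max_le_iff] at hn
    rw [hL, cuspIsometry_apply] at h ⊢
    exact hM u _ (e γ) (hUH hu).le hw'.le ((le_abs_self _).trans hn.1) (by simpa using hn.2.1) (by simpa using hn.2.2) h
  have hQ0 : ∀ u ∈ U, ∀ γ : cuspGroup A v, 0 < quad u (γ.1 w') := fun u hu γ =>
    pos_of_mul_pos_right (lt_of_lt_of_le (by positivity) (hgeo u hu γ).1) hM0.le
  have hcone : ∀ u ∈ U, ∀ γ : cuspGroup A v, 2 * |(relMap m k (u, γ.1 w')).1 *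
      (relMap m k (u, γ.1 w')).2.1| + M⁻¹ * relQuad (relMap m k (u, γ.1 w')) ≤
      relQuad (relMap m k (u, γ.1 w')) := fun u hu γ => by
    have h := (hgeo u hu γ).2
    have hx : 0 < w'.1 * u.1 := mul_pos hw' (hUH hu)
    rw [relQuad_relMap, relMap_apply, hΓ.apply_fst γ.2, abs_of_pos hx]
    exact h
  have hmem : ∀ u ∈ U, ∀ γ : cuspGroup A v, relMap m k (u, γ.1 w') ∈ relCone m k := fun u hu γ => by
    have h := hcone u hu γ
    have h' := mul_pos (inv_pos.mpr hM0) (hQ0 u hu γ)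
    rw [relQuad_relMap] at h
    show 2 * |_| < relQuad _
    rw [relQuad_relMap]
    linarith
  have hfs : ∀ γ, ContDiffOn ℝ ∞ (f γ) U := fun γ => hcf.comp
    ((relMap m k).contDiff.comp (contDiff_id.prodMk contDiff_const)).contDiffOn fun u hu => hmem u hu γ
  have hterm : ∀ r, ∀ u ∈ U, ∀ γ, ‖iteratedFDeriv ℝ r (f γ) u‖ ≤ K r *
      (1 + u.1 ^ 2 + ‖u.2.1‖ ^ 2 + ‖u.2.2 - (e γ).1‖ ^ 2) ^ (-q r) := by
    intro r u hu γ
    have h3 : f γ = fun u => coneFun s (a u + relMap m k (0, γ.1 w')) :=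
      funext fun u => by rw [hf, ← hfe]
    have h4 := hmem u hu γ
    have h5 := hCG r _ (relQuad_pos h4) (hcone u hu γ)
    rw [relQuad_relMap, hfe] at h5
    rw [hfe] at h4
    have h6 := rpow_neg_le_of_le_mul hM0 (by positivity) (hq0 r).le (hgeo u hu γ).1
    have hCG0' := (hCG0 r).le
    rw [h3]
    refine (norm_iteratedFDeriv_comp_affine isOpen_relCone hcf a _ h4 r).trans ?_
    calc _ ≤ CG r * (M ^ q r * _) * ‖a‖ ^ r :=
          mul_le_mul_of_nonneg_right (h5.trans (mul_le_mul_of_nonneg_left h6 hCG0')) (by positivity)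
      _ = _ := by rw [hK]; ring
  -- near a point the bounds can be made independent of the point: the summands with `|z - z₀| < 1`
  -- are comparable with a factor `3`
  have hev : ∀ u ∈ U, ∃ V, IsOpen V ∧ u ∈ V ∧ V ⊆ U ∧ ∃ b : ℕ → cuspGroup A v → ℝ, (∀ r, Summable (b r)) ∧
      ∀ r γ, ∀ p ∈ V, ‖iteratedFDeriv ℝ r (f γ) p‖ ≤ b r γ := by
    intro u hu
    refine ⟨U ∩ {p | ‖p.2.2 - u.2.2‖ < 1}, hU.inter (isOpen_lt (by fun_prop) continuous_const), ⟨hu, by simp⟩,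
      inter_subset_left, fun r γ => K r * (3 ^ q r * (1 ^ 2 + ‖u.2.2 - (e γ).1‖ ^ 2) ^ (-q r)),
      fun r => ?_, fun r γ p hp => ?_⟩
    · have := e.summable_iff.mpr (hCS r 1 le_rfl u.2.2).1
      exact (this.mul_left _).mul_left _
    · refine (hterm r p hp.1 γ).trans (mul_le_mul_of_nonneg_left ?_ (hK0 r))
      have h4 : ‖u.2.2 - (e γ).1‖ ≤ ‖p.2.2 - (e γ).1‖ + 1 := by
        have h5 := norm_sub_le (p.2.2 - (e γ).1) (p.2.2 - u.2.2)
        rw [sub_sub_sub_cancel_left] at h5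
        have h6 : ‖p.2.2 - u.2.2‖ < 1 := hp.2
        linarith
      have h5 := pow_le_pow_left₀ (norm_nonneg _) h4 2
      refine rpow_neg_le_of_le_mul (by norm_num) (by positivity) (hq0 r).le ?_
      nlinarith [sq_nonneg (‖p.2.2 - (e γ).1‖ - 1), sq_nonneg p.1, sq_nonneg ‖p.2.1‖]
  have heq : ∀ u ∈ U, scaledKernel A v s w' u = ∑' γ, f γ u := fun u hu =>
    scaledKernel_eq hk hA hv hs (hUH hu) hw' fun γ h => by
      have := hd u hu γ
      rw [← h, dist_self] at this
      linarith
  refine ⟨fun u hu => ?_, fun r u hu => ?_⟩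
  · obtain ⟨V, hV, huV, hVU, b, hb, hbb⟩ := hev u hu
    exact (((contDiffOn_tsum_of_isOpen hV (fun γ => (hfs γ).mono hVU) hb hbb).congr fun p hp =>
      heq p (hVU hp)).contDiffAt (hV.mem_nhds huV)).contDiffWithinAt
  · obtain ⟨V, hV, huV, hVU, b, hb, hbb⟩ := hev u hu
    have h3 : scaledKernel A v s w' =ᶠ[𝓝 u] fun p => ∑' γ, f γ p := by
      filter_upwards [hU.mem_nhds hu] with p hp using heq p hp
    rw [(Filter.EventuallyEq.iteratedFDeriv ℝ h3 r).eq_of_nhds,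
      (iteratedFDeriv_tsum_of_isOpen hV (fun γ => (hfs γ).mono hVU) hb hbb r u huV).1]
    set P := 1 + u.1 ^ 2 + ‖u.2.1‖ ^ 2 with hP
    have hP1 : 1 ≤ P := by rw [hP, add_assoc]; exact le_add_of_nonneg_right (by positivity)
    -- the lattice sum with `r² = 1 + x² + |y|²`
    obtain ⟨h4, h5⟩ := hCS r (√P) (Real.one_le_sqrt.mpr hP1) u.2.2
    rw [Real.sq_sqrt (by linarith)] at h4 h5
    have h6 := (e.summable_iff.mpr h4).hasSum.mul_left (K r)
    refine (tsum_of_norm_bounded h6 fun γ => hterm r u hu γ).trans ?_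
    have h7 : √P ^ ((k : ℝ) - 2 * (s.re + r / 2)) = P ^ (((k : ℝ) - r) / 2 - s.re) := by
      rw [Real.sqrt_eq_rpow, ← Real.rpow_mul (by linarith)]
      congr 1; ring
    rw [← (e.tsum_eq fun g : Submodule.span ℤ (range v) => (P + ‖u.2.2 - (g : EuclideanSpace ℝ (Fin k))‖ ^ 2) ^ (-(s.re + (r : ℝ) / 2)))] at h5
    rw [h7] at h5
    have := hCS0 r
    have hK0' := hK0 r
    calc _ ≤ K r * (CS r * P ^ (((k : ℝ) - r) / 2 - s.re)) := mul_le_mul_of_nonneg_left h5 hK0'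
      _ ≤ (K r + 1) * (CS r * P ^ (((k : ℝ) - r) / 2 - s.re)) := by gcongr; linarith
      _ = _ := by ring

end

end

end ModelCusp

namespace ModelCusp

section

open Filter Topology MeasureTheory Set

variable {m k : ℕ}

/-! ### The estimates and the series -/

lemma CuspLike.apply_mem_closedSupport {Γ : Subgroup (Equiv.Perm (Pt m k))} {F : Set (Pt m k)} {a : ℝ}
    (hΓ : CuspLike Γ F a) {ψ : Pt m k → ℂ} (hψ : IsSmoothUpToBoundary Γ ψ) {γ : Equiv.Perm (Pt m k)} (hγ : γ ∈ Γ)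
    {w : Pt m k} (hw : w ∈ closedSupport ψ) : γ w ∈ closedSupport ψ := by
  refine map_mem_closure (hΓ.continuous_apply ⟨γ, hγ⟩) hw fun u hu => ⟨?_, ?_⟩
  · show 0 ≤ (γ u).1
    rw [hΓ.apply_fst hγ]
    exact hu.1
  · rw [hψ.2 γ hγ u hu.1]
    exact hu.2

/-- Modulo `Γ` the support of `χ` is compact, so it has positive distance from that of `ψ`. -/
lemma CuspLike.exists_separation {Γ : Subgroup (Equiv.Perm (Pt m k))} {F : Set (Pt m k)} {a : ℝ}
    (hΓ : CuspLike Γ F a) {χ ψ : Pt m k → ℂ} (hχ : IsCutoff Γ χ) (hψ : IsSmoothUpToBoundary Γ ψ)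
    (hd : Disjoint (closedSupport χ) (closedSupport ψ)) : ∃ B δ : ℝ, 0 < δ ∧ ∀ w' ∈ closedHalfSpace m k, χ w' ≠ 0 →
      ∃ γ₀ ∈ Γ, ‖γ₀ w'‖ ≤ B ∧ ∀ u ∈ Metric.thickening δ (closedSupport ψ), ∀ γ ∈ Γ, δ ≤ dist u (γ (γ₀ w')) := by
  obtain ⟨K, hKH, hK, hKχ⟩ := hχ.2
  obtain ⟨B, hB⟩ := hK.isBounded.exists_norm_le
  obtain ⟨δ, hδ, hdis⟩ := (hd.mono_left inter_subset_right).exists_thickenings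
    (hK.inter_right isClosed_closure) (isClosed_closure : IsClosed (closedSupport ψ))
  refine ⟨B, δ, hδ, fun w' hw' hne => ?_⟩
  obtain ⟨γ₀, hγ₀, hmem⟩ := hKχ w' hw' hne
  refine ⟨γ₀, hγ₀, hB _ hmem, fun u hu γ hγ => ?_⟩
  by_contra! h
  have hχm : γ₀ w' ∈ closedSupport χ := subset_closure ⟨hKH hmem, by rwa [hχ.1.2 γ₀ hγ₀ w' hw']⟩
  obtain ⟨p, hp, hup⟩ := Metric.mem_thickening_iff.mp hu
  have hγ' := Γ.inv_mem hγ
  have h1 : γ⁻¹ u ∈ Metric.thickening δ (K ∩ closedSupport χ) := by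
    refine Metric.mem_thickening_iff.mpr ⟨γ₀ w', ⟨hmem, hχm⟩, ?_⟩
    rw [← hΓ.dist_apply hγ]
    exact (congrArg (fun q => dist q _) (γ.apply_symm_apply u)).trans_lt h
  have h2 : γ⁻¹ u ∈ Metric.thickening δ (closedSupport ψ) :=
    Metric.mem_thickening_iff.mpr ⟨γ⁻¹ p, hΓ.apply_mem_closedSupport hψ hγ' hp, by rwa [hΓ.dist_apply hγ']⟩
  exact Set.disjoint_left.mp hdis h1 h2

section

variable {A : Fin k → (EuclideanSpace ℝ (Fin m) ≃ₗᵢ[ℝ] EuclideanSpace ℝ (Fin m))}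
  {v : Fin k → EuclideanSpace ℝ (Fin k)}

/-- The bounds on a neighbourhood of the support of `ψ`, uniform in `w'`: by invariance `w'` may be
moved into a bounded set, which has positive distance from that support. -/
lemma exists_scaledKernel_bound_of_disjoint (hk : 0 < k) (hA : ∀ i j, Commute (A i) (A j))
    (hv : LinearIndependent ℝ v) {χ ψ : Pt m k → ℂ} (hχ : IsCutoff (cuspGroup A v) χ)
    (hψ : IsSmoothUpToBoundary (cuspGroup A v) ψ) (hd : Disjoint (closedSupport χ) (closedSupport ψ)) {s : ℂ}
    (hs : (k : ℝ) / 2 < s.re) : ∃ U, IsOpen U ∧ U ⊆ halfSpace m k ∧ halfSpace m k ∩ closedSupport ψ ⊆ U ∧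
      ∃ C : ℕ → ℝ, (∀ r, 0 < C r) ∧ ∀ w' ∈ halfSpace m k, χ w' ≠ 0 →
      ContDiffOn ℝ ∞ (scaledKernel A v s w') U ∧ ∀ r, ∀ u ∈ U, ‖iteratedFDeriv ℝ r (scaledKernel A v s w') u‖ ≤
        C r * (1 + u.1 ^ 2 + ‖u.2.1‖ ^ 2) ^ (((k : ℝ) - r) / 2 - s.re) := by
  have hΓ := cuspLike_cuspGroup hk hA hv
  obtain ⟨B, δ, hδ, hsep⟩ := hΓ.exists_separation hχ hψ hd
  obtain ⟨C, hC0, hC⟩ := exists_scaledKernel_bound hk hA hv hs B hδ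
  refine ⟨halfSpace m k ∩ Metric.thickening δ (closedSupport ψ), isOpen_halfSpace.inter Metric.isOpen_thickening,
    inter_subset_left, inter_subset_inter_right _ (Metric.self_subset_thickening hδ _), C, hC0, fun w' hw' hne => ?_⟩
  obtain ⟨γ₀, hγ₀, hB, hdist⟩ := hsep w' (show 0 ≤ w'.1 from le_of_lt hw') hne
  have hU := isOpen_halfSpace.inter (Metric.isOpen_thickening (δ := δ) (E := closedSupport ψ))
  obtain ⟨h1, h2⟩ := hC (γ₀ w') ((hΓ.apply_mem hγ₀).mpr hw') hB _ hU inter_subset_left fun u hu γ => hdist u hu.2 γ γ.2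
  have heq : EqOn (scaledKernel A v s w') (scaledKernel A v s (γ₀ w')) (halfSpace m k) := fun u hu => by
    rw [scaledKernel, scaledKernel, hΓ.apply_fst hγ₀]
    exact congrArg _ (hΓ.isResolventKernel_resolventKernel.invariant s hs u hu w' hw' γ₀ hγ₀).2.symm
  refine ⟨h1.congr fun u hu => heq hu.1, fun r u hu => ?_⟩
  have h3 : scaledKernel A v s w' =ᶠ[𝓝 u] scaledKernel A v s (γ₀ w') := by
    filter_upwards [hU.mem_nhds hu] with p hp using heq hp.1
  rw [(Filter.EventuallyEq.iteratedFDeriv ℝ h3 r).eq_of_nhds]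
  exact h2 r u hu

/-- The decay of the derivatives on the support of `ψ`. -/
theorem exists_mixedDeriv_bound (hk : 0 < k) (hA : ∀ i j, Commute (A i) (A j))
    (hv : LinearIndependent ℝ v) {χ ψ : Pt m k → ℂ} (hχ : IsCutoff (cuspGroup A v) χ)
    (hψ : IsSmoothUpToBoundary (cuspGroup A v) ψ) (hd : Disjoint (closedSupport χ) (closedSupport ψ)) {s : ℂ}
    (hs : (k : ℝ) / 2 < s.re) (j : ℕ) (α : Fin m → ℕ) (β : Fin k → ℕ) :
    ∃ C > 0, ∀ w ∈ halfSpace m k ∩ closedSupport ψ, ∀ w' ∈ halfSpace m k,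
      ‖mixedDeriv j α β (fun u => ((u.1 * w'.1 : ℝ) : ℂ) ^ (-s) * cuspKernel A v s u w' * χ w') w‖ ≤
        C * (1 + w.1 ^ 2 + ‖w.2.1‖ ^ 2) ^
          (((k : ℝ) - ((∑ i, α i : ℕ) : ℝ) - ((∑ i, β i : ℕ) : ℝ) - (j : ℝ)) / 2 - s.re) := by
  obtain ⟨U, hU, -, hψU, C, hC0, hC⟩ := exists_scaledKernel_bound_of_disjoint hk hA hv hχ hψ hd hs
  obtain ⟨b, hb1, -, hb⟩ := (cuspLike_cuspGroup hk hA hv).exists_cutoff_bound hχ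
  set l := mixedWord j α β with hl
  refine ⟨C l.length * b, mul_pos (hC0 _) (by linarith), fun w hw w' hw' => ?_⟩
  have hP : (0 : ℝ) ≤ 1 + w.1 ^ 2 + ‖w.2.1‖ ^ 2 := by positivity
  rw [mixedDeriv_eq_pdList, ← hl]
  change ‖pdList l (fun u => scaledKernel A v s w' u * χ w') w‖ ≤ _
  rw [pdList_mul_const]
  beta_reduce
  rw [norm_mul]
  have hC0' := (hC0 l.length).le
  rcases eq_or_ne (χ w') 0 with h | h
  · rw [h, norm_zero, mul_zero]
    have := Real.rpow_nonneg hP (((k : ℝ) - ((∑ i, α i : ℕ) : ℝ) - ((∑ i, β i : ℕ) : ℝ) - (j : ℝ)) / 2 - s.re)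
    exact mul_nonneg (mul_nonneg hC0' (by linarith)) this
  · obtain ⟨h1, h2⟩ := hC w' hw' h
    have h3 := (norm_pdList_le hU h1 (l := l) norm_le_one_of_mem_mixedWord (hψU hw)).trans (h2 _ w (hψU hw))
    refine (mul_le_mul h3 (hb w' (show 0 ≤ w'.1 from le_of_lt hw')) (norm_nonneg _)
      (mul_nonneg hC0' (Real.rpow_nonneg hP _))).trans_eq ?_
    rw [mul_right_comm, hl, length_mixedWord]
    congr 2
    push_cast; ring

/-- The decay of the derivatives with the factor `ψ` included: in the Leibniz rule every derivative,
whichever factor it falls on, gains `(1 + x² + |y|²)^{-1/2}`. -/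
theorem exists_mixedDeriv_mul_bound (hk : 0 < k) (hA : ∀ i j, Commute (A i) (A j))
    (hv : LinearIndependent ℝ v) {χ ψ : Pt m k → ℂ} (hχ : IsCutoff (cuspGroup A v) χ)
    (hψ : IsSmoothUpToBoundary (cuspGroup A v) ψ) (hd : Disjoint (closedSupport χ) (closedSupport ψ)) {s : ℂ}
    (hs : (k : ℝ) / 2 < s.re) (j : ℕ) (α : Fin m → ℕ) (β : Fin k → ℕ)
    (hb : ∀ j' ≤ j, ∀ α' ≤ α, ∀ β' ≤ β, ∃ B : ℝ, ∀ w ∈ halfSpace m k,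
      ‖mixedDeriv j' α' β' ψ w‖ ≤ B * (1 + w.1 ^ 2 + ‖w.2.1‖ ^ 2) ^
        (-(((∑ i, α' i : ℕ) : ℝ) + ((∑ i, β' i : ℕ) : ℝ) + (j' : ℝ)) / 2)) :
    ∃ C > 0, ∀ w ∈ halfSpace m k, ∀ w' ∈ halfSpace m k,
      ‖mixedDeriv j α β (fun u => ((u.1 * w'.1 : ℝ) : ℂ) ^ (-s) * ψ u * cuspKernel A v s u w' * χ w') w‖ ≤
        C * (1 + w.1 ^ 2 + ‖w.2.1‖ ^ 2) ^
          (((k : ℝ) - ((∑ i, α i : ℕ) : ℝ) - ((∑ i, β i : ℕ) : ℝ) - (j : ℝ)) / 2 - s.re) := by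
  classical
  obtain ⟨U, hU, hUH, hψU, C, hC0, hC⟩ := exists_scaledKernel_bound_of_disjoint hk hA hv hχ hψ hd hs
  obtain ⟨b, hb1, -, hbχ⟩ := (cuspLike_cuspGroup hk hA hv).exists_cutoff_bound hχ
  set l := mixedWord j α β with hl
  -- the subwords that occur in the Leibniz rule are words of smaller multi-indices
  have hb' : ∀ S : List (Pt m k), ∃ B : ℝ, S.Sublist l → ∀ w ∈ halfSpace m k,
      ‖pdList S ψ w‖ ≤ B * (1 + w.1 ^ 2 + ‖w.2.1‖ ^ 2) ^ (-(S.length : ℝ) / 2) := fun S => by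
    by_cases hS : S.Sublist l
    · obtain ⟨j', hj, α', hα, β', hβ, rfl⟩ := exists_mixedWord_of_sublist hS
      obtain ⟨B, hB⟩ := hb j' hj α' hα β' hβ
      refine ⟨B, fun _ w hw => ?_⟩
      have := hB w hw
      rw [mixedDeriv_eq_pdList] at this
      refine this.trans_eq ?_
      rw [length_mixedWord]
      congr 2
      push_cast; ring
    · exact ⟨0, fun h => absurd h hS⟩
  choose Bψ hBψ using hb'
  set a := ∑ S ∈ l.sublists.toFinset, |Bψ S| with ha
  set c := ∑ i ∈ Finset.range (l.length + 1), C i with hc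
  have ha0 : 0 ≤ a := Finset.sum_nonneg fun _ _ => abs_nonneg _
  have hc0 : 0 ≤ c := Finset.sum_nonneg fun i _ => (hC0 i).le
  refine ⟨2 ^ l.length * (a * c) * b + 1, by positivity, fun w hw w' hw' => ?_⟩
  set P := 1 + w.1 ^ 2 + ‖w.2.1‖ ^ 2 with hP
  have hP0 : 0 < P := by positivity
  have hexp : ((k : ℝ) - ((∑ i, α i : ℕ) : ℝ) - ((∑ i, β i : ℕ) : ℝ) - (j : ℝ)) / 2 - s.re =
      ((k : ℝ) - l.length) / 2 - s.re := by rw [hl, length_mixedWord]; push_cast; ring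
  rw [hexp]
  set Q := P ^ (((k : ℝ) - l.length) / 2 - s.re) with hQ
  have hQ0 : 0 ≤ Q := Real.rpow_nonneg hP0.le _
  have hfun : (fun u : Pt m k => ((u.1 * w'.1 : ℝ) : ℂ) ^ (-s) * ψ u * cuspKernel A v s u w' * χ w') =
      fun u => (fun u => ψ u * scaledKernel A v s w' u) u * χ w' := by funext u; simp only [scaledKernel]; ring
  rw [mixedDeriv_eq_pdList, ← hl, hfun, pdList_mul_const]
  beta_reduce
  rw [norm_mul]
  have hmain : ‖pdList l (fun u => ψ u * scaledKernel A v s w' u) w‖ * ‖χ w'‖ ≤ 2 ^ l.length * (a * c) * b * Q := by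
    rcases eq_or_ne (χ w') 0 with h | h
    · rw [h, norm_zero, mul_zero]; positivity
    by_cases hwψ : w ∈ closedSupport ψ
    · obtain ⟨h1, h2⟩ := hC w' hw' h
      have hwU := hψU ⟨hw, hwψ⟩
      have hρ : ∀ n : ℕ, (P ^ (-(1 : ℝ) / 2)) ^ n = P ^ (-(n : ℝ) / 2) := fun n => by
        rw [← Real.rpow_natCast, ← Real.rpow_mul hP0.le]; congr 1; ring
      have h3 := norm_pdList_mul_le hU hwU (ρ := P ^ (-(1 : ℝ) / 2)) l (f := ψ)
        (g := scaledKernel A v s w') (a := a) (b := c * P ^ ((k : ℝ) / 2 - s.re))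
        (hψ.1.mono fun u hu => show 0 ≤ u.1 from le_of_lt (hUH hu)) h1 (fun S hS => ?_) fun S hS => ?_
      · have h4 : P ^ ((k : ℝ) / 2 - s.re) * P ^ (-(l.length : ℝ) / 2) = Q := by
          rw [← Real.rpow_add hP0, hQ]; congr 1; ring
        rw [hρ] at h3
        calc _ ≤ 2 ^ l.length * (a * (c * P ^ ((k : ℝ) / 2 - s.re)) * P ^ (-(l.length : ℝ) / 2)) * b :=
              mul_le_mul h3 (hbχ w' (show 0 ≤ w'.1 from le_of_lt hw')) (norm_nonneg _) (by positivity)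
          _ = 2 ^ l.length * (a * c) * b * (P ^ ((k : ℝ) / 2 - s.re) * P ^ (-(l.length : ℝ) / 2)) := by ring
          _ = _ := by rw [h4]
      · rw [hρ]
        refine (hBψ S hS w hw).trans (mul_le_mul_of_nonneg_right ((le_abs_self _).trans ?_) (Real.rpow_nonneg hP0.le _))
        exact Finset.single_le_sum (f := fun S => |Bψ S|) (fun _ _ => abs_nonneg _)
          (List.mem_toFinset.mpr (List.mem_sublists.mpr hS))
      · rw [hρ, mul_assoc, ← Real.rpow_add hP0]
        have h5 := (norm_pdList_le hU h1 (l := S) (fun e he => norm_le_one_of_mem_mixedWord e (hS.subset he)) hwU).trans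
          (h2 _ w hwU)
        refine h5.trans ((mul_le_mul_of_nonneg_right (Finset.single_le_sum (f := C) (fun i _ => (hC0 i).le)
          (Finset.mem_range_succ_iff.mpr hS.length_le)) (Real.rpow_nonneg hP0.le _)).trans_eq ?_)
        congr 2; ring
    · -- outside the support of `ψ` the product vanishes near `w`
      have hO := isOpen_halfSpace.sdiff (isClosed_closure : IsClosed (closedSupport ψ))
      have h1 : EqOn (fun u => ψ u * scaledKernel A v s w' u) (fun u => scaledKernel A v s w' u * 0)
          (halfSpace m k \ closedSupport ψ) := fun u hu => by
        have : ψ u = 0 := by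
          by_contra h
          exact hu.2 (subset_closure ⟨show 0 ≤ u.1 from le_of_lt hu.1, h⟩)
        simp [this]
      rw [pdList_eqOn hO h1 l ⟨hw, hwψ⟩, pdList_mul_const]
      simp only [mul_zero, norm_zero, zero_mul]
      positivity
  linarith

end

/-- The sum over the trivial group has one term. -/
lemma freeKernel_eq (h : 0 < m + k) {s : ℂ} (hs : 0 < s.re) {w w' : Pt m k} (hw : w ∈ halfSpace m k)
    (hw' : w' ∈ halfSpace m k) (hne : w ≠ w') : freeKernel m k s w w' = resFun (m + k) s (twoCosh w w') := by
  have h1 : freeKernel m k s w w' = _ := (cuspLike_bot h).resolventKernel_eq hs (p := (w, w'))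
    ⟨hw, hw', fun γ hγ => by rw [Subgroup.mem_bot.mp hγ]; exact hne⟩
  rw [h1, foldKer_eq _ hw hw', tsum_eq_single 1 fun γ hγ => absurd (Subsingleton.elim γ 1) hγ]
  rfl

theorem hasSum_freeKernel (hk : 0 < k) {A : Fin k → (EuclideanSpace ℝ (Fin m) ≃ₗᵢ[ℝ] EuclideanSpace ℝ (Fin m))}
    (hA : ∀ i j, Commute (A i) (A j)) {v : Fin k → EuclideanSpace ℝ (Fin k)} (hv : LinearIndependent ℝ v) {s : ℂ}
    (hs : (k : ℝ) / 2 < s.re) {p : Pt m k × Pt m k} (hp : p ∈ offDiagonal (cuspGroup A v)) :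
    HasSum (fun γ : cuspGroup A v => freeKernel m k s p.1 (γ.1 p.2))
      (cuspKernel A v s p.1 p.2) := by
  have hΓ := cuspLike_cuspGroup hk hA hv
  have hs0 : 0 < s.re := hΓ.nonneg.trans_lt hs
  have h1 : cuspKernel A v s p.1 p.2 = _ := hΓ.resolventKernel_eq hs hp
  have h2 : ∀ γ : cuspGroup A v, freeKernel m k s p.1 (γ.1 p.2) =
      resFun (m + k) s (twoCosh p.1 (γ.1 p.2)) := fun γ =>
    freeKernel_eq hΓ.dim_pos hs0 hp.1 ((hΓ.apply_mem γ.2).mpr hp.2.1) (hp.2.2 γ γ.2)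
  rw [h1, foldKer_eq _ hp.1 hp.2.1]
  simp only [h2]
  exact (hΓ.summable_norm_fold (tame_resFun hΓ.dim_pos hs0 hs) hp.1 hp.2.1).of_norm.hasSum

end

end ModelCusp

theorem mainTheorem6 (m k : ℕ) (hk : 0 < k)
    (A : Fin k → (EuclideanSpace ℝ (Fin m) ≃ₗᵢ[ℝ] EuclideanSpace ℝ (Fin m)))
    (hA : ∀ i j, Commute (A i) (A j))
    (v : Fin k → EuclideanSpace ℝ (Fin k)) (hv : LinearIndependent ℝ v) :
    -- `R_ℍ` and `R_{X_c}` are the resolvent kernels, continued to `Re s > 0`, `Re s > k / 2`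
    ModelCusp.IsResolventKernel ⊥ (ModelCusp.halfSpace m k) 0 (ModelCusp.freeKernel m k) ∧
    ModelCusp.IsResolventKernel (ModelCusp.cuspGroup A v) (ModelCusp.cuspDomain m v) ((k : ℝ) / 2)
      (ModelCusp.cuspKernel A v) ∧
    -- `R_{X_c}(s; w, w')` is the sum over the group
    (∀ s : ℂ, (k : ℝ) / 2 < s.re → ∀ p ∈ ModelCusp.offDiagonal (ModelCusp.cuspGroup A v),
      HasSum (fun γ : ModelCusp.cuspGroup A v =>
          ModelCusp.freeKernel m k s p.1 ((γ : Equiv.Perm (ModelCusp.Pt m k)) p.2))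
        (ModelCusp.cuspKernel A v s p.1 p.2)) ∧
    -- it converges in `C^∞` on compact sets, up to the terms that are singular there
    (∀ s : ℂ, (k : ℝ) / 2 < s.re → ∀ K : Set (ModelCusp.Pt m k × ModelCusp.Pt m k),
      IsCompact K → K ⊆ ModelCusp.halfSpace m k ×ˢ ModelCusp.halfSpace m k →
      (ModelCusp.singularElements (ModelCusp.cuspGroup A v) K).Finite ∧
      ModelCusp.ConvergesSmoothlyOn
        (fun (γ : {γ : ModelCusp.cuspGroup A v //
              γ ∉ ModelCusp.singularElements (ModelCusp.cuspGroup A v) K})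
            (p : ModelCusp.Pt m k × ModelCusp.Pt m k) =>
          ModelCusp.freeKernel m k s p.1 ((γ.1 : Equiv.Perm (ModelCusp.Pt m k)) p.2)) K) ∧
    -- the estimates
    (∀ (χ ψ : ModelCusp.Pt m k → ℂ),
      ModelCusp.IsCutoff (ModelCusp.cuspGroup A v) χ →
      ModelCusp.IsSmoothUpToBoundary (ModelCusp.cuspGroup A v) ψ →
      Disjoint (ModelCusp.closedSupport χ) (ModelCusp.closedSupport ψ) →
      ∀ s : ℂ, (k : ℝ) / 2 < s.re → ∀ (j : ℕ) (α : Fin m → ℕ) (β : Fin k → ℕ),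
      (∃ C > 0, ∀ w ∈ ModelCusp.halfSpace m k ∩ ModelCusp.closedSupport ψ,
        ∀ w' ∈ ModelCusp.halfSpace m k,
        ‖ModelCusp.mixedDeriv j α β (fun u => ((u.1 * w'.1 : ℝ) : ℂ) ^ (-s) *
            ModelCusp.cuspKernel A v s u w' * χ w') w‖
          ≤ C * (1 + w.1 ^ 2 + ‖w.2.1‖ ^ 2) ^
              (((k : ℝ) - ((∑ i, α i : ℕ) : ℝ) - ((∑ i, β i : ℕ) : ℝ) - (j : ℝ)) / 2 - s.re)) ∧
      ((∀ j' ≤ j, ∀ α' ≤ α, ∀ β' ≤ β, ∃ B : ℝ, ∀ w ∈ ModelCusp.halfSpace m k,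
          ‖ModelCusp.mixedDeriv j' α' β' ψ w‖
            ≤ B * (1 + w.1 ^ 2 + ‖w.2.1‖ ^ 2) ^
              (-(((∑ i, α' i : ℕ) : ℝ) + ((∑ i, β' i : ℕ) : ℝ) + (j' : ℝ)) / 2)) →
        ∃ C > 0, ∀ w ∈ ModelCusp.halfSpace m k, ∀ w' ∈ ModelCusp.halfSpace m k,
        ‖ModelCusp.mixedDeriv j α β (fun u => ((u.1 * w'.1 : ℝ) : ℂ) ^ (-s) *
            ψ u * ModelCusp.cuspKernel A v s u w' * χ w') w‖
          ≤ C * (1 + w.1 ^ 2 + ‖w.2.1‖ ^ 2) ^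
              (((k : ℝ) - ((∑ i, α i : ℕ) : ℝ) - ((∑ i, β i : ℕ) : ℝ) - (j : ℝ)) / 2 - s.re))) := by
  have hn : 0 < m + k := by omega
  have hΓ := ModelCusp.cuspLike_cuspGroup hk hA hv
  exact ⟨(ModelCusp.cuspLike_bot hn).isResolventKernel_resolventKernel, hΓ.isResolventKernel_resolventKernel,
    fun s hs p hp => ModelCusp.hasSum_freeKernel hk hA hv hs hp,
    fun s hs K hK hKH => hΓ.convergesSmoothlyOn hs
      (fun w hw w' hw' hne => ModelCusp.freeKernel_eq hn (hΓ.nonneg.trans_lt hs) hw hw' hne) hK hKH,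
    fun χ ψ hχ hψ hd s hs j α β => ⟨ModelCusp.exists_mixedDeriv_bound hk hA hv hχ hψ hd hs j α β,
      ModelCusp.exists_mixedDeriv_mul_bound hk hA hv hχ hψ hd hs j α β⟩⟩
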